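/- **Setting.** Let $-\infty\le \ell_-<0<\ell_+\le\infty$, $\Omega_0=(\ell_-,\ell_+)$, and let $\alpha>0$, $0<\beta<\tfrac12$, $\gamma>0$. Let $\varepsilon_0>0$ satisfy $$\varepsilon_0<\min\{(2\gamma)^{-1/\alpha},|\ell_-|,\ell_+\},\qquad \varepsilon_0<\gamma^{-1/(\alpha+1-\beta)},\qquad \varepsilon_0<\min\{\gamma,\gamma^{-1}\},$$ and let $V_0\in L^\infty(\Omega_0)$ be real-valued with $V_0\ge 0$ almost everywhere. For $\varepsilon\in(0,\varepsilon_0]$ put $d_\varepsilon=\gamma\varepsilon^{\alpha+1}$, $h_\varepsilon=\varepsilon^\alpha$, $b_\varepsilon=\varepsilon^\beta$ and $$S_\varepsilon=\Omega_0\times(-\varepsilon,0),\quad P_\varepsilon=\{|x_1|<\tfrac{d_\varepsilon}2,\ 0<x_2<h_\varepsilon\},\quad R_\varepsilon=\{|x_1|<\tfrac{b_\varepsilon}2,\ h_\varepsilon<x_2<h_\varepsilon+b_\varepsilon\},$$ and let $\Omega_\varepsilon\subset\mathbb R^2$ be the interior of $\overline{S_\varepsilon\cup P_\varepsilon\cup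 R_\varepsilon}$. Let $V_\varepsilon(x)=V_0(x_1)$ on $S_\varepsilon$ and $V_\varepsilon=0$ on $P_\varepsilon\cup R_\varepsilon$. Let $\mathcal A_\varepsilon$ be the operator in $L^2(\Omega_\varepsilon)$ associated with the form $$\mathfrak a_\varepsilon[u,v]=\int_{\Omega_\varepsilon}\big(\nabla u\cdot\overline{\nabla v}+V_\varepsilon u\overline v\big)\,dx,\qquad \operatorname{dom}\mathfrak a_\varepsilon=H^1(\Omega_\varepsilon),$$ that is, $\mathcal A_\varepsilon=-\Delta+V_\varepsilon$ with Neumann boundary conditions. Let $\mathcal A_0$ be the operator in $L^2(\Omega_0)\oplus\mathbb C$ associated with the form $$\mathfrak a_0[f,g]=\int_{\Omega_0}\big(f_1'\overline{g_1'}+V_0f_1\overline{g_1}\big)\,dx+\gamma f_1(0)\overline{g_1(0)},\qquad \operatorname{dom}\mathfrak a_0=H^1(\Omega_0)\times\mathbb C.$$ Let $\widehat{\mathcal A}_0$ be the Schrödinger operator with a $\delta$-interaction in $L^2(\Omega_0)$: $\widehat{\mathcal A}_0f=-f''+V_0f$ on $\Omega_0\setminus\{0\}$, with domain all $f\in H^2(\Omega_0\setminus\{0\})$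 such that $f(-0)=f(+0)$, $f'(+0)-f'(-0)=\gamma f(\pm0)$, and $f'(\ell_\pm)=0$ at each finite endpoint. For $X,Y\subset[0,\infty)$ let $\widetilde d_H(X,Y)$ be the Hausdorff distance between $\overline{\{(1+x)^{-1}:x\in X\}}$ and $\overline{\{(1+y)^{-1}:y\in Y\}}$. **Theorem.** One has $\sigma(\mathcal A_0)=\sigma(\widehat{\mathcal A}_0)\cup\{0\}$, and there is a constant $C_2>0$, independent of $\varepsilon$, such that for all $\varepsilon\in(0,\varepsilon_0]$ $$\widetilde d_H\big(\sigma(\mathcal A_\varepsilon),\sigma(\mathcal A_0)\big)\le C_2\,\varepsilon^{\min\{\alpha,\,1/2-\beta,\,2\beta\}}.$$ -/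

import Mathlib

open MeasureTheory Set Filter Topology TopologicalSpace
open scoped ENNReal ContDiff

noncomputable section

set_option linter.unusedSectionVars false

namespace Waveguide
/-! ### Weak derivatives and first order Sobolev spaces -/

section Sobolev

variable {E : Type*} [NormedAddCommGroup E] [NormedSpace ℝ E] [FiniteDimensional ℝ E]
  [MeasureSpace E] [BorelSpace E]

/-- The complex Hilbert space `L²(Ω)` of an open set `Ω`. -/
abbrev L2 (Ω : Opens E) : Type _ := Lp ℂ 2 (volume.restrict (Ω : Set E))

/-- `g` is the weak (distributional) derivative of `u` in the direction `e` on the open set `Ω`. -/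
def HasWeakDeriv (Ω : Opens E) (e : E) (u g : E → ℂ) : Prop :=
  LocallyIntegrableOn u (Ω : Set E) ∧ LocallyIntegrableOn g (Ω : Set E) ∧
    ∀ φ : E → ℝ, ContDiff ℝ ∞ φ → HasCompactSupport φ → tsupport φ ⊆ (Ω : Set E) →
      ∫ x in (Ω : Set E), fderiv ℝ φ x e • u x = -∫ x in (Ω : Set E), φ x • g x

theorem integrable_smul_of_tsupport {Ω : Opens E} {φ : E → ℝ} {g : E → ℂ} (hc : Continuous φ)
    (hs : HasCompactSupport φ) (ht : tsupport φ ⊆ (Ω : Set E))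
    (hg : LocallyIntegrableOn g (Ω : Set E)) :
    Integrable (fun x => φ x • g x) (volume : Measure E) := by
  have h1 : IntegrableOn g (tsupport φ) := hg.integrableOn_compact_subset ht hs
  have h2 : IntegrableOn (fun x => φ x • g x) (tsupport φ) :=
    h1.continuousOn_smul hc.continuousOn hs
  refine (integrableOn_iff_integrable_of_support_subset ?_).1 h2
  intro x hx
  apply subset_tsupport
  intro h0
  exact hx (by simp [h0])

theorem integrable_fderiv_smul {Ω : Opens E} {φ : E → ℝ} {g : E → ℂ} (e : E)
    (hc : ContDiff ℝ ∞ φ)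
    (hs : HasCompactSupport φ) (ht : tsupport φ ⊆ (Ω : Set E))
    (hg : LocallyIntegrableOn g (Ω : Set E)) :
    Integrable (fun x => fderiv ℝ φ x e • g x) (volume : Measure E) := by
  have hs' : tsupport (fun x => fderiv ℝ φ x e) ⊆ tsupport φ := tsupport_fderiv_apply_subset ℝ e
  refine integrable_smul_of_tsupport ?_ (hs.fderiv_apply (𝕜 := ℝ) e) (hs'.trans ht) hg
  exact (hc.continuous_fderiv (by simp)).clm_apply continuous_const

namespace HasWeakDeriv

variable {Ω : Opens E} {e : E} {u u' g g' : E → ℂ}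

theorem add (h : HasWeakDeriv Ω e u g) (h' : HasWeakDeriv Ω e u' g') :
    HasWeakDeriv Ω e (u + u') (g + g') := by
  refine ⟨h.1.add h'.1, h.2.1.add h'.2.1, fun φ h1 h2 h3 => ?_⟩
  simp only [Pi.add_apply, smul_add]
  rw [integral_add (integrable_fderiv_smul e h1 h2 h3 h.1).integrableOn
    (integrable_fderiv_smul e h1 h2 h3 h'.1).integrableOn,
    integral_add (integrable_smul_of_tsupport h1.continuous h2 h3 h.2.1).integrableOn
    (integrable_smul_of_tsupport h1.continuous h2 h3 h'.2.1).integrableOn,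
    h.2.2 φ h1 h2 h3, h'.2.2 φ h1 h2 h3, neg_add]

theorem smul (c : ℂ) (h : HasWeakDeriv Ω e u g) : HasWeakDeriv Ω e (c • u) (c • g) := by
  refine ⟨h.1.smul c, h.2.1.smul c, fun φ h1 h2 h3 => ?_⟩
  have h4 := h.2.2 φ h1 h2 h3
  simp only [Pi.smul_apply, smul_comm _ c]
  rw [integral_smul, integral_smul, h4, smul_neg]

theorem congr (h : HasWeakDeriv Ω e u g) (hu : u =ᵐ[volume.restrict (Ω : Set E)] u')
    (hg : g =ᵐ[volume.restrict (Ω : Set E)] g') : HasWeakDeriv Ω e u' g' := by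
  refine ⟨h.1.congr hu, h.2.1.congr hg, fun φ h1 h2 h3 => ?_⟩
  have e1 : ∫ x in (Ω : Set E), fderiv ℝ φ x e • u' x = ∫ x in (Ω : Set E), fderiv ℝ φ x e • u x :=
    integral_congr_ae (by filter_upwards [hu] with x hx; rw [hx])
  have e2 : ∫ x in (Ω : Set E), φ x • g' x = ∫ x in (Ω : Set E), φ x • g x :=
    integral_congr_ae (by filter_upwards [hg] with x hx; rw [hx])
  rw [e1, e2, h.2.2 φ h1 h2 h3]

theorem unique (h : HasWeakDeriv Ω e u g) (h' : HasWeakDeriv Ω e u g') :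
    g =ᵐ[volume.restrict (Ω : Set E)] g' := by
  have key : ∀ᵐ x, x ∈ (Ω : Set E) → (g - g') x = 0 := by
    refine Ω.isOpen.ae_eq_zero_of_integral_contDiff_smul_eq_zero (h.2.1.sub h'.2.1) ?_
    intro φ h1 h2 h3
    have i1 := integrable_smul_of_tsupport h1.continuous h2 h3 h.2.1
    have i2 := integrable_smul_of_tsupport h1.continuous h2 h3 h'.2.1
    have e1 := (h.2.2 φ h1 h2 h3).symm.trans (h'.2.2 φ h1 h2 h3)
    have hz : ∀ x ∉ (Ω : Set E), φ x = 0 := fun x hx => image_eq_zero_of_notMem_tsupport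
      (fun hx' => hx (h3 hx'))
    rw [setIntegral_eq_integral_of_forall_compl_eq_zero (fun x hx => by simp [hz x hx]),
      setIntegral_eq_integral_of_forall_compl_eq_zero (fun x hx => by simp [hz x hx])] at e1
    simp only [Pi.sub_apply, smul_sub]
    rw [integral_sub i1 i2, sub_eq_zero]
    exact neg_injective e1
  rw [EventuallyEq, ae_restrict_iff' Ω.isOpen.measurableSet]
  filter_upwards [key] with x hx hx'
  exact sub_eq_zero.1 (hx hx')

end HasWeakDeriv

theorem L2.locallyIntegrableOn {Ω : Opens E} [IsLocallyFiniteMeasure (volume : Measure E)]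
    (u : L2 Ω) :
    LocallyIntegrableOn u (Ω : Set E) :=
  locallyIntegrableOn_of_locallyIntegrable_restrict
    ((Lp.memLp u).locallyIntegrable (by norm_num))

variable [IsLocallyFiniteMeasure (volume : Measure E)]

/-- The Sobolev space `H¹(Ω)`: all `u ∈ L²(Ω)` whose weak derivatives in all directions exist and
belong to `L²(Ω)`. -/
def H1 (Ω : Opens E) : Submodule ℂ (L2 Ω) where
  carrier := {u | ∀ e : E, ∃ g : L2 Ω, HasWeakDeriv Ω e u g}
  zero_mem' := by
    intro e
    refine ⟨0, L2.locallyIntegrableOn _, L2.locallyIntegrableOn _, fun φ _ _ _ => ?_⟩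
    rw [integral_eq_zero_of_ae, integral_eq_zero_of_ae, neg_zero] <;>
      · filter_upwards [Lp.coeFn_zero ℂ 2 (volume.restrict (Ω : Set E))] with x hx
        exact (congrArg _ hx).trans (smul_zero _)
  add_mem' := by
    intro u v hu hv e
    obtain ⟨g, hg⟩ := hu e
    obtain ⟨g', hg'⟩ := hv e
    exact ⟨g + g', (hg.add hg').congr (Lp.coeFn_add _ _).symm (Lp.coeFn_add _ _).symm⟩
  smul_mem' := by
    intro c u hu e
    obtain ⟨g, hg⟩ := hu e
    exact ⟨c • g, (hg.smul c).congr (Lp.coeFn_smul _ _).symm (Lp.coeFn_smul _ _).symm⟩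

/-- The weak derivative in the direction `e` as a linear map `H¹(Ω) → L²(Ω)`. -/
def weakDeriv (Ω : Opens E) (e : E) : H1 Ω →ₗ[ℂ] L2 Ω where
  toFun u := (u.2 e).choose
  map_add' u v := by
    refine Lp.ext (((u + v).2 e).choose_spec.unique ?_)
    exact ((u.2 e).choose_spec.add (v.2 e).choose_spec).congr (Lp.coeFn_add _ _).symm
      (Lp.coeFn_add _ _).symm
  map_smul' c u := by
    refine Lp.ext (((c • u).2 e).choose_spec.unique ?_)
    exact ((u.2 e).choose_spec.smul c).congr (Lp.coeFn_smul _ _).symm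
      (Lp.coeFn_smul _ _).symm

theorem hasWeakDeriv_weakDeriv (Ω : Opens E) (e : E) (u : H1 Ω) :
    HasWeakDeriv Ω e (u : L2 Ω) (weakDeriv Ω e u) :=
  (u.2 e).choose_spec

theorem mem_H1_of_test [(volume : Measure E).IsAddHaarMeasure] {Ω : Opens E} {ψ : E → ℝ}
    (h1 : ContDiff ℝ ∞ ψ) (h2 : HasCompactSupport ψ)
    (u : L2 Ω) (hu : u =ᵐ[volume.restrict (Ω : Set E)] fun x => (ψ x : ℂ)) : u ∈ H1 Ω := by
  intro e
  have hd : Continuous fun x => ((fderiv ℝ ψ x e : ℝ) : ℂ) :=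
    Complex.continuous_ofReal.comp ((h1.continuous_fderiv (by simp)).clm_apply continuous_const)
  have hds : HasCompactSupport fun x => ((fderiv ℝ ψ x e : ℝ) : ℂ) :=
    (h2.fderiv_apply (𝕜 := ℝ) e).comp_left (g := Complex.ofReal) (by simp)
  have hL : MemLp (fun x => ((fderiv ℝ ψ x e : ℝ) : ℂ)) 2 (volume.restrict (Ω : Set E)) :=
    (hd.memLp_of_hasCompactSupport hds).restrict _
  refine ⟨hL.toLp _, ?_⟩
  refine HasWeakDeriv.congr (u := fun x => (ψ x : ℂ))
    (g := fun x => ((fderiv ℝ ψ x e : ℝ) : ℂ)) ?_ hu.symm hL.coeFn_toLp.symm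
  have hcψ : Continuous fun x => (ψ x : ℂ) := Complex.continuous_ofReal.comp h1.continuous
  refine ⟨hcψ.locallyIntegrable.locallyIntegrableOn _,
    hd.locallyIntegrable.locallyIntegrableOn _, fun φ g1 g2 g3 => ?_⟩
  have hz : ∀ x ∉ (Ω : Set E), φ x = 0 := fun x hx => image_eq_zero_of_notMem_tsupport
    (fun hx' => hx (g3 hx'))
  have hz' : ∀ x ∉ (Ω : Set E), fderiv ℝ φ x e = 0 := fun x hx =>
    image_eq_zero_of_notMem_tsupport (f := fun x => fderiv ℝ φ x e)
    (fun hx' => hx (g3 (tsupport_fderiv_apply_subset ℝ e hx')))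
  rw [setIntegral_eq_integral_of_forall_compl_eq_zero (fun x hx => by simp [hz' x hx]),
      setIntegral_eq_integral_of_forall_compl_eq_zero (fun x hx => by simp [hz x hx])]
  have i1 : Integrable (fun x => fderiv ℝ φ x e * ψ x) (volume : Measure E) := by
    refine Continuous.integrable_of_hasCompactSupport ?_ ?_
    · exact ((g1.continuous_fderiv (by simp)).clm_apply continuous_const).mul h1.continuous
    · exact (g2.fderiv_apply (𝕜 := ℝ) e).mul_right
  have i2 : Integrable (fun x => φ x * fderiv ℝ ψ x e) (volume : Measure E) := by
    refine Continuous.integrable_of_hasCompactSupport ?_ ?_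
    · exact g1.continuous.mul ((h1.continuous_fderiv (by simp)).clm_apply continuous_const)
    · exact g2.mul_right
  have i3 : Integrable (fun x => φ x * ψ x) (volume : Measure E) := by
    refine Continuous.integrable_of_hasCompactSupport ?_ ?_
    · exact g1.continuous.mul h1.continuous
    · exact g2.mul_right
  have key := integral_mul_fderiv_eq_neg_fderiv_mul_of_integrable (μ := (volume : Measure E)) i1 i2
    i3 (fun x _ => (g1.differentiable (by simp)) x) (fun x _ => (h1.differentiable (by simp)) x)
  have e1 : ∀ x, fderiv ℝ φ x e • (ψ x : ℂ) = ((fderiv ℝ φ x e * ψ x : ℝ) : ℂ) := by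
    intro x; simp
  have e2 : ∀ x, φ x • ((fderiv ℝ ψ x e : ℝ) : ℂ) = ((φ x * fderiv ℝ ψ x e : ℝ) : ℂ) := by
    intro x; simp
  simp only [e1, e2]
  rw [integral_complex_ofReal, integral_complex_ofReal, key]
  simp

theorem eq_zero_of_orthogonal_H1 [(volume : Measure E).IsAddHaarMeasure] {Ω : Opens E} (f : L2 Ω)
    (hf : ∀ u ∈ H1 Ω, inner ℂ u f = 0) : f = 0 := by
  have key : ∀ᵐ x, x ∈ (Ω : Set E) → (f : E → ℂ) x = 0 := by
    refine Ω.isOpen.ae_eq_zero_of_integral_contDiff_smul_eq_zero (L2.locallyIntegrableOn f) ?_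
    intro φ h1 h2 h3
    have hz : ∀ x ∉ (Ω : Set E), φ x = 0 := fun x hx => image_eq_zero_of_notMem_tsupport
      (fun hx' => hx (h3 hx'))
    have hL : MemLp (fun x => (φ x : ℂ)) 2 (volume.restrict (Ω : Set E)) :=
      ((Complex.continuous_ofReal.comp h1.continuous).memLp_of_hasCompactSupport
        (h2.comp_left (g := Complex.ofReal) (by simp))).restrict _
    have h := hf (hL.toLp _) (mem_H1_of_test h1 h2 _ hL.coeFn_toLp)
    rw [L2.inner_def] at h
    rw [← setIntegral_eq_integral_of_forall_compl_eq_zero (s := (Ω : Set E))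
      (fun x hx => by simp [hz x hx]), ← h]
    refine integral_congr_ae ?_
    filter_upwards [hL.coeFn_toLp] with x hx
    rw [hx]
    simp [mul_comm]
  refine Lp.ext ?_
  refine EventuallyEq.trans ?_ (Lp.coeFn_zero _ _ _).symm
  rw [EventuallyEq, ae_restrict_iff' Ω.isOpen.measurableSet]
  exact key

theorem dense_H1 [(volume : Measure E).IsAddHaarMeasure] (Ω : Opens E) :
    Dense (H1 Ω : Set (L2 Ω)) := by
  rw [Submodule.dense_iff_topologicalClosure_eq_top,
    Submodule.topologicalClosure_eq_top_iff, eq_bot_iff]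
  intro f hf
  exact eq_zero_of_orthogonal_H1 f (fun u hu => (Submodule.mem_orthogonal _ _).1 hf u hu)

end Sobolev
theorem exists_Icc {Ω : Set ℝ} (hΩ : OrdConnected Ω) {x₀ : ℝ} (hx₀ : x₀ ∈ Ω)
    {K : Set ℝ} (h2 : IsCompact K) (h3 : K ⊆ Ω) :
    ∃ a b : ℝ, Icc a b ⊆ Ω ∧ K ⊆ Icc a b ∧ x₀ ∈ Icc a b := by
  have hK : IsCompact (K ∪ {x₀}) := IsCompact.union h2 isCompact_singleton
  have hne : (K ∪ {x₀}).Nonempty := ⟨x₀, by simp⟩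
  have hKΩ : K ∪ {x₀} ⊆ Ω := union_subset h3 (by simpa using hx₀)
  have hx : ∀ x ∈ K ∪ {x₀}, x ∈ Icc (sInf (K ∪ {x₀})) (sSup (K ∪ {x₀})) := fun x hx =>
    ⟨csInf_le hK.bddBelow hx, le_csSup hK.bddAbove hx⟩
  exact ⟨sInf (K ∪ {x₀}), sSup (K ∪ {x₀}),
    hΩ.out (hKΩ (hK.sInf_mem hne)) (hKΩ (hK.sSup_mem hne)), fun x h => hx x (Or.inl h),
    hx x₀ (Or.inr rfl)⟩

theorem exists_primitive {Ω : Set ℝ} (hΩ : OrdConnected Ω) {x₀ : ℝ} (hx₀ : x₀ ∈ Ω)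
    {ψ : ℝ → ℝ} (h1 : ContDiff ℝ ∞ ψ) (h2 : HasCompactSupport ψ) (h3 : tsupport ψ ⊆ Ω)
    (h0 : ∫ x, ψ x = 0) :
    ∃ φ : ℝ → ℝ, ContDiff ℝ ∞ φ ∧ HasCompactSupport φ ∧ tsupport φ ⊆ Ω ∧ deriv φ = ψ := by
  obtain ⟨a, b, hab, hsub, -⟩ := exists_Icc hΩ hx₀ h2 h3
  have hz : ∀ x, x ∉ Icc a b → ψ x = 0 := fun x hx => image_eq_zero_of_notMem_tsupport
    (fun h => hx (hsub h))
  have hint : Integrable ψ := h1.continuous.integrable_of_hasCompactSupport h2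
  have hd : ∀ x, HasDerivAt (fun x => ∫ t in Iic x, ψ t) (ψ x) x := by
    intro x
    have e : (fun x => ∫ t in Iic x, ψ t) = fun x => (∫ t in Iic (0 : ℝ), ψ t) +
        ∫ t in (0 : ℝ)..x, ψ t := by
      funext y
      rw [← intervalIntegral.integral_Iic_sub_Iic hint.integrableOn hint.integrableOn]
      ring
    rw [e]
    exact (intervalIntegral.integral_hasDerivAt_right hint.intervalIntegrable
      h1.continuous.stronglyMeasurable.stronglyMeasurableAtFilter
      h1.continuous.continuousAt).const_add _
  have hder : deriv (fun x => ∫ t in Iic x, ψ t) = ψ := funext fun x => (hd x).deriv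
  have hsupp : tsupport (fun x => ∫ t in Iic x, ψ t) ⊆ Icc a b := by
    refine closure_minimal (fun x hx => ?_) isClosed_Icc
    by_contra hx'
    apply hx
    rcases not_and_or.1 hx' with h | h
    · exact setIntegral_eq_zero_of_forall_eq_zero fun t ht => hz t fun ht' =>
        h (ht'.1.trans ht)
    · change ∫ t in Iic x, ψ t = 0
      rw [setIntegral_eq_integral_of_forall_compl_eq_zero, h0]
      intro t ht
      exact hz t fun ht' => ht (le_trans ht'.2 (not_le.1 h).le)
  refine ⟨fun x => ∫ t in Iic x, ψ t, ?_, ?_, hsupp.trans hab, hder⟩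
  · rw [contDiff_infty_iff_deriv, hder]
    exact ⟨fun x => (hd x).differentiableAt, h1⟩
  · exact isCompact_Icc.of_isClosed_subset (isClosed_tsupport _) hsupp

theorem integral_deriv_smul_primitive {φ : ℝ → ℝ} (h1 : ContDiff ℝ ∞ φ) (h2 : HasCompactSupport φ)
    {g : ℝ → ℂ} (hg : Integrable g) :
    ∫ x, deriv φ x • ∫ t in Iic x, g t = -∫ x, φ x • g x := by
  have hdi : Integrable (deriv φ) :=
    (h1.continuous_deriv (by simp)).integrable_of_hasCompactSupport h2.deriv
  have hprod : Integrable (fun p : ℝ × ℝ => deriv φ p.1 • g p.2) := hdi.smul_prod hg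
  have hms : MeasurableSet {p : ℝ × ℝ | p.2 ≤ p.1} :=
    measurableSet_le measurable_snd measurable_fst
  have hi := hprod.indicator hms
  have e1 : ∀ x, deriv φ x • ∫ t in Iic x, g t =
      ∫ t, {p : ℝ × ℝ | p.2 ≤ p.1}.indicator (fun p : ℝ × ℝ => deriv φ p.1 • g p.2) (x, t) := by
    intro x
    rw [← integral_smul, ← integral_indicator measurableSet_Iic]
    rfl
  have e2 : ∀ t, ∫ x, {p : ℝ × ℝ | p.2 ≤ p.1}.indicator
      (fun p : ℝ × ℝ => deriv φ p.1 • g p.2) (x, t) = -(φ t • g t) := by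
    intro t
    have : ∀ x, {p : ℝ × ℝ | p.2 ≤ p.1}.indicator
      (fun p : ℝ × ℝ => deriv φ p.1 • g p.2) (x, t) =
      (Ici t).indicator (fun x => deriv φ x • g t) x := fun x => rfl
    simp only [this]
    rw [integral_indicator measurableSet_Ici, integral_smul_const, integral_Ici_eq_integral_Ioi,
      h2.integral_Ioi_deriv_eq (h1.of_le (by simp)), neg_smul]
  simp only [e1]
  rw [integral_integral_swap (f := fun x t => {p : ℝ × ℝ | p.2 ≤ p.1}.indicator
    (fun p : ℝ × ℝ => deriv φ p.1 • g p.2) (x, t)) hi]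
  simp only [e2]
  rw [integral_neg]


theorem exists_continuousOn_ae_eq {Ω : Opens ℝ} (hΩ : OrdConnected (Ω : Set ℝ)) {x₀ : ℝ}
    (hx₀ : x₀ ∈ Ω) {u g : ℝ → ℂ} (h : HasWeakDeriv Ω 1 u g) :
    ∃ U : ℝ → ℂ, ContinuousOn U (Ω : Set ℝ) ∧ u =ᵐ[volume.restrict (Ω : Set ℝ)] U := by
  obtain ⟨hu, hg, hw⟩ := h
  have hgI : ∀ a b, Icc a b ⊆ (Ω : Set ℝ) → IntegrableOn g (Icc a b) := fun a b hab =>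
    hg.integrableOn_compact_subset hab isCompact_Icc
  set G : ℝ → ℂ := fun x => ∫ t in x₀..x, g t with hG
  have hGc : ContinuousOn G (Ω : Set ℝ) := by
    intro x hx
    obtain ⟨r, hr, hball⟩ := Metric.isOpen_iff.1 Ω.isOpen x hx
    have hK : Icc (x - r / 2) (x + r / 2) ⊆ (Ω : Set ℝ) := by
      refine Subset.trans (fun y hy => ?_) hball
      rw [Metric.mem_ball, Real.dist_eq, abs_lt]
      constructor <;> linarith [hy.1, hy.2]
    obtain ⟨a, b, hab, hsub, hx₀'⟩ := exists_Icc hΩ hx₀ isCompact_Icc hK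
    have hle : a ≤ b := hx₀'.1.trans hx₀'.2
    have hc := intervalIntegral.continuousOn_primitive_interval' (a := x₀)
      (IntegrableOn.intervalIntegrable (by rw [uIcc_of_le hle]; exact hgI a b hab))
      (by rw [uIcc_of_le hle]; exact hx₀')
    rw [uIcc_of_le hle] at hc
    have hn : Icc a b ∈ 𝓝 x :=
      mem_of_superset (Icc_mem_nhds (by linarith) (by linarith)) hsub
    exact (hc.continuousAt hn).continuousWithinAt
  have hGl : LocallyIntegrableOn G (Ω : Set ℝ) := hGc.locallyIntegrableOn Ω.isOpen.measurableSet
  -- the primitive has the same weak derivative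
  have hGw : ∀ φ : ℝ → ℝ, ContDiff ℝ ∞ φ → HasCompactSupport φ → tsupport φ ⊆ (Ω : Set ℝ) →
      ∫ x, deriv φ x • G x = -∫ x, φ x • g x := by
    intro φ h1 h2 h3
    obtain ⟨a, b, hab, hsub, hx₀'⟩ := exists_Icc hΩ hx₀ h2 h3
    have hi : Integrable ((Icc a b).indicator g) :=
      (integrable_indicator_iff measurableSet_Icc).2 (hgI a b hab)
    have hz : ∀ x, x ∉ Icc a b → φ x = 0 := fun x hx => image_eq_zero_of_notMem_tsupport
      (fun h => hx (hsub h))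
    have hz' : ∀ x, x ∉ Icc a b → deriv φ x = 0 := fun x hx => image_eq_zero_of_notMem_tsupport
      (fun h => hx (hsub (tsupport_deriv_subset h)))
    have hGx : ∀ x ∈ Icc a b, G x = (∫ t in Iic x, (Icc a b).indicator g t) -
        ∫ t in Iic x₀, (Icc a b).indicator g t := by
      intro x hx
      rw [intervalIntegral.integral_Iic_sub_Iic hi.integrableOn hi.integrableOn]
      refine intervalIntegral.integral_congr fun t ht => ?_
      rw [indicator_of_mem]
      exact (uIcc_subset_Icc hx₀' hx) ht
    have e1 : ∀ x, deriv φ x • G x = deriv φ x • (∫ t in Iic x, (Icc a b).indicator g t) -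
        deriv φ x • ∫ t in Iic x₀, (Icc a b).indicator g t := by
      intro x
      by_cases hx : x ∈ Icc a b
      · rw [hGx x hx, smul_sub]
      · simp [hz' x hx]
    have hdc : Continuous (deriv φ) := h1.continuous_deriv (by simp)
    have hdi : Integrable (deriv φ) := hdc.integrable_of_hasCompactSupport h2.deriv
    have hd0 : ∫ x, deriv φ x = 0 := by
      have := integral_of_hasDerivAt_of_tendsto (f := φ) (f' := deriv φ) (m := 0) (n := 0)
        (fun x => ((h1.differentiable (by simp)) x).hasDerivAt) hdi
        (h2.is_zero_at_infty.mono_left atBot_le_cocompact)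
        (h2.is_zero_at_infty.mono_left atTop_le_cocompact)
      simpa using this
    have hHc : Continuous fun x => ∫ t in Iic x, (Icc a b).indicator g t := by
      have e : (fun x => ∫ t in Iic x, (Icc a b).indicator g t) = fun x =>
          (∫ t in Iic (0 : ℝ), (Icc a b).indicator g t) +
          ∫ t in (0 : ℝ)..x, (Icc a b).indicator g t := by
        funext y
        rw [← intervalIntegral.integral_Iic_sub_Iic hi.integrableOn hi.integrableOn]
        ring
      rw [e]
      exact continuous_const.add
        (intervalIntegral.continuous_primitive (fun _ _ => hi.intervalIntegrable) 0)
    have i1 : Integrable fun x => deriv φ x • (∫ t in Iic x, (Icc a b).indicator g t) :=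
      (hdc.smul hHc).integrable_of_hasCompactSupport h2.deriv.smul_right
    simp only [e1]
    rw [integral_sub i1 (hdi.smul_const _), integral_deriv_smul_primitive h1 h2 hi,
      integral_smul_const, hd0, zero_smul, sub_zero]
    congr 1
    refine integral_congr_ae (Eventually.of_forall fun x => ?_)
    by_cases hx : x ∈ Icc a b
    · simp [hx]
    · simp [hz x hx]
  -- the difference is orthogonal to all derivatives of test functions
  have hv : LocallyIntegrableOn (u - G) (Ω : Set ℝ) := hu.sub hGl
  have hvw : ∀ φ : ℝ → ℝ, ContDiff ℝ ∞ φ → HasCompactSupport φ → tsupport φ ⊆ (Ω : Set ℝ) →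
      ∫ x, deriv φ x • (u - G) x = 0 := by
    intro φ h1 h2 h3
    have hz : ∀ x ∉ (Ω : Set ℝ), φ x = 0 := fun x hx => image_eq_zero_of_notMem_tsupport
      (fun hx' => hx (h3 hx'))
    have hz' : ∀ x ∉ (Ω : Set ℝ), deriv φ x = 0 := fun x hx =>
      image_eq_zero_of_notMem_tsupport
      (fun hx' => hx (h3 (tsupport_deriv_subset hx')))
    have h4 := hw φ h1 h2 h3
    simp only [fderiv_apply_one_eq_deriv] at h4
    rw [setIntegral_eq_integral_of_forall_compl_eq_zero (fun x hx => by simp [hz' x hx]),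
      setIntegral_eq_integral_of_forall_compl_eq_zero (fun x hx => by simp [hz x hx])] at h4
    have i1 := integrable_fderiv_smul (Ω := Ω) (1 : ℝ) h1 h2 h3 hu
    have i2 := integrable_fderiv_smul (Ω := Ω) (1 : ℝ) h1 h2 h3 hGl
    simp only [fderiv_apply_one_eq_deriv] at i1 i2
    simp only [Pi.sub_apply, smul_sub]
    rw [integral_sub i1 i2, h4, hGw φ h1 h2 h3, sub_self]
  -- a fixed test function of integral one
  obtain ⟨r, hr, hball⟩ := Metric.isOpen_iff.1 Ω.isOpen x₀ hx₀
  let B : ContDiffBump x₀ := ⟨r / 4, r / 2, by linarith, by linarith⟩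
  have hη1 : ContDiff ℝ ∞ (B.normed volume) := B.contDiff_normed
  have hη2 : HasCompactSupport (B.normed volume) := B.hasCompactSupport_normed
  have hη3 : tsupport (B.normed volume) ⊆ (Ω : Set ℝ) := by
    rw [B.tsupport_normed_eq]
    exact (Metric.closedBall_subset_ball (show r / 2 < r by linarith)).trans hball
  have hη4 : ∫ x, B.normed volume x = 1 := B.integral_normed
  set η := B.normed volume with hη
  have hηi : Integrable η := hη1.continuous.integrable_of_hasCompactSupport hη2
  set c : ℂ := ∫ x, η x • (u - G) x with hc
  refine ⟨fun x => G x + c, hGc.add continuousOn_const, ?_⟩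
  have key : ∀ᵐ x, x ∈ (Ω : Set ℝ) → ((u - G) - fun _ : ℝ => c : ℝ → ℂ) x = 0 := by
    refine Ω.isOpen.ae_eq_zero_of_integral_contDiff_smul_eq_zero
      (hv.sub ((locallyIntegrable_const c).locallyIntegrableOn _)) ?_
    intro φ h1 h2 h3
    have hφi : Integrable φ := h1.continuous.integrable_of_hasCompactSupport h2
    have hψ1 : ContDiff ℝ ∞ (φ - fun x => (∫ y, φ y) * η x) := h1.sub (contDiff_const.mul hη1)
    have hψ2 : HasCompactSupport (φ - fun x => (∫ y, φ y) * η x) := h2.sub hη2.mul_left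
    have hψ3 : tsupport (φ - fun x => (∫ y, φ y) * η x) ⊆ (Ω : Set ℝ) := by
      refine (tsupport_sub _ _).trans (union_subset h3 ?_)
      exact (tsupport_mul_subset_right (f := fun _ => ∫ y, φ y)).trans hη3
    have hψ4 : ∫ x, (φ - fun x => (∫ y, φ y) * η x) x = 0 := by
      simp only [Pi.sub_apply]
      rw [integral_sub hφi (hηi.const_mul _), integral_const_mul, hη4]
      ring
    obtain ⟨Φ, p1, p2, p3, p4⟩ := exists_primitive hΩ hx₀ hψ1 hψ2 hψ3 hψ4
    have h5 := hvw Φ p1 p2 p3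
    rw [p4] at h5
    have i1 := integrable_smul_of_tsupport (Ω := Ω) h1.continuous h2 h3 hv
    have i2 := integrable_smul_of_tsupport (Ω := Ω) hη1.continuous hη2 hη3 hv
    have e5 : ∀ x, (φ - fun x => (∫ y, φ y) * η x) x • (u - G) x =
        φ x • (u - G) x - (∫ y, φ y) • (η x • (u - G) x) := by
      intro x
      rw [Pi.sub_apply, sub_smul, mul_smul]
    simp only [e5] at h5
    have i3 : Integrable fun x => (∫ y, φ y) • (η x • (u - G) x) :=
      Integrable.smul (∫ y, φ y) i2
    rw [integral_sub i1 i3, integral_smul, ← hc, sub_eq_zero] at h5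
    have e6 : ∀ x, φ x • ((u - G) - fun _ : ℝ => c : ℝ → ℂ) x = φ x • (u - G) x - φ x • c := by
      intro x
      rw [Pi.sub_apply _ (fun _ => c), smul_sub]
    simp only [e6]
    rw [integral_sub i1 (hφi.smul_const c), integral_smul_const, h5, sub_self]
  rw [EventuallyEq, ae_restrict_iff' Ω.isOpen.measurableSet]
  filter_upwards [key] with x hx hx'
  have := hx hx'
  simp only [Pi.sub_apply] at this
  linear_combination this


/-- Point evaluation `u ↦ u(x₀)` on `H¹(Ω)` for an open interval `Ω ∋ x₀`: the value at `x₀` of the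
continuous representative of `u`. -/
def evalAt {Ω : Opens ℝ} (hΩ : OrdConnected (Ω : Set ℝ)) {x₀ : ℝ} (hx₀ : x₀ ∈ Ω) :
    H1 Ω →ₗ[ℂ] ℂ where
  toFun u := (exists_continuousOn_ae_eq hΩ hx₀ (hasWeakDeriv_weakDeriv Ω 1 u)).choose x₀
  map_add' u v := by
    have hu := (exists_continuousOn_ae_eq hΩ hx₀ (hasWeakDeriv_weakDeriv Ω 1 u)).choose_spec
    have hv := (exists_continuousOn_ae_eq hΩ hx₀ (hasWeakDeriv_weakDeriv Ω 1 v)).choose_spec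
    have hs := (exists_continuousOn_ae_eq hΩ hx₀ (hasWeakDeriv_weakDeriv Ω 1 (u + v))).choose_spec
    refine Measure.eqOn_open_of_ae_eq (μ := (volume : Measure ℝ)) ?_ Ω.isOpen hs.1
      (hu.1.add hv.1) hx₀
    exact hs.2.symm.trans ((Lp.coeFn_add _ _).trans (hu.2.add hv.2))
  map_smul' c u := by
    have hu := (exists_continuousOn_ae_eq hΩ hx₀ (hasWeakDeriv_weakDeriv Ω 1 u)).choose_spec
    have hs := (exists_continuousOn_ae_eq hΩ hx₀ (hasWeakDeriv_weakDeriv Ω 1 (c • u))).choose_spec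
    refine Measure.eqOn_open_of_ae_eq (μ := (volume : Measure ℝ)) ?_ Ω.isOpen hs.1
      (hu.1.const_smul c) hx₀
    exact hs.2.symm.trans ((Lp.coeFn_smul _ _).trans (hu.2.const_smul c))

theorem evalAt_eq {Ω : Opens ℝ} (hΩ : OrdConnected (Ω : Set ℝ)) {x₀ : ℝ} (hx₀ : x₀ ∈ Ω)
    (u : H1 Ω) {U : ℝ → ℂ} (hU : ContinuousOn U (Ω : Set ℝ))
    (h : (u : L2 Ω) =ᵐ[volume.restrict (Ω : Set ℝ)] U) : evalAt hΩ hx₀ u = U x₀ := by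
  have hu := (exists_continuousOn_ae_eq hΩ hx₀ (hasWeakDeriv_weakDeriv Ω 1 u)).choose_spec
  exact Measure.eqOn_open_of_ae_eq (μ := (volume : Measure ℝ)) (hu.2.symm.trans h) Ω.isOpen hu.1
    hU hx₀

/-! ### Operators associated with sesquilinear forms, and their spectra -/

section Forms

/-- The sesquilinear form `(u, v) ↦ (T u, S v)`, linear in `u` and antilinear in `v`. -/
def sesq {D K : Type*} [AddCommGroup D] [Module ℂ D] [NormedAddCommGroup K]
    [InnerProductSpace ℂ K] (T S : D →ₗ[ℂ] K) : D →ₗ[ℂ] D →ₗ⋆[ℂ] ℂ :=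
  LinearMap.mk₂'ₛₗ (RingHom.id ℂ) (starRingEnd ℂ) (fun u v => inner ℂ (S v) (T u))
    (fun u u' v => by rw [map_add, inner_add_right])
    (fun c u v => by rw [map_smul, inner_smul_right]; rfl)
    (fun u v v' => by rw [map_add, inner_add_left])
    (fun c u v => by rw [map_smul, inner_smul_left]; rfl)

theorem sesq_apply {D K : Type*} [AddCommGroup D] [Module ℂ D] [NormedAddCommGroup K]
    [InnerProductSpace ℂ K] (T S : D →ₗ[ℂ] K) (u v : D) :
    sesq T S u v = inner ℂ (S v) (T u) := rfl

/-- A densely defined sesquilinear form in a complex Hilbert space, linear in the first and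
antilinear in the second argument. -/
structure DenseForm (H : Type*) [NormedAddCommGroup H] [InnerProductSpace ℂ H] where
  /-- the domain of the form -/
  dom : Submodule ℂ H
  /-- the form itself -/
  form : dom →ₗ[ℂ] dom →ₗ⋆[ℂ] ℂ
  /-- the domain is dense -/
  dense_dom : Dense (dom : Set H)

variable {H : Type*} [NormedAddCommGroup H] [InnerProductSpace ℂ H]

/-- The graph of the operator associated with the form `a`: all pairs `(u, w)` with `u ∈ dom a` and
`a[u, v] = (w, v)` for every `v ∈ dom a`. -/
def DenseForm.graph (a : DenseForm H) : Submodule ℂ (H × H) where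
  carrier := {p | ∃ hu : p.1 ∈ a.dom, ∀ v : a.dom, a.form ⟨p.1, hu⟩ v = inner ℂ (v : H) p.2}
  zero_mem' := ⟨a.dom.zero_mem, fun v => by
    have : (⟨(0 : H × H).1, a.dom.zero_mem⟩ : a.dom) = 0 := rfl
    rw [this]; simp⟩
  add_mem' := by
    rintro p q ⟨hp, hp'⟩ ⟨hq, hq'⟩
    refine ⟨a.dom.add_mem hp hq, fun v => ?_⟩
    have : (⟨(p + q).1, a.dom.add_mem hp hq⟩ : a.dom) = ⟨p.1, hp⟩ + ⟨q.1, hq⟩ := rfl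
    rw [this, map_add, LinearMap.add_apply, hp', hq', Prod.snd_add, inner_add_right]
  smul_mem' := by
    rintro c p ⟨hp, hp'⟩
    refine ⟨a.dom.smul_mem c hp, fun v => ?_⟩
    have : (⟨(c • p).1, a.dom.smul_mem c hp⟩ : a.dom) = c • ⟨p.1, hp⟩ := rfl
    rw [this, map_smul, LinearMap.smul_apply, hp', Prod.smul_snd, inner_smul_right, smul_eq_mul]

/-- The operator associated with a densely defined form: `u ∈ dom a` lies in its domain, with image
`w`, if and only if `a[u, v] = (w, v)` for every `v ∈ dom a`. -/
def DenseForm.operator (a : DenseForm H) : H →ₗ.[ℂ] H := a.graph.toLinearPMap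

theorem DenseForm.graph_operator (a : DenseForm H) : a.operator.graph = a.graph := by
  refine Submodule.toLinearPMap_graph_eq _ ?_
  rintro ⟨u, w⟩ ⟨hu, h⟩ (rfl : u = 0)
  refine a.dense_dom.eq_zero_of_inner_right ℂ fun v hv => ?_
  refine (h ⟨v, hv⟩).symm.trans ?_
  have : (⟨((0 : H), w).1, hu⟩ : a.dom) = 0 := rfl
  rw [this]; simp

/-- The resolvent set of an (in general unbounded) operator `A`: all `z ∈ ℂ` such that `A - z` is a
bijection from the domain of `A` onto the whole space with bounded inverse. -/
def resolventSet (A : H →ₗ.[ℂ] H) : Set ℂ :=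
  {z | ∃ R : H →L[ℂ] H,
    (∀ g : H, ∃ hg : R g ∈ A.domain, A ⟨R g, hg⟩ - z • R g = g) ∧
    ∀ u : A.domain, R (A u - z • (u : H)) = u}

/-- The spectrum of an (in general unbounded) operator. -/
def opSpectrum (A : H →ₗ.[ℂ] H) : Set ℂ := (resolventSet A)ᶜ

end Forms

/-- The metric measuring the distance of two sets after the map `z ↦ (1 + z)⁻¹`: the Hausdorff
distance of the closures of the images. (As an extended distance it has no junk values.) -/
def dTilde (X Y : Set ℂ) : ℝ≥0∞ :=
  Metric.hausdorffEDist (closure ((fun z => (1 + z)⁻¹) '' X)) (closure ((fun z => (1 + z)⁻¹) '' Y))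

/-- Multiplication by a bounded real-valued function as an operator on `L²`. -/
def mulOp {E : Type*} [MeasurableSpace E] {μ : Measure E} (V : Lp ℝ ∞ μ) :
    Lp ℂ 2 μ →ₗ[ℂ] Lp ℂ 2 μ where
  toFun u := V • u
  map_add' u v := Lp.add_smul V u v
  map_smul' c u := by
    refine Lp.ext ?_
    filter_upwards [Lp.coeFn_lpSMul (r := 2) V (c • u), Lp.coeFn_lpSMul (r := 2) V u,
      Lp.coeFn_smul c u, Lp.coeFn_smul c (V • u : Lp ℂ 2 μ)] with x h1 h2 h3 h4
    rw [RingHom.id_apply, h1, h4, Pi.smul_apply', h3, Pi.smul_apply, Pi.smul_apply, h2,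
      Pi.smul_apply', smul_comm]

theorem coeFn_mulOp {E : Type*} [MeasurableSpace E] {μ : Measure E} (V : Lp ℝ ∞ μ)
    (u : Lp ℂ 2 μ) : mulOp V u =ᵐ[μ] fun x => (V x : ℂ) * u x := by
  filter_upwards [Lp.coeFn_lpSMul (r := 2) V u] with x hx
  exact hx

/-! ### The operator on the waveguide -/

/-- The interval `Ω₀ = (ℓ₋, ℓ₊)`, bounded or not. -/
def interval (ℓm ℓp : EReal) : Opens ℝ :=
  ⟨{x | ℓm < (x : EReal) ∧ (x : EReal) < ℓp},
    (isOpen_lt continuous_const continuous_coe_real_ereal).inter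
      (isOpen_lt continuous_coe_real_ereal continuous_const)⟩

theorem ordConnected_interval (ℓm ℓp : EReal) : OrdConnected (interval ℓm ℓp : Set ℝ) :=
  ⟨fun _ hx _ hy _ hz => ⟨hx.1.trans_le (EReal.coe_le_coe_iff.2 hz.1),
    (EReal.coe_le_coe_iff.2 hz.2).trans_lt hy.2⟩⟩

/-- The straight strip `S_ε = Ω₀ × (-ε, 0)`. -/
def strip (ℓm ℓp : EReal) (ε : ℝ) : Set (ℝ × ℝ) :=
  {x | x.1 ∈ interval ℓm ℓp ∧ x.2 ∈ Ioo (-ε) 0}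

/-- The passage `P_ε` of width `d_ε = γ ε ^ (α + 1)` and height `h_ε = ε ^ α`. -/
def passage (α γ ε : ℝ) : Set (ℝ × ℝ) :=
  {x | |x.1| < γ * ε ^ (α + 1) / 2 ∧ x.2 ∈ Ioo 0 (ε ^ α)}

/-- The room `R_ε`, a square of side length `b_ε = ε ^ β` on top of the passage. -/
def room (α β ε : ℝ) : Set (ℝ × ℝ) :=
  {x | |x.1| < ε ^ β / 2 ∧ x.2 ∈ Ioo (ε ^ α) (ε ^ α + ε ^ β)}

/-- The waveguide `Ω_ε`, the interior of the closure of the union of strip, passage and room. -/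
def waveguide (ℓm ℓp : EReal) (α β γ ε : ℝ) : Opens (ℝ × ℝ) :=
  ⟨interior (closure (strip ℓm ℓp ε ∪ passage α γ ε ∪ room α β ε)), isOpen_interior⟩

theorem measurableSet_strip (ℓm ℓp : EReal) (ε : ℝ) : MeasurableSet (strip ℓm ℓp ε) :=
  (measurable_fst (interval ℓm ℓp).isOpen.measurableSet).inter (measurable_snd measurableSet_Ioo)

/-- The potential `V_ε` is `V₀(x₁)` on the strip and zero on the passage and the room. -/
def stripPotential (ℓm ℓp : EReal) (ε : ℝ) (V₀ : ℝ → ℝ) : ℝ × ℝ → ℝ :=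
  (strip ℓm ℓp ε).indicator fun x => V₀ x.1

theorem memLp_stripPotential {ℓm ℓp : EReal} (α β γ ε : ℝ)
    (V₀ : Lp ℝ ∞ (volume.restrict (interval ℓm ℓp : Set ℝ))) :
    MemLp (stripPotential ℓm ℓp ε V₀) ∞
      (volume.restrict (waveguide ℓm ℓp α β γ ε : Set (ℝ × ℝ))) := by
  refine MemLp.restrict _ ?_
  have hm : StronglyMeasurable (stripPotential ℓm ℓp ε V₀) :=
    ((Lp.stronglyMeasurable V₀).comp_measurable measurable_fst).indicator
      (measurableSet_strip ℓm ℓp ε)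
  have hb : ∀ᵐ t : ℝ, t ∈ (interval ℓm ℓp : Set ℝ) → ‖V₀ t‖ ≤ ‖V₀‖ := by
    rw [← ae_restrict_iff' (interval ℓm ℓp).isOpen.measurableSet]
    have h := ae_le_eLpNormEssSup (f := V₀) (μ := volume.restrict (interval ℓm ℓp : Set ℝ))
    filter_upwards [h] with t ht
    rw [Lp.norm_def, eLpNorm_exponent_top, ← toReal_enorm]
    refine ENNReal.toReal_mono ?_ ht
    rw [← eLpNorm_exponent_top]
    exact Lp.eLpNorm_ne_top V₀
  refine memLp_top_of_bound hm.aestronglyMeasurable ‖V₀‖ ?_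
  have hb' : ∀ᵐ x : ℝ × ℝ, x.1 ∈ (interval ℓm ℓp : Set ℝ) → ‖V₀ x.1‖ ≤ ‖V₀‖ :=
    Measure.quasiMeasurePreserving_fst.ae hb
  filter_upwards [hb'] with x hx
  unfold stripPotential
  by_cases h : x ∈ strip ℓm ℓp ε
  · rw [indicator_of_mem h]; exact hx h.1
  · rw [indicator_of_notMem h, norm_zero]; exact norm_nonneg _

/-- The form `a[u, v] = ∫ ∇u · conj ∇v + V u conj v` on `H¹(Ω)`, for a planar open set `Ω`. -/
def schrodingerForm (Ω : Opens (ℝ × ℝ)) (V : Lp ℝ ∞ (volume.restrict (Ω : Set (ℝ × ℝ)))) :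
    DenseForm (L2 Ω) where
  dom := H1 Ω
  form := sesq (weakDeriv Ω (1, 0)) (weakDeriv Ω (1, 0)) +
    sesq (weakDeriv Ω (0, 1)) (weakDeriv Ω (0, 1)) +
    sesq (mulOp V ∘ₗ (H1 Ω).subtype) (H1 Ω).subtype
  dense_dom := dense_H1 Ω

/-- The operator `A_ε = -Δ + V_ε` with Neumann boundary conditions on the waveguide. -/
def opEps (ℓm ℓp : EReal) (α β γ ε : ℝ)
    (V₀ : Lp ℝ ∞ (volume.restrict (interval ℓm ℓp : Set ℝ))) :
    L2 (waveguide ℓm ℓp α β γ ε) →ₗ.[ℂ] L2 (waveguide ℓm ℓp α β γ ε) :=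
  (schrodingerForm (waveguide ℓm ℓp α β γ ε)
    ((memLp_stripPotential α β γ ε V₀).toLp (stripPotential ℓm ℓp ε V₀))).operator

/-! ### The limit operator -/

/-- The Hilbert space `L²(Ω₀) ⊕ ℂ`. -/
abbrev H0 (Ω : Opens ℝ) : Type := WithLp 2 (L2 Ω × ℂ)

/-- The first component as a linear map `L²(Ω₀) ⊕ ℂ → L²(Ω₀)`. -/
def projL2 (Ω : Opens ℝ) : H0 Ω →ₗ[ℂ] L2 Ω :=
  LinearMap.fst ℂ (L2 Ω) ℂ ∘ₗ (WithLp.linearEquiv 2 ℂ (L2 Ω × ℂ)).toLinearMap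

/-- The subspace `H¹(Ω₀) × ℂ` of `L²(Ω₀) ⊕ ℂ`. -/
def dom0 (Ω : Opens ℝ) : Submodule ℂ (H0 Ω) := (H1 Ω).comap (projL2 Ω)

/-- The first component as a linear map `H¹(Ω₀) × ℂ → H¹(Ω₀)`. -/
def projH1 (Ω : Opens ℝ) : dom0 Ω →ₗ[ℂ] H1 Ω := (projL2 Ω).restrict fun _ hf => hf

theorem dense_dom0 (Ω : Opens ℝ) : Dense (dom0 Ω : Set (H0 Ω)) := by
  rw [Submodule.dense_iff_topologicalClosure_eq_top,
    Submodule.topologicalClosure_eq_top_iff, eq_bot_iff]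
  intro f hf
  rw [Submodule.mem_orthogonal] at hf
  have h1 : f.fst = 0 := by
    refine eq_zero_of_orthogonal_H1 _ fun u hu => ?_
    have := hf (WithLp.toLp 2 (u, 0)) hu
    simpa [WithLp.prod_inner_apply] using this
  have h2 : f.snd = 0 := by
    have := hf (WithLp.toLp 2 (0, 1)) (H1 Ω).zero_mem
    simpa [WithLp.prod_inner_apply] using this
  rw [Submodule.mem_bot]
  exact WithLp.ofLp_injective 2 (Prod.ext h1 h2)

/-- The form `a₀[f, g] = ∫ f₁' conj g₁' + V₀ f₁ conj g₁ + γ f₁(0) conj g₁(0)` on `H¹(Ω₀) × ℂ`, for an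
open interval `Ω₀` containing `0`. -/
def limitForm {Ω : Opens ℝ} (hΩ : OrdConnected (Ω : Set ℝ)) (h0 : (0 : ℝ) ∈ Ω) (γ : ℝ)
    (V₀ : Lp ℝ ∞ (volume.restrict (Ω : Set ℝ))) : DenseForm (H0 Ω) where
  dom := dom0 Ω
  form := sesq (weakDeriv Ω 1 ∘ₗ projH1 Ω) (weakDeriv Ω 1 ∘ₗ projH1 Ω) +
    sesq (mulOp V₀ ∘ₗ (H1 Ω).subtype ∘ₗ projH1 Ω) ((H1 Ω).subtype ∘ₗ projH1 Ω) +
    (γ : ℂ) • sesq (evalAt hΩ h0 ∘ₗ projH1 Ω) (evalAt hΩ h0 ∘ₗ projH1 Ω)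
  dense_dom := dense_dom0 Ω

theorem zero_mem_interval {ℓm ℓp : EReal} (hm : ℓm < 0) (hp : 0 < ℓp) :
    (0 : ℝ) ∈ interval ℓm ℓp := ⟨by simpa using hm, by simpa using hp⟩

/-- The limit operator `A₀` in `L²(Ω₀) ⊕ ℂ`. -/
def opZero {ℓm ℓp : EReal} (hm : ℓm < 0) (hp : 0 < ℓp) (γ : ℝ)
    (V₀ : Lp ℝ ∞ (volume.restrict (interval ℓm ℓp : Set ℝ))) :
    H0 (interval ℓm ℓp) →ₗ.[ℂ] H0 (interval ℓm ℓp) :=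
  (limitForm (ordConnected_interval ℓm ℓp) (zero_mem_interval hm hp) γ V₀).operator

/-! ### The Schrödinger operator with a `δ`-interaction -/

/-- The punctured interval `Ω₀ \ {0}`. -/
def punctured (ℓm ℓp : EReal) : Opens ℝ :=
  ⟨(interval ℓm ℓp : Set ℝ) \ {0}, (interval ℓm ℓp).isOpen.sdiff isClosed_singleton⟩

/-- `f₀`, `f₁`, `f₂` are a function in `H²(Ω₀ \ {0})` and its first and second weak derivatives, `f₀`
and `f₁` being continuous on `Ω₀ \ {0}`, subject to the coupling conditions
`f₀(-0) = f₀(+0)`, `f₁(+0) - f₁(-0) = γ f₀(±0)`, and to the Neumann condition at each finite end. -/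
structure IsDeltaDomain (ℓm ℓp : EReal) (γ : ℝ) (f₀ f₁ f₂ : ℝ → ℂ) : Prop where
  memLp_zero : MemLp f₀ 2 (volume.restrict (interval ℓm ℓp : Set ℝ))
  memLp_one : MemLp f₁ 2 (volume.restrict (interval ℓm ℓp : Set ℝ))
  memLp_two : MemLp f₂ 2 (volume.restrict (interval ℓm ℓp : Set ℝ))
  deriv_zero : HasWeakDeriv (punctured ℓm ℓp) 1 f₀ f₁
  deriv_one : HasWeakDeriv (punctured ℓm ℓp) 1 f₁ f₂
  cont_zero : ContinuousOn f₀ (punctured ℓm ℓp : Set ℝ)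
  cont_one : ContinuousOn f₁ (punctured ℓm ℓp : Set ℝ)
  coupling : ∃ c p m : ℂ, Tendsto f₀ (𝓝[<] 0) (𝓝 c) ∧ Tendsto f₀ (𝓝[>] 0) (𝓝 c) ∧
    Tendsto f₁ (𝓝[>] 0) (𝓝 p) ∧ Tendsto f₁ (𝓝[<] 0) (𝓝 m) ∧ p - m = γ * c
  neumann_left : ∀ a : ℝ, ℓm = a → Tendsto f₁ (𝓝[>] a) (𝓝 0)
  neumann_right : ∀ b : ℝ, ℓp = b → Tendsto f₁ (𝓝[<] b) (𝓝 0)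

namespace IsDeltaDomain

variable {ℓm ℓp : EReal} {γ : ℝ} {f₀ f₁ f₂ g₀ g₁ g₂ : ℝ → ℂ}

theorem add (h : IsDeltaDomain ℓm ℓp γ f₀ f₁ f₂) (h' : IsDeltaDomain ℓm ℓp γ g₀ g₁ g₂) :
    IsDeltaDomain ℓm ℓp γ (f₀ + g₀) (f₁ + g₁) (f₂ + g₂) where
  memLp_zero := h.memLp_zero.add h'.memLp_zero
  memLp_one := h.memLp_one.add h'.memLp_one
  memLp_two := h.memLp_two.add h'.memLp_two
  deriv_zero := h.deriv_zero.add h'.deriv_zero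
  deriv_one := h.deriv_one.add h'.deriv_one
  cont_zero := h.cont_zero.add h'.cont_zero
  cont_one := h.cont_one.add h'.cont_one
  coupling := by
    obtain ⟨c, p, m, h1, h2, h3, h4, h5⟩ := h.coupling
    obtain ⟨c', p', m', h1', h2', h3', h4', h5'⟩ := h'.coupling
    exact ⟨c + c', p + p', m + m', h1.add h1', h2.add h2', h3.add h3', h4.add h4',
      by linear_combination h5 + h5'⟩
  neumann_left a ha := by
    have := (h.neumann_left a ha).add (h'.neumann_left a ha)
    rwa [add_zero] at this
  neumann_right b hb := by
    have := (h.neumann_right b hb).add (h'.neumann_right b hb)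
    rwa [add_zero] at this

theorem smul (k : ℂ) (h : IsDeltaDomain ℓm ℓp γ f₀ f₁ f₂) :
    IsDeltaDomain ℓm ℓp γ (k • f₀) (k • f₁) (k • f₂) where
  memLp_zero := h.memLp_zero.const_smul k
  memLp_one := h.memLp_one.const_smul k
  memLp_two := h.memLp_two.const_smul k
  deriv_zero := h.deriv_zero.smul k
  deriv_one := h.deriv_one.smul k
  cont_zero := h.cont_zero.const_smul k
  cont_one := h.cont_one.const_smul k
  coupling := by
    obtain ⟨c, p, m, h1, h2, h3, h4, h5⟩ := h.coupling
    exact ⟨k * c, k * p, k * m, h1.const_mul k, h2.const_mul k, h3.const_mul k, h4.const_mul k,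
      by linear_combination k * h5⟩
  neumann_left a ha := by
    have := (h.neumann_left a ha).const_mul k
    rwa [mul_zero] at this
  neumann_right b hb := by
    have := (h.neumann_right b hb).const_mul k
    rwa [mul_zero] at this

theorem zero : IsDeltaDomain ℓm ℓp γ 0 0 0 where
  memLp_zero := MemLp.zero
  memLp_one := MemLp.zero
  memLp_two := MemLp.zero
  deriv_zero := ⟨locallyIntegrableOn_zero, locallyIntegrableOn_zero, by simp⟩
  deriv_one := ⟨locallyIntegrableOn_zero, locallyIntegrableOn_zero, by simp⟩
  cont_zero := continuousOn_const
  cont_one := continuousOn_const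
  coupling := ⟨0, 0, 0, tendsto_const_nhds, tendsto_const_nhds, tendsto_const_nhds,
    tendsto_const_nhds, by simp⟩
  neumann_left _ _ := tendsto_const_nhds
  neumann_right _ _ := tendsto_const_nhds

end IsDeltaDomain

/-- The graph of the Schrödinger operator with `δ`-interaction: `f ∈ L²(Ω₀)` with a representative as
in `IsDeltaDomain` is mapped to `-f'' + V₀ f`. -/
def deltaGraph (ℓm ℓp : EReal) (γ : ℝ) (V₀ : Lp ℝ ∞ (volume.restrict (interval ℓm ℓp : Set ℝ))) :
    Submodule ℂ (L2 (interval ℓm ℓp) × L2 (interval ℓm ℓp)) where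
  carrier := {q | ∃ f₀ f₁ f₂ : ℝ → ℂ, IsDeltaDomain ℓm ℓp γ f₀ f₁ f₂ ∧
    q.1 =ᵐ[volume.restrict (interval ℓm ℓp : Set ℝ)] f₀ ∧
    (q.2 - mulOp V₀ q.1 : L2 (interval ℓm ℓp)) =ᵐ[volume.restrict (interval ℓm ℓp : Set ℝ)] -f₂}
  zero_mem' := by
    refine ⟨0, 0, 0, IsDeltaDomain.zero, Lp.coeFn_zero _ _ _, ?_⟩
    simp only [Prod.fst_zero, Prod.snd_zero, map_zero, sub_zero, neg_zero]
    exact Lp.coeFn_zero _ _ _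
  add_mem' := by
    rintro q q' ⟨f₀, f₁, f₂, h, h0, h2⟩ ⟨f₀', f₁', f₂', h', h0', h2'⟩
    refine ⟨_, _, _, h.add h', (Lp.coeFn_add _ _).trans (h0.add h0'), ?_⟩
    have e : (q + q').2 - mulOp V₀ (q + q').1 = (q.2 - mulOp V₀ q.1) + (q'.2 - mulOp V₀ q'.1) := by
      rw [Prod.fst_add, Prod.snd_add, map_add]; abel
    rw [e, neg_add]
    exact (Lp.coeFn_add _ _).trans (h2.add h2')
  smul_mem' := by
    rintro k q ⟨f₀, f₁, f₂, h, h0, h2⟩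
    refine ⟨_, _, _, h.smul k, (Lp.coeFn_smul _ _).trans (h0.const_smul k), ?_⟩
    have e : (k • q).2 - mulOp V₀ (k • q).1 = k • (q.2 - mulOp V₀ q.1) := by
      rw [Prod.smul_fst, Prod.smul_snd, map_smul, smul_sub]
    rw [e, ← smul_neg]
    exact (Lp.coeFn_smul _ _).trans (h2.const_smul k)

/-- The Schrödinger operator `-d²/dx² + V₀` on `Ω₀ \ {0}` with a `δ`-interaction of strength `γ` at `0`
and Neumann conditions at the finite ends of `Ω₀`. -/
def deltaOp (ℓm ℓp : EReal) (γ : ℝ) (V₀ : Lp ℝ ∞ (volume.restrict (interval ℓm ℓp : Set ℝ))) :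
    L2 (interval ℓm ℓp) →ₗ.[ℂ] L2 (interval ℓm ℓp) :=
  (deltaGraph ℓm ℓp γ V₀).toLinearPMap

theorem restrict_punctured (ℓm ℓp : EReal) :
    volume.restrict (punctured ℓm ℓp : Set ℝ) = volume.restrict (interval ℓm ℓp : Set ℝ) :=
  Measure.restrict_congr_set (sdiff_null_ae_eq_self (by simp))

theorem graph_deltaOp (ℓm ℓp : EReal) (γ : ℝ)
    (V₀ : Lp ℝ ∞ (volume.restrict (interval ℓm ℓp : Set ℝ))) :
    (deltaOp ℓm ℓp γ V₀).graph = deltaGraph ℓm ℓp γ V₀ := by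
  refine Submodule.toLinearPMap_graph_eq _ ?_
  rintro ⟨u, w⟩ ⟨f₀, f₁, f₂, h, h0, h2⟩ (rfl : u = 0)
  have hz : HasWeakDeriv (punctured ℓm ℓp) 1 0 0 := (IsDeltaDomain.zero (γ := γ)).deriv_zero
  have e0 : f₀ =ᵐ[volume.restrict (punctured ℓm ℓp : Set ℝ)] 0 := by
    rw [restrict_punctured]
    exact h0.symm.trans (Lp.coeFn_zero _ _ _)
  have e1 := (h.deriv_zero.congr e0 (EventuallyEq.refl _ _)).unique hz
  have e2 := (h.deriv_one.congr e1 (EventuallyEq.refl _ _)).unique hz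
  rw [restrict_punctured] at e2
  simp only [map_zero, sub_zero] at h2
  refine Lp.ext (h2.trans ?_)
  refine EventuallyEq.trans ?_ (Lp.coeFn_zero _ _ _).symm
  simpa using e2.neg

end Waveguide
end

open Waveguide

open Waveguide

/-! Write `J` for the isometry `embedding` of `L²(Ω₀) ⊕ ℂ` into `L²(Ω_ε)`, and `R₀`, `R` for the
inverses of `A₀ + 1` and `A_ε + 1`. The estimate rests on `‖R - J R₀ J*‖ ≤ C ε ^ r` with `r = min α
(min (1/2 - β) (2β))`. A perturbation of a self-adjoint operator moves its spectrum by at most its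
norm (`exists_mem_spectrum_dist_le`), conjugation by `J` affects the spectrum at most at `0`
(`spectrum_conj_isometry`), and the closed image of the spectrum of an operator under `z ↦ (1 +
z)⁻¹` is the whole spectrum of its resolvent, including `0`
(`IsFormResolvent.closure_image_opSpectrum`). `dTilde_le` combines these facts.

The norm is estimated in blocks relative to the range of `J` (`norm_sub_conj_isometry_le`). Put `d =
γ ε ^ (α + 1)`, `h = ε ^ α`, `b = ε ^ β` for the width and height of the passage and the side of the
room.

On the range of `J`: for `u = R₀ f` a trial function `U` on the waveguide equals `J u` on strip and
room and interpolates linearly in the passage (`exists_trial_bounds`). The first component of `J* v`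
is the transversal mean of `v` times `√ε`, and taking it commutes with the horizontal derivative;
hence in `a₀[u, J* v] - a_ε[U, v]` the horizontal and potential terms cancel up to errors of order
`ε ^ α` from the passage. What remains is the point interaction `γ u(0) conj (J* v)(0)` against the
flux of `v` through the passage. There the slope of `U` is about `-u(0) / (√ε h)`, the flux of `v`
is about `d` times the difference of its values above and below, and `d / h = γ ε`. The value below,
times `√ε`, is about `(J* v)(0)`: this produces the interaction. The value in the room is at most of
order `‖v‖ / b`, so it contributes `√ε / b = ε ^ (1/2 - β)`: in the limit the strip sees the room as
a sink held at zero (`norm_flux_add_le`). Means over squares of side `ε` or `b` must be compared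
with means at the mouths, over squares of side `d`. A direct comparison costs the ratio of the
sides; a chain of `n + 1` intermediate squares, with `n` independent of `ε`, costs only the factor
`1 / b`, which is affordable (`exists_good_squares`). By duality this gives
`norm_resolvent_embedding_sub_le`.

Off the range of `J`: every `v ∈ H¹(Ω_ε)` satisfies `dist(v, ran J)² ≤ k · energy(v)` with `k` of
order `b² + ε ^ α` (`exists_norm_sub_embedding_le`). If `J* g = 0`, the energy of `R g` is at most
the product of `‖g‖` and the distance of `R g` from `ran J`, so that this distance is at most `k
‖g‖`, with no square root lost (`norm_resolvent_sub_proj_le`). This accounts for the exponents `2β`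
and `α`.

For the identity of spectra, `a₀` ignores the component in `ℂ`, so `A₀` is the direct sum of the
`δ`-operator and the zero operator on `ℂ`. Green's formula in one direction and suitable test
functions in the other identify the `δ`-operator with the operator of the form
(`mem_deltaGraph_iff`, `opSpectrum_opZero`). -/

namespace Waveguide

/-! ### Resolvents of forms and comparison of spectra -/

section AbstractSpectrum

variable {H K : Type*} [NormedAddCommGroup H] [InnerProductSpace ℂ H] [CompleteSpace H]
  [NormedAddCommGroup K] [InnerProductSpace ℂ K] [CompleteSpace K]

/-- A bounded self-adjoint operator `R` is the inverse of `a + 1`, for a form `a`. -/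
structure IsFormResolvent (a : DenseForm H) (R : H →L[ℂ] H) : Prop where
  selfAdjoint : IsSelfAdjoint R
  mem_dom : ∀ g, R g ∈ a.dom
  form_eq : ∀ g (v : a.dom), a.form ⟨R g, mem_dom g⟩ v + inner ℂ (v : H) (R g) = inner ℂ (v : H) g
  eq_of_form_eq : ∀ (u : a.dom) (g : H),
    (∀ v : a.dom, a.form u v + inner ℂ (v : H) (u : H) = inner ℂ (v : H) g) → R g = u

theorem mem_operator_domain_iff (a : DenseForm H) (u w : H) :
    (∃ hu : u ∈ a.operator.domain, a.operator ⟨u, hu⟩ = w) ↔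
      ∃ hu : u ∈ a.dom, ∀ v : a.dom, a.form ⟨u, hu⟩ v = inner ℂ (v : H) w := by
  have h : (u, w) ∈ a.operator.graph ↔ (u, w) ∈ a.graph := by rw [a.graph_operator]
  rw [LinearPMap.mem_graph_iff] at h
  constructor
  · rintro ⟨hu, hw⟩
    exact h.1 ⟨⟨u, hu⟩, rfl, hw⟩
  · intro h'
    obtain ⟨y, hy, hy'⟩ := h.2 h'
    obtain rfl : (y : H) = u := hy
    exact ⟨y.2, hy'⟩

/-- `R` is the inverse of `A + 1`. -/
structure IsResolventNegOne (A : H →ₗ.[ℂ] H) (R : H →L[ℂ] H) : Prop where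
  right_inv : ∀ g, ∃ hg : R g ∈ A.domain, A ⟨R g, hg⟩ + R g = g
  left_inv : ∀ u : A.domain, R (A u + u) = u

theorem IsFormResolvent.isResolventNegOne {a : DenseForm H} {R : H →L[ℂ] H}
    (h : IsFormResolvent a R) : IsResolventNegOne a.operator R where
  right_inv g := by
    obtain ⟨hu, hw⟩ := (mem_operator_domain_iff a (R g) (g - R g)).2 ⟨h.mem_dom g, fun v => by
      rw [inner_sub_right, ← h.form_eq g v]; ring⟩
    exact ⟨hu, by rw [hw]; abel⟩
  left_inv u := by
    obtain ⟨hu, hw⟩ := (mem_operator_domain_iff a u (a.operator u)).1 ⟨u.2, rfl⟩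
    refine h.eq_of_form_eq ⟨u, hu⟩ _ fun v => ?_
    rw [hw, inner_add_right]

/-- With `μ = 1 + z`, the operator `A - z = (A + 1) - μ` composed with `R` is `1 - μ R`, so it is
invertible exactly when `μ⁻¹ - R` is. The point `z = -1` never lies in the spectrum of `A`, but
there `(1 + z)⁻¹` has the default value `0`, which may lie in the spectrum of `R`; hence the
separate clause. -/
theorem IsResolventNegOne.mem_opSpectrum_iff {A : H →ₗ.[ℂ] H} {R : H →L[ℂ] H}
    (h : IsResolventNegOne A R) (z : ℂ) :
    z ∈ opSpectrum A ↔ z ≠ -1 ∧ (1 + z)⁻¹ ∈ spectrum ℂ R := by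
  by_cases hz : z = -1
  · subst hz
    simp only [ne_eq, not_true_eq_false, false_and, iff_false]
    intro h'
    refine h' ⟨R, fun g => ?_, fun u => ?_⟩
    · obtain ⟨hg, e⟩ := h.right_inv g
      exact ⟨hg, by linear_combination (norm := module) e⟩
    · simpa using h.left_inv u
  have hz1 : 1 + z ≠ 0 := fun h0 => hz (by linear_combination h0)
  simp only [ne_eq, hz, not_false_eq_true, true_and, opSpectrum, mem_compl_iff, spectrum,
    not_iff_not]
  set μ := 1 + z with hμ
  have hsm : algebraMap ℂ (H →L[ℂ] H) μ⁻¹ - R = μ⁻¹ • (1 - μ • R) := by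
    ext x; simp [smul_sub, smul_smul, inv_mul_cancel₀ hz1, Algebra.algebraMap_eq_smul_one]
  have hun : IsUnit (algebraMap ℂ (H →L[ℂ] H) μ⁻¹ - R) ↔ IsUnit (1 - μ • R) := by
    rw [hsm]
    have : μ⁻¹ • (1 - μ • R) = (Units.mk0 μ⁻¹ (inv_ne_zero hz1)) • (1 - μ • R) := rfl
    rw [this]
    constructor
    · intro hh
      have := hh.smul (Units.mk0 μ⁻¹ (inv_ne_zero hz1))⁻¹
      rwa [inv_smul_smul] at this
    · exact fun hh => hh.smul _
  rw [_root_.resolventSet, mem_ofPred_eq, hun]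
  constructor
  · rintro ⟨Rz, h1, h2⟩
    -- Resolvent identity: if `Rz` inverts `A - z`, then `R = Rz - μ R Rz`, so `1 + μ Rz` inverts `1
    -- - μ R`.
    refine isUnit_iff_exists.2 ⟨1 + μ • Rz, ?_, ?_⟩
    · ext g
      obtain ⟨hg, e⟩ := h1 g
      have e2 := h.left_inv ⟨Rz g, hg⟩
      have e3 : A ⟨Rz g, hg⟩ + Rz g = g + μ • Rz g := by
        rw [hμ, add_smul, one_smul]; nth_rewrite 3 [← e]; abel
      rw [show ((⟨Rz g, hg⟩ : A.domain) : H) = Rz g from rfl, e3, map_add, map_smul] at e2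
      simp only [mul_apply_eq_comp, sub_apply,
        one_apply_eq_self, smul_apply,
        add_apply, map_add, map_smul]
      linear_combination (norm := module) (-μ) • e2
    · ext g
      obtain ⟨hg, e⟩ := h.right_inv g
      have e2 := h2 ⟨R g, hg⟩
      have e3 : A ⟨R g, hg⟩ - z • R g = g - μ • R g := by
        rw [hμ, add_smul, one_smul]; nth_rewrite 3 [← e]; abel
      rw [show ((⟨R g, hg⟩ : A.domain) : H) = R g from rfl, e3] at e2
      simp only [mul_apply_eq_comp, sub_apply,
        one_apply_eq_self, smul_apply,
        add_apply, e2]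
      abel
  · rintro hU
    obtain ⟨B, hB1, hB2⟩ := isUnit_iff_exists.1 hU
    have hcomm : R * B = B * R := by
      have h3 : (1 - μ • R) * R = R * (1 - μ • R) := by
        rw [sub_mul, mul_sub, one_mul, mul_one, smul_mul_assoc, mul_smul_comm]
      calc R * B = (B * (1 - μ • R)) * (R * B) := by rw [hB2, one_mul]
        _ = B * ((1 - μ • R) * R) * B := by simp only [mul_assoc]
        _ = B * R * ((1 - μ • R) * B) := by rw [h3]; simp only [mul_assoc]
        _ = B * R := by rw [hB1, mul_one]
    -- Conversely `A - z = (1 - μ R)(A + 1)` on the domain, whose inverse is `R B` because `R` and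
    -- `B` commute.
    refine ⟨R * B, fun g => ?_, fun u => ?_⟩
    · obtain ⟨hg, e⟩ := h.right_inv (B g)
      refine ⟨hg, ?_⟩
      have e1 := congrArg (fun T : H →L[ℂ] H => T g) hB1
      simp only [mul_apply_eq_comp, sub_apply,
        one_apply_eq_self, smul_apply] at e1
      refine Eq.trans ?_ e1
      change A ⟨R (B g), hg⟩ - z • R (B g) = _
      rw [hμ]
      linear_combination (norm := module) e
    · rw [hcomm]
      have e := h.left_inv u
      have e1 := congrArg (fun T : H →L[ℂ] H => T (A u + u)) hB2
      simp only [mul_apply_eq_comp, sub_apply,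
        one_apply_eq_self, smul_apply, e] at e1
      have e2 : A u - z • (u : H) = A u + u - μ • (u : H) := by
        rw [hμ, add_smul, one_smul]; abel
      rw [e2, hcomm.symm]
      have e3 : R (B (A u + u - μ • (u : H))) = u := by rw [e1, e]
      exact e3

/-- If `R g = 0`, the defining identity says that `g` is orthogonal to the dense form domain. -/
theorem IsFormResolvent.injective {a : DenseForm H} {R : H →L[ℂ] H}
    (h : IsFormResolvent a R) : Function.Injective R := by
  rw [injective_iff_map_eq_zero]
  intro g hg
  refine a.dense_dom.eq_zero_of_inner_right ℂ fun v hv => ?_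
  have := h.form_eq g ⟨v, hv⟩
  rw [← this]
  have e : (⟨R g, h.mem_dom g⟩ : a.dom) = 0 := Subtype.ext hg
  rw [e, hg]
  simp

/-- `0` is not an isolated point of the spectrum of an injective self-adjoint operator. -/
theorem zero_mem_closure_spectrum {R : H →L[ℂ] H} (hR : IsSelfAdjoint R)
    (hinj : Function.Injective R) (h0 : (0 : ℂ) ∈ spectrum ℂ R) :
    (0 : ℂ) ∈ closure (spectrum ℂ R \ {0}) := by
  by_contra hcl
  rw [Metric.mem_closure_iff] at hcl
  push Not at hcl
  obtain ⟨r, hr, hdist⟩ := hcl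
  have hn : IsStarNormal R := hR.isStarNormal
  -- A bump at `0` that vanishes on the rest of the spectrum. Then `z f(z) = 0` on the spectrum
  -- gives `R f(R) = 0`, and injectivity forces `f(R) = 0`, although `f(0) = 1` lies in the spectrum
  -- of `f(R)`.
  let f : ℂ → ℂ := fun z => ((max 0 (1 - ‖z‖ / r) : ℝ) : ℂ)
  have hf : Continuous f := by
    refine Complex.continuous_ofReal.comp ?_
    fun_prop
  have hz : ∀ z ∈ spectrum ℂ R, z * f z = 0 := by
    intro z hz
    by_cases h : z = 0
    · simp [h]
    · have := hdist z ⟨hz, h⟩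
      rw [dist_zero_left] at this
      have : f z = 0 := by
        have : 1 - ‖z‖ / r ≤ 0 := by
          rw [sub_nonpos, le_div_iff₀ hr]; linarith
        simp [f, max_eq_left this]
      rw [this, mul_zero]
  have h1 : R * cfc f R = 0 := by
    nth_rewrite 1 [← cfc_id ℂ R]
    rw [← cfc_mul (id : ℂ → ℂ) f R continuousOn_id hf.continuousOn]
    rw [cfc_congr (f := fun z => id z * f z) (g := fun _ => (0 : ℂ)) (fun z hz' => hz z hz')]
    simp
  have h2 : cfc f R = 0 := by
    ext x
    apply hinj
    have := congrArg (fun T : H →L[ℂ] H => T x) h1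
    simpa using this
  have h3 := cfc_map_spectrum (R := ℂ) f R hn hf.continuousOn
  have hnt : Nontrivial H := by
    by_contra hh
    rw [not_nontrivial_iff_subsingleton] at hh
    have : Subsingleton (H →L[ℂ] H) := inferInstance
    rw [spectrum.of_subsingleton] at h0
    exact h0
  rw [h2, spectrum.zero_eq] at h3
  have : f 0 ∈ f '' spectrum ℂ R := ⟨0, h0, rfl⟩
  rw [← h3] at this
  simp [f] at this

/-- If `z` were farther than `δ` from the spectrum of `R'`, the functional calculus would bound `B =
(z - R')⁻¹` by `δ⁻¹`, and `z - R = (1 - (R - R') B)(z - R')` would be invertible by a Neumann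
series. Only `R'` has to be self-adjoint. -/
theorem exists_mem_spectrum_dist_le {R R' : H →L[ℂ] H} (hR' : IsSelfAdjoint R') {z : ℂ} {δ : ℝ}
    (hδ : ‖R - R'‖ < δ) (hz : z ∈ spectrum ℂ R) : ∃ w ∈ spectrum ℂ R', dist z w ≤ δ := by
  by_contra hcon
  push Not at hcon
  have hδ0 : 0 < δ := (norm_nonneg _).trans_lt hδ
  have hn : IsStarNormal R' := hR'.isStarNormal
  have hne : ∀ w ∈ spectrum ℂ R', z - w ≠ 0 := by
    intro w hw h
    have := hcon w hw
    rw [dist_eq_norm, h, norm_zero] at this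
    linarith
  have hc : ContinuousOn (fun w : ℂ => (z - w)⁻¹) (spectrum ℂ R') :=
    ContinuousOn.inv₀ (by fun_prop) hne
  have hnorm : ‖cfc (fun w : ℂ => (z - w)⁻¹) R'‖ ≤ δ⁻¹ := by
    refine norm_cfc_le (by positivity) fun w hw => ?_
    rw [norm_inv, ← dist_eq_norm]
    exact inv_anti₀ hδ0 (hcon w hw).le
  have e1 : cfc (fun w : ℂ => z - w) R' = algebraMap ℂ _ z - R' := by
    rw [cfc_sub (fun _ => z) (fun w => w) R', cfc_const z R', cfc_id' ℂ R']
  have hmul : (algebraMap ℂ _ z - R') * cfc (fun w : ℂ => (z - w)⁻¹) R' = 1 := by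
    rw [← e1, ← cfc_mul (fun w : ℂ => z - w) (fun w : ℂ => (z - w)⁻¹) R' (by fun_prop) hc]
    rw [cfc_congr (g := fun _ => (1 : ℂ)) (fun w hw => mul_inv_cancel₀ (hne w hw))]
    exact cfc_one ℂ R'
  have hmul' : cfc (fun w : ℂ => (z - w)⁻¹) R' * (algebraMap ℂ _ z - R') = 1 := by
    rw [← e1, ← cfc_mul (fun w : ℂ => (z - w)⁻¹) (fun w : ℂ => z - w) R' hc (by fun_prop)]
    rw [cfc_congr (g := fun _ => (1 : ℂ)) (fun w hw => inv_mul_cancel₀ (hne w hw))]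
    exact cfc_one ℂ R'
  set B := cfc (fun w : ℂ => (z - w)⁻¹) R' with hB
  let U : (H →L[ℂ] H)ˣ := ⟨algebraMap ℂ _ z - R', B, hmul, hmul'⟩
  apply hz
  have hlt : ‖(R - R') * B‖ < 1 := by
    refine (norm_mul_le _ _).trans_lt ?_
    calc ‖R - R'‖ * ‖B‖ ≤ ‖R - R'‖ * δ⁻¹ := by gcongr
      _ < δ * δ⁻¹ := by gcongr
      _ = 1 := mul_inv_cancel₀ hδ0.ne'
  have hu : IsUnit (1 - (R - R') * B) := isUnit_one_sub_of_norm_lt_one hlt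
  have : algebraMap ℂ (H →L[ℂ] H) z - R = (1 - (R - R') * B) * (algebraMap ℂ _ z - R') := by
    rw [sub_mul, one_mul, mul_assoc, hmul', mul_one]; abel
  rw [_root_.resolventSet, mem_ofPred_eq, this]
  exact hu.mul U.isUnit

/-- On the graph `W` of `D` the inner product is `a[u, v] + (u, v)`. With `π` the projection to the
first component, the equation `a[u, v] + (u, v) = (g, v)` says that `(u, D u)` is the orthogonal
projection of `π* g` onto `W`. Closedness of `D` makes this projection available, and `R = π P_W π*`
is visibly self-adjoint. -/
theorem exists_isFormResolvent (a : DenseForm H) (D : a.dom →ₗ[ℂ] K)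
    (ha : ∀ u v, a.form u v = inner ℂ (D v) (D u))
    (hD : IsClosed {p : H × K | ∃ hu : p.1 ∈ a.dom, D ⟨p.1, hu⟩ = p.2}) :
    ∃ R, IsFormResolvent a R := by
  let T : a.dom →ₗ[ℂ] WithLp 2 (H × K) :=
    (WithLp.linearEquiv 2 ℂ (H × K)).symm.toLinearMap ∘ₗ (a.dom.subtype.prod D)
  have hT : ∀ u, T u = WithLp.toLp 2 ((u : H), D u) := fun u => rfl
  have hTi : ∀ u v, inner ℂ (T v) (T u) = a.form u v + inner ℂ (v : H) (u : H) := by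
    intro u v
    rw [hT, hT, WithLp.prod_inner_apply, ha, add_comm]
  let W : Submodule ℂ (WithLp 2 (H × K)) := LinearMap.range T
  have hWc : IsClosed (W : Set (WithLp 2 (H × K))) := by
    have : (W : Set (WithLp 2 (H × K))) = (WithLp.ofLp : WithLp 2 (H × K) → H × K) ⁻¹'
        {p : H × K | ∃ hu : p.1 ∈ a.dom, D ⟨p.1, hu⟩ = p.2} := by
      ext p
      constructor
      · rintro ⟨u, rfl⟩
        exact ⟨u.2, rfl⟩
      · rintro ⟨hu, hp⟩
        exact ⟨⟨_, hu⟩, WithLp.ofLp_injective 2 (Prod.ext rfl hp)⟩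
    rw [this]
    exact hD.preimage (WithLp.prod_continuous_ofLp 2 H K)
  have : CompleteSpace W := hWc.completeSpace_coe
  let π : WithLp 2 (H × K) →L[ℂ] H :=
    ContinuousLinearMap.fst ℂ H K ∘L (WithLp.prodContinuousLinearEquiv 2 ℂ H K).toContinuousLinearMap
  have hπ : ∀ u, π (T u) = u := fun u => rfl
  let R : H →L[ℂ] H := π ∘L W.starProjection ∘L ContinuousLinearMap.adjoint π
  have hRT : ∀ g, ∃ u, T u = W.starProjection (ContinuousLinearMap.adjoint π g) := fun g =>
    Submodule.starProjection_apply_mem W (ContinuousLinearMap.adjoint π g)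
  have hRu : ∀ g u, T u = W.starProjection (ContinuousLinearMap.adjoint π g) → R g = u := by
    intro g u hu
    change π (W.starProjection (ContinuousLinearMap.adjoint π g)) = u
    rw [← hu, hπ]
  have hproj : ∀ g v, inner ℂ (T v) (W.starProjection (ContinuousLinearMap.adjoint π g)) =
      inner ℂ (v : H) g := by
    intro g v
    rw [← Submodule.inner_starProjection_left_eq_right,
      Submodule.starProjection_eq_self_iff.2 (⟨v, rfl⟩ : T v ∈ W),
      ContinuousLinearMap.adjoint_inner_right, hπ]
  have hmem : ∀ g, R g ∈ a.dom := fun g => by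
    obtain ⟨u, hu⟩ := hRT g
    rw [hRu g u hu]
    exact u.2
  refine ⟨R, ?_, hmem, ?_, ?_⟩
  · rw [ContinuousLinearMap.isSelfAdjoint_iff_isSymmetric]
    intro x y
    change inner ℂ (π (W.starProjection (ContinuousLinearMap.adjoint π x))) y =
      inner ℂ x (π (W.starProjection (ContinuousLinearMap.adjoint π y)))
    rw [← ContinuousLinearMap.adjoint_inner_right, Submodule.inner_starProjection_left_eq_right,
      ContinuousLinearMap.adjoint_inner_left]
  · intro g v
    obtain ⟨u, hu⟩ := hRT g
    have e : (⟨R g, hmem g⟩ : a.dom) = u := Subtype.ext (hRu g u hu)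
    rw [e, hRu g u hu, ← hTi, hu, hproj]
  · intro u g h
    obtain ⟨u', hu'⟩ := hRT g
    rw [hRu g u' hu']
    have h1 : ∀ v, inner ℂ (T v) (T u' - T u) = 0 := by
      intro v
      rw [inner_sub_right, hu', hproj, hTi, h, sub_self]
    have h2 := h1 (u' - u)
    rw [map_sub, inner_self_eq_zero, sub_eq_zero] at h2
    rw [← hπ, ← hπ, h2]

/-- The range of `R` lies in the form domain, so `R` cannot be surjective. -/
theorem IsFormResolvent.zero_mem_spectrum {a : DenseForm H} {R : H →L[ℂ] H}
    (h : IsFormResolvent a R) (hdom : a.dom ≠ ⊤) : (0 : ℂ) ∈ spectrum ℂ R := by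
  rw [spectrum.zero_mem_iff]
  intro hU
  apply hdom
  rw [eq_top_iff]
  intro g _
  obtain ⟨B, hB, -⟩ := isUnit_iff_exists.1 hU
  have e := congrArg (fun T : H →L[ℂ] H => T g) hB
  have := h.mem_dom (B g)
  simp only [mul_apply_eq_comp, one_apply_eq_self] at e
  rwa [e] at this

/-- The image before closure is the spectrum of `R` without `0`. As `R` is injective, `0` is not
isolated in its spectrum, so the closure restores exactly this point. This turns `dTilde` into a
distance of spectra of bounded operators. -/
theorem IsFormResolvent.closure_image_opSpectrum {a : DenseForm H} {R : H →L[ℂ] H}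
    (h : IsFormResolvent a R) (hdom : a.dom ≠ ⊤) :
    closure ((fun z : ℂ => (1 + z)⁻¹) '' opSpectrum a.operator) = spectrum ℂ R := by
  have h0 := h.zero_mem_spectrum hdom
  have himg : (fun z : ℂ => (1 + z)⁻¹) '' opSpectrum a.operator = spectrum ℂ R \ {0} := by
    ext μ
    constructor
    · rintro ⟨z, hz, rfl⟩
      obtain ⟨h1, h2⟩ := (h.isResolventNegOne.mem_opSpectrum_iff z).1 hz
      refine ⟨h2, ?_⟩
      simp only [mem_singleton_iff, inv_eq_zero]
      exact fun h0 => h1 (by linear_combination h0)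
    · rintro ⟨h1, h2⟩
      have h2' : μ ≠ 0 := h2
      refine ⟨μ⁻¹ - 1, (h.isResolventNegOne.mem_opSpectrum_iff _).2 ⟨?_, ?_⟩, ?_⟩
      · intro h3
        exact inv_ne_zero h2' (by linear_combination h3)
      · simpa using h1
      · simp
  rw [himg]
  refine Subset.antisymm ?_ ?_
  · exact closure_minimal sdiff_subset (spectrum.isClosed R)
  · intro μ hμ
    by_cases h2 : μ = 0
    · rw [h2]
      exact zero_mem_closure_spectrum h.selfAdjoint h.injective h0
    · exact subset_closure ⟨hμ, h2⟩

/-- The resolvent of the smaller space, transplanted by an isometry, has the same spectrum. -/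
theorem spectrum_conj_isometry {R₀ : H →L[ℂ] H} (J : H →L[ℂ] K)
    (hJ : ContinuousLinearMap.adjoint J ∘L J = 1) {z : ℂ} (hz : z ≠ 0) :
    z ∈ spectrum ℂ (J ∘L R₀ ∘L ContinuousLinearMap.adjoint J) ↔ z ∈ spectrum ℂ R₀ := by
  have hJx : ∀ x, ContinuousLinearMap.adjoint J (J x) = x := fun x =>
    congrArg (fun T : H →L[ℂ] H => T x) hJ
  rw [spectrum.mem_iff, spectrum.mem_iff, not_iff_not]
  set J' := ContinuousLinearMap.adjoint J
  have am : ∀ x : H, algebraMap ℂ (H →L[ℂ] H) z x = z • x := fun x => by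
    simp [Algebra.algebraMap_eq_smul_one]
  have am' : ∀ x : K, algebraMap ℂ (K →L[ℂ] K) z x = z • x := fun x => by
    simp [Algebra.algebraMap_eq_smul_one]
  constructor
  · intro hU
    obtain ⟨C, hC1, hC2⟩ := isUnit_iff_exists.1 hU
    have h1 : ∀ y, z • C y - J (R₀ (J' (C y))) = y := fun y => by
      have := congrArg (fun T : K →L[ℂ] K => T y) hC1
      simpa [am'] using this
    have h2 : ∀ y, z • C y - C (J (R₀ (J' y))) = y := fun y => by
      have := congrArg (fun T : K →L[ℂ] K => T y) hC2
      simpa [am'] using this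
    refine isUnit_iff_exists.2 ⟨J' ∘L C ∘L J, ?_, ?_⟩
    · ext x
      have := congrArg J' (h1 (J x))
      rw [map_sub, map_smul, hJx, hJx] at this
      simpa [am] using this
    · ext x
      have := congrArg J' (h2 (J x))
      simp only [map_sub, map_smul, hJx] at this
      simpa [am] using this
  · intro hU
    obtain ⟨B, hB1, hB2⟩ := isUnit_iff_exists.1 hU
    have h1 : ∀ y, z • B y - R₀ (B y) = y := fun y => by
      have := congrArg (fun T : H →L[ℂ] H => T y) hB1
      simpa [am] using this
    have h2 : ∀ y, z • B y - B (R₀ y) = y := fun y => by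
      have := congrArg (fun T : H →L[ℂ] H => T y) hB2
      simpa [am] using this
    -- `z - J R₀ J*` acts as `z - R₀` on the range of `J` and as multiplication by `z` on its
    -- orthogonal complement; the witness inverts both parts, the second one because `z ≠ 0`.
    refine isUnit_iff_exists.2 ⟨J ∘L B ∘L J' + z⁻¹ • (1 - J ∘L J'), ?_, ?_⟩
    · ext y
      have e := congrArg J (h1 (J' y))
      rw [map_sub, map_smul] at e
      simp only [mul_apply_eq_comp, sub_apply, add_apply, smul_apply, one_apply_eq_self, am',
        ContinuousLinearMap.comp_apply, map_add, map_sub, map_smul, hJx, smul_smul, smul_sub]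
      rw [inv_mul_cancel₀ hz]
      linear_combination (norm := module) e
    · ext y
      have e := congrArg J (h2 (J' y))
      rw [map_sub, map_smul] at e
      simp only [mul_apply_eq_comp, sub_apply, add_apply, smul_apply, one_apply_eq_self, am',
        ContinuousLinearMap.comp_apply, map_sub, map_smul, hJx, smul_add, smul_smul, smul_sub]
      rw [mul_inv_cancel₀ hz]
      linear_combination (norm := module) e

/-- Decompose with respect to the range of `J` and its complement. The assumption `hδ` controls the
two blocks that start in the range. The block from the complement into the range is the adjoint of
one of them, so self-adjointness bounds it by `δ` as well. The remaining corner is `hκ`. -/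
theorem norm_sub_conj_isometry_le {R₀ : H →L[ℂ] H} {R : K →L[ℂ] K} (hR : IsSelfAdjoint R)
    (J : H →L[ℂ] K) (hJ : ContinuousLinearMap.adjoint J ∘L J = 1) {δ κ : ℝ}
    (hδ : ∀ x, ‖R (J x) - J (R₀ x)‖ ≤ δ * ‖x‖) (hδ0 : 0 ≤ δ)
    (hκ : ∀ g, ContinuousLinearMap.adjoint J g = 0 →
      ‖R g - J (ContinuousLinearMap.adjoint J (R g))‖ ≤ κ * ‖g‖) (hκ0 : 0 ≤ κ) :
    ‖R - J ∘L R₀ ∘L ContinuousLinearMap.adjoint J‖ ≤ 2 * δ + κ := by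
  have hJx : ∀ x, ContinuousLinearMap.adjoint J (J x) = x := fun x =>
    congrArg (fun T : H →L[ℂ] H => T x) hJ
  set J' := ContinuousLinearMap.adjoint J with hJ'
  have hJn : ∀ x, ‖J x‖ = ‖x‖ := by
    intro x
    have : inner ℂ (J x) (J x) = inner ℂ x x := by
      rw [← ContinuousLinearMap.adjoint_inner_right, hJx]
    rw [inner_self_eq_norm_sq_to_K, inner_self_eq_norm_sq_to_K] at this
    have h2 : ‖J x‖ ^ 2 = ‖x‖ ^ 2 := by exact_mod_cast this
    exact (sq_eq_sq₀ (norm_nonneg _) (norm_nonneg _)).1 h2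
  have hpyth : ∀ g, ‖J' g‖ ≤ ‖g‖ ∧ ‖g - J (J' g)‖ ≤ ‖g‖ := by
    intro g
    have hort : inner ℂ (J (J' g)) (g - J (J' g)) = 0 := by
      rw [← ContinuousLinearMap.adjoint_inner_right, map_sub, ← hJ', hJx, sub_self,
        inner_zero_right]
    have h1 := norm_add_sq_eq_norm_sq_add_norm_sq_of_inner_eq_zero _ _ hort
    rw [add_sub_cancel, hJn] at h1
    constructor <;> nlinarith [norm_nonneg g, norm_nonneg (J' g), norm_nonneg (g - J (J' g))]
  have hQ : ∀ x, ‖R (J x) - J (J' (R (J x)))‖ ≤ δ * ‖x‖ := by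
    intro x
    have h1 := (hpyth (R (J x) - J (R₀ x))).2
    rw [map_sub, hJx, map_sub] at h1
    refine le_trans (le_of_eq ?_) (h1.trans (hδ x))
    congr 1; abel
  -- For `g` orthogonal to the range, moving `R` to the other side of `‖J* R g‖²` leaves only the
  -- component of `R J (J* R g)` orthogonal to the range, which `hQ` bounds.
  have hP : ∀ g, J' g = 0 → ‖J' (R g)‖ ≤ δ * ‖g‖ := by
    intro g hg
    have h1 : inner ℂ (J' (R g)) (J' (R g)) =
        inner ℂ g (R (J (J' (R g))) - J (J' (R (J (J' (R g)))))) := by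
      rw [inner_sub_right, ← ContinuousLinearMap.adjoint_inner_left J, ← hJ', hg, inner_zero_left,
        sub_zero]
      have hs := (ContinuousLinearMap.isSelfAdjoint_iff_isSymmetric.1 hR) g (J (J' (R g)))
      refine Eq.trans ?_ hs
      exact ContinuousLinearMap.adjoint_inner_left J _ _
    have h2 : ‖J' (R g)‖ ^ 2 ≤ ‖g‖ * (δ * ‖J' (R g)‖) := by
      have h3 := congrArg norm h1
      rw [inner_self_eq_norm_sq_to_K] at h3
      simp only [norm_pow, RCLike.norm_ofReal, abs_norm] at h3
      rw [h3]
      exact (norm_inner_le_norm _ _).trans (by gcongr; exact hQ _)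
    by_cases h0 : ‖J' (R g)‖ = 0
    · rw [h0]; positivity
    · have : 0 < ‖J' (R g)‖ := lt_of_le_of_ne (norm_nonneg _) (Ne.symm h0)
      nlinarith
  refine ContinuousLinearMap.opNorm_le_bound _ (by positivity) fun g => ?_
  have hg0 : J' (g - J (J' g)) = 0 := by rw [map_sub, hJx, sub_self]
  have e : (R - J ∘L R₀ ∘L J') g = (R (J (J' g)) - J (R₀ (J' g))) +
      J (J' (R (g - J (J' g)))) +
      (R (g - J (J' g)) - J (J' (R (g - J (J' g))))) := by
    simp only [sub_apply, ContinuousLinearMap.comp_apply, map_sub]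
    abel
  rw [e]
  have n1 := hδ (J' g)
  have n2 := hP _ hg0
  have n3 := hκ _ hg0
  have n4 := hpyth g
  refine (norm_add₃_le).trans ?_
  rw [hJn]
  calc _ ≤ δ * ‖J' g‖ + δ * ‖g - J (J' g)‖ + κ * ‖g - J (J' g)‖ := by gcongr
    _ ≤ δ * ‖g‖ + δ * ‖g‖ + κ * ‖g‖ := by gcongr <;> simp [n4]
    _ = _ := by ring

/-- Closeness of resolvents implies closeness of spectra. -/
theorem dTilde_le {a₀ : DenseForm H} {a : DenseForm K} {R₀ : H →L[ℂ] H} {R : K →L[ℂ] K}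
    (h₀ : IsFormResolvent a₀ R₀) (h : IsFormResolvent a R) (hd₀ : a₀.dom ≠ ⊤) (hd : a.dom ≠ ⊤)
    (J : H →L[ℂ] K) (hJ : ContinuousLinearMap.adjoint J ∘L J = 1) {η : ℝ}
    (hη : ‖R - J ∘L R₀ ∘L ContinuousLinearMap.adjoint J‖ < η) :
    dTilde (opSpectrum a.operator) (opSpectrum a₀.operator) ≤ ENNReal.ofReal η := by
  rw [dTilde, h.closure_image_opSpectrum hd, h₀.closure_image_opSpectrum hd₀]
  have hsa : IsSelfAdjoint (J ∘L R₀ ∘L ContinuousLinearMap.adjoint J) := by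
    have := h₀.selfAdjoint.conj_adjoint J
    exact this
  refine Metric.hausdorffEDist_le_of_mem_edist ?_ ?_
  · intro z hz
    obtain ⟨w, hw, hzw⟩ := exists_mem_spectrum_dist_le hsa hη hz
    refine ⟨w, ?_, ?_⟩
    -- Conjugation by the isometry preserves only the nonzero spectrum; `0` belongs to the spectra
    -- of both resolvents anyway.
    · by_cases h0 : w = 0
      · rw [h0]; exact h₀.zero_mem_spectrum hd₀
      · exact (spectrum_conj_isometry J hJ h0).1 hw
    · rw [edist_dist]; exact ENNReal.ofReal_le_ofReal hzw
  · intro z hz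
    by_cases h0 : z = 0
    · exact ⟨0, h.zero_mem_spectrum hd, by simp [h0]⟩
    · have hz' := (spectrum_conj_isometry J hJ h0).2 hz
      rw [← norm_sub_rev] at hη
      obtain ⟨w, hw, hzw⟩ := exists_mem_spectrum_dist_le h.selfAdjoint hη hz'
      exact ⟨w, hw, by rw [edist_dist]; exact ENNReal.ofReal_le_ofReal hzw⟩

end AbstractSpectrum

/-! ### Primitives and weak derivatives on an interval -/

section Primitives

theorem sq_lintegral_le {α : Type*} [MeasurableSpace α] (μ : Measure α) {f : α → ℝ≥0∞}
    (hf : AEMeasurable f μ) : (∫⁻ x, f x ∂μ) ^ 2 ≤ μ univ * ∫⁻ x, f x ^ 2 ∂μ := by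
  have h := ENNReal.lintegral_mul_le_Lp_mul_Lq μ Real.HolderConjugate.two_two
    (aemeasurable_const (b := (1 : ℝ≥0∞))) hf
  simp only [Pi.mul_apply, one_mul, ENNReal.one_rpow, lintegral_const] at h
  calc _ ≤ (μ univ ^ (1 / 2 : ℝ) * (∫⁻ a, f a ^ (2 : ℝ) ∂μ) ^ (1 / 2 : ℝ)) ^ 2 := by gcongr
    _ = _ := by
      rw [mul_pow, ← ENNReal.rpow_natCast, ← ENNReal.rpow_natCast, ← ENNReal.rpow_mul,
        ← ENNReal.rpow_mul]
      norm_num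

theorem enorm_add_sq_le {E : Type*} [NormedAddCommGroup E] (x y : E) :
    ‖x + y‖ₑ ^ 2 ≤ 2 * (‖x‖ₑ ^ 2 + ‖y‖ₑ ^ 2) := by
  calc ‖x + y‖ₑ ^ 2 ≤ (‖x‖ₑ + ‖y‖ₑ) ^ 2 := by gcongr; exact enorm_add_le _ _
    _ ≤ _ := by
      have := ENNReal.rpow_add_le_mul_rpow_add_rpow ‖x‖ₑ ‖y‖ₑ (p := 2) (by norm_num)
      norm_num at this
      exact_mod_cast this

/-- `u` is a primitive of the locally integrable function `g` on `I`. -/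
def IsPrimitiveOn (I : Set ℝ) (u g : ℝ → ℂ) : Prop :=
  LocallyIntegrableOn g I ∧ ∀ x ∈ I, ∀ y ∈ I, u y - u x = ∫ t in x..y, g t

variable {I : Set ℝ} {u v g k : ℝ → ℂ}

theorem intervalIntegrable_of_locallyIntegrableOn (hI : OrdConnected I)
    (hg : LocallyIntegrableOn g I) {x y : ℝ} (hx : x ∈ I) (hy : y ∈ I) :
    IntervalIntegrable g volume x y :=
  (hg.integrableOn_compact_subset (hI.uIcc_subset hx hy) isCompact_uIcc).intervalIntegrable

namespace IsPrimitiveOn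

theorem mono {J : Set ℝ} (h : IsPrimitiveOn I u g) (hJ : J ⊆ I) : IsPrimitiveOn J u g :=
  ⟨h.1.mono_set hJ, fun x hx y hy => h.2 x (hJ hx) y (hJ hy)⟩

theorem intervalIntegrable (h : IsPrimitiveOn I u g) (hI : OrdConnected I) {x y : ℝ} (hx : x ∈ I)
    (hy : y ∈ I) : IntervalIntegrable g volume x y :=
  intervalIntegrable_of_locallyIntegrableOn hI h.1 hx hy

theorem continuousOn_Icc (h : IsPrimitiveOn I u g) {a b : ℝ} (hab : Icc a b ⊆ I) (hle : a ≤ b) :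
    ContinuousOn u (Icc a b) := by
  have hc := intervalIntegral.continuousOn_primitive_interval' (a := a) (b₁ := a) (b₂ := b) (f := g)
      (μ := volume) (IntegrableOn.intervalIntegrable (by
        rw [uIcc_of_le hle]; exact h.1.integrableOn_compact_subset hab isCompact_Icc))
      left_mem_uIcc
  rw [uIcc_of_le hle] at hc
  refine (hc.const_add (u a)).congr fun x hx => ?_
  have := h.2 a (hab (left_mem_Icc.2 hle)) x (hab hx)
  simp only
  rw [← this]; ring

theorem continuousOn (h : IsPrimitiveOn I u g) (hI : IsOpen I) : ContinuousOn u I := by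
  intro x hx
  obtain ⟨r, hr, hball⟩ := Metric.isOpen_iff.1 hI x hx
  have hK : Icc (x - r / 2) (x + r / 2) ⊆ I := by
    refine Subset.trans (fun y hy => ?_) hball
    rw [Metric.mem_ball, Real.dist_eq, abs_lt]
    constructor <;> linarith [hy.1, hy.2]
  exact ((h.continuousOn_Icc hK (by linarith)).continuousAt
    (Icc_mem_nhds (by linarith) (by linarith))).continuousWithinAt

theorem star (h : IsPrimitiveOn I u g) :
    IsPrimitiveOn I (fun x => starRingEnd ℂ (u x)) (fun x => starRingEnd ℂ (g x)) := by
  refine ⟨?_, fun x hx y hy => ?_⟩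
  · intro x hx
    obtain ⟨s, hs, h'⟩ := h.1 x hx
    exact ⟨s, hs, (Complex.conjCLE.toContinuousLinearMap.integrable_comp h' :)⟩
  · rw [← map_sub, h.2 x hx y hy]
    rw [intervalIntegral.intervalIntegral_eq_integral_uIoc,
      intervalIntegral.intervalIntegral_eq_integral_uIoc, integral_conj]
    split_ifs <;> simp

/-- Integration by parts. -/
theorem integral_mul_add (h : IsPrimitiveOn I u g) (h' : IsPrimitiveOn I v k)
    (hI : OrdConnected I) {x y : ℝ} (hx : x ∈ I) (hy : y ∈ I) (hxy : x ≤ y) :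
    ∫ t in x..y, (g t * v t + u t * k t) = u y * v y - u x * v x := by
  have hsub : Icc x y ⊆ I := hI.out hx hy
  have hgi : IntegrableOn g (Ioc x y) := (h.intervalIntegrable hI hx hy).1
  have hki : IntegrableOn k (Ioc x y) := (h'.intervalIntegrable hI hx hy).1
  set μ : Measure ℝ := volume.restrict (Ioc x y) with hμ
  have hu : ∀ t ∈ Ioc x y, u t = u x + ∫ s, (Iic t).indicator g s ∂μ := by
    intro t ht
    have h1 := h.2 x hx t (hsub (Ioc_subset_Icc_self ht))
    rw [intervalIntegral.integral_of_le ht.1.le] at h1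
    rw [integral_indicator measurableSet_Iic, hμ, Measure.restrict_restrict measurableSet_Iic,
      inter_comm, Ioc_inter_Iic, min_eq_right ht.2, ← h1]
    ring
  have hv : ∀ t ∈ Ioc x y, v t = v y - ∫ s, (Ioi t).indicator k s ∂μ := by
    intro t ht
    have h1 := h'.2 t (hsub (Ioc_subset_Icc_self ht)) y hy
    rw [intervalIntegral.integral_of_le ht.2] at h1
    rw [integral_indicator measurableSet_Ioi, hμ, Measure.restrict_restrict measurableSet_Ioi,
      inter_comm, Ioc_inter_Ioi, max_eq_right ht.1.le, ← h1]
    ring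
  have hprod : Integrable (fun p : ℝ × ℝ => g p.1 * k p.2) (μ.prod μ) := hgi.mul_prod hki
  -- Fubini on a triangle: with `u t = u x + ∫ g` over `s ≤ t` and `v t = v y - ∫ k` over `s > t`,
  -- both products produce the integral of `g(t) k(s)` over `t < s`, with opposite signs.
  have hms : MeasurableSet {p : ℝ × ℝ | p.1 < p.2} := measurableSet_lt measurable_fst measurable_snd
  have hi : Integrable (Function.uncurry fun t s => {p : ℝ × ℝ | p.1 < p.2}.indicator
      (fun p => g p.1 * k p.2) (t, s)) (μ.prod μ) := hprod.indicator hms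
  have hms' : MeasurableSet {p : ℝ × ℝ | p.1 ≤ p.2} :=
    measurableSet_le measurable_fst measurable_snd
  have e1 : ∀ t, g t * ∫ s, (Ioi t).indicator k s ∂μ =
      ∫ s, {p : ℝ × ℝ | p.1 < p.2}.indicator (fun p => g p.1 * k p.2) (t, s) ∂μ := by
    intro t
    rw [← integral_const_mul]
    refine integral_congr_ae (Eventually.of_forall fun s => ?_)
    by_cases hs : t < s <;> simp [hs]
  have e2 : ∀ s, (∫ t, (Iic s).indicator g t ∂μ) * k s =
      ∫ t, {p : ℝ × ℝ | p.1 < p.2}.indicator (fun p => g p.1 * k p.2) (t, s) ∂μ := by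
    intro s
    rw [← integral_mul_const]
    refine integral_congr_ae ?_
    -- The primitive of `g` is taken over `t ≤ s`, the triangle is strict; the two differ by the
    -- null diagonal.
    have : ∀ᵐ t ∂μ, t ≠ s := by
      rw [hμ]; exact ae_restrict_of_ae (Measure.ae_ne volume s)
    filter_upwards [this] with t ht
    by_cases hs : t < s
    · simp [hs, hs.le]
    · simp [hs, not_le.2 (lt_of_le_of_ne (not_lt.1 hs) (Ne.symm ht))]
  have swap := integral_integral_swap hi
  simp only [← e1, ← e2] at swap
  have hgv : IntegrableOn (fun t => g t * v t) (Ioc x y) := by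
    have hc := (h'.continuousOn_Icc hsub hxy)
    have := (h.1.integrableOn_compact_subset hsub isCompact_Icc).mul_continuousOn hc isCompact_Icc
    exact this.mono_set Ioc_subset_Icc_self
  have huk : IntegrableOn (fun t => u t * k t) (Ioc x y) := by
    have hc := (h.continuousOn_Icc hsub hxy)
    have := (h'.1.integrableOn_compact_subset hsub isCompact_Icc).continuousOn_mul hc isCompact_Icc
    exact this.mono_set Ioc_subset_Icc_self
  rw [intervalIntegral.integral_of_le hxy, integral_add hgv huk]
  have a1 : ∫ t in Ioc x y, g t * v t = (u y - u x) * v y -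
      ∫ t in Ioc x y, g t * ∫ s, (Ioi t).indicator k s ∂μ := by
    have : ∀ᵐ t ∂μ, g t * v t = g t * v y - g t * ∫ s, (Ioi t).indicator k s ∂μ := by
      rw [hμ]
      filter_upwards [ae_restrict_mem measurableSet_Ioc] with t ht
      rw [hv t ht]; ring
    rw [integral_congr_ae this, integral_sub, integral_mul_const, h.2 x hx y hy,
      intervalIntegral.integral_of_le hxy]
    · exact hgi.mul_const _
    · simp only [e1]; exact hi.integral_prod_left
  have a2 : ∫ t in Ioc x y, u t * k t = u x * (v y - v x) +
      ∫ t in Ioc x y, (∫ s, (Iic t).indicator g s ∂μ) * k t := by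
    have : ∀ᵐ t ∂μ, u t * k t = u x * k t + (∫ s, (Iic t).indicator g s ∂μ) * k t := by
      rw [hμ]
      filter_upwards [ae_restrict_mem measurableSet_Ioc] with t ht
      rw [hu t ht]; ring
    rw [integral_congr_ae this, integral_add, integral_const_mul, h'.2 x hx y hy,
      intervalIntegral.integral_of_le hxy]
    · exact hki.const_mul _
    · simp only [e2]; exact hi.integral_prod_right
  rw [a1, a2, swap]
  ring

theorem mul (h : IsPrimitiveOn I u g) (h' : IsPrimitiveOn I v k) (hI : OrdConnected I)
    (hIo : IsOpen I) :
    IsPrimitiveOn I (fun t => u t * v t) (fun t => g t * v t + u t * k t) := by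
  refine ⟨?_, fun x hx y hy => ?_⟩
  · exact (h.1.mul_continuousOn (h'.continuousOn hIo) hIo.isLocallyClosed).add
      (h'.1.continuousOn_mul (h.continuousOn hIo) hIo.isLocallyClosed)
  · rcases le_total x y with hxy | hxy
    · exact (h.integral_mul_add h' hI hx hy hxy).symm
    · rw [intervalIntegral.integral_symm, h.integral_mul_add h' hI hy hx hxy]; ring

end IsPrimitiveOn

theorem isPrimitiveOn_of_contDiff {φ : ℝ → ℝ} (hφ : ContDiff ℝ ∞ φ) (I : Set ℝ) :
    IsPrimitiveOn I (fun x => ((φ x : ℝ) : ℂ)) (fun x => ((deriv φ x : ℝ) : ℂ)) := by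
  have hd : Continuous (deriv φ) := hφ.continuous_deriv (by simp)
  refine ⟨(Complex.continuous_ofReal.comp hd).locallyIntegrable.locallyIntegrableOn _,
    fun x _ y _ => ?_⟩
  rw [intervalIntegral.integral_ofReal, intervalIntegral.integral_deriv_eq_sub]
  · simp
  · exact fun t _ => (hφ.differentiable (by simp)) t
  · exact hd.intervalIntegrable _ _

theorem isPrimitiveOn_integral (hI : OrdConnected I) {x₀ : ℝ} (hx₀ : x₀ ∈ I)
    (hg : LocallyIntegrableOn g I) : IsPrimitiveOn I (fun x => ∫ t in x₀..x, g t) g :=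
  ⟨hg, fun x hx y hy => by
    rw [sub_eq_iff_eq_add', intervalIntegral.integral_add_adjacent_intervals]
    · exact intervalIntegrable_of_locallyIntegrableOn hI hg hx₀ hx
    · exact intervalIntegrable_of_locallyIntegrableOn hI hg hx hy⟩

theorem setIntegral_eq_of_support {E : Type*} [NormedAddCommGroup E] [NormedSpace ℝ E]
    {F : ℝ → E} {a b : ℝ} (hab : a ≤ b) (hIcc : Icc a b ⊆ I)
    (hF : ∀ x, x ∉ Icc a b → F x = 0) : ∫ x in I, F x = ∫ x in a..b, F x := by
  rw [intervalIntegral.integral_of_le hab, ← integral_Icc_eq_integral_Ioc,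
    setIntegral_eq_integral_of_forall_compl_eq_zero (fun x hx => hF x fun h => hx (hIcc h)),
    setIntegral_eq_integral_of_forall_compl_eq_zero hF]

theorem IsPrimitiveOn.hasWeakDeriv {Ω : Opens ℝ} (hΩ : OrdConnected (Ω : Set ℝ))
    (h : IsPrimitiveOn (Ω : Set ℝ) u g) : HasWeakDeriv Ω 1 u g := by
  refine ⟨(h.continuousOn Ω.isOpen).locallyIntegrableOn Ω.isOpen.measurableSet, h.1,
    fun φ h1 h2 h3 => ?_⟩
  rcases (Ω : Set ℝ).eq_empty_or_nonempty with he | ⟨x₀, hx₀⟩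
  · simp [he]
  obtain ⟨a, b, hab, hsub, hx₀'⟩ := exists_Icc hΩ hx₀ h2 h3
  have hle : a ≤ b := hx₀'.1.trans hx₀'.2
  -- The interval containing the support is enlarged inside `Ω`, so that `φ` vanishes at both new
  -- endpoints and the boundary terms drop out.
  obtain ⟨a', ha', haΩ⟩ : ∃ a' < a, Icc a' a ⊆ (Ω : Set ℝ) := by
    obtain ⟨r, hr, hball⟩ := Metric.isOpen_iff.1 Ω.isOpen a (hab (left_mem_Icc.2 hle))
    refine ⟨a - r / 2, by linarith, Subset.trans (fun y hy => ?_) hball⟩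
    rw [Metric.mem_ball, Real.dist_eq, abs_lt]
    constructor <;> linarith [hy.1, hy.2]
  obtain ⟨b', hb', hbΩ⟩ : ∃ b' > b, Icc b b' ⊆ (Ω : Set ℝ) := by
    obtain ⟨r, hr, hball⟩ := Metric.isOpen_iff.1 Ω.isOpen b (hab (right_mem_Icc.2 hle))
    refine ⟨b + r / 2, by linarith, Subset.trans (fun y hy => ?_) hball⟩
    rw [Metric.mem_ball, Real.dist_eq, abs_lt]
    constructor <;> linarith [hy.1, hy.2]
  have hz : ∀ x, x ∉ Icc a b → φ x = 0 := fun x hx => image_eq_zero_of_notMem_tsupport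
      (fun h => hx (hsub h))
  have hz' : ∀ x, x ∉ Icc a b → deriv φ x = 0 := fun x hx => image_eq_zero_of_notMem_tsupport
      (fun h => hx (hsub (tsupport_deriv_subset h)))
  have ha'Ω : a' ∈ (Ω : Set ℝ) := haΩ (left_mem_Icc.2 ha'.le)
  have hb'Ω : b' ∈ (Ω : Set ℝ) := hbΩ (right_mem_Icc.2 hb'.le)
  have hle' : a' ≤ b' := by linarith
  have hmem : ∀ x, x ∉ Icc a' b' → x ∉ Icc a b := fun x hx hx' =>
    hx ⟨ha'.le.trans hx'.1, hx'.2.trans hb'.le⟩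
  have key := (isPrimitiveOn_of_contDiff h1 (Ω : Set ℝ)).integral_mul_add h hΩ ha'Ω hb'Ω hle'
  rw [hz a' (fun h => absurd h.1 (not_le.2 ha')), hz b' (fun h => absurd h.2 (not_le.2 hb')),
    Complex.ofReal_zero] at key
  simp only [fderiv_apply_one_eq_deriv, Complex.real_smul]
  rw [setIntegral_eq_of_support hle' (hΩ.out ha'Ω hb'Ω) (fun x hx => by simp [hz' x (hmem x hx)]),
    setIntegral_eq_of_support hle' (hΩ.out ha'Ω hb'Ω) (fun x hx => by simp [hz x (hmem x hx)])]
  rw [intervalIntegral.integral_add] at key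
  · linear_combination key
  · refine (h.continuousOn_Icc (hΩ.out ha'Ω hb'Ω) hle' |>.intervalIntegrable_of_Icc hle').continuousOn_mul ?_
    exact (Complex.continuous_ofReal.comp (h1.continuous_deriv (by simp))).continuousOn
  · refine (h.intervalIntegrable hΩ ha'Ω hb'Ω).continuousOn_mul ?_
    exact (Complex.continuous_ofReal.comp h1.continuous).continuousOn

/-- A locally integrable function on an interval with weak derivative zero is constant. -/
theorem ae_eq_const_of_hasWeakDeriv_zero {Ω : Opens ℝ} (hΩ : OrdConnected (Ω : Set ℝ)) {x₀ : ℝ}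
    (hx₀ : x₀ ∈ Ω) (h : HasWeakDeriv Ω 1 u 0) :
    ∃ c : ℂ, u =ᵐ[volume.restrict (Ω : Set ℝ)] fun _ => c := by
  have hvw : ∀ φ : ℝ → ℝ, ContDiff ℝ ∞ φ → HasCompactSupport φ → tsupport φ ⊆ (Ω : Set ℝ) →
      ∫ x, deriv φ x • u x = 0 := by
    intro φ h1 h2 h3
    have hz' : ∀ x ∉ (Ω : Set ℝ), deriv φ x = 0 := fun x hx =>
      image_eq_zero_of_notMem_tsupport
      (fun hx' => hx (h3 (tsupport_deriv_subset hx')))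
    have h4 := h.2.2 φ h1 h2 h3
    simp only [fderiv_apply_one_eq_deriv] at h4
    rw [setIntegral_eq_integral_of_forall_compl_eq_zero (fun x hx => by simp [hz' x hx])] at h4
    simpa using h4
  obtain ⟨r, hr, hball⟩ := Metric.isOpen_iff.1 Ω.isOpen x₀ hx₀
  let B : ContDiffBump x₀ := ⟨r / 4, r / 2, by linarith, by linarith⟩
  have hη1 : ContDiff ℝ ∞ (B.normed volume) := B.contDiff_normed
  have hη2 : HasCompactSupport (B.normed volume) := B.hasCompactSupport_normed
  have hη3 : tsupport (B.normed volume) ⊆ (Ω : Set ℝ) := by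
    rw [B.tsupport_normed_eq]
    exact (Metric.closedBall_subset_ball (show r / 2 < r by linarith)).trans hball
  have hη4 : ∫ x, B.normed volume x = 1 := B.integral_normed
  set η := B.normed volume with hη
  have hηi : Integrable η := hη1.continuous.integrable_of_hasCompactSupport hη2
  set c : ℂ := ∫ x, η x • u x with hc
  refine ⟨c, ?_⟩
  have key : ∀ᵐ x, x ∈ (Ω : Set ℝ) → (u - fun _ : ℝ => c : ℝ → ℂ) x = 0 := by
    refine Ω.isOpen.ae_eq_zero_of_integral_contDiff_smul_eq_zero
      (h.1.sub ((locallyIntegrable_const c).locallyIntegrableOn _)) ?_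
    intro φ h1 h2 h3
    have hφi : Integrable φ := h1.continuous.integrable_of_hasCompactSupport h2
    -- Subtracting the multiple of `η` with the same integral leaves a test function of mean zero,
    -- which is the derivative of a test function. Hence `∫ φ u = c ∫ φ`.
    have hψ1 : ContDiff ℝ ∞ (φ - fun x => (∫ y, φ y) * η x) := h1.sub (contDiff_const.mul hη1)
    have hψ2 : HasCompactSupport (φ - fun x => (∫ y, φ y) * η x) := h2.sub hη2.mul_left
    have hψ3 : tsupport (φ - fun x => (∫ y, φ y) * η x) ⊆ (Ω : Set ℝ) := by
      refine (tsupport_sub _ _).trans (union_subset h3 ?_)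
      exact (tsupport_mul_subset_right (f := fun _ => ∫ y, φ y)).trans hη3
    have hψ4 : ∫ x, (φ - fun x => (∫ y, φ y) * η x) x = 0 := by
      simp only [Pi.sub_apply]
      rw [integral_sub hφi (hηi.const_mul _), integral_const_mul, hη4]
      ring
    obtain ⟨Φ, p1, p2, p3, p4⟩ := exists_primitive hΩ hx₀ hψ1 hψ2 hψ3 hψ4
    have h5 := hvw Φ p1 p2 p3
    rw [p4] at h5
    have i1 := integrable_smul_of_tsupport (Ω := Ω) h1.continuous h2 h3 h.1
    have i2 := integrable_smul_of_tsupport (Ω := Ω) hη1.continuous hη2 hη3 h.1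
    have e5 : ∀ x, (φ - fun x => (∫ y, φ y) * η x) x • u x =
        φ x • u x - (∫ y, φ y) • (η x • u x) := by
      intro x
      rw [Pi.sub_apply, sub_smul, mul_smul]
    simp only [e5] at h5
    have i3 : Integrable fun x => (∫ y, φ y) • (η x • u x) := Integrable.smul (∫ y, φ y) i2
    rw [integral_sub i1 i3, integral_smul, ← hc, sub_eq_zero] at h5
    have e6 : ∀ x, φ x • (u - fun _ : ℝ => c : ℝ → ℂ) x = φ x • u x - φ x • c := by
      intro x
      rw [Pi.sub_apply, smul_sub]
    simp only [e6]
    rw [integral_sub i1 (hφi.smul_const c), integral_smul_const, h5, sub_self]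
  rw [EventuallyEq, ae_restrict_iff' Ω.isOpen.measurableSet]
  filter_upwards [key] with x hx hx'
  exact sub_eq_zero.1 (hx hx')

/-- The difference of `u` and a primitive of `g` has weak derivative zero, hence is constant. This
converts weak derivatives into the fundamental theorem of calculus, on which all later estimates
rest. -/
theorem HasWeakDeriv.exists_isPrimitiveOn {Ω : Opens ℝ} (hΩ : OrdConnected (Ω : Set ℝ))
    (h : HasWeakDeriv Ω 1 u g) :
    ∃ U, IsPrimitiveOn (Ω : Set ℝ) U g ∧ u =ᵐ[volume.restrict (Ω : Set ℝ)] U := by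
  rcases (Ω : Set ℝ).eq_empty_or_nonempty with he | ⟨x₀, hx₀⟩
  · exact ⟨0, ⟨h.2.1, by simp [he]⟩, by simp [he, EventuallyEq]⟩
  have hG := isPrimitiveOn_integral hΩ hx₀ h.2.1
  have hd := h.add ((hG.hasWeakDeriv hΩ).smul (-1))
  have e : g + (-1 : ℂ) • g = 0 := by simp
  rw [e] at hd
  obtain ⟨c, hc⟩ := ae_eq_const_of_hasWeakDeriv_zero hΩ hx₀ hd
  refine ⟨fun x => (∫ t in x₀..x, g t) + c, ⟨h.2.1, fun x hx y hy => ?_⟩, ?_⟩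
  · rw [← hG.2 x hx y hy]; ring
  · filter_upwards [hc] with x hx
    simp only [Pi.add_apply, Pi.smul_apply, smul_eq_mul] at hx
    linear_combination hx

theorem HasWeakDeriv.isPrimitiveOn {Ω : Opens ℝ} (hΩ : OrdConnected (Ω : Set ℝ))
    (h : HasWeakDeriv Ω 1 u g) (hc : ContinuousOn u (Ω : Set ℝ)) :
    IsPrimitiveOn (Ω : Set ℝ) u g := by
  obtain ⟨U, hU, hae⟩ := h.exists_isPrimitiveOn hΩ
  have e : EqOn u U (Ω : Set ℝ) := Measure.eqOn_open_of_ae_eq hae Ω.isOpen hc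
    (hU.continuousOn Ω.isOpen)
  exact ⟨hU.1, fun x hx y hy => by rw [e hx, e hy, hU.2 x hx y hy]⟩

theorem HasWeakDeriv.mono {E : Type*} [NormedAddCommGroup E] [NormedSpace ℝ E]
    [FiniteDimensional ℝ E] [MeasureSpace E] [BorelSpace E] {Ω Ω' : Opens E} {e : E} {u g : E → ℂ}
    (h : HasWeakDeriv Ω e u g) (hle : (Ω' : Set E) ⊆ Ω) : HasWeakDeriv Ω' e u g := by
  refine ⟨h.1.mono_set hle, h.2.1.mono_set hle, fun φ h1 h2 h3 => ?_⟩
  have hz : ∀ x ∉ (Ω' : Set E), φ x = 0 := fun x hx => image_eq_zero_of_notMem_tsupport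
    (fun hx' => hx (h3 hx'))
  have hz' : ∀ x ∉ (Ω' : Set E), fderiv ℝ φ x e = 0 := fun x hx =>
    image_eq_zero_of_notMem_tsupport (f := fun x => fderiv ℝ φ x e)
    (fun hx' => hx (h3 (tsupport_fderiv_apply_subset ℝ e hx')))
  have := h.2.2 φ h1 h2 (h3.trans hle)
  rw [setIntegral_eq_integral_of_forall_compl_eq_zero (fun x hx => by
      simp [hz' x (fun h => hx (hle h))]),
    setIntegral_eq_integral_of_forall_compl_eq_zero (fun x hx => by
      simp [hz x (fun h => hx (hle h))])] at this
  rw [setIntegral_eq_integral_of_forall_compl_eq_zero (fun x hx => by simp [hz' x hx]),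
    setIntegral_eq_integral_of_forall_compl_eq_zero (fun x hx => by simp [hz x hx]), this]

theorem IsPrimitiveOn.enorm_sub_sq_le (h : IsPrimitiveOn I u g) (hI : OrdConnected I)
    {x y : ℝ} (hx : x ∈ I) (hy : y ∈ I) :
    ‖u y - u x‖ₑ ^ 2 ≤ volume I * ∫⁻ t in I, ‖g t‖ₑ ^ 2 := by
  have hsub : uIoc x y ⊆ I := uIoc_subset_uIcc.trans (hI.uIcc_subset hx hy)
  have h1 : ‖u y - u x‖ₑ ≤ ∫⁻ t in uIoc x y, ‖g t‖ₑ := by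
    rw [h.2 x hx y hy, intervalIntegral.intervalIntegral_eq_integral_uIoc]
    refine le_trans ?_ (enorm_integral_le_lintegral_enorm _)
    split_ifs <;> simp
  have hm : AEMeasurable (fun t => ‖g t‖ₑ) (volume.restrict (uIoc x y)) :=
    (h.1.integrableOn_compact_subset (hI.uIcc_subset hx hy) isCompact_uIcc
      |>.mono_set uIoc_subset_uIcc).aestronglyMeasurable.enorm
  calc ‖u y - u x‖ₑ ^ 2 ≤ (∫⁻ t in uIoc x y, ‖g t‖ₑ) ^ 2 := by gcongr
    _ ≤ volume (uIoc x y) * ∫⁻ t in uIoc x y, ‖g t‖ₑ ^ 2 := by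
      simpa using sq_lintegral_le _ hm
    _ ≤ _ := by gcongr

/-- Compare `u x` with `u y` by Cauchy–Schwarz and average over `y ∈ I`. Multiplying by the volume
instead of dividing spares a discussion of its degenerate values. -/
theorem IsPrimitiveOn.enorm_sq_le (h : IsPrimitiveOn I u g) (hI : OrdConnected I)
    (hIm : MeasurableSet I) {x : ℝ} (hx : x ∈ I) :
    volume I * ‖u x‖ₑ ^ 2 ≤
      2 * ((∫⁻ t in I, ‖u t‖ₑ ^ 2) + volume I ^ 2 * ∫⁻ t in I, ‖g t‖ₑ ^ 2) := by
  have h1 : ∀ y ∈ I, ‖u x‖ₑ ^ 2 ≤ 2 * (‖u y‖ₑ ^ 2 + volume I * ∫⁻ t in I, ‖g t‖ₑ ^ 2) := by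
    intro y hy
    have h2 := enorm_add_sq_le (u y) (u x - u y)
    rw [add_sub_cancel] at h2
    refine h2.trans ?_
    gcongr
    exact h.enorm_sub_sq_le hI hy hx
  calc volume I * ‖u x‖ₑ ^ 2 = ∫⁻ _ in I, ‖u x‖ₑ ^ 2 := by
        rw [setLIntegral_const, mul_comm]
    _ ≤ ∫⁻ y in I, 2 * (‖u y‖ₑ ^ 2 + volume I * ∫⁻ t in I, ‖g t‖ₑ ^ 2) :=
        setLIntegral_mono' hIm h1
    _ = _ := by
      rw [lintegral_const_mul' _ _ (by simp), lintegral_add_right _ measurable_const,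
        setLIntegral_const]
      ring

end Primitives

/-! ### Boundary values and Green's formula on both sides of `0` -/

section HalfLines

variable {F G f g V k : ℝ → ℂ}

theorem IsPrimitiveOn.tendsto_right {a b c : ℝ} (h : IsPrimitiveOn (Ioo a b) F G)
    (hG : IntegrableOn G (Ioo a b)) (hc : c ∈ Ioo a b) :
    Tendsto F (𝓝[<] b) (𝓝 (F c + ∫ t in c..b, G t)) := by
  have hi : IntervalIntegrable G volume a b :=
    (intervalIntegrable_iff_integrableOn_Ioo_of_le (hc.1.trans hc.2).le).2 hG
  have hab : a ≤ b := (hc.1.trans hc.2).le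
  have hcont := intervalIntegral.continuousOn_primitive_interval' (a := c) hi
    (by rw [uIcc_of_le hab]; exact Ioo_subset_Icc_self hc)
  rw [uIcc_of_le hab] at hcont
  have h1 : Tendsto (fun x => ∫ t in c..x, G t) (𝓝[Ioo a b] b) (𝓝 (∫ t in c..b, G t)) :=
    (hcont b (right_mem_Icc.2 hab)).mono_left (nhdsWithin_mono _ Ioo_subset_Icc_self)
  rw [nhdsWithin_Ioo_eq_nhdsLT (hc.1.trans hc.2)] at h1
  refine (h1.const_add (F c)).congr' ?_
  filter_upwards [Ioo_mem_nhdsLT (hc.1.trans hc.2)] with x hx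
  rw [← h.2 c hc x hx]; ring

theorem IsPrimitiveOn.tendsto_left {a b c : ℝ} (h : IsPrimitiveOn (Ioo a b) F G)
    (hG : IntegrableOn G (Ioo a b)) (hc : c ∈ Ioo a b) :
    Tendsto F (𝓝[>] a) (𝓝 (F c + ∫ t in c..a, G t)) := by
  have hi : IntervalIntegrable G volume a b :=
    (intervalIntegrable_iff_integrableOn_Ioo_of_le (hc.1.trans hc.2).le).2 hG
  have hab : a ≤ b := (hc.1.trans hc.2).le
  have hcont := intervalIntegral.continuousOn_primitive_interval' (a := c) hi
    (by rw [uIcc_of_le hab]; exact Ioo_subset_Icc_self hc)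
  rw [uIcc_of_le hab] at hcont
  have h1 : Tendsto (fun x => ∫ t in c..x, G t) (𝓝[Ioo a b] a) (𝓝 (∫ t in c..a, G t)) :=
    (hcont a (left_mem_Icc.2 hab)).mono_left (nhdsWithin_mono _ Ioo_subset_Icc_self)
  rw [nhdsWithin_Ioo_eq_nhdsGT (hc.1.trans hc.2)] at h1
  refine (h1.const_add (F c)).congr' ?_
  filter_upwards [Ioo_mem_nhdsGT (hc.1.trans hc.2)] with x hx
  rw [← h.2 c hc x hx]; ring

theorem IsPrimitiveOn.integral_Ioo {a b : ℝ} (hab : a < b) (h : IsPrimitiveOn (Ioo a b) F G)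
    (hG : IntegrableOn G (Ioo a b)) {A B : ℂ} (hA : Tendsto F (𝓝[>] a) (𝓝 A))
    (hB : Tendsto F (𝓝[<] b) (𝓝 B)) : ∫ t in Ioo a b, G t = B - A := by
  have hc : (a + b) / 2 ∈ Ioo a b := ⟨by linarith, by linarith⟩
  have e1 := tendsto_nhds_unique hB (h.tendsto_right hG hc)
  have e2 := tendsto_nhds_unique hA (h.tendsto_left hG hc)
  have i1 : IntervalIntegrable G volume a ((a + b) / 2) :=
    (intervalIntegrable_iff_integrableOn_Ioo_of_le hc.1.le).2
      (hG.mono_set (Ioo_subset_Ioo_right hc.2.le))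
  have i2 : IntervalIntegrable G volume ((a + b) / 2) b :=
    (intervalIntegrable_iff_integrableOn_Ioo_of_le hc.2.le).2
      (hG.mono_set (Ioo_subset_Ioo_left hc.1.le))
  rw [← integral_Ioc_eq_integral_Ioo, ← intervalIntegral.integral_of_le hab.le,
    ← intervalIntegral.integral_add_adjacent_intervals i1 i2, e1, e2,
    intervalIntegral.integral_symm a]
  ring

/-- Integrability of `G` gives `F` a limit at infinity, and integrability of `F` forces that limit
to be `0`, because neighbourhoods of infinity have infinite measure. So an infinite end contributes
nothing and needs no boundary condition. -/
theorem IsPrimitiveOn.integral_Ioi {a : ℝ} (h : IsPrimitiveOn (Ioi a) F G)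
    (hG : IntegrableOn G (Ioi a)) (hF : IntegrableOn F (Ioi a)) {A : ℂ}
    (hA : Tendsto F (𝓝[>] a) (𝓝 A)) : ∫ t in Ioi a, G t = -A := by
  have hc : a + 1 ∈ Ioo a (a + 2) := ⟨by linarith, by linarith⟩
  have h' := h.mono (fun x hx => hx.1 : Ioo a (a + 2) ⊆ Ioi a)
  have e1 := tendsto_nhds_unique hA (h'.tendsto_left (hG.mono_set Ioo_subset_Ioi_self) hc)
  have t2 : Tendsto F atTop (𝓝 (F (a + 1) + ∫ t in Ioi (a + 1), G t)) := by
    refine ((intervalIntegral_tendsto_integral_Ioi (a + 1)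
      (hG.mono_set (Ioi_subset_Ioi hc.1.le)) tendsto_id).const_add (F (a + 1))).congr' ?_
    filter_upwards [eventually_gt_atTop a] with x hx
    rw [id, ← h.2 (a + 1) hc.1 x hx]; ring
  have e2 := IntegrableAtFilter.eq_zero_of_tendsto (l := atTop) (μ := volume)
    ⟨Ioi a, Ioi_mem_atTop a, hF⟩ (fun s hs => by
      obtain ⟨c, hc⟩ := mem_atTop_sets.1 hs
      exact top_unique ((Real.volume_Ici (a := c)).ge.trans (measure_mono fun x hx => hc x hx))) t2
  rw [← Ioc_union_Ioi_eq_Ioi hc.1.le, setIntegral_union Ioc_disjoint_Ioi_same measurableSet_Ioi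
    (hG.mono_set Ioc_subset_Ioi_self) (hG.mono_set (Ioi_subset_Ioi hc.1.le)),
    ← intervalIntegral.integral_of_le hc.1.le, e1, intervalIntegral.integral_symm a]
  linear_combination e2

theorem IsPrimitiveOn.integral_Iio {a : ℝ} (h : IsPrimitiveOn (Iio a) F G)
    (hG : IntegrableOn G (Iio a)) (hF : IntegrableOn F (Iio a)) {A : ℂ}
    (hA : Tendsto F (𝓝[<] a) (𝓝 A)) : ∫ t in Iio a, G t = A := by
  have hc : a - 1 ∈ Ioo (a - 2) a := ⟨by linarith, by linarith⟩
  have h' := h.mono (Ioo_subset_Iio_self (a := a - 2) (b := a))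
  have e1 := tendsto_nhds_unique hA (h'.tendsto_right (hG.mono_set Ioo_subset_Iio_self) hc)
  have t2 : Tendsto F atBot (𝓝 (F (a - 1) - ∫ t in Iic (a - 1), G t)) := by
    refine ((intervalIntegral_tendsto_integral_Iic (a - 1)
      (hG.mono_set (Iic_subset_Iio.2 hc.2)) tendsto_id).const_sub (F (a - 1))).congr' ?_
    filter_upwards [eventually_lt_atBot a] with x hx
    rw [id, ← h.2 x hx (a - 1) hc.2]; ring
  have e2 := IntegrableAtFilter.eq_zero_of_tendsto (l := atBot) (μ := volume)
    ⟨Iio a, Iio_mem_atBot a, hF⟩ (fun s hs => by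
      obtain ⟨c, hc⟩ := mem_atBot_sets.1 hs
      exact top_unique ((Real.volume_Iic (a := c)).ge.trans (measure_mono fun x hx => hc x hx))) t2
  rw [← Iic_union_Ioo_eq_Iio hc.2, setIntegral_union (by
      rw [Set.disjoint_left]; exact fun x hx hx' => absurd hx'.1 (not_lt.2 hx)) measurableSet_Ioo
    (hG.mono_set (Iic_subset_Iio.2 hc.2)) (hG.mono_set Ioo_subset_Iio_self),
    ← integral_Ioc_eq_integral_Ioo, ← intervalIntegral.integral_of_le hc.2.le, e1]
  linear_combination -e2

theorem interval_coe (a b : ℝ) : (interval a b : Set ℝ) = Ioo a b := by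
  ext x; simp [interval]

theorem interval_top (a : ℝ) : (interval a ⊤ : Set ℝ) = Ioi a := by
  ext x; simp [interval]

theorem interval_bot (b : ℝ) : (interval ⊥ b : Set ℝ) = Iio b := by
  ext x; simp [interval]

theorem integrableOn_mul_of_memLp {s : Set ℝ} (hf : MemLp f 2 (volume.restrict s))
    (hg : MemLp g 2 (volume.restrict s)) : IntegrableOn (fun t => f t * g t) s :=
  hf.integrable_mul hg

/-- Green's formula to the right of a point, with a Neumann condition at the right end. -/
theorem green_right {a : ℝ} {ℓ : EReal} (hℓ : (a : EReal) < ℓ)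
    (hf : IsPrimitiveOn (interval a ℓ : Set ℝ) f g) (hV : IsPrimitiveOn (interval a ℓ : Set ℝ) V k)
    (hf2 : MemLp f 2 (volume.restrict (interval a ℓ : Set ℝ)))
    (hg2 : MemLp g 2 (volume.restrict (interval a ℓ : Set ℝ)))
    (hV2 : MemLp V 2 (volume.restrict (interval a ℓ : Set ℝ)))
    (hk2 : MemLp k 2 (volume.restrict (interval a ℓ : Set ℝ))) {p c : ℂ}
    (hp : Tendsto f (𝓝[>] a) (𝓝 p)) (hc : Tendsto V (𝓝[>] a) (𝓝 c))
    (hN : ∀ b : ℝ, ℓ = b → Tendsto f (𝓝[<] b) (𝓝 0)) :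
    ∫ t in (interval a ℓ : Set ℝ), (g t * V t + f t * k t) = -(p * c) := by
  have hFG := hf.mul hV (ordConnected_interval _ _) (interval a ℓ).isOpen
  have hG : IntegrableOn (fun t => g t * V t + f t * k t) (interval a ℓ : Set ℝ) :=
    (integrableOn_mul_of_memLp hg2 hV2).add (integrableOn_mul_of_memLp hf2 hk2)
  have hF : IntegrableOn (fun t => f t * V t) (interval a ℓ : Set ℝ) :=
    integrableOn_mul_of_memLp hf2 hV2
  induction ℓ with
  | bot => simp at hℓ
  | top =>
    rw [interval_top] at *
    exact hFG.integral_Ioi hG hF (hp.mul hc)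
  | coe b =>
    have hab : a < b := by simpa using hℓ
    rw [interval_coe] at *
    have hm : (a + b) / 2 ∈ Ioo a b := ⟨by linarith, by linarith⟩
    have hki : IntegrableOn k (Ioo a b) := hk2.integrable (by norm_num)
    have := (hN b rfl).mul (hV.tendsto_right hki hm)
    rw [zero_mul] at this
    rw [hFG.integral_Ioo hab hG (hp.mul hc) this, zero_sub]

/-- Green's formula to the left of a point, with a Neumann condition at the left end. -/
theorem green_left {b : ℝ} {ℓ : EReal} (hℓ : ℓ < (b : EReal))
    (hf : IsPrimitiveOn (interval ℓ b : Set ℝ) f g) (hV : IsPrimitiveOn (interval ℓ b : Set ℝ) V k)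
    (hf2 : MemLp f 2 (volume.restrict (interval ℓ b : Set ℝ)))
    (hg2 : MemLp g 2 (volume.restrict (interval ℓ b : Set ℝ)))
    (hV2 : MemLp V 2 (volume.restrict (interval ℓ b : Set ℝ)))
    (hk2 : MemLp k 2 (volume.restrict (interval ℓ b : Set ℝ))) {p c : ℂ}
    (hp : Tendsto f (𝓝[<] b) (𝓝 p)) (hc : Tendsto V (𝓝[<] b) (𝓝 c))
    (hN : ∀ a : ℝ, ℓ = a → Tendsto f (𝓝[>] a) (𝓝 0)) :
    ∫ t in (interval ℓ b : Set ℝ), (g t * V t + f t * k t) = p * c := by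
  have hFG := hf.mul hV (ordConnected_interval _ _) (interval ℓ b).isOpen
  have hG : IntegrableOn (fun t => g t * V t + f t * k t) (interval ℓ b : Set ℝ) :=
    (integrableOn_mul_of_memLp hg2 hV2).add (integrableOn_mul_of_memLp hf2 hk2)
  have hF : IntegrableOn (fun t => f t * V t) (interval ℓ b : Set ℝ) :=
    integrableOn_mul_of_memLp hf2 hV2
  induction ℓ with
  | top => simp at hℓ
  | bot =>
    rw [interval_bot] at *
    exact hFG.integral_Iio hG hF (hp.mul hc)
  | coe a =>
    have hab : a < b := by simpa using hℓ
    rw [interval_coe] at *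
    have hm : (a + b) / 2 ∈ Ioo a b := ⟨by linarith, by linarith⟩
    have hki : IntegrableOn k (Ioo a b) := hk2.integrable (by norm_num)
    have := (hN a rfl).mul (hV.tendsto_left hki hm)
    rw [zero_mul] at this
    rw [hFG.integral_Ioo hab hG this (hp.mul hc), sub_zero]

variable {ℓm ℓp : EReal}

theorem interval_zero_subset_right (hm : ℓm < 0) :
    (interval (0 : ℝ) ℓp : Set ℝ) ⊆ interval ℓm ℓp := fun _ hx => ⟨hm.trans hx.1, hx.2⟩

theorem interval_zero_subset_left (hp : 0 < ℓp) :
    (interval ℓm (0 : ℝ) : Set ℝ) ⊆ interval ℓm ℓp := fun _ hx => ⟨hx.1, hx.2.trans hp⟩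

theorem punctured_eq_union (hm : ℓm < 0) (hp : 0 < ℓp) :
    (punctured ℓm ℓp : Set ℝ) = (interval ℓm (0 : ℝ) : Set ℝ) ∪ interval (0 : ℝ) ℓp := by
  ext x
  constructor
  · rintro ⟨⟨h1, h2⟩, h3⟩
    rcases lt_or_gt_of_ne (h3 : x ≠ 0) with h | h
    · exact Or.inl ⟨h1, EReal.coe_lt_coe_iff.2 h⟩
    · exact Or.inr ⟨EReal.coe_lt_coe_iff.2 h, h2⟩
  · rintro (h | h)
    · exact ⟨interval_zero_subset_left hp h, (EReal.coe_lt_coe_iff.1 h.2).ne⟩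
    · exact ⟨interval_zero_subset_right hm h, (EReal.coe_lt_coe_iff.1 h.1).ne'⟩

theorem disjoint_interval_zero :
    Disjoint (interval ℓm (0 : ℝ) : Set ℝ) (interval (0 : ℝ) ℓp : Set ℝ) := by
  rw [Set.disjoint_left]
  exact fun x h h' => absurd (EReal.coe_lt_coe_iff.1 h.2) (EReal.coe_lt_coe_iff.1 h'.1).not_gt

theorem setIntegral_interval (hm : ℓm < 0) (hp : 0 < ℓp)
    (hF : IntegrableOn F (interval ℓm ℓp : Set ℝ)) :
    ∫ x in (interval ℓm ℓp : Set ℝ), F x =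
      (∫ x in (interval ℓm (0 : ℝ) : Set ℝ), F x) + ∫ x in (interval (0 : ℝ) ℓp : Set ℝ), F x := by
  rw [← restrict_punctured, punctured_eq_union hm hp,
    setIntegral_union disjoint_interval_zero (interval (0 : ℝ) ℓp).isOpen.measurableSet
    (hF.mono_set (interval_zero_subset_left hp)) (hF.mono_set (interval_zero_subset_right hm))]

theorem mem_interval_zero_nhdsGT (hp : 0 < ℓp) : (interval (0 : ℝ) ℓp : Set ℝ) ∈ 𝓝[>] (0 : ℝ) := by
  have h : (interval (-1 : ℝ) ℓp : Set ℝ) ∈ 𝓝 (0 : ℝ) :=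
    (interval (-1 : ℝ) ℓp).isOpen.mem_nhds ⟨by exact_mod_cast (by norm_num : (-1 : ℝ) < 0), hp⟩
  filter_upwards [mem_nhdsWithin_of_mem_nhds h, self_mem_nhdsWithin] with x hx hx'
  exact ⟨EReal.coe_lt_coe_iff.2 hx', hx.2⟩

theorem mem_interval_zero_nhdsLT (hm : ℓm < 0) : (interval ℓm (0 : ℝ) : Set ℝ) ∈ 𝓝[<] (0 : ℝ) := by
  have h : (interval ℓm (1 : ℝ) : Set ℝ) ∈ 𝓝 (0 : ℝ) :=
    (interval ℓm (1 : ℝ)).isOpen.mem_nhds ⟨hm, by exact_mod_cast (by norm_num : (0 : ℝ) < 1)⟩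
  filter_upwards [mem_nhdsWithin_of_mem_nhds h, self_mem_nhdsWithin] with x hx hx'
  exact ⟨hx.1, EReal.coe_lt_coe_iff.2 hx'⟩

theorem memLp_restrict_mono {s t : Set ℝ} (hf : MemLp f 2 (volume.restrict t)) (h : s ⊆ t) :
    MemLp f 2 (volume.restrict s) := hf.mono_measure (Measure.restrict_mono h le_rfl)

theorem locallyIntegrableOn_of_memLp {s : Set ℝ} (hf : MemLp f 2 (volume.restrict s)) :
    LocallyIntegrableOn f s :=
  locallyIntegrableOn_of_locallyIntegrable_restrict (hf.locallyIntegrable (by norm_num))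

/-- Green's formula on `Ω₀` for functions with a jump of the derivative at `0`. -/
theorem green_interval (hm : ℓm < 0) (hp : 0 < ℓp)
    (hfl : IsPrimitiveOn (interval ℓm (0 : ℝ) : Set ℝ) f g)
    (hfr : IsPrimitiveOn (interval (0 : ℝ) ℓp : Set ℝ) f g)
    (hV : IsPrimitiveOn (interval ℓm ℓp : Set ℝ) V k)
    (hf2 : MemLp f 2 (volume.restrict (interval ℓm ℓp : Set ℝ)))
    (hg2 : MemLp g 2 (volume.restrict (interval ℓm ℓp : Set ℝ)))
    (hV2 : MemLp V 2 (volume.restrict (interval ℓm ℓp : Set ℝ)))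
    (hk2 : MemLp k 2 (volume.restrict (interval ℓm ℓp : Set ℝ))) {p m : ℂ}
    (hp' : Tendsto f (𝓝[>] 0) (𝓝 p)) (hm' : Tendsto f (𝓝[<] 0) (𝓝 m))
    (hNm : ∀ a : ℝ, ℓm = a → Tendsto f (𝓝[>] a) (𝓝 0))
    (hNp : ∀ b : ℝ, ℓp = b → Tendsto f (𝓝[<] b) (𝓝 0)) :
    ∫ t in (interval ℓm ℓp : Set ℝ), (g t * V t + f t * k t) = (m - p) * V 0 := by
  have hVc : ContinuousAt V 0 := (hV.continuousOn (interval ℓm ℓp).isOpen).continuousAt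
    ((interval ℓm ℓp).isOpen.mem_nhds (zero_mem_interval hm hp))
  have sl := interval_zero_subset_left (ℓm := ℓm) hp
  have sr := interval_zero_subset_right (ℓp := ℓp) hm
  have h1 := green_left (b := 0) (by exact_mod_cast hm) hfl (hV.mono sl) (memLp_restrict_mono hf2 sl)
    (memLp_restrict_mono hg2 sl) (memLp_restrict_mono hV2 sl) (memLp_restrict_mono hk2 sl) hm'
    (hVc.tendsto.mono_left nhdsWithin_le_nhds) hNm
  have h2 := green_right (a := 0) (by exact_mod_cast hp) hfr (hV.mono sr) (memLp_restrict_mono hf2 sr)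
    (memLp_restrict_mono hg2 sr) (memLp_restrict_mono hV2 sr) (memLp_restrict_mono hk2 sr) hp'
    (hVc.tendsto.mono_left nhdsWithin_le_nhds) hNp
  rw [setIntegral_interval (F := fun t => g t * V t + f t * k t) hm hp
    ((integrableOn_mul_of_memLp hg2 hV2).add (integrableOn_mul_of_memLp hf2 hk2)), h1, h2]
  ring

/-- Two primitives on both sides of `0` with the same limit at `0` form a primitive. -/
theorem isPrimitiveOn_update (hm : ℓm < 0) (hp : 0 < ℓp)
    (hfl : IsPrimitiveOn (interval ℓm (0 : ℝ) : Set ℝ) f g)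
    (hfr : IsPrimitiveOn (interval (0 : ℝ) ℓp : Set ℝ) f g)
    (hg2 : LocallyIntegrableOn g (interval ℓm ℓp : Set ℝ)) {c : ℂ}
    (hr : Tendsto f (𝓝[>] 0) (𝓝 c)) (hl : Tendsto f (𝓝[<] 0) (𝓝 c)) :
    IsPrimitiveOn (interval ℓm ℓp : Set ℝ) (Function.update f 0 c) g := by
  have h0 := zero_mem_interval hm hp
  have hpr := isPrimitiveOn_integral (ordConnected_interval ℓm ℓp) h0 hg2
  have hcont : ContinuousAt (fun x => ∫ t in (0 : ℝ)..x, g t) 0 :=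
    (hpr.continuousOn (interval ℓm ℓp).isOpen).continuousAt ((interval ℓm ℓp).isOpen.mem_nhds h0)
  have ht : Tendsto (fun x => ∫ t in (0 : ℝ)..x, g t) (𝓝 0) (𝓝 0) := by
    simpa using hcont.tendsto
  -- On each side of `0`, `f` differs from the primitive of `g` based at `0` by a constant; letting
  -- the point tend to `0` identifies both constants with `c`.
  have key : ∀ y ∈ (interval ℓm ℓp : Set ℝ), Function.update f 0 c y = c + ∫ t in (0 : ℝ)..y, g t := by
    intro y hy
    by_cases hy0 : y = 0
    · simp [hy0]
    rw [Function.update_of_ne hy0]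
    have hyp : y ∈ (punctured ℓm ℓp : Set ℝ) := ⟨hy, hy0⟩
    rw [punctured_eq_union hm hp] at hyp
    rcases hyp with hy' | hy'
    · have e : Tendsto f (𝓝[<] 0) (𝓝 ((f y - ∫ t in (0 : ℝ)..y, g t) + 0)) := by
        refine ((ht.mono_left nhdsWithin_le_nhds).const_add _).congr' ?_
        filter_upwards [mem_interval_zero_nhdsLT hm] with x hx
        have e1 := hfl.2 x hx y hy'
        have e2 := hpr.2 x (interval_zero_subset_left hp hx) y hy
        simp only at e2; linear_combination e1 - e2
      rw [tendsto_nhds_unique hl e]; ring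
    · have e : Tendsto f (𝓝[>] 0) (𝓝 ((f y - ∫ t in (0 : ℝ)..y, g t) + 0)) := by
        refine ((ht.mono_left nhdsWithin_le_nhds).const_add _).congr' ?_
        filter_upwards [mem_interval_zero_nhdsGT hp] with x hx
        have e1 := hfr.2 x hx y hy'
        have e2 := hpr.2 x (interval_zero_subset_right hm hx) y hy
        simp only at e2; linear_combination e1 - e2
      rw [tendsto_nhds_unique hr e]; ring
  refine ⟨hg2, fun x hx y hy => ?_⟩
  rw [key x hx, key y hy, ← hpr.2 x hx y hy]; ring

end HalfLines

/-! ### Dependence of the weak derivative on the direction -/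

section Directions

variable {E : Type*} [NormedAddCommGroup E] [NormedSpace ℝ E] [FiniteDimensional ℝ E]
  [MeasureSpace E] [BorelSpace E] {Ω : Opens E} {e e' : E} {u g g' : E → ℂ}

/-- `H1` asks for weak derivatives in all directions; linearity in the direction reduces membership
to the coordinate directions. -/
theorem HasWeakDeriv.add_dir (h : HasWeakDeriv Ω e u g) (h' : HasWeakDeriv Ω e' u g') :
    HasWeakDeriv Ω (e + e') u (g + g') := by
  refine ⟨h.1, h.2.1.add h'.2.1, fun φ h1 h2 h3 => ?_⟩
  simp only [map_add, Pi.add_apply, smul_add, add_smul]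
  rw [integral_add (integrable_fderiv_smul e h1 h2 h3 h.1).integrableOn
    (integrable_fderiv_smul e' h1 h2 h3 h.1).integrableOn,
    integral_add (integrable_smul_of_tsupport h1.continuous h2 h3 h.2.1).integrableOn
    (integrable_smul_of_tsupport h1.continuous h2 h3 h'.2.1).integrableOn,
    h.2.2 φ h1 h2 h3, h'.2.2 φ h1 h2 h3, neg_add]

theorem HasWeakDeriv.smul_dir (c : ℝ) (h : HasWeakDeriv Ω e u g) :
    HasWeakDeriv Ω (c • e) u ((c : ℂ) • g) := by
  refine ⟨h.1, h.2.1.smul (c : ℂ), fun φ h1 h2 h3 => ?_⟩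
  have h4 := h.2.2 φ h1 h2 h3
  simp only [map_smul, Pi.smul_apply, smul_comm _ (c : ℂ), smul_assoc]
  rw [integral_smul, integral_smul, h4, smul_neg, Complex.coe_smul]

end Directions

/-! ### `H¹` functions of one variable and their representatives -/

section OneDim

variable {Ω : Opens ℝ}

theorem mem_H1_of_hasWeakDeriv (u g : L2 Ω) (h : HasWeakDeriv Ω 1 u g) : u ∈ H1 Ω := by
  intro e
  refine ⟨(e : ℂ) • g, ?_⟩
  have := h.smul_dir e
  rw [smul_eq_mul, mul_one] at this
  exact this.congr (EventuallyEq.refl _ _) (Lp.coeFn_smul _ _).symm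

theorem weakDeriv_eq {E : Type*} [NormedAddCommGroup E] [NormedSpace ℝ E] [FiniteDimensional ℝ E]
    [MeasureSpace E] [BorelSpace E] [IsLocallyFiniteMeasure (volume : Measure E)] {Ω : Opens E}
    {e : E} (u : H1 Ω) (g : L2 Ω) (h : HasWeakDeriv Ω e (u : L2 Ω) g) : weakDeriv Ω e u = g :=
  Lp.ext ((hasWeakDeriv_weakDeriv Ω e u).unique h)

theorem exists_representative (hΩ : OrdConnected (Ω : Set ℝ)) (u : H1 Ω) :
    ∃ U, IsPrimitiveOn (Ω : Set ℝ) U (weakDeriv Ω 1 u) ∧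
      (u : L2 Ω) =ᵐ[volume.restrict (Ω : Set ℝ)] U ∧
      ∀ {x : ℝ} (hx : x ∈ Ω), evalAt hΩ hx u = U x := by
  obtain ⟨U, hU, hae⟩ := (hasWeakDeriv_weakDeriv Ω 1 u).exists_isPrimitiveOn hΩ
  exact ⟨U, hU, hae, fun hx => evalAt_eq hΩ hx u (hU.continuousOn Ω.isOpen) hae⟩

theorem IsPrimitiveOn.congr {I : Set ℝ} {u v g : ℝ → ℂ} (h : IsPrimitiveOn I u g)
    (he : EqOn u v I) : IsPrimitiveOn I v g :=
  ⟨h.1, fun x hx y hy => by rw [← he hx, ← he hy, h.2 x hx y hy]⟩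

/-- An element of `H¹` given by a primitive of an `L²` function. -/
theorem IsPrimitiveOn.exists_H1 (hΩ : OrdConnected (Ω : Set ℝ)) {U g : ℝ → ℂ}
    (h : IsPrimitiveOn (Ω : Set ℝ) U g) (hU : MemLp U 2 (volume.restrict (Ω : Set ℝ)))
    (hg : MemLp g 2 (volume.restrict (Ω : Set ℝ))) :
    ∃ u : H1 Ω, (u : L2 Ω) = hU.toLp ∧ weakDeriv Ω 1 u = hg.toLp ∧
      ∀ {x : ℝ} (hx : x ∈ Ω), evalAt hΩ hx u = U x := by
  have hw : HasWeakDeriv Ω 1 hU.toLp hg.toLp :=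
    (h.hasWeakDeriv hΩ).congr hU.coeFn_toLp.symm hg.coeFn_toLp.symm
  exact ⟨⟨_, mem_H1_of_hasWeakDeriv _ _ hw⟩, rfl, weakDeriv_eq _ _ hw, fun hx =>
    evalAt_eq hΩ hx _ (h.continuousOn Ω.isOpen) hU.coeFn_toLp⟩

/-- The support of `ψ` need not lie in `Ω`: functions that do not vanish at an endpoint are what
detects the Neumann conditions. -/
theorem exists_H1_of_test (hΩ : OrdConnected (Ω : Set ℝ)) {ψ : ℝ → ℝ} (h1 : ContDiff ℝ ∞ ψ)
    (h2 : HasCompactSupport ψ) :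
    ∃ v : H1 Ω, (v : L2 Ω) =ᵐ[volume.restrict (Ω : Set ℝ)] (fun x => ((ψ x : ℝ) : ℂ)) ∧
      weakDeriv Ω 1 v =ᵐ[volume.restrict (Ω : Set ℝ)] (fun x => ((deriv ψ x : ℝ) : ℂ)) ∧
      ∀ {x : ℝ} (hx : x ∈ Ω), evalAt hΩ hx v = ψ x := by
  have hU : MemLp (fun x => ((ψ x : ℝ) : ℂ)) 2 (volume.restrict (Ω : Set ℝ)) :=
    ((Complex.continuous_ofReal.comp h1.continuous).memLp_of_hasCompactSupport
      (h2.comp_left (g := Complex.ofReal) (by simp))).restrict _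
  have hg : MemLp (fun x => ((deriv ψ x : ℝ) : ℂ)) 2 (volume.restrict (Ω : Set ℝ)) :=
    ((Complex.continuous_ofReal.comp (h1.continuous_deriv (by simp))).memLp_of_hasCompactSupport
      (h2.deriv.comp_left (g := Complex.ofReal) (by simp))).restrict _
  obtain ⟨v, hv, hv', hv0⟩ := (isPrimitiveOn_of_contDiff h1 (Ω : Set ℝ)).exists_H1 hΩ hU hg
  refine ⟨v, ?_, ?_, hv0⟩
  · rw [hv]; exact hU.coeFn_toLp
  · rw [hv']; exact hg.coeFn_toLp

theorem inner_eq_integral {α : Type*} [MeasurableSpace α] {μ : Measure α} (f g : Lp ℂ 2 μ)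
    {f' g' : α → ℂ} (hf : f =ᵐ[μ] f') (hg : g =ᵐ[μ] g') :
    inner ℂ f g = ∫ x, g' x * starRingEnd ℂ (f' x) ∂μ := by
  rw [L2.inner_def]
  refine integral_congr_ae ?_
  filter_upwards [hf, hg] with x h1 h2
  rw [RCLike.inner_apply, h1, h2]

theorem memLp_star {s : Set ℝ} {f : ℝ → ℂ} (hf : MemLp f 2 (volume.restrict s)) :
    MemLp (fun x => starRingEnd ℂ (f x)) 2 (volume.restrict s) := hf.star

end OneDim

/-! ### The `δ`-interaction as a form, and the splitting of the limit operator -/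

section DeltaForm

variable {ℓm ℓp : EReal}

/-- The form of the Schrödinger operator with a `δ`-interaction. -/
noncomputable def deltaForm (hm : ℓm < 0) (hp : 0 < ℓp) (γ : ℝ)
    (V₀ : Lp ℝ ∞ (volume.restrict (interval ℓm ℓp : Set ℝ))) (u v : H1 (interval ℓm ℓp)) : ℂ :=
  inner ℂ (weakDeriv _ 1 v) (weakDeriv _ 1 u) + inner ℂ (v : L2 (interval ℓm ℓp)) (mulOp V₀ u) +
    γ * inner ℂ (evalAt (ordConnected_interval ℓm ℓp) (zero_mem_interval hm hp) v)
      (evalAt (ordConnected_interval ℓm ℓp) (zero_mem_interval hm hp) u)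

theorem exists_pos_Ioo_subset (hp : 0 < ℓp) : ∃ r > 0, Ioo 0 r ⊆ (interval (0 : ℝ) ℓp : Set ℝ) := by
  obtain ⟨r, hr, h⟩ := mem_nhdsGT_iff_exists_Ioo_subset.1 (mem_interval_zero_nhdsGT hp)
  exact ⟨r, hr, h⟩

theorem exists_neg_Ioo_subset (hm : ℓm < 0) : ∃ r < 0, Ioo r 0 ⊆ (interval ℓm (0 : ℝ) : Set ℝ) := by
  obtain ⟨r, hr, h⟩ := mem_nhdsLT_iff_exists_Ioo_subset.1 (mem_interval_zero_nhdsLT hm)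
  exact ⟨r, hr, h⟩

/-- Integration by parts on the two sides of `0` leaves the boundary term `(m - p) conj v(0)`. By
the jump condition it equals `-γ f₀(0) conj v(0)`, which cancels the point interaction of the form.
-/
theorem form_of_mem_deltaGraph (hm : ℓm < 0) (hp : 0 < ℓp) {γ : ℝ}
    {V₀ : Lp ℝ ∞ (volume.restrict (interval ℓm ℓp : Set ℝ))} {u w : L2 (interval ℓm ℓp)}
    (h : (u, w) ∈ deltaGraph ℓm ℓp γ V₀) :
    ∃ hu : u ∈ H1 (interval ℓm ℓp), ∀ v, deltaForm hm hp γ V₀ ⟨u, hu⟩ v = inner ℂ (v : L2 _) w := by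
  obtain ⟨f₀, f₁, f₂, hf, h0, h2⟩ := h
  obtain ⟨c, p, m, hl, hr, hp', hm', hj⟩ := hf.coupling
  have hΩ := ordConnected_interval ℓm ℓp
  have hsl : (interval ℓm (0 : ℝ) : Set ℝ) ⊆ punctured ℓm ℓp := by
    rw [punctured_eq_union hm hp]; exact subset_union_left
  have hsr : (interval (0 : ℝ) ℓp : Set ℝ) ⊆ punctured ℓm ℓp := by
    rw [punctured_eq_union hm hp]; exact subset_union_right
  have p0l := (hf.deriv_zero.mono hsl).isPrimitiveOn (ordConnected_interval _ _)
    (hf.cont_zero.mono hsl)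
  have p0r := (hf.deriv_zero.mono hsr).isPrimitiveOn (ordConnected_interval _ _)
    (hf.cont_zero.mono hsr)
  have p1l := (hf.deriv_one.mono hsl).isPrimitiveOn (ordConnected_interval _ _)
    (hf.cont_one.mono hsl)
  have p1r := (hf.deriv_one.mono hsr).isPrimitiveOn (ordConnected_interval _ _)
    (hf.cont_one.mono hsr)
  -- The value of `f₀` at `0` is arbitrary; replacing it by the common one-sided limit gives the
  -- continuous representative.
  have hU := isPrimitiveOn_update hm hp p0l p0r (locallyIntegrableOn_of_memLp hf.memLp_one) hr hl
  have hUae : Function.update f₀ 0 c =ᵐ[volume.restrict (interval ℓm ℓp : Set ℝ)] f₀ := by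
    filter_upwards [ae_restrict_of_ae (Measure.ae_ne volume 0)] with x hx
    rw [Function.update_of_ne hx]
  obtain ⟨u', hu', hu1, hu0⟩ := hU.exists_H1 hΩ ((memLp_congr_ae hUae).2 hf.memLp_zero) hf.memLp_one
  have hu : u = (u' : L2 _) := by
    rw [hu']
    exact Lp.ext (h0.trans (hUae.symm.trans (MemLp.coeFn_toLp _).symm))
  subst hu
  refine ⟨u'.2, fun v => ?_⟩
  obtain ⟨V, hV, hVae, hV0⟩ := exists_representative hΩ v
  have hVs := hV.star
  have hV2 := memLp_star ((memLp_congr_ae hVae).1 (Lp.memLp (v : L2 (interval ℓm ℓp))))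
  have hV1 := memLp_star (Lp.memLp (weakDeriv (interval ℓm ℓp) 1 v))
  have green := green_interval hm hp p1l p1r hVs hf.memLp_one hf.memLp_two hV2
    hV1 hp' hm' hf.neumann_left hf.neumann_right
  have hw : w = (w - mulOp V₀ u') + mulOp V₀ u' := by abel
  rw [hw, inner_add_right, deltaForm, hu1, hu0, hV0, Function.update_self,
    inner_eq_integral _ _ (EventuallyEq.refl _ _) (MemLp.coeFn_toLp _),
    inner_eq_integral _ _ hVae h2]
  rw [integral_add (integrableOn_mul_of_memLp hf.memLp_two hV2)
    (integrableOn_mul_of_memLp hf.memLp_one hV1)] at green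
  simp only [Pi.neg_apply, neg_mul, integral_neg, RCLike.inner_apply]
  linear_combination green - starRingEnd ℂ (V 0) * hj

/-- Three kinds of test functions are used: those supported away from `0` and the ends give the
differential equation, a bump at a finite end gives the Neumann condition there, and a bump at `0`,
once the ends are settled, gives the jump of the derivative. -/
theorem mem_deltaGraph_of_form (hm : ℓm < 0) (hp : 0 < ℓp) {γ : ℝ}
    {V₀ : Lp ℝ ∞ (volume.restrict (interval ℓm ℓp : Set ℝ))} (u : H1 (interval ℓm ℓp))
    {w : L2 (interval ℓm ℓp)} (h : ∀ v, deltaForm hm hp γ V₀ u v = inner ℂ (v : L2 _) w) :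
    ((u : L2 (interval ℓm ℓp)), w) ∈ deltaGraph ℓm ℓp γ V₀ := by
  have hΩ := ordConnected_interval ℓm ℓp
  obtain ⟨U, hU, hUae, hU0⟩ := exists_representative hΩ u
  set u₁ := weakDeriv (interval ℓm ℓp) 1 u with hu₁
  -- The equation `-u'' + V₀ u = w` dictates the candidate for the second derivative.
  set f₂ : L2 (interval ℓm ℓp) := -(w - mulOp V₀ u) with hf₂
  have hE : ∀ ψ : ℝ → ℝ, ContDiff ℝ ∞ ψ → HasCompactSupport ψ →
      ∫ x in (interval ℓm ℓp : Set ℝ), (f₂ x * (ψ x : ℂ) + u₁ x * (deriv ψ x : ℝ)) =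
        -(γ * U 0 * (ψ 0 : ℝ)) := by
    intro ψ h1 h2
    obtain ⟨v, hv, hv', hv0⟩ := exists_H1_of_test hΩ h1 h2
    have e := h v
    have hw : w = -f₂ + mulOp V₀ u := by rw [hf₂]; abel
    rw [hw, inner_add_right, deltaForm, hU0, hv0, inner_neg_right,
      inner_eq_integral _ _ hv' (EventuallyEq.refl _ _),
      inner_eq_integral _ _ hv (EventuallyEq.refl _ f₂)] at e
    simp only [Complex.conj_ofReal, RCLike.inner_apply] at e
    have i1 := integrableOn_mul_of_memLp (Lp.memLp f₂) ((memLp_congr_ae hv).1 (Lp.memLp _))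
    have i2 := integrableOn_mul_of_memLp (Lp.memLp u₁) ((memLp_congr_ae hv').1 (Lp.memLp _))
    rw [integral_add i1 i2]
    linear_combination e
  have hw2 : HasWeakDeriv (punctured ℓm ℓp) 1 u₁ f₂ := by
    have hsub : (punctured ℓm ℓp : Set ℝ) ⊆ interval ℓm ℓp := sdiff_subset
    refine ⟨(L2.locallyIntegrableOn u₁).mono_set hsub, (L2.locallyIntegrableOn f₂).mono_set hsub,
      fun φ h1 h2 h3 => ?_⟩
    have e := hE φ h1 h2
    have h00 : φ 0 = 0 := image_eq_zero_of_notMem_tsupport fun h' => (h3 h').2 rfl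
    have i1 := (integrable_smul_of_tsupport h1.continuous h2 (h3.trans hsub)
      (L2.locallyIntegrableOn f₂)).integrableOn (s := (interval ℓm ℓp : Set ℝ))
    have i2 := (integrable_fderiv_smul 1 h1 h2 (h3.trans hsub)
      (L2.locallyIntegrableOn u₁)).integrableOn (s := (interval ℓm ℓp : Set ℝ))
    simp only [fderiv_apply_one_eq_deriv, Complex.real_smul, mul_comm] at i1 i2 e ⊢
    rw [integral_add i1 i2, h00] at e
    rw [restrict_punctured]
    simp only [Complex.ofReal_zero, zero_mul, neg_zero] at e
    linear_combination e
  have hsl : (interval ℓm (0 : ℝ) : Set ℝ) ⊆ punctured ℓm ℓp := by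
    rw [punctured_eq_union hm hp]; exact subset_union_left
  have hsr : (interval (0 : ℝ) ℓp : Set ℝ) ⊆ punctured ℓm ℓp := by
    rw [punctured_eq_union hm hp]; exact subset_union_right
  obtain ⟨fl, hfl, hfl'⟩ := (hw2.mono hsl).exists_isPrimitiveOn (ordConnected_interval _ _)
  obtain ⟨fr, hfr, hfr'⟩ := (hw2.mono hsr).exists_isPrimitiveOn (ordConnected_interval _ _)
  -- Continuous representatives of `u'` on the two sides, glued together; the value at `0` is
  -- irrelevant.
  let f₁ : ℝ → ℂ := fun x => if 0 < x then fr x else fl x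
  have er : EqOn fr f₁ (interval (0 : ℝ) ℓp : Set ℝ) := fun x hx =>
    (if_pos (EReal.coe_lt_coe_iff.1 hx.1)).symm
  have el : EqOn fl f₁ (interval ℓm (0 : ℝ) : Set ℝ) := fun x hx =>
    (if_neg (EReal.coe_lt_coe_iff.1 hx.2).not_gt).symm
  replace hfl := hfl.congr el
  replace hfr := hfr.congr er
  have hu1 : u₁ =ᵐ[volume.restrict (interval ℓm ℓp : Set ℝ)] f₁ := by
    have hae : ae (volume.restrict (interval ℓm ℓp : Set ℝ)) =
        ae (volume.restrict ((interval ℓm (0 : ℝ) : Set ℝ) ∪ interval (0 : ℝ) ℓp)) := by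
      rw [← restrict_punctured, punctured_eq_union hm hp]
    rw [EventuallyEq, hae, ae_restrict_union_iff]
    constructor
    · filter_upwards [hfl', ae_restrict_mem (interval ℓm (0 : ℝ)).isOpen.measurableSet] with x h1 h2
      rw [h1, el h2]
    · filter_upwards [hfr', ae_restrict_mem (interval (0 : ℝ) ℓp).isOpen.measurableSet] with x h1 h2
      rw [h1, er h2]
  have hf12 : MemLp f₁ 2 (volume.restrict (interval ℓm ℓp : Set ℝ)) :=
    (memLp_congr_ae hu1).1 (Lp.memLp u₁)
  have sl := interval_zero_subset_left (ℓm := ℓm) hp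
  have sr := interval_zero_subset_right (ℓp := ℓp) hm
  have hE' : ∀ ψ : ℝ → ℝ, ContDiff ℝ ∞ ψ → HasCompactSupport ψ →
      ∫ x in (interval ℓm ℓp : Set ℝ), (f₂ x * (ψ x : ℂ) + f₁ x * (deriv ψ x : ℝ)) =
        -(γ * U 0 * (ψ 0 : ℝ)) := by
    intro ψ h1 h2
    rw [← hE ψ h1 h2]
    refine integral_congr_ae ?_
    filter_upwards [hu1] with x hx
    rw [hx]
  have hGi : ∀ ψ : ℝ → ℝ, ContDiff ℝ ∞ ψ → HasCompactSupport ψ →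
      IntegrableOn (fun x => f₂ x * (ψ x : ℂ) + f₁ x * (deriv ψ x : ℝ)) (interval ℓm ℓp : Set ℝ) := by
    intro ψ h1 h2
    obtain ⟨v, hv, hv', -⟩ := exists_H1_of_test hΩ h1 h2
    exact (integrableOn_mul_of_memLp (Lp.memLp f₂) ((memLp_congr_ae hv).1 (Lp.memLp _))).add
      (integrableOn_mul_of_memLp hf12 ((memLp_congr_ae hv').1 (Lp.memLp _)))
  have hlim : (∃ p, Tendsto f₁ (𝓝[>] 0) (𝓝 p)) := by
    obtain ⟨r, hr, hs⟩ := exists_pos_Ioo_subset hp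
    have hi : IntegrableOn f₂ (Ioo 0 r) :=
      (memLp_restrict_mono (Lp.memLp f₂) (hs.trans sr)).integrable (by norm_num)
    exact ⟨_, (hfr.mono hs).tendsto_left hi (c := r / 2) ⟨by linarith, by linarith⟩⟩
  have hlim' : (∃ m, Tendsto f₁ (𝓝[<] 0) (𝓝 m)) := by
    obtain ⟨r, hr, hs⟩ := exists_neg_Ioo_subset hm
    have hi : IntegrableOn f₂ (Ioo r 0) :=
      (memLp_restrict_mono (Lp.memLp f₂) (hs.trans sl)).integrable (by norm_num)
    exact ⟨_, (hfl.mono hs).tendsto_right hi (c := r / 2) ⟨by linarith, by linarith⟩⟩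
  obtain ⟨p, hp'⟩ := hlim
  obtain ⟨m, hm'⟩ := hlim'
  have hNp : ∀ b : ℝ, ℓp = b → Tendsto f₁ (𝓝[<] b) (𝓝 0) := by
    intro b hb
    subst hb
    have hb0 : 0 < b := by exact_mod_cast hp
    rw [interval_coe] at hfr
    have hi : IntegrableOn f₂ (Ioo 0 b) := by
      have := memLp_restrict_mono (Lp.memLp f₂) sr
      rw [interval_coe] at this
      exact this.integrable (by norm_num)
    have hB := hfr.tendsto_right hi (c := b / 2) ⟨by linarith, by linarith⟩
    set B := f₁ (b / 2) + ∫ t in (b / 2)..b, f₂ t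
    -- The bump is `1` at `b` and supported in `[b/2, 3b/2]`, hence vanishes on the left half and at
    -- `0`. The only boundary term left is the limit `B` of `f₁` at `b`, so it must be `0`.
    let ψ : ContDiffBump b := ⟨b / 4, b / 2, by linarith, by linarith⟩
    have hψ1 : ContDiff ℝ ∞ ψ := ψ.contDiff
    have hψ0 : ∀ x ≤ 0, ψ x = 0 ∧ deriv ψ x = 0 := by
      intro x hx
      have hd : x ∉ tsupport ψ := by
        rw [ψ.tsupport_eq, Metric.mem_closedBall, Real.dist_eq, not_le]
        change b / 2 < _
        rw [lt_abs]; right; linarith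
      exact ⟨image_eq_zero_of_notMem_tsupport hd,
        image_eq_zero_of_notMem_tsupport fun h => hd (tsupport_deriv_subset h)⟩
    have hψb : ψ b = 1 := ψ.one_of_mem_closedBall (by simp [ψ.rIn_pos.le])
    have e := hE' ψ hψ1 ψ.hasCompactSupport
    rw [setIntegral_interval (F := fun x => f₂ x * (ψ x : ℂ) + f₁ x * (deriv ψ x : ℝ)) hm hp
      (hGi ψ hψ1 ψ.hasCompactSupport), (hψ0 0 le_rfl).1,
      setIntegral_eq_zero_of_forall_eq_zero (t := (interval ℓm (0 : ℝ) : Set ℝ))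
      (fun x hx => by
        have := hψ0 x (EReal.coe_lt_coe_iff.1 hx.2).le
        rw [this.1, this.2]; simp), interval_coe] at e
    have hprod := hfr.mul (isPrimitiveOn_of_contDiff hψ1 _) ordConnected_Ioo isOpen_Ioo
    have hGi' := (hGi ψ hψ1 ψ.hasCompactSupport).mono_set sr
    rw [interval_coe] at hGi'
    have hψc : Continuous fun x => ((ψ x : ℝ) : ℂ) := Complex.continuous_ofReal.comp hψ1.continuous
    rw [hprod.integral_Ioo hb0 hGi'
      (hp'.mul ((hψc.tendsto 0).mono_left nhdsWithin_le_nhds))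
      (hB.mul ((hψc.tendsto b).mono_left nhdsWithin_le_nhds)), hψb, (hψ0 0 le_rfl).1] at e
    simp only [Complex.ofReal_one, mul_one, Complex.ofReal_zero, mul_zero, sub_zero, neg_zero,
      zero_add] at e
    rwa [e] at hB
  have hNm : ∀ b : ℝ, ℓm = b → Tendsto f₁ (𝓝[>] b) (𝓝 0) := by
    intro b hb
    subst hb
    have hb0 : b < 0 := by exact_mod_cast hm
    rw [interval_coe] at hfl
    have hi : IntegrableOn f₂ (Ioo b 0) := by
      have := memLp_restrict_mono (Lp.memLp f₂) sl
      rw [interval_coe] at this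
      exact this.integrable (by norm_num)
    have hB := hfl.tendsto_left hi (c := b / 2) ⟨by linarith, by linarith⟩
    set B := f₁ (b / 2) + ∫ t in (b / 2)..b, f₂ t
    -- Mirror image of the argument at the right end: here `b < 0` and the support is `[3b/2, b/2]`.
    let ψ : ContDiffBump b := ⟨-b / 4, -b / 2, by linarith, by linarith⟩
    have hψ1 : ContDiff ℝ ∞ ψ := ψ.contDiff
    have hψ0 : ∀ x, 0 ≤ x → ψ x = 0 ∧ deriv ψ x = 0 := by
      intro x hx
      have hd : x ∉ tsupport ψ := by
        rw [ψ.tsupport_eq, Metric.mem_closedBall, Real.dist_eq, not_le]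
        change -b / 2 < _
        rw [lt_abs]; left; linarith
      exact ⟨image_eq_zero_of_notMem_tsupport hd,
        image_eq_zero_of_notMem_tsupport fun h => hd (tsupport_deriv_subset h)⟩
    have hψb : ψ b = 1 := ψ.one_of_mem_closedBall (by simp [ψ.rIn_pos.le])
    have e := hE' ψ hψ1 ψ.hasCompactSupport
    rw [setIntegral_interval (F := fun x => f₂ x * (ψ x : ℂ) + f₁ x * (deriv ψ x : ℝ)) hm hp
      (hGi ψ hψ1 ψ.hasCompactSupport), (hψ0 0 le_rfl).1,
      setIntegral_eq_zero_of_forall_eq_zero (t := (interval (0 : ℝ) ℓp : Set ℝ))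
      (fun x hx => by
        have := hψ0 x (EReal.coe_lt_coe_iff.1 hx.1).le
        rw [this.1, this.2]; simp), interval_coe] at e
    have hprod := hfl.mul (isPrimitiveOn_of_contDiff hψ1 _) ordConnected_Ioo isOpen_Ioo
    have hGi' := (hGi ψ hψ1 ψ.hasCompactSupport).mono_set sl
    rw [interval_coe] at hGi'
    have hψc : Continuous fun x => ((ψ x : ℝ) : ℂ) := Complex.continuous_ofReal.comp hψ1.continuous
    rw [hprod.integral_Ioo hb0 hGi'
      (hB.mul ((hψc.tendsto b).mono_left nhdsWithin_le_nhds))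
      (hm'.mul ((hψc.tendsto 0).mono_left nhdsWithin_le_nhds)), hψb, (hψ0 0 le_rfl).1] at e
    simp only [Complex.ofReal_one, mul_one, Complex.ofReal_zero, mul_zero, zero_sub, neg_zero,
      add_zero, neg_eq_zero] at e
    rwa [e] at hB
  have hUc := hU.continuousOn (interval ℓm ℓp).isOpen
  have hU0' : Tendsto U (𝓝 0) (𝓝 (U 0)) := hUc.continuousAt
    ((interval ℓm ℓp).isOpen.mem_nhds (zero_mem_interval hm hp))
  refine ⟨U, f₁, f₂, ?_, hUae, ?_⟩
  · refine ⟨(memLp_congr_ae hUae).1 (Lp.memLp _), hf12, Lp.memLp f₂, ?_, ?_, ?_, ?_, ?_, hNm, hNp⟩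
    · refine ((hU.hasWeakDeriv hΩ).mono sdiff_subset).congr (EventuallyEq.refl _ _) ?_
      rw [restrict_punctured]; exact hu1
    · refine hw2.congr ?_ (EventuallyEq.refl _ _)
      rw [restrict_punctured]; exact hu1
    · exact hUc.mono sdiff_subset
    · rw [punctured_eq_union hm hp]
      exact (hfl.continuousOn (interval ℓm (0 : ℝ)).isOpen).union_of_isOpen
        (hfr.continuousOn (interval (0 : ℝ) ℓp).isOpen) (interval ℓm (0 : ℝ)).isOpen
        (interval (0 : ℝ) ℓp).isOpen
    · refine ⟨U 0, p, m, hU0'.mono_left nhdsWithin_le_nhds, hU0'.mono_left nhdsWithin_le_nhds,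
        hp', hm', ?_⟩
      -- This bump may reach past the ends of `Ω₀`; the Neumann conditions already obtained remove
      -- any contribution from there.
      let ψ : ContDiffBump (0 : ℝ) := ⟨1, 2, by norm_num, by norm_num⟩
      have hψ1 : ContDiff ℝ ∞ ψ := ψ.contDiff
      have hψ0 : ψ 0 = 1 := ψ.one_of_mem_closedBall (by simp [ψ.rIn_pos.le])
      obtain ⟨v, hv, hv', -⟩ := exists_H1_of_test hΩ hψ1 ψ.hasCompactSupport
      have e := hE' ψ hψ1 ψ.hasCompactSupport
      rw [green_interval hm hp hfl hfr (isPrimitiveOn_of_contDiff hψ1 _) hf12 (Lp.memLp f₂)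
        ((memLp_congr_ae hv).1 (Lp.memLp _)) ((memLp_congr_ae hv').1 (Lp.memLp _)) hp' hm' hNm hNp,
        hψ0] at e
      simp only [Complex.ofReal_one, mul_one] at e
      linear_combination -e
  · rw [hf₂]
    have := Lp.coeFn_neg (-(w - mulOp V₀ (u : L2 (interval ℓm ℓp))))
    rwa [neg_neg] at this

theorem mem_deltaGraph_iff (hm : ℓm < 0) (hp : 0 < ℓp) {γ : ℝ}
    {V₀ : Lp ℝ ∞ (volume.restrict (interval ℓm ℓp : Set ℝ))} {u w : L2 (interval ℓm ℓp)} :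
    (u, w) ∈ deltaGraph ℓm ℓp γ V₀ ↔ ∃ hu : u ∈ H1 (interval ℓm ℓp),
      ∀ v, deltaForm hm hp γ V₀ ⟨u, hu⟩ v = inner ℂ (v : L2 _) w :=
  ⟨form_of_mem_deltaGraph hm hp, fun ⟨hu, h⟩ => mem_deltaGraph_of_form hm hp ⟨u, hu⟩ h⟩

/-- The form does not see the second component, so testing with `(v, 0)` and with `(0, 1)` decouples
the equation: `A₀` is the `δ`-operator on `L²(Ω₀)` and zero on `ℂ`. -/
theorem mem_opZero_iff (hm : ℓm < 0) (hp : 0 < ℓp) {γ : ℝ}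
    {V₀ : Lp ℝ ∞ (volume.restrict (interval ℓm ℓp : Set ℝ))} {u w : H0 (interval ℓm ℓp)} :
    (∃ hu : u ∈ (opZero hm hp γ V₀).domain, opZero hm hp γ V₀ ⟨u, hu⟩ = w) ↔
      (u.fst, w.fst) ∈ deltaGraph ℓm ℓp γ V₀ ∧ w.snd = 0 := by
  rw [opZero, mem_operator_domain_iff, mem_deltaGraph_iff hm hp]
  constructor
  · rintro ⟨hu, h⟩
    refine ⟨⟨hu, fun v => ?_⟩, ?_⟩
    · have e : deltaForm hm hp γ V₀ ⟨u.fst, hu⟩ v =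
          inner ℂ (WithLp.toLp 2 ((v : L2 (interval ℓm ℓp)), (0 : ℂ)) : H0 (interval ℓm ℓp)) w :=
        h ⟨_, (show WithLp.toLp 2 ((v : L2 _), (0 : ℂ)) ∈ dom0 (interval ℓm ℓp) from v.2)⟩
      rw [WithLp.prod_inner_apply] at e
      simpa using e
    · have e : deltaForm hm hp γ V₀ ⟨u.fst, hu⟩ 0 =
          inner ℂ (WithLp.toLp 2 (0, 1) : H0 (interval ℓm ℓp)) w :=
        h ⟨_, (show WithLp.toLp 2 (0, (1 : ℂ)) ∈ dom0 (interval ℓm ℓp) from (H1 _).zero_mem)⟩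
      rw [WithLp.prod_inner_apply, deltaForm] at e
      simpa using e.symm
  · rintro ⟨⟨hu, h⟩, h0⟩
    refine ⟨hu, fun v => ?_⟩
    refine Eq.trans (h (projH1 _ v)) ?_
    rw [WithLp.prod_inner_apply]
    change _ = inner ℂ v.1.fst w.fst + inner ℂ v.1.snd w.snd
    rw [h0, inner_zero_right, add_zero]
    rfl

theorem mem_deltaOp_iff {γ : ℝ} {V₀ : Lp ℝ ∞ (volume.restrict (interval ℓm ℓp : Set ℝ))}
    {u w : L2 (interval ℓm ℓp)} :
    (∃ hu : u ∈ (deltaOp ℓm ℓp γ V₀).domain, deltaOp ℓm ℓp γ V₀ ⟨u, hu⟩ = w) ↔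
      (u, w) ∈ deltaGraph ℓm ℓp γ V₀ := by
  rw [← graph_deltaOp, LinearPMap.mem_graph_iff]
  constructor
  · rintro ⟨hu, hw⟩
    exact ⟨⟨u, hu⟩, rfl, hw⟩
  · rintro ⟨y, hy, hy'⟩
    obtain rfl : (y : L2 _) = u := hy
    exact ⟨y.2, hy'⟩

/-- The spectrum of the limit operator is the spectrum of the `δ`-operator together with `0`. -/
theorem opSpectrum_opZero (hm : ℓm < 0) (hp : 0 < ℓp) (γ : ℝ)
    (V₀ : Lp ℝ ∞ (volume.restrict (interval ℓm ℓp : Set ℝ))) :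
    opSpectrum (opZero hm hp γ V₀) = opSpectrum (deltaOp ℓm ℓp γ V₀) ∪ {0} := by
  suffices h : ∀ z, z ∈ resolventSet (opZero hm hp γ V₀) ↔
      z ∈ resolventSet (deltaOp ℓm ℓp γ V₀) ∧ z ≠ 0 by
    ext z
    simp only [opSpectrum, mem_compl_iff, mem_union, mem_singleton_iff, h, not_and_or, not_not,
      ne_eq]
  intro z
  let ι : L2 (interval ℓm ℓp) →L[ℂ] H0 (interval ℓm ℓp) :=
    (WithLp.prodContinuousLinearEquiv 2 ℂ (L2 (interval ℓm ℓp)) ℂ).symm.toContinuousLinearMap ∘L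
      ContinuousLinearMap.inl ℂ _ _
  let ι₂ : ℂ →L[ℂ] H0 (interval ℓm ℓp) :=
    (WithLp.prodContinuousLinearEquiv 2 ℂ (L2 (interval ℓm ℓp)) ℂ).symm.toContinuousLinearMap ∘L
      ContinuousLinearMap.inr ℂ _ _
  let π : H0 (interval ℓm ℓp) →L[ℂ] L2 (interval ℓm ℓp) := ContinuousLinearMap.fst ℂ _ _ ∘L
    (WithLp.prodContinuousLinearEquiv 2 ℂ (L2 (interval ℓm ℓp)) ℂ).toContinuousLinearMap
  let π₂ : H0 (interval ℓm ℓp) →L[ℂ] ℂ := ContinuousLinearMap.snd ℂ _ _ ∘L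
    (WithLp.prodContinuousLinearEquiv 2 ℂ (L2 (interval ℓm ℓp)) ℂ).toContinuousLinearMap
  have ext' : ∀ {a b : H0 (interval ℓm ℓp)}, a.fst = b.fst → a.snd = b.snd → a = b :=
    fun h1 h2 => WithLp.ofLp_injective 2 (Prod.ext h1 h2)
  constructor
  · rintro ⟨R, h1, h2⟩
    refine ⟨⟨π ∘L R ∘L ι, fun g => ?_, fun u => ?_⟩, ?_⟩
    · obtain ⟨hg, e⟩ := h1 (ι g)
      obtain ⟨h3, -⟩ := (mem_opZero_iff hm hp).1 ⟨hg, rfl⟩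
      obtain ⟨hu, e'⟩ := mem_deltaOp_iff.2 h3
      refine ⟨hu, ?_⟩
      refine Eq.trans ?_ (congrArg WithLp.fst e)
      exact congrArg (· - z • (R (ι g)).fst) e'
    · have h3 := mem_deltaOp_iff.1 ⟨u.2, rfl⟩
      obtain ⟨hu, e⟩ := (mem_opZero_iff hm hp (u := ι u) (w := ι (deltaOp ℓm ℓp γ V₀ u))).2
        ⟨h3, rfl⟩
      have e2 := h2 ⟨_, hu⟩
      rw [e] at e2
      have e3 : ι (deltaOp ℓm ℓp γ V₀ u) - z • ι u = ι (deltaOp ℓm ℓp γ V₀ u - z • (u : L2 _)) := by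
        rw [map_sub, map_smul]
      change R (ι (deltaOp ℓm ℓp γ V₀ u) - z • ι u) = ι u at e2
      rw [e3] at e2
      exact congrArg WithLp.fst e2
    -- If `0` were in the resolvent set, `(0, 1)` would be in the range of `A₀`, whose second
    -- components all vanish.
    · rintro rfl
      obtain ⟨hg, e⟩ := h1 (ι₂ 1)
      obtain ⟨-, h4⟩ := (mem_opZero_iff hm hp).1 ⟨hg, rfl⟩
      rw [zero_smul, sub_zero] at e
      rw [e] at h4
      exact one_ne_zero h4
  · rintro ⟨⟨R, h1, h2⟩, hz⟩
    -- The resolvent of the direct sum is `R` on the first component and division by `-z` on the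
    -- second.
    have hfst : ∀ g, ((ι ∘L R ∘L π - z⁻¹ • (ι₂ ∘L π₂)) g).fst = R (π g) := fun g => by
      change R (π g) - z⁻¹ • (0 : L2 _) = _
      rw [smul_zero, sub_zero]
    have hsnd : ∀ g, ((ι ∘L R ∘L π - z⁻¹ • (ι₂ ∘L π₂)) g).snd = - (z⁻¹ * g.snd) := fun g => by
      change (0 : ℂ) - z⁻¹ • g.snd = _
      rw [zero_sub, smul_eq_mul]
    refine ⟨ι ∘L R ∘L π - z⁻¹ • (ι₂ ∘L π₂), fun g => ?_, fun u => ?_⟩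
    · obtain ⟨hg, e⟩ := h1 (π g)
      have h3 := mem_deltaOp_iff.1 ⟨hg, rfl⟩
      generalize deltaOp ℓm ℓp γ V₀ ⟨R (π g), hg⟩ = w at h3 e
      have hf := hfst g
      have hs := hsnd g
      generalize (ι ∘L R ∘L π - z⁻¹ • (ι₂ ∘L π₂)) g = y at hf hs
      rw [← hf] at h3
      obtain ⟨hu, e'⟩ := (mem_opZero_iff hm hp (w := WithLp.toLp 2 (w, 0))).2 ⟨h3, rfl⟩
      refine ⟨hu, ?_⟩
      rw [e']
      refine ext' ?_ ?_
      · change w - z • y.fst = π g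
        rw [hf, e]
      · change (0 : ℂ) - z • y.snd = g.snd
        rw [hs, smul_eq_mul]
        field_simp
        ring
    · obtain ⟨h3, h4⟩ := (mem_opZero_iff hm hp).1 ⟨u.2, rfl⟩
      obtain ⟨hu, e⟩ := mem_deltaOp_iff.2 h3
      have e2 := h2 ⟨_, hu⟩
      rw [e] at e2
      generalize opZero hm hp γ V₀ ⟨u, u.2⟩ = w at h4 e2
      refine ext' ?_ ?_
      · rw [hfst, map_sub, map_smul]
        exact e2
      · have e5 : (w - z • (u : H0 (interval ℓm ℓp))).snd = w.snd - z * (u : H0 (interval ℓm ℓp)).snd := rfl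
        rw [hsnd, e5, h4]
        field_simp
        ring

end DeltaForm

/-! ### Slices of functions with weak partial derivatives -/

section Slices

variable {Ω : Opens (ℝ × ℝ)} {v g : ℝ × ℝ → ℂ}

/-- Rational endpoints leave only countably many boxes, so that their exceptional null sets can be
united. -/
theorem exists_rat_Icc {K : Opens ℝ} (hK : OrdConnected (K : Set ℝ)) {x₀ : ℝ} (hx₀ : x₀ ∈ K)
    {k : Set ℝ} (hk : IsCompact k) (hkK : k ⊆ K) :
    ∃ c d : ℚ, Icc (c : ℝ) d ⊆ K ∧ k ⊆ Icc (c : ℝ) d ∧ x₀ ∈ Ioo (c : ℝ) d := by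
  obtain ⟨a, b, hab, hsub, hx⟩ := exists_Icc hK hx₀ hk hkK
  have hle : a ≤ b := hx.1.trans hx.2
  obtain ⟨r, hr, hball⟩ := Metric.isOpen_iff.1 K.isOpen a (hab (left_mem_Icc.2 hle))
  obtain ⟨s, hs, hball'⟩ := Metric.isOpen_iff.1 K.isOpen b (hab (right_mem_Icc.2 hle))
  obtain ⟨c, hc1, hc2⟩ := exists_rat_btwn (show a - r < a by linarith)
  obtain ⟨d, hd1, hd2⟩ := exists_rat_btwn (show b < b + s by linarith)
  refine ⟨c, d, hK.out (hball ?_) (hball' ?_), hsub.trans (Icc_subset_Icc hc2.le hd1.le),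
    hc2.trans_le hx.1, hx.2.trans_lt hd1⟩
  · rw [Metric.mem_ball, Real.dist_eq, abs_lt]; constructor <;> linarith
  · rw [Metric.mem_ball, Real.dist_eq, abs_lt]; constructor <;> linarith

theorem integrableOn_box {f : ℝ × ℝ → ℂ} (hf : LocallyIntegrableOn f (Ω : Set (ℝ × ℝ)))
    {a b c d : ℝ} (hbox : Icc a b ×ˢ Icc c d ⊆ (Ω : Set (ℝ × ℝ))) :
    Integrable f ((volume.restrict (Icc a b)).prod (volume.restrict (Icc c d))) := by
  rw [Measure.prod_restrict, ← Measure.volume_eq_prod]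
  exact hf.integrableOn_compact_subset hbox (isCompact_Icc.prod isCompact_Icc)

/-- Testing with products `φ(x) θ(y)` for fixed `θ` and all `φ` reduces the claim to the fundamental
lemma in the variable `x`. The exceptional set depends on `θ`. -/
theorem HasWeakDeriv.ae_slice_test (h : HasWeakDeriv Ω (0, 1) v g) {a b c d : ℝ}
    (hbox : Icc a b ×ˢ Icc c d ⊆ (Ω : Set (ℝ × ℝ))) {θ : ℝ → ℝ} (hθ : ContDiff ℝ ∞ θ)
    (hθs : tsupport θ ⊆ Icc c d) :
    ∀ᵐ x, x ∈ Ioo a b → ∫ y in Icc c d, (deriv θ y • v (x, y) + θ y • g (x, y)) = 0 := by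
  have hθc : HasCompactSupport θ := isCompact_Icc.of_isClosed_subset (isClosed_tsupport _) hθs
  have hθd : Continuous (deriv θ) := hθ.continuous_deriv (by simp)
  have hcv : Integrable (fun p : ℝ × ℝ => deriv θ p.2 • v p + θ p.2 • g p)
      ((volume.restrict (Icc a b)).prod (volume.restrict (Icc c d))) := by
    rw [Measure.prod_restrict, ← Measure.volume_eq_prod]
    have i1 := h.1.integrableOn_compact_subset hbox (isCompact_Icc.prod isCompact_Icc)
    have i2 := h.2.1.integrableOn_compact_subset hbox (isCompact_Icc.prod isCompact_Icc)
    exact (i1.continuousOn_smul (hθd.comp continuous_snd).continuousOn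
      (isCompact_Icc.prod isCompact_Icc)).add (i2.continuousOn_smul
      (hθ.continuous.comp continuous_snd).continuousOn (isCompact_Icc.prod isCompact_Icc))
  refine isOpen_Ioo.ae_eq_zero_of_integral_contDiff_smul_eq_zero
    (IntegrableOn.locallyIntegrableOn (hcv.integral_prod_left.mono_measure
      (Measure.restrict_mono Ioo_subset_Icc_self le_rfl))) fun φ h1 h2 h3 => ?_
  have hz : ∀ x ∉ Icc a b, φ x = 0 := fun x hx => image_eq_zero_of_notMem_tsupport
    (fun hx' => hx (Ioo_subset_Icc_self (h3 hx')))
  have hzθ : ∀ x ∉ Icc c d, θ x = 0 := fun x hx => image_eq_zero_of_notMem_tsupport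
    (fun hx' => hx (hθs hx'))
  have hzθ' : ∀ x ∉ Icc c d, deriv θ x = 0 := fun x hx => image_eq_zero_of_notMem_tsupport
    (fun hx' => hx (hθs (tsupport_deriv_subset hx')))
  let Φ : ℝ × ℝ → ℝ := fun p => φ p.1 * θ p.2
  have hΦ1 : ContDiff ℝ ∞ Φ := (h1.comp contDiff_fst).mul (hθ.comp contDiff_snd)
  have hΦt : tsupport Φ ⊆ Icc a b ×ˢ Icc c d := by
    refine closure_minimal (fun p hp => ?_) (isClosed_Icc.prod isClosed_Icc)
    by_contra hp'
    apply hp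
    rw [mem_prod, not_and_or] at hp'
    rcases hp' with hp' | hp'
    · simp [Φ, hz _ hp']
    · simp [Φ, hzθ _ hp']
  have hΦ2 : HasCompactSupport Φ :=
    (isCompact_Icc.prod isCompact_Icc).of_isClosed_subset (isClosed_tsupport _) hΦt
  have hΦd : ∀ p, fderiv ℝ Φ p (0, 1) = φ p.1 * deriv θ p.2 := by
    intro p
    have e1 : HasFDerivAt (fun p : ℝ × ℝ => φ p.1)
        ((fderiv ℝ φ p.1).comp (ContinuousLinearMap.fst ℝ ℝ ℝ)) p :=
      ((h1.differentiable (by simp)) p.1).hasFDerivAt.comp p hasFDerivAt_fst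
    have e2 : HasFDerivAt (fun p : ℝ × ℝ => θ p.2)
        ((fderiv ℝ θ p.2).comp (ContinuousLinearMap.snd ℝ ℝ ℝ)) p :=
      ((hθ.differentiable (by simp)) p.2).hasFDerivAt.comp p hasFDerivAt_snd
    have hΦe : Φ = (fun p : ℝ × ℝ => φ p.1) * fun p => θ p.2 := rfl
    rw [hΦe, (e1.mul e2).fderiv]
    simp
  have key := h.2.2 Φ hΦ1 hΦ2 (hΦt.trans hbox)
  have j1 := integrable_fderiv_smul (0, 1) hΦ1 hΦ2 (hΦt.trans hbox) h.1
  have j2 := integrable_smul_of_tsupport hΦ1.continuous hΦ2 (hΦt.trans hbox) h.2.1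
  have hzΦ : ∀ p ∉ Icc a b ×ˢ Icc c d, Φ p = 0 := fun p hp =>
    image_eq_zero_of_notMem_tsupport fun hp' => hp (hΦt hp')
  have hzΦ' : ∀ p ∉ Icc a b ×ˢ Icc c d, fderiv ℝ Φ p (0, 1) = 0 := fun p hp => by
    rw [hΦd]
    rw [mem_prod, not_and_or] at hp
    rcases hp with hp | hp
    · simp [hz _ hp]
    · simp [hzθ' _ hp]
  have e3 : ∫ x, φ x • ∫ y in Icc c d, (deriv θ y • v (x, y) + θ y • g (x, y)) =
      ∫ p, (fderiv ℝ Φ p (0, 1) • v p + Φ p • g p) := by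
    rw [← setIntegral_eq_integral_of_forall_compl_eq_zero (s := Icc a b)
      (fun x hx => by simp [hz x hx]),
      ← setIntegral_eq_integral_of_forall_compl_eq_zero (s := Icc a b ×ˢ Icc c d)
      (fun p hp => by simp [hzΦ p hp, hzΦ' p hp])]
    rw [Measure.volume_eq_prod, ← Measure.prod_restrict, integral_prod]
    · refine integral_congr_ae (Eventually.of_forall fun x => ?_)
      simp only
      rw [← integral_smul]
      refine integral_congr_ae (Eventually.of_forall fun y => ?_)
      simp only [hΦd, Φ, smul_add, mul_smul]
    · rw [Measure.prod_restrict, ← Measure.volume_eq_prod]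
      exact (j1.add j2).integrableOn
  rw [e3, integral_add j1 j2]
  rw [setIntegral_eq_integral_of_forall_compl_eq_zero
      (fun x hx => by simp [hzΦ' x (fun h' => hx (hbox h'))]),
    setIntegral_eq_integral_of_forall_compl_eq_zero
      (fun x hx => by simp [hzΦ x (fun h' => hx (hbox h'))])] at key
  rw [key, neg_add_cancel]

/-- One null set serves all `θ`: the pairs `(θ, θ')` form a separable subset of a product of spaces
of continuous functions, and the identity for a dense countable family passes to uniform limits. -/
theorem HasWeakDeriv.ae_slice_box (h : HasWeakDeriv Ω (0, 1) v g) {a b c d : ℝ}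
    (hbox : Icc a b ×ˢ Icc c d ⊆ (Ω : Set (ℝ × ℝ))) :
    ∀ᵐ x, x ∈ Ioo a b → IntegrableOn (fun y => v (x, y)) (Icc c d) ∧
      IntegrableOn (fun y => g (x, y)) (Icc c d) ∧
      ∀ θ : ℝ → ℝ, ContDiff ℝ ∞ θ → tsupport θ ⊆ Icc c d →
        ∫ y in Icc c d, (deriv θ y • v (x, y) + θ y • g (x, y)) = 0 := by
  let Θ := {θ : ℝ → ℝ // ContDiff ℝ ∞ θ ∧ tsupport θ ⊆ Icc c d}
  let j : Θ → C(Icc c d, ℝ) × C(Icc c d, ℝ) := fun θ =>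
    (⟨fun y => θ.1 y, θ.2.1.continuous.comp continuous_subtype_val⟩,
      ⟨fun y => deriv θ.1 y, (θ.2.1.continuous_deriv (by simp)).comp continuous_subtype_val⟩)
  obtain ⟨T₀, hTc₀, hTd₀⟩ := TopologicalSpace.exists_countable_dense (range j)
  let T : Set Θ := (fun p : range j => p.2.choose) '' T₀
  have hTc : T.Countable := hTc₀.image _
  have hTd : ∀ θ : Θ, ∀ δ > 0, ∃ ϑ ∈ T, dist (j θ) (j ϑ) < δ := by
    intro θ δ hδ
    obtain ⟨p, hp, hd⟩ := hTd₀.exists_dist_lt ⟨j θ, mem_range_self θ⟩ hδ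
    refine ⟨_, mem_image_of_mem _ hp, ?_⟩
    have := p.2.choose_spec
    rw [this]
    exact hd
  have h1 : ∀ᵐ x, ∀ θ ∈ T, x ∈ Ioo a b →
      ∫ y in Icc c d, (deriv θ.1 y • v (x, y) + θ.1 y • g (x, y)) = 0 :=
    (ae_ball_iff hTc).2 fun θ _ => h.ae_slice_test hbox θ.2.1 θ.2.2
  have h2 := (integrableOn_box h.1 hbox).prod_right_ae
  have h3 := (integrableOn_box h.2.1 hbox).prod_right_ae
  rw [ae_restrict_iff' measurableSet_Icc] at h2 h3
  filter_upwards [h1, h2, h3] with x hx1 hx2 hx3 hx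
  have iv : IntegrableOn (fun y => v (x, y)) (Icc c d) := hx2 (Ioo_subset_Icc_self hx)
  have ig : IntegrableOn (fun y => g (x, y)) (Icc c d) := hx3 (Ioo_subset_Icc_self hx)
  refine ⟨iv, ig, fun θ hθ hθs => ?_⟩
  have hint : ∀ ϑ : Θ, IntegrableOn (fun y => deriv ϑ.1 y • v (x, y) + ϑ.1 y • g (x, y))
      (Icc c d) := fun ϑ =>
    (iv.continuousOn_smul (ϑ.2.1.continuous_deriv (by simp)).continuousOn isCompact_Icc).add
      (ig.continuousOn_smul ϑ.2.1.continuous.continuousOn isCompact_Icc)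
  rw [← norm_le_zero_iff]
  set C := ∫ y in Icc c d, (‖v (x, y)‖ + ‖g (x, y)‖) with hC
  have hCi : IntegrableOn (fun y => ‖v (x, y)‖ + ‖g (x, y)‖) (Icc c d) := iv.norm.add ig.norm
  have hC0 : 0 ≤ C := integral_nonneg fun y => by positivity
  refine le_of_forall_pos_le_add fun ε hε => ?_
  -- The denominator is `C + 1` rather than `C`, since `C`, the integral of `‖v‖ + ‖g‖` over the
  -- slice, may vanish.
  obtain ⟨ϑ, hϑT, hϑ⟩ := hTd ⟨θ, hθ, hθs⟩ _ (show 0 < ε / (C + 1) by positivity)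
  set δ := ε / (C + 1) with hδ
  have hdist : dist (j ⟨θ, hθ, hθs⟩) (j ϑ) < δ := hϑ
  rw [Prod.dist_eq, max_lt_iff] at hdist
  have d1 : ∀ y ∈ Icc c d, ‖θ y - ϑ.1 y‖ ≤ δ := fun y hy =>
    (ContinuousMap.dist_apply_le_dist (⟨y, hy⟩ : Icc c d)).trans hdist.1.le
  have d2 : ∀ y ∈ Icc c d, ‖deriv θ y - deriv ϑ.1 y‖ ≤ δ := fun y hy =>
    (ContinuousMap.dist_apply_le_dist (⟨y, hy⟩ : Icc c d)).trans hdist.2.le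
  have e := hx1 ϑ hϑT hx
  rw [← sub_zero (∫ y in Icc c d, (deriv θ y • v (x, y) + θ y • g (x, y))), ← e,
    ← integral_sub (hint ⟨θ, hθ, hθs⟩) (hint ϑ)]
  calc _ ≤ ∫ y in Icc c d, δ * (‖v (x, y)‖ + ‖g (x, y)‖) := by
        refine norm_integral_le_of_norm_le (hCi.const_mul _) ?_
        filter_upwards [ae_restrict_mem measurableSet_Icc] with y hy
        have e2 : deriv θ y • v (x, y) + θ y • g (x, y) -
            (deriv ϑ.1 y • v (x, y) + ϑ.1 y • g (x, y)) =
            (deriv θ y - deriv ϑ.1 y) • v (x, y) + (θ y - ϑ.1 y) • g (x, y) := by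
          module
        rw [e2, mul_add]
        refine (norm_add_le _ _).trans ?_
        rw [norm_smul, norm_smul]
        gcongr
        · exact d2 y hy
        · exact d1 y hy
    _ = δ * C := integral_const_mul _ _
    _ ≤ 0 + ε := by
      rw [hδ, zero_add, div_mul_eq_mul_div, div_le_iff₀ (by positivity)]
      nlinarith

/-- Almost every vertical slice of a function with a weak vertical derivative has a weak
derivative. -/
theorem HasWeakDeriv.slice_snd (h : HasWeakDeriv Ω (0, 1) v g) {I K : Opens ℝ}
    (hK : OrdConnected (K : Set ℝ))
    (hIK : (I : Set ℝ) ×ˢ (K : Set ℝ) ⊆ (Ω : Set (ℝ × ℝ))) :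
    ∀ᵐ x, x ∈ I → HasWeakDeriv K 1 (fun y => v (x, y)) (fun y => g (x, y)) := by
  -- All rational boxes at once; around a given `x` one of them contains `x` in its base and any
  -- prescribed compact part of `K` in its height.
  have h1 : ∀ᵐ x, ∀ a b c d : ℚ, Icc (a : ℝ) b ⊆ I → Icc (c : ℝ) d ⊆ K → x ∈ Ioo (a : ℝ) b →
      IntegrableOn (fun y => v (x, y)) (Icc (c : ℝ) d) ∧
      IntegrableOn (fun y => g (x, y)) (Icc (c : ℝ) d) ∧
      ∀ θ : ℝ → ℝ, ContDiff ℝ ∞ θ → tsupport θ ⊆ Icc (c : ℝ) d →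
        ∫ y in Icc (c : ℝ) d, (deriv θ y • v (x, y) + θ y • g (x, y)) = 0 := by
    simp only [ae_all_iff]
    intro a b c d h1 h2
    exact h.ae_slice_box ((prod_mono h1 h2).trans hIK)
  filter_upwards [h1] with x hx hxI
  obtain ⟨r, hr, hball⟩ := Metric.isOpen_iff.1 I.isOpen x hxI
  obtain ⟨a, ha1, ha2⟩ := exists_rat_btwn (show x - r < x by linarith)
  obtain ⟨b, hb1, hb2⟩ := exists_rat_btwn (show x < x + r by linarith)
  have hab : Icc (a : ℝ) b ⊆ I := fun y hy => hball (by
    rw [Metric.mem_ball, Real.dist_eq, abs_lt]; constructor <;> linarith [hy.1, hy.2])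
  have hx' := fun c d hcd => hx a b c d hab hcd ⟨ha2, hb1⟩
  rcases (K : Set ℝ).eq_empty_or_nonempty with he | ⟨x₀, hx₀⟩
  · unfold HasWeakDeriv
    rw [he]
    exact ⟨fun _ h => absurd h (notMem_empty _), fun _ h => absurd h (notMem_empty _),
      fun φ _ _ _ => by simp⟩
  refine ⟨?_, ?_, fun φ h1 h2 h3 => ?_⟩
  · rw [locallyIntegrableOn_iff K.isOpen.isLocallyClosed]
    intro k hkK hk
    obtain ⟨c, d, hcd, hkcd, -⟩ := exists_rat_Icc hK hx₀ hk hkK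
    exact (hx' c d hcd).1.mono_set hkcd
  · rw [locallyIntegrableOn_iff K.isOpen.isLocallyClosed]
    intro k hkK hk
    obtain ⟨c, d, hcd, hkcd, -⟩ := exists_rat_Icc hK hx₀ hk hkK
    exact (hx' c d hcd).2.1.mono_set hkcd
  · obtain ⟨c, d, hcd, hkcd, -⟩ := exists_rat_Icc hK hx₀ h2 h3
    obtain ⟨iv, ig, e⟩ := hx' c d hcd
    have e1 := e φ h1 hkcd
    have hz : ∀ y ∉ Icc (c : ℝ) d, φ y = 0 := fun y hy => image_eq_zero_of_notMem_tsupport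
      (fun hy' => hy (hkcd hy'))
    have hz' : ∀ y ∉ Icc (c : ℝ) d, deriv φ y = 0 := fun y hy => image_eq_zero_of_notMem_tsupport
      (fun hy' => hy (hkcd (tsupport_deriv_subset hy')))
    rw [integral_add
      (iv.continuousOn_smul (h1.continuous_deriv (by simp)).continuousOn isCompact_Icc)
      (ig.continuousOn_smul h1.continuous.continuousOn isCompact_Icc),
      setIntegral_eq_integral_of_forall_compl_eq_zero (fun y hy => by simp [hz' y hy]),
      setIntegral_eq_integral_of_forall_compl_eq_zero (fun y hy => by simp [hz y hy])] at e1
    simp only [fderiv_apply_one_eq_deriv]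
    rw [setIntegral_eq_integral_of_forall_compl_eq_zero
        (fun y hy => by simp [hz' y (fun h' => hy (hcd h'))]),
      setIntegral_eq_integral_of_forall_compl_eq_zero
        (fun y hy => by simp [hz y (fun h' => hy (hcd h'))])]
    exact eq_neg_of_add_eq_zero_left e1

/-- Exchanging the coordinates turns horizontal derivatives into vertical ones, so only one slicing
argument is needed. -/
theorem HasWeakDeriv.swap (h : HasWeakDeriv Ω (1, 0) v g) :
    HasWeakDeriv (Ω.comap ⟨Prod.swap, continuous_swap⟩) (0, 1) (v ∘ Prod.swap) (g ∘ Prod.swap) := by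
  have hmp : MeasurePreserving (Prod.swap : ℝ × ℝ → ℝ × ℝ) volume volume :=
    Measure.measurePreserving_swap
  have hme : MeasurableEmbedding (Prod.swap : ℝ × ℝ → ℝ × ℝ) :=
    MeasurableEquiv.prodComm.measurableEmbedding
  have hloc : ∀ f : ℝ × ℝ → ℂ, LocallyIntegrableOn f (Ω : Set (ℝ × ℝ)) →
      LocallyIntegrableOn (f ∘ Prod.swap)
        (Ω.comap ⟨Prod.swap, continuous_swap⟩ : Opens (ℝ × ℝ)) := by
    intro f hf
    rw [locallyIntegrableOn_iff (Opens.isOpen _).isLocallyClosed]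
    intro k hkK hk
    have hk' : IsCompact (Prod.swap '' k) := hk.image continuous_swap
    have := hf.integrableOn_compact_subset (by
      rintro _ ⟨p, hp, rfl⟩; exact hkK hp) hk'
    rw [← hmp.integrableOn_comp_preimage hme, Set.preimage_image_eq _ Prod.swap_injective] at this
    exact this
  refine ⟨hloc v h.1, hloc g h.2.1, fun φ h1 h2 h3 => ?_⟩
  have hc1 : ContDiff ℝ ∞ (φ ∘ Prod.swap) := h1.comp (contDiff_snd.prodMk contDiff_fst)
  have hts : tsupport (φ ∘ Prod.swap) = Prod.swap ⁻¹' tsupport φ :=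
    tsupport_comp_eq_preimage φ (Homeomorph.prodComm ℝ ℝ)
  have hc2 : HasCompactSupport (φ ∘ Prod.swap) :=
    h2.comp_homeomorph (Homeomorph.prodComm ℝ ℝ)
  have hc3 : tsupport (φ ∘ Prod.swap) ⊆ (Ω : Set (ℝ × ℝ)) := by
    rw [hts]
    intro p hp
    have := h3 hp
    simpa using this
  have e := h.2.2 _ hc1 hc2 hc3
  have hd : ∀ p, fderiv ℝ (φ ∘ Prod.swap) p (1, 0) = fderiv ℝ φ p.swap (0, 1) := by
    intro p
    have e1 : HasFDerivAt (Prod.swap : ℝ × ℝ → ℝ × ℝ)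
        ((ContinuousLinearMap.snd ℝ ℝ ℝ).prod (ContinuousLinearMap.fst ℝ ℝ ℝ)) p :=
      hasFDerivAt_snd.prodMk hasFDerivAt_fst
    rw [(((h1.differentiable (by simp)) p.swap).hasFDerivAt.comp p e1).fderiv]
    simp
  simp only [hd] at e
  have a1 := hmp.setIntegral_preimage_emb hme (fun p => fderiv ℝ φ p.swap (0, 1) • v p)
    (Ω : Set (ℝ × ℝ))
  have a2 := hmp.setIntegral_preimage_emb hme (fun p => (φ ∘ Prod.swap) p • g p)
    (Ω : Set (ℝ × ℝ))
  simp only [Prod.swap_swap, Function.comp_apply] at a1 a2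
  simp only [Function.comp_apply] at e
  rw [← a1, ← a2] at e
  exact e

/-- Almost every horizontal slice of a function with a weak horizontal derivative has a weak
derivative. -/
theorem HasWeakDeriv.slice_fst (h : HasWeakDeriv Ω (1, 0) v g) {I K : Opens ℝ}
    (hI : OrdConnected (I : Set ℝ))
    (hIK : (I : Set ℝ) ×ˢ (K : Set ℝ) ⊆ (Ω : Set (ℝ × ℝ))) :
    ∀ᵐ y, y ∈ K → HasWeakDeriv I 1 (fun x => v (x, y)) (fun x => g (x, y)) :=
  h.swap.slice_snd (I := K) hI fun _ hp => hIK ⟨hp.2, hp.1⟩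

end Slices

/-! ### Poincaré-type inequalities on boxes and the flux through a channel -/

section Estimates

variable {Ω : Opens (ℝ × ℝ)} {v g g₁ g₂ : ℝ × ℝ → ℂ}

theorem setLIntegral_prod_enorm_sq (hv : Measurable v) (I K : Set ℝ) :
    ∫⁻ p in I ×ˢ K, ‖v p‖ₑ ^ 2 = ∫⁻ x in I, ∫⁻ y in K, ‖v (x, y)‖ₑ ^ 2 :=
  setLIntegral_prod _ (hv.enorm.pow_const 2).aemeasurable

theorem setLIntegral_prod_enorm_sq_symm (hv : Measurable v) (I K : Set ℝ) :
    ∫⁻ p in I ×ˢ K, ‖v p‖ₑ ^ 2 = ∫⁻ y in K, ∫⁻ x in I, ‖v (x, y)‖ₑ ^ 2 :=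
  setLIntegral_prod_symm _ (hv.enorm.pow_const 2).aemeasurable

theorem IsPrimitiveOn.mul_enorm_sq_le {K J : Set ℝ} {u g : ℝ → ℂ} (h : IsPrimitiveOn K u g)
    (hK : OrdConnected K) (hJm : MeasurableSet J) (hJ : J ⊆ K) {x : ℝ} (hx : x ∈ K) :
    volume J * ‖u x‖ₑ ^ 2 ≤
      2 * ((∫⁻ y in J, ‖u y‖ₑ ^ 2) + volume J * (volume K * ∫⁻ t in K, ‖g t‖ₑ ^ 2)) := by
  have h1 : ∀ y ∈ J, ‖u x‖ₑ ^ 2 ≤ 2 * (‖u y‖ₑ ^ 2 + volume K * ∫⁻ t in K, ‖g t‖ₑ ^ 2) := by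
    intro y hy
    have h2 := enorm_add_sq_le (u y) (u x - u y)
    rw [add_sub_cancel] at h2
    refine h2.trans ?_
    gcongr
    exact h.enorm_sub_sq_le hK (hJ hy) hx
  calc volume J * ‖u x‖ₑ ^ 2 = ∫⁻ _ in J, ‖u x‖ₑ ^ 2 := by
        rw [setLIntegral_const, mul_comm]
    _ ≤ ∫⁻ y in J, 2 * (‖u y‖ₑ ^ 2 + volume K * ∫⁻ t in K, ‖g t‖ₑ ^ 2) :=
        setLIntegral_mono' hJm h1
    _ = _ := by
      rw [lintegral_const_mul' _ _ (by simp), lintegral_add_right _ measurable_const,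
        setLIntegral_const]
      ring

/-- Integrating the pointwise comparison with the mean over `J` over all points of `L`. Applied to
slices, it carries information from the strip into the passage. -/
theorem HasWeakDeriv.mul_lintegral_slice_le {K : Opens ℝ} {u g : ℝ → ℂ} (h : HasWeakDeriv K 1 u g)
    (hK : OrdConnected (K : Set ℝ)) {J L : Set ℝ} (hJm : MeasurableSet J) (hJ : J ⊆ K)
    (hLm : MeasurableSet L) (hL : L ⊆ K) :
    volume J * ∫⁻ x in L, ‖u x‖ₑ ^ 2 ≤ volume L *
      (2 * ((∫⁻ y in J, ‖u y‖ₑ ^ 2) +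
        volume J * (volume (K : Set ℝ) * ∫⁻ t in K, ‖g t‖ₑ ^ 2))) := by
  obtain ⟨U, hU, hae⟩ := h.exists_isPrimitiveOn hK
  have e : ∀ S ⊆ (K : Set ℝ), ∫⁻ x in S, ‖u x‖ₑ ^ 2 = ∫⁻ x in S, ‖U x‖ₑ ^ 2 := fun S hS =>
    lintegral_congr_ae (by
      filter_upwards [ae_restrict_of_ae_restrict_of_subset hS hae] with x hx
      rw [hx])
  rw [e L hL, e J hJ]
  have hm : AEMeasurable (fun x => ‖U x‖ₑ ^ 2) (volume.restrict L) := by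
    have : AEStronglyMeasurable U (volume.restrict (K : Set ℝ)) :=
      (hU.continuousOn K.isOpen).aestronglyMeasurable K.isOpen.measurableSet
    exact (this.mono_measure (Measure.restrict_mono hL le_rfl)).enorm.pow_const 2
  rw [← lintegral_const_mul'' _ hm]
  refine (setLIntegral_mono' hLm fun x hx => hU.mul_enorm_sq_le hK hJm hJ (hL hx)).trans ?_
  rw [setLIntegral_const, mul_comm]

theorem lintegral_mul_add_mul {α : Type*} [MeasurableSpace α] {μ : Measure α} {A B : α → ℝ≥0∞}
    (hA : Measurable A) (hB : Measurable B) (a b c e : ℝ≥0∞) :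
    ∫⁻ x, a * (e * (A x + b * (c * B x))) ∂μ =
      a * (e * ((∫⁻ x, A x ∂μ) + b * (c * ∫⁻ x, B x ∂μ))) := by
  rw [lintegral_const_mul _ (by fun_prop), lintegral_const_mul _ (by fun_prop),
    lintegral_add_left hA, lintegral_const_mul _ (by fun_prop), lintegral_const_mul _ hB]

/-- Comparison of the `L²`-norms on two pieces `I × L` and `I × J` of a box `I × K`. -/
theorem HasWeakDeriv.mul_lintegral_snd_le (h : HasWeakDeriv Ω (0, 1) v g) (hv : Measurable v)
    (hg : Measurable g) {I K : Opens ℝ} (hK : OrdConnected (K : Set ℝ))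
    (hIK : (I : Set ℝ) ×ˢ (K : Set ℝ) ⊆ (Ω : Set (ℝ × ℝ))) {J L : Set ℝ}
    (hJm : MeasurableSet J) (hJ : J ⊆ K) (hLm : MeasurableSet L) (hL : L ⊆ K) :
    volume J * ∫⁻ p in (I : Set ℝ) ×ˢ L, ‖v p‖ₑ ^ 2 ≤ volume L *
      (2 * ((∫⁻ p in (I : Set ℝ) ×ˢ J, ‖v p‖ₑ ^ 2) +
        volume J * (volume (K : Set ℝ) * ∫⁻ p in (I : Set ℝ) ×ˢ (K : Set ℝ), ‖g p‖ₑ ^ 2))) := by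
  have hm : ∀ (f : ℝ × ℝ → ℂ) (S : Set ℝ), Measurable f →
      Measurable fun x => ∫⁻ y in S, ‖f (x, y)‖ₑ ^ 2 := fun f S hf =>
    (hf.enorm.pow_const 2).lintegral_prod_right'
  rw [setLIntegral_prod_enorm_sq hv, setLIntegral_prod_enorm_sq hv, setLIntegral_prod_enorm_sq hg,
    ← lintegral_const_mul _ (hm v L hv), ← lintegral_mul_add_mul (hm v J hv) (hm g K hg)]
  refine lintegral_mono_ae ?_
  rw [ae_restrict_iff' I.isOpen.measurableSet]
  filter_upwards [h.slice_snd hK hIK] with x hx hxI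
  exact (hx hxI).mul_lintegral_slice_le hK hJm hJ hLm hL

/-- Comparison of the `L²`-norms on two pieces `L × K` and `J × K` of a box `I × K`. -/
theorem HasWeakDeriv.mul_lintegral_fst_le (h : HasWeakDeriv Ω (1, 0) v g) (hv : Measurable v)
    (hg : Measurable g) {I K : Opens ℝ} (hI : OrdConnected (I : Set ℝ))
    (hIK : (I : Set ℝ) ×ˢ (K : Set ℝ) ⊆ (Ω : Set (ℝ × ℝ))) {J L : Set ℝ}
    (hJm : MeasurableSet J) (hJ : J ⊆ I) (hLm : MeasurableSet L) (hL : L ⊆ I) :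
    volume J * ∫⁻ p in L ×ˢ (K : Set ℝ), ‖v p‖ₑ ^ 2 ≤ volume L *
      (2 * ((∫⁻ p in J ×ˢ (K : Set ℝ), ‖v p‖ₑ ^ 2) +
        volume J * (volume (I : Set ℝ) * ∫⁻ p in (I : Set ℝ) ×ˢ (K : Set ℝ), ‖g p‖ₑ ^ 2))) := by
  have hm : ∀ (f : ℝ × ℝ → ℂ) (S : Set ℝ), Measurable f →
      Measurable fun y => ∫⁻ x in S, ‖f (x, y)‖ₑ ^ 2 := fun f S hf =>
    (hf.enorm.pow_const 2).lintegral_prod_left'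
  rw [setLIntegral_prod_enorm_sq_symm hv, setLIntegral_prod_enorm_sq_symm hv,
    setLIntegral_prod_enorm_sq_symm hg,
    ← lintegral_const_mul _ (hm v L hv), ← lintegral_mul_add_mul (hm v J hv) (hm g I hg)]
  refine lintegral_mono_ae ?_
  rw [ae_restrict_iff' K.isOpen.measurableSet]
  filter_upwards [h.slice_fst hI hIK] with x hx hxI
  exact (hx hxI).mul_lintegral_slice_le hI hJm hJ hLm hL

/-- A function on a box differs little from almost every one of its horizontal slices. -/
theorem HasWeakDeriv.ae_lintegral_enorm_sub_sq_le (h : HasWeakDeriv Ω (0, 1) v g)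
    (hv : Measurable v) (hg : Measurable g) {I K : Opens ℝ} (hK : OrdConnected (K : Set ℝ))
    (hIK : (I : Set ℝ) ×ˢ (K : Set ℝ) ⊆ (Ω : Set (ℝ × ℝ))) :
    ∀ᵐ y' ∂volume.restrict (K : Set ℝ),
      ∫⁻ p in (I : Set ℝ) ×ˢ (K : Set ℝ), ‖v p - v (p.1, y')‖ₑ ^ 2 ≤
        volume (K : Set ℝ) ^ 2 * ∫⁻ p in (I : Set ℝ) ×ˢ (K : Set ℝ), ‖g p‖ₑ ^ 2 := by
  have hG : Measurable fun x => ∫⁻ t in (K : Set ℝ), ‖g (x, t)‖ₑ ^ 2 :=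
    (hg.enorm.pow_const 2).lintegral_prod_right'
  let A : ℝ × ℝ → ℝ≥0∞ := fun p => ∫⁻ y in (K : Set ℝ), ‖v (p.1, y) - v p‖ₑ ^ 2
  have hA : Measurable A := by
    have : Measurable fun q : (ℝ × ℝ) × ℝ => ‖v (q.1.1, q.2) - v q.1‖ₑ ^ 2 :=
      ((hv.comp (by fun_prop)).sub (hv.comp (by fun_prop))).enorm.pow_const 2
    exact this.lintegral_prod_right'
  have h1 : ∀ᵐ x ∂volume.restrict (I : Set ℝ), ∀ᵐ y' ∂volume.restrict (K : Set ℝ),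
      A (x, y') ≤ volume (K : Set ℝ) ^ 2 * ∫⁻ t in (K : Set ℝ), ‖g (x, t)‖ₑ ^ 2 := by
    rw [ae_restrict_iff' I.isOpen.measurableSet]
    filter_upwards [h.slice_snd hK hIK] with x hx hxI
    obtain ⟨U, hU, hae⟩ := (hx hxI).exists_isPrimitiveOn hK
    have hae' := hae.and (ae_restrict_mem K.isOpen.measurableSet)
    filter_upwards [hae'] with y' hy'
    calc A (x, y') ≤ ∫⁻ _ in (K : Set ℝ), volume (K : Set ℝ) *
          ∫⁻ t in (K : Set ℝ), ‖g (x, t)‖ₑ ^ 2 := by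
          refine lintegral_mono_ae ?_
          filter_upwards [hae'] with y hy
          rw [hy.1, hy'.1]
          exact hU.enorm_sub_sq_le hK hy'.2 hy.2
      _ = _ := by rw [setLIntegral_const]; ring
  -- The slice bound holds for almost every `x` and then almost every `y'`; a fixed height `y'` is
  -- wanted first. Exchanging the quantifiers requires a measurable set, which is why `v` and `g`
  -- are taken measurable.
  have h2 := (Measure.ae_ae_comm (μ := volume.restrict (I : Set ℝ))
    (ν := volume.restrict (K : Set ℝ)) (p := fun x y' =>
      A (x, y') ≤ volume (K : Set ℝ) ^ 2 * ∫⁻ t in (K : Set ℝ), ‖g (x, t)‖ₑ ^ 2)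
    (measurableSet_le hA ((hG.comp measurable_fst).const_mul _))).1 h1
  filter_upwards [h2] with y' hy'
  rw [setLIntegral_prod_enorm_sq hg, ← lintegral_const_mul _ hG]
  have hm : Measurable fun p : ℝ × ℝ => v p - v (p.1, y') := hv.sub (hv.comp (by fun_prop))
  rw [setLIntegral_prod_enorm_sq hm]
  exact lintegral_mono_ae hy'

/-- The Poincaré inequality on a box. -/
theorem exists_lintegral_enorm_sub_const_sq_le (h₁ : HasWeakDeriv Ω (1, 0) v g₁)
    (h₂ : HasWeakDeriv Ω (0, 1) v g₂) (hv : Measurable v) (hg₁ : Measurable g₁)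
    (hg₂ : Measurable g₂) {a b c d : ℝ} (hab : a < b) (hcd : c < d)
    (hbox : Ioo a b ×ˢ Ioo c d ⊆ (Ω : Set (ℝ × ℝ))) :
    ∃ k : ℂ, ∫⁻ p in Ioo a b ×ˢ Ioo c d, ‖v p - k‖ₑ ^ 2 ≤
      2 * (volume (Ioo c d) ^ 2 * (∫⁻ p in Ioo a b ×ˢ Ioo c d, ‖g₂ p‖ₑ ^ 2) +
        volume (Ioo a b) ^ 2 * ∫⁻ p in Ioo a b ×ˢ Ioo c d, ‖g₁ p‖ₑ ^ 2) := by
  let I : Opens ℝ := ⟨Ioo a b, isOpen_Ioo⟩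
  let K : Opens ℝ := ⟨Ioo c d, isOpen_Ioo⟩
  have hI : OrdConnected (I : Set ℝ) := ordConnected_Ioo
  have hK : OrdConnected (K : Set ℝ) := ordConnected_Ioo
  have e1 := h₂.ae_lintegral_enorm_sub_sq_le hv hg₂ hK (I := I) hbox
  have e2 := h₁.slice_fst hI (K := K) hbox
  replace e2 := (ae_restrict_iff' K.isOpen.measurableSet).2 e2
  have hm : Measurable fun y => ∫⁻ x in Ioo a b, ‖g₁ (x, y)‖ₑ ^ 2 :=
    (hg₁.enorm.pow_const 2).lintegral_prod_left'
  have hμ : volume.restrict (Ioo c d) ≠ 0 := by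
    rw [Ne, Measure.restrict_eq_zero, Real.volume_Ioo]
    simpa using hcd
  have : IsFiniteMeasure (volume.restrict (Ioo c d)) := ⟨by simp⟩
  -- A height outside the exceptional null set at which the energy of the horizontal slice does not
  -- exceed its average over heights. The constant is then the value of that slice at the midpoint.
  obtain ⟨y', hy', hle⟩ := exists_notMem_null_le_laverage hμ hm.aemeasurable (e1.and e2)
  simp only [mem_compl_iff, mem_ofPred_eq, not_not] at hy'
  obtain ⟨hy1, hy2⟩ := hy'
  obtain ⟨U, hU, hae⟩ := hy2.exists_isPrimitiveOn hI
  have hx₀ : (a + b) / 2 ∈ (I : Set ℝ) := ⟨by linarith, by linarith⟩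
  refine ⟨U ((a + b) / 2), ?_⟩
  have hm' : Measurable fun p : ℝ × ℝ => v p - v (p.1, y') := hv.sub (hv.comp (by fun_prop))
  have hm'' : Measurable fun p : ℝ × ℝ => v (p.1, y') - U ((a + b) / 2) :=
    (hv.comp (by fun_prop)).sub_const _
  have hvol : volume (Ioo c d) ≠ 0 := by rwa [Ne, ← Measure.restrict_eq_zero]
  calc ∫⁻ p in Ioo a b ×ˢ Ioo c d, ‖v p - U ((a + b) / 2)‖ₑ ^ 2
      ≤ ∫⁻ p in Ioo a b ×ˢ Ioo c d, 2 * (‖v p - v (p.1, y')‖ₑ ^ 2 +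
          ‖v (p.1, y') - U ((a + b) / 2)‖ₑ ^ 2) := by
        refine lintegral_mono fun p => ?_
        have := enorm_add_sq_le (v p - v (p.1, y')) (v (p.1, y') - U ((a + b) / 2))
        rwa [sub_add_sub_cancel] at this
    _ = 2 * ((∫⁻ p in Ioo a b ×ˢ Ioo c d, ‖v p - v (p.1, y')‖ₑ ^ 2) +
          ∫⁻ p in Ioo a b ×ˢ Ioo c d, ‖v (p.1, y') - U ((a + b) / 2)‖ₑ ^ 2) := by
        rw [lintegral_const_mul' _ _ (by simp), lintegral_add_left (hm'.enorm.pow_const 2)]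
    _ ≤ _ := by
        gcongr
        · exact hy1
        · rw [setLIntegral_prod_enorm_sq_symm hm'', setLIntegral_prod_enorm_sq_symm hg₁]
          simp only
          rw [setLIntegral_const]
          calc _ ≤ (∫⁻ _ in Ioo a b, volume (Ioo a b) *
                ∫⁻ t in Ioo a b, ‖g₁ (t, y')‖ₑ ^ 2) * volume (Ioo c d) := by
                gcongr ?_ * _
                refine lintegral_mono_ae ?_
                filter_upwards [hae, ae_restrict_mem measurableSet_Ioo] with x hx hxI
                rw [hx]
                exact hU.enorm_sub_sq_le hI hx₀ hxI
            _ = volume (Ioo a b) ^ 2 * ((∫⁻ t in Ioo a b, ‖g₁ (t, y')‖ₑ ^ 2) *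
                volume (Ioo c d)) := by
                rw [setLIntegral_const]; ring
            _ ≤ _ := by
                gcongr
                rw [laverage_eq, Measure.restrict_apply_univ] at hle
                rwa [ENNReal.le_div_iff_mul_le (Or.inl hvol) (Or.inl (by simp))] at hle

/-- The flux through a channel `I × (0, h)` is determined up to a small error by the mean values of
`v` near the two ends of the channel. -/
theorem HasWeakDeriv.flux_sub_sq_le (h : HasWeakDeriv Ω (0, 1) v g) (hv : Measurable v)
    (hg : Measurable g) {I : Opens ℝ} {d η : ℝ} (hd : 0 < d) (hdη : d ≤ η)
    (hId : volume (I : Set ℝ) = ENNReal.ofReal d)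
    (hbox : (I : Set ℝ) ×ˢ Ioo (-d) (η + d) ⊆ (Ω : Set (ℝ × ℝ)))
    (hgi : IntegrableOn g ((I : Set ℝ) ×ˢ Ioo 0 η)) (k₀ k₁ : ℂ) :
    ‖(∫ p in (I : Set ℝ) ×ˢ Ioo 0 η, g p) - (d : ℂ) * (k₁ - k₀)‖ₑ ^ 2 ≤
      4 * ((∫⁻ p in (I : Set ℝ) ×ˢ Ioo (-d) 0, ‖v p - k₀‖ₑ ^ 2) +
        (∫⁻ p in (I : Set ℝ) ×ˢ Ioo η (η + d), ‖v p - k₁‖ₑ ^ 2) +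
        ENNReal.ofReal (4 * d ^ 2) *
          ∫⁻ p in (I : Set ℝ) ×ˢ Ioo (-d) (η + d), ‖g p‖ₑ ^ 2) := by
  let K : Opens ℝ := ⟨Ioo (-d) (η + d), isOpen_Ioo⟩
  have hK : OrdConnected (K : Set ℝ) := ordConnected_Ioo
  set D := ENNReal.ofReal d with hD
  have hD0 : D ≠ 0 := by simpa [hD] using hd
  have hDt : D ≠ ⊤ := by simp [hD]
  set F : ℝ → ℂ := fun x => ∫ y in Ioo 0 η, g (x, y) with hF
  have hgm : ∀ J : Set ℝ, Measurable fun x => ∫⁻ y in J, ‖g (x, y)‖ₑ ^ 2 := fun J =>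
    (hg.enorm.pow_const 2).lintegral_prod_right'
  have hvm : ∀ (J : Set ℝ) (k : ℂ), Measurable fun x => ∫⁻ y in J, ‖v (x, y) - k‖ₑ ^ 2 :=
    fun J k => ((hv.sub_const k).enorm.pow_const 2).lintegral_prod_right'
  have hJvol : ∀ s : ℝ, volume (Ioo (s - d) (s + d)) = 2 * D := by
    intro s
    rw [Real.volume_Ioo, show s + d - (s - d) = 2 * d by ring, ENNReal.ofReal_mul (by norm_num)]
    simp [hD]
  -- the bound on one slice
  have h1 : ∀ᵐ x ∂volume.restrict (I : Set ℝ), D * ‖F x - (k₁ - k₀)‖ₑ ^ 2 ≤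
      4 * ((∫⁻ y in Ioo (-d) 0, ‖v (x, y) - k₀‖ₑ ^ 2) +
        (∫⁻ y in Ioo η (η + d), ‖v (x, y) - k₁‖ₑ ^ 2) +
        4 * D ^ 2 * ∫⁻ y in Ioo (-d) (η + d), ‖g (x, y)‖ₑ ^ 2) := by
    rw [ae_restrict_iff' I.isOpen.measurableSet]
    filter_upwards [h.slice_snd hK hbox] with x hx hxI
    obtain ⟨U, hU, hae⟩ := (hx hxI).exists_isPrimitiveOn hK
    -- The value at an end `s` of the channel is compared with the values on one side of it, over a
    -- length `d` inside a window of length `2 d`. Using the short window, not the whole channel,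
    -- keeps the gradient error at `d²`.
    have end_le : ∀ (s : ℝ) (k : ℂ) (J : Set ℝ), MeasurableSet J → J ⊆ Ioo (s - d) (s + d) →
        volume J = D → Ioo (s - d) (s + d) ⊆ Ioo (-d) (η + d) →
        D * ‖U s - k‖ₑ ^ 2 ≤ 2 * ((∫⁻ y in J, ‖v (x, y) - k‖ₑ ^ 2) +
          2 * D ^ 2 * ∫⁻ y in Ioo (-d) (η + d), ‖g (x, y)‖ₑ ^ 2) := by
      intro s k J hJm hJ hJv hsub
      have hU' : IsPrimitiveOn (Ioo (s - d) (s + d)) (fun y => U y - k) (fun y => g (x, y)) :=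
        ⟨hU.1.mono_set hsub, fun y hy z hz => by
          rw [← hU.2 y (hsub hy) z (hsub hz)]; ring⟩
      have := hU'.mul_enorm_sq_le ordConnected_Ioo hJm hJ
        (x := s) ⟨by linarith, by linarith⟩
      rw [hJv, hJvol] at this
      refine this.trans ?_
      have e1 : ∫⁻ y in J, ‖U y - k‖ₑ ^ 2 = ∫⁻ y in J, ‖v (x, y) - k‖ₑ ^ 2 :=
        lintegral_congr_ae (by
          filter_upwards [ae_restrict_of_ae_restrict_of_subset (hJ.trans hsub) hae] with y hy
          rw [hy])
      rw [e1]
      gcongr 2 * (_ + ?_)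
      calc D * (2 * D * ∫⁻ t in Ioo (s - d) (s + d), ‖g (x, t)‖ₑ ^ 2)
          = 2 * D ^ 2 * ∫⁻ t in Ioo (s - d) (s + d), ‖g (x, t)‖ₑ ^ 2 := by ring
        _ ≤ _ := by gcongr
    have b0 := end_le 0 k₀ (Ioo (-d) 0) measurableSet_Ioo
      (Ioo_subset_Ioo (by linarith) (by linarith)) (by simp [hD])
      (Ioo_subset_Ioo (by linarith) (by linarith))
    have b1 := end_le η k₁ (Ioo η (η + d)) measurableSet_Ioo
      (Ioo_subset_Ioo (by linarith) (by linarith)) (by simp [hD])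
      (Ioo_subset_Ioo (by linarith) (by linarith))
    have e : F x = U η - U 0 := by
      rw [hU.2 0 ⟨by linarith, by linarith⟩ η ⟨by linarith, by linarith⟩,
        intervalIntegral.integral_of_le (by linarith), integral_Ioc_eq_integral_Ioo]
    have e' : F x - (k₁ - k₀) = (U η - k₁) + -(U 0 - k₀) := by rw [e]; ring
    calc D * ‖F x - (k₁ - k₀)‖ₑ ^ 2
        ≤ D * (2 * (‖U η - k₁‖ₑ ^ 2 + ‖U 0 - k₀‖ₑ ^ 2)) := by
          rw [e', ← enorm_neg (U 0 - k₀)]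
          gcongr
          exact enorm_add_sq_le _ _
      _ = 2 * (D * ‖U η - k₁‖ₑ ^ 2 + D * ‖U 0 - k₀‖ₑ ^ 2) := by ring
      _ ≤ _ := (mul_le_mul' le_rfl (add_le_add b1 b0)).trans (le_of_eq (by ring))
  have h2 : (∫ p in (I : Set ℝ) ×ˢ Ioo 0 η, g p) - (d : ℂ) * (k₁ - k₀) =
      ∫ x in (I : Set ℝ), (F x - (k₁ - k₀)) := by
    rw [IntegrableOn, Measure.volume_eq_prod, ← Measure.prod_restrict] at hgi
    rw [Measure.volume_eq_prod, ← Measure.prod_restrict]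
    rw [integral_sub hgi.integral_prod_left (integrableOn_const (by simp [hId, hD])),
      integral_prod _ hgi, setIntegral_const]
    simp [Measure.real, hId, hD, hd.le]
  have hFm : AEMeasurable (fun x => ‖F x - (k₁ - k₀)‖ₑ) (volume.restrict (I : Set ℝ)) := by
    rw [Measure.volume_eq_prod, IntegrableOn, ← Measure.prod_restrict] at hgi
    exact (hgi.integral_prod_left.aestronglyMeasurable.sub aestronglyMeasurable_const).enorm
  have e4 : ENNReal.ofReal (4 * d ^ 2) = 4 * D ^ 2 := by
    rw [ENNReal.ofReal_mul (by norm_num), ENNReal.ofReal_pow hd.le]; simp [hD]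
  rw [h2, e4]
  calc ‖∫ x in (I : Set ℝ), (F x - (k₁ - k₀))‖ₑ ^ 2
      ≤ (∫⁻ x in (I : Set ℝ), ‖F x - (k₁ - k₀)‖ₑ) ^ 2 := by
        gcongr; exact enorm_integral_le_lintegral_enorm _
    _ ≤ D * ∫⁻ x in (I : Set ℝ), ‖F x - (k₁ - k₀)‖ₑ ^ 2 := by
        have := sq_lintegral_le _ hFm
        rwa [Measure.restrict_apply_univ, hId] at this
    _ = ∫⁻ x in (I : Set ℝ), D * ‖F x - (k₁ - k₀)‖ₑ ^ 2 := by
        rw [lintegral_const_mul' _ _ hDt]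
    _ ≤ _ := lintegral_mono_ae h1
    _ = _ := by
      have hm2 : Measurable fun p : ℝ × ℝ => v p - k₀ := hv.sub_const _
      have hm3 : Measurable fun p : ℝ × ℝ => v p - k₁ := hv.sub_const _
      rw [setLIntegral_prod_enorm_sq hm2, setLIntegral_prod_enorm_sq hm3,
        setLIntegral_prod_enorm_sq hg, lintegral_const_mul' _ _ (by simp),
        lintegral_add_right _ ((hgm _).const_mul _), lintegral_add_right _ (hvm _ _),
        lintegral_const_mul _ (hgm _)]

end Estimates

/-! ### Shape of the waveguide -/

section Geometry

/-- The restrictions on the parameters under which the waveguide has the shape in question. -/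
structure IsAdmissible (ℓm ℓp : EReal) (α β γ ε : ℝ) : Prop where
  pos : 0 < ε
  lt_one : ε < 1
  alpha_pos : 0 < α
  beta_pos : 0 < β
  beta_lt : β < 1 / 2
  gamma_pos : 0 < γ
  lt_left : (ε : EReal) < -ℓm
  lt_right : (ε : EReal) < ℓp
  mul_rpow_le : γ * ε ^ α ≤ 1 / 2
  mul_le_one : γ * ε ≤ 1
  le_gamma : ε ≤ γ

variable {ℓm ℓp : EReal} {α β γ ε : ℝ}

theorem strip_eq : strip ℓm ℓp ε = (interval ℓm ℓp : Set ℝ) ×ˢ Ioo (-ε) 0 := rfl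

theorem passage_eq : passage α γ ε =
    Ioo (-(γ * ε ^ (α + 1) / 2)) (γ * ε ^ (α + 1) / 2) ×ˢ Ioo 0 (ε ^ α) := by
  ext p; simp [passage, abs_lt]

theorem room_eq : room α β ε =
    Ioo (-(ε ^ β / 2)) (ε ^ β / 2) ×ˢ Ioo (ε ^ α) (ε ^ α + ε ^ β) := by
  ext p; simp [room, abs_lt]

theorem isOpen_strip : IsOpen (strip ℓm ℓp ε) := by
  rw [strip_eq]; exact (interval ℓm ℓp).isOpen.prod isOpen_Ioo

theorem isOpen_passage : IsOpen (passage α γ ε) := by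
  rw [passage_eq]; exact isOpen_Ioo.prod isOpen_Ioo

theorem isOpen_room : IsOpen (room α β ε) := by
  rw [room_eq]; exact isOpen_Ioo.prod isOpen_Ioo

theorem subset_waveguide :
    strip ℓm ℓp ε ∪ passage α γ ε ∪ room α β ε ⊆ (waveguide ℓm ℓp α β γ ε : Set (ℝ × ℝ)) :=
  interior_maximal subset_closure ((isOpen_strip.union isOpen_passage).union isOpen_room)

theorem strip_subset : strip ℓm ℓp ε ⊆ (waveguide ℓm ℓp α β γ ε : Set (ℝ × ℝ)) :=
  fun _ hp => subset_waveguide (Or.inl (Or.inl hp))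

theorem passage_subset : passage α γ ε ⊆ (waveguide ℓm ℓp α β γ ε : Set (ℝ × ℝ)) :=
  fun _ hp => subset_waveguide (Or.inl (Or.inr hp))

theorem room_subset : room α β ε ⊆ (waveguide ℓm ℓp α β γ ε : Set (ℝ × ℝ)) :=
  fun _ hp => subset_waveguide (Or.inr hp)

theorem waveguide_subset_closure : (waveguide ℓm ℓp α β γ ε : Set (ℝ × ℝ)) ⊆
    closure (strip ℓm ℓp ε) ∪ closure (passage α γ ε) ∪ closure (room α β ε) := by
  rw [← closure_union, ← closure_union]
  exact interior_subset

/-- Taking the interior of the closure adds only points on the boundaries of three convex sets, and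
boundaries of convex sets are null. -/
theorem ae_waveguide_subset :
    ∀ᵐ p, p ∈ (waveguide ℓm ℓp α β γ ε : Set (ℝ × ℝ)) →
      p ∈ strip ℓm ℓp ε ∪ passage α γ ε ∪ room α β ε := by
  have key : ∀ s : Set (ℝ × ℝ), IsOpen s → Convex ℝ s → ∀ᵐ p, p ∈ closure s → p ∈ s := by
    intro s ho hc
    have := hc.addHaar_frontier volume
    filter_upwards [measure_eq_zero_iff_ae_notMem.1 this] with p hp hps
    by_contra h
    exact hp ⟨hps, fun h' => h (interior_subset h')⟩
  have k1 := key _ (isOpen_strip (ℓm := ℓm) (ℓp := ℓp) (ε := ε)) (by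
    rw [strip_eq]
    exact (ordConnected_interval ℓm ℓp).convex.prod (convex_Ioo _ _))
  have k2 := key _ (isOpen_passage (α := α) (γ := γ) (ε := ε)) (by
    rw [passage_eq]
    exact (convex_Ioo _ _).prod (convex_Ioo _ _))
  have k3 := key _ (isOpen_room (α := α) (β := β) (ε := ε)) (by
    rw [room_eq]
    exact (convex_Ioo _ _).prod (convex_Ioo _ _))
  filter_upwards [k1, k2, k3] with p h1 h2 h3 hp
  rcases waveguide_subset_closure hp with (h | h) | h
  · exact Or.inl (Or.inl (h1 h))
  · exact Or.inl (Or.inr (h2 h))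
  · exact Or.inr (h3 h)

theorem waveguide_ae_eq : (waveguide ℓm ℓp α β γ ε : Set (ℝ × ℝ)) =ᵐ[volume]
    (strip ℓm ℓp ε ∪ passage α γ ε ∪ room α β ε : Set (ℝ × ℝ)) := by
  filter_upwards [ae_waveguide_subset (ℓm := ℓm) (ℓp := ℓp) (α := α) (β := β) (γ := γ)
    (ε := ε)] with p hp
  exact propext ⟨hp, fun h => subset_waveguide h⟩

theorem disjoint_strip_passage : Disjoint (strip ℓm ℓp ε) (passage α γ ε) :=
  Set.disjoint_left.2 fun _ h h' => lt_asymm h.2.2 h'.2.1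

theorem disjoint_room (hε : 0 < ε) : Disjoint (strip ℓm ℓp ε ∪ passage α γ ε) (room α β ε) := by
  refine Set.disjoint_left.2 fun p h h' => ?_
  rcases h with h | h
  · exact lt_asymm (h.2.2.trans (Real.rpow_pos_of_pos hε α)) h'.2.1
  · exact lt_asymm h.2.2 h'.2.1

theorem setLIntegral_waveguide (hε : 0 < ε) (f : ℝ × ℝ → ℝ≥0∞) :
    ∫⁻ p in (waveguide ℓm ℓp α β γ ε : Set (ℝ × ℝ)), f p =
      (∫⁻ p in strip ℓm ℓp ε, f p) + (∫⁻ p in passage α γ ε, f p) +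
        ∫⁻ p in room α β ε, f p := by
  rw [Measure.restrict_congr_set waveguide_ae_eq,
    lintegral_union isOpen_room.measurableSet (disjoint_room hε),
    lintegral_union isOpen_passage.measurableSet disjoint_strip_passage]

namespace IsAdmissible

variable (h : IsAdmissible ℓm ℓp α β γ ε)
include h

theorem width_eq : γ * ε ^ (α + 1) = γ * ε * ε ^ α := by
  rw [Real.rpow_add_one h.pos.ne']; ring

theorem width_pos : 0 < γ * ε ^ (α + 1) :=
  mul_pos h.gamma_pos (Real.rpow_pos_of_pos h.pos _)

theorem height_pos : 0 < ε ^ α := Real.rpow_pos_of_pos h.pos _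

theorem size_pos : 0 < ε ^ β := Real.rpow_pos_of_pos h.pos _

theorem height_le_one : ε ^ α ≤ 1 := Real.rpow_le_one h.pos.le h.lt_one.le h.alpha_pos.le

theorem size_le_one : ε ^ β ≤ 1 := Real.rpow_le_one h.pos.le h.lt_one.le h.beta_pos.le

theorem width_le : γ * ε ^ (α + 1) ≤ ε := by
  rw [Real.rpow_add_one h.pos.ne']
  nlinarith [h.mul_rpow_le, h.pos]

theorem width_le_height : γ * ε ^ (α + 1) ≤ ε ^ α := by
  rw [h.width_eq]
  nlinarith [h.mul_le_one, h.height_pos]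

theorem le_size : ε ≤ ε ^ β := by
  have := Real.rpow_le_rpow_of_exponent_ge h.pos h.lt_one.le
    (show β ≤ 1 by linarith [h.beta_lt])
  rwa [Real.rpow_one] at this

theorem width_le_size : γ * ε ^ (α + 1) ≤ ε ^ β := h.width_le.trans h.le_size

theorem Icc_subset_interval : Icc (-ε) ε ⊆ (interval ℓm ℓp : Set ℝ) := by
  intro x hx
  refine ⟨?_, (EReal.coe_le_coe_iff.2 hx.2).trans_lt h.lt_right⟩
  refine lt_of_lt_of_le ?_ (EReal.coe_le_coe_iff.2 hx.1)
  rw [EReal.coe_neg]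
  exact EReal.lt_neg_comm.1 h.lt_left

theorem window_subset :
    Ioo (-(γ * ε ^ (α + 1) / 2)) (γ * ε ^ (α + 1) / 2) ⊆ Ioo (-(ε / 2)) (ε / 2) := by
  refine Ioo_subset_Ioo ?_ ?_ <;> linarith [h.width_le]

/-- The vertical channel through strip, passage and room. -/
theorem channel_subset :
    Ioo (-(γ * ε ^ (α + 1) / 2)) (γ * ε ^ (α + 1) / 2) ×ˢ Ioo (-ε) (ε ^ α + ε ^ β) ⊆
      (waveguide ℓm ℓp α β γ ε : Set (ℝ × ℝ)) := by
  -- The rectangle crosses the two mouths of the passage, at heights `0` and `ε ^ α`. These points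
  -- lie in none of the open pieces but in their closures, so an open rectangle in the closure is
  -- enough.
  refine interior_maximal ?_ (isOpen_Ioo.prod isOpen_Ioo)
  rintro ⟨x, y⟩ ⟨hx, hy⟩
  simp only at hx hy
  have hh := h.height_pos
  have hb := h.size_pos
  have hε := h.pos
  rw [closure_union, closure_union]
  rcases le_total y 0 with h0 | h0
  · refine Or.inl (Or.inl ?_)
    rw [strip_eq, closure_prod_eq, closure_Ioo (by linarith)]
    refine ⟨subset_closure (h.Icc_subset_interval ?_), hy.1.le, h0⟩
    have := h.window_subset hx
    exact ⟨by linarith [this.1], by linarith [this.2]⟩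
  rcases le_total y (ε ^ α) with h1 | h1
  · refine Or.inl (Or.inr ?_)
    rw [passage_eq, closure_prod_eq, closure_Ioo (a := (0 : ℝ)) hh.ne]
    exact ⟨subset_closure hx, h0, h1⟩
  · refine Or.inr ?_
    rw [room_eq, closure_prod_eq, closure_Ioo (a := ε ^ α) (by linarith)]
    refine ⟨subset_closure ?_, h1, hy.2.le⟩
    have := h.width_le_size
    exact ⟨by linarith [hx.1], by linarith [hx.2]⟩

/-- Crude bounds, used to see that products of a function of `x₁` and a bounded function of `x₂` are
square integrable, and that above the strip a cut-off to `|x₁| < 1` changes nothing. -/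
theorem bound_of_mem {p : ℝ × ℝ} (hp : p ∈ (waveguide ℓm ℓp α β γ ε : Set (ℝ × ℝ))) :
    p.2 ∈ Ioo (-2) 3 ∧ (0 < p.2 → p.1 ∈ Ioo (-1) 1) := by
  have hh := h.height_pos
  have hb := h.size_pos
  have hε := h.pos
  have hd := h.width_pos
  have h1 := h.height_le_one
  have h2 := h.size_le_one
  have h3 := h.lt_one
  have h4 := h.width_le
  rcases waveguide_subset_closure hp with (h' | h') | h'
  · rw [strip_eq, closure_prod_eq, closure_Ioo (by linarith)] at h'
    obtain ⟨-, h5, h6⟩ := h'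
    exact ⟨⟨by linarith, by linarith⟩, fun h => absurd h h6.not_gt⟩
  · rw [passage_eq, closure_prod_eq, closure_Ioo (a := (0 : ℝ)) hh.ne,
      closure_Ioo (by linarith)] at h'
    obtain ⟨⟨h5, h6⟩, h7, h8⟩ := h'
    exact ⟨⟨by linarith, by linarith⟩, fun _ => ⟨by linarith, by linarith⟩⟩
  · rw [room_eq, closure_prod_eq, closure_Ioo (a := ε ^ α) (by linarith),
      closure_Ioo (by linarith)] at h'
    obtain ⟨⟨h5, h6⟩, h7, h8⟩ := h'
    exact ⟨⟨by linarith, by linarith⟩, fun _ => ⟨by linarith, by linarith⟩⟩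

/-- Below the room, the projection of the waveguide is an open subset of the closure of `Ω₀`, hence
of `Ω₀` itself. The restriction on the height is needed because the room may be wider than `Ω₀`. -/
theorem fst_mem_interval {p : ℝ × ℝ} (hp : p ∈ (waveguide ℓm ℓp α β γ ε : Set (ℝ × ℝ)))
    (hp2 : p.2 < ε ^ α) : p.1 ∈ (interval ℓm ℓp : Set ℝ) := by
  have hsub : Prod.fst '' ((waveguide ℓm ℓp α β γ ε : Set (ℝ × ℝ)) ∩ {p | p.2 < ε ^ α}) ⊆
      closure (interval ℓm ℓp : Set ℝ) := by
    rintro _ ⟨q, ⟨hq, hq2⟩, rfl⟩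
    have hε := h.pos
    rcases waveguide_subset_closure hq with (h' | h') | h'
    · rw [strip_eq, closure_prod_eq] at h'
      exact h'.1
    · rw [passage_eq, closure_prod_eq, closure_Ioo (by linarith [h.width_pos])] at h'
      have := h.width_le
      exact subset_closure (h.Icc_subset_interval ⟨by linarith [h'.1.1], by linarith [h'.1.2]⟩)
    · rw [room_eq, closure_prod_eq, closure_Ioo (a := ε ^ α) (by linarith [h.size_pos])] at h'
      exact absurd hq2 (not_lt.2 h'.2.1)
  have ho : IsOpen (Prod.fst '' ((waveguide ℓm ℓp α β γ ε : Set (ℝ × ℝ)) ∩ {p | p.2 < ε ^ α})) :=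
    isOpenMap_fst _ ((waveguide ℓm ℓp α β γ ε).isOpen.inter
      (isOpen_lt continuous_snd continuous_const))
  have hi := interior_maximal hsub ho ⟨p, ⟨hp, hp2⟩, rfl⟩
  rw [(ordConnected_interval ℓm ℓp).convex (𝕜 := ℝ) |>.interior_closure_eq_interior_of_nonempty_interior,
    (interval ℓm ℓp).isOpen.interior_eq] at hi
  · exact hi
  · rw [(interval ℓm ℓp).isOpen.interior_eq]
    exact ⟨0, h.Icc_subset_interval ⟨by linarith [h.pos], h.pos.le⟩⟩

end IsAdmissible

end Geometry

/-! ### Comparison of mean values over squares of different sizes -/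

section Chain

variable {good : ℝ → ℂ → Prop} {L₀ A : ℝ}

/-- Mean values over squares of comparable sizes are close; by going through finitely many
intermediate sizes the loss in the ratio of the sizes is reduced to an arbitrarily small power. -/
theorem norm_sub_le_of_chain (hA : 0 ≤ A) (hex : ∀ L, 0 < L → L ≤ L₀ → ∃ k, good L k)
    (hcmp : ∀ L L' k k', 0 < L' → L' ≤ L → L ≤ L₀ → good L k → good L' k' →
      ‖k - k'‖ ≤ 3 * (L / L') * A) {ρ : ℝ} (hρ : 1 ≤ ρ) (n : ℕ) :
    ∀ L L' k k', 0 < L' → L' ≤ L → L ≤ L₀ → L ≤ ρ ^ (n + 1) * L' → good L k → good L' k' →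
      ‖k - k'‖ ≤ 3 * (n + 1) * ρ * A := by
  induction n with
  | zero =>
    intro L L' k k' h0 h1 h2 h3 h4 h5
    refine (hcmp L L' k k' h0 h1 h2 h4 h5).trans ?_
    simp only [zero_add, pow_one] at h3
    have : L / L' ≤ ρ := by rwa [div_le_iff₀ h0]
    simp only [Nat.cast_zero, zero_add, mul_one]
    gcongr
  | succ n ih =>
    intro L L' k k' h0 h1 h2 h3 h4 h5
    have hρ0 : 0 < ρ := by linarith
    have hL : 0 < L := h0.trans_le h1
    -- The next size reduces `L` by the factor `ρ`, unless `L'` is reached before; the ratio left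
    -- over is at most `ρ ^ (n + 1)`.
    set m := max L' (L / ρ) with hm
    have hm0 : 0 < m := h0.trans_le (le_max_left _ _)
    have hmL : m ≤ L := max_le h1 (div_le_self hL.le hρ)
    obtain ⟨k'', hk⟩ := hex m hm0 (hmL.trans h2)
    have e1 := hcmp L m k k'' hm0 hmL h2 h4 hk
    have e2 := ih m L' k'' k' h0 (le_max_left _ _) (hmL.trans h2) (max_le
      (le_mul_of_one_le_left h0.le (one_le_pow₀ hρ)) (by
        rw [div_le_iff₀ hρ0]; refine h3.trans (le_of_eq ?_); ring)) hk h5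
    have e3 : L / m ≤ ρ := by
      rw [div_le_iff₀ hm0, mul_comm, ← div_le_iff₀ hρ0]
      exact le_max_right _ _
    calc ‖k - k'‖ ≤ ‖k - k''‖ + ‖k'' - k'‖ := norm_sub_le_norm_sub_add_norm_sub _ _ _
      _ ≤ 3 * ρ * A + 3 * (n + 1) * ρ * A := add_le_add (e1.trans (by gcongr)) e2
      _ = _ := by push_cast; ring

theorem enorm_sq_le_ofReal_iff {z : ℂ} {c : ℝ} (hc : 0 ≤ c) :
    ‖z‖ₑ ^ 2 ≤ ENNReal.ofReal (c ^ 2) ↔ ‖z‖ ≤ c := by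
  rw [← ofReal_norm, ← ENNReal.ofReal_pow (norm_nonneg _),
    ENNReal.ofReal_le_ofReal_iff (by positivity), pow_le_pow_iff_left₀ (norm_nonneg _) hc two_ne_zero]

/-- The triangle inequality through the values of `v`, averaged over the smaller set. -/
theorem volume_mul_enorm_sub_sq_le {v : ℝ × ℝ → ℂ} (hv : Measurable v) {S T : Set (ℝ × ℝ)}
    (hST : S ⊆ T) (k k' : ℂ) :
    volume S * ‖k - k'‖ₑ ^ 2 ≤
      2 * ((∫⁻ p in T, ‖v p - k‖ₑ ^ 2) + ∫⁻ p in S, ‖v p - k'‖ₑ ^ 2) := by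
  calc volume S * ‖k - k'‖ₑ ^ 2 = ∫⁻ _ in S, ‖k - k'‖ₑ ^ 2 := by
        rw [setLIntegral_const, mul_comm]
    _ ≤ ∫⁻ p in S, 2 * (‖v p - k‖ₑ ^ 2 + ‖v p - k'‖ₑ ^ 2) := by
        refine lintegral_mono fun p => ?_
        have := enorm_add_sq_le (k - v p) (v p - k')
        rwa [sub_add_sub_cancel, ← enorm_neg (k - v p), neg_sub] at this
    _ = 2 * ((∫⁻ p in S, ‖v p - k‖ₑ ^ 2) + ∫⁻ p in S, ‖v p - k'‖ₑ ^ 2) := by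
        rw [lintegral_const_mul' _ _ (by simp),
          lintegral_add_left ((hv.sub_const k).enorm.pow_const 2)]
    _ ≤ _ := by gcongr

/-- Comparison of the mean values of `v` over squares of sizes `L' ≤ L` of a nested family of
squares `Ioo (-L / 2) (L / 2) × Ioo (s L) (s L + L)`. -/
theorem exists_good_squares {Ω : Opens (ℝ × ℝ)} {v g₁ g₂ : ℝ × ℝ → ℂ}
    (h₁ : HasWeakDeriv Ω (1, 0) v g₁) (h₂ : HasWeakDeriv Ω (0, 1) v g₂) (hv : Measurable v)
    (hg₁ : Measurable g₁) (hg₂ : Measurable g₂) (hA : 0 ≤ A) {s : ℝ → ℝ} (hs : Antitone s)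
    (hs' : Monotone fun L => s L + L)
    (hbox : Ioo (-(L₀ / 2)) (L₀ / 2) ×ˢ Ioo (s L₀) (s L₀ + L₀) ⊆ (Ω : Set (ℝ × ℝ)))
    (hA₁ : ∫⁻ p in (Ω : Set (ℝ × ℝ)), ‖g₁ p‖ₑ ^ 2 ≤ ENNReal.ofReal (A ^ 2))
    (hA₂ : ∫⁻ p in (Ω : Set (ℝ × ℝ)), ‖g₂ p‖ₑ ^ 2 ≤ ENNReal.ofReal (A ^ 2))
    {ρ : ℝ} (hρ : 1 ≤ ρ) (n : ℕ) {L : ℝ} (hL : 0 < L) (hLL : L ≤ L₀)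
    (hratio : L₀ ≤ ρ ^ (n + 1) * L) :
    ∃ k k' : ℂ,
      ∫⁻ p in Ioo (-(L₀ / 2)) (L₀ / 2) ×ˢ Ioo (s L₀) (s L₀ + L₀), ‖v p - k‖ₑ ^ 2 ≤
        ENNReal.ofReal (4 * L₀ ^ 2 * A ^ 2) ∧
      ∫⁻ p in Ioo (-(L / 2)) (L / 2) ×ˢ Ioo (s L) (s L + L), ‖v p - k'‖ₑ ^ 2 ≤
        ENNReal.ofReal (4 * L ^ 2 * A ^ 2) ∧ ‖k - k'‖ ≤ 3 * (n + 1) * ρ * (2 * A) := by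
  -- The monotonicity of both ends makes the squares nested, and covers squares hanging from a line
  -- as well as squares standing on one.
  let Q : ℝ → Set (ℝ × ℝ) := fun L => Ioo (-(L / 2)) (L / 2) ×ˢ Ioo (s L) (s L + L)
  have hQ : ∀ {L L' : ℝ}, L' ≤ L → Q L' ⊆ Q L := fun {L L'} hle =>
    prod_mono (Ioo_subset_Ioo (by linarith) (by linarith)) (Ioo_subset_Ioo (hs hle) (hs' hle))
  have hvol : ∀ {L : ℝ}, 0 < L → volume (Q L) = ENNReal.ofReal (L ^ 2) := fun {L} hL => by
    simp only [Q]
    rw [Measure.volume_eq_prod, Measure.prod_prod, Real.volume_Ioo, Real.volume_Ioo,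
      ← ENNReal.ofReal_mul (by linarith)]
    congr 1; ring
  -- A constant is good if it attains the Poincaré bound, whose two gradient contributions add up to
  -- `2 (L² A² + L² A²) = 4 L² A²`.
  let good : ℝ → ℂ → Prop := fun L k =>
    ∫⁻ p in Q L, ‖v p - k‖ₑ ^ 2 ≤ ENNReal.ofReal (4 * L ^ 2 * A ^ 2)
  have hex : ∀ L, 0 < L → L ≤ L₀ → ∃ k, good L k := by
    intro L hL hLL
    have hsub : Q L ⊆ (Ω : Set (ℝ × ℝ)) := (hQ hLL).trans hbox
    obtain ⟨k, hk⟩ := exists_lintegral_enorm_sub_const_sq_le h₁ h₂ hv hg₁ hg₂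
      (a := -(L / 2)) (b := L / 2) (c := s L) (d := s L + L) (by linarith) (by linarith) hsub
    refine ⟨k, hk.trans ?_⟩
    rw [Real.volume_Ioo, Real.volume_Ioo, show s L + L - s L = L by ring,
      show L / 2 - -(L / 2) = L by ring]
    calc _ ≤ 2 * (ENNReal.ofReal L ^ 2 * ENNReal.ofReal (A ^ 2) +
          ENNReal.ofReal L ^ 2 * ENNReal.ofReal (A ^ 2)) := by
          gcongr
          · exact (lintegral_mono_set hsub).trans hA₂
          · exact (lintegral_mono_set hsub).trans hA₁
      _ = _ := by
          rw [show (2 : ℝ≥0∞) = ENNReal.ofReal 2 by simp, ← ENNReal.ofReal_pow hL.le,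
            ← ENNReal.ofReal_mul (by positivity), ← ENNReal.ofReal_add (by positivity)
            (by positivity), ← ENNReal.ofReal_mul (by positivity)]
          congr 1; ring
  -- Since `2 (4 L² A² + 4 L'² A²) ≤ 16 L² A²`, division by the area `L'²` gives `4 (L / L') A`,
  -- within the stated `6 (L / L') A`.
  have hcmp : ∀ L L' k k', 0 < L' → L' ≤ L → L ≤ L₀ → good L k → good L' k' →
      ‖k - k'‖ ≤ 3 * (L / L') * (2 * A) := by
    intro L L' k k' h0 h1 h2 h3 h4
    have hL : 0 < L := h0.trans_le h1
    rw [← enorm_sq_le_ofReal_iff (by positivity)]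
    have h5 := volume_mul_enorm_sub_sq_le hv (hQ h1) k k'
    rw [hvol h0] at h5
    have h6 : ENNReal.ofReal (L' ^ 2) * ‖k - k'‖ₑ ^ 2 ≤
        ENNReal.ofReal (L' ^ 2) * ENNReal.ofReal ((3 * (L / L') * (2 * A)) ^ 2) := by
      refine h5.trans ?_
      calc _ ≤ 2 * (ENNReal.ofReal (4 * L ^ 2 * A ^ 2) + ENNReal.ofReal (4 * L' ^ 2 * A ^ 2)) := by
            gcongr
        _ ≤ _ := by
            rw [show (2 : ℝ≥0∞) = ENNReal.ofReal 2 by simp, ← ENNReal.ofReal_add (by positivity)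
              (by positivity), ← ENNReal.ofReal_mul (by positivity),
              ← ENNReal.ofReal_mul (by positivity)]
            refine ENNReal.ofReal_le_ofReal ?_
            rw [show L' ^ 2 * (3 * (L / L') * (2 * A)) ^ 2 = 36 * L ^ 2 * A ^ 2 by field_simp; ring]
            have : L' ^ 2 ≤ L ^ 2 := by gcongr
            nlinarith [mul_le_mul_of_nonneg_right this (sq_nonneg A),
              mul_nonneg (sq_nonneg L) (sq_nonneg A)]
    rwa [ENNReal.mul_le_mul_iff_right (by simpa using h0.ne') (by simp)] at h6
  obtain ⟨k, hk⟩ := hex L₀ (hL.trans_le hLL) le_rfl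
  obtain ⟨k', hk'⟩ := hex L hL hLL
  exact ⟨k, k', hk, hk', norm_sub_le_of_chain (by positivity) hex hcmp hρ n L₀ L k k' hL hLL le_rfl
    hratio hk hk'⟩

end Chain

theorem enorm_sq_eq_lintegral {α : Type*} [MeasurableSpace α] {μ : Measure α} (f : Lp ℂ 2 μ) :
    ‖f‖ₑ ^ 2 = ∫⁻ x, ‖f x‖ₑ ^ 2 ∂μ := by
  rw [Lp.enorm_def, eLpNorm_eq_lintegral_rpow_enorm_toReal (by norm_num) (by norm_num),
    ← ENNReal.rpow_natCast, ← ENNReal.rpow_mul]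
  norm_num

theorem enorm_sq_le_ofReal_sq_iff {F : Type*} [NormedAddCommGroup F] {z : F} {c : ℝ} (hc : 0 ≤ c) :
    ‖z‖ₑ ^ 2 ≤ ENNReal.ofReal (c ^ 2) ↔ ‖z‖ ≤ c := by
  rw [← ofReal_norm, ← ENNReal.ofReal_pow (norm_nonneg _),
    ENNReal.ofReal_le_ofReal_iff (by positivity), pow_le_pow_iff_left₀ (norm_nonneg _) hc two_ne_zero]

theorem mem_H1_of_hasWeakDeriv_prod {Ω : Opens (ℝ × ℝ)} {u g₁ g₂ : L2 Ω}
    (h₁ : HasWeakDeriv Ω (1, 0) u g₁) (h₂ : HasWeakDeriv Ω (0, 1) u g₂) : u ∈ H1 Ω := by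
  rintro ⟨a, b⟩
  refine ⟨(a : ℂ) • g₁ + (b : ℂ) • g₂, ?_⟩
  have := (h₁.smul_dir a).add_dir (h₂.smul_dir b)
  simp only [Prod.smul_mk, smul_eq_mul, mul_one, mul_zero, Prod.mk_add_mk, add_zero,
    zero_add] at this
  exact this.congr (EventuallyEq.refl _ _)
    (((Lp.coeFn_smul _ _).add (Lp.coeFn_smul _ _)).symm.trans (Lp.coeFn_add _ _).symm)

/-! ### Weak derivatives of products of functions of one variable -/

section Tensor

variable {Ω : Opens (ℝ × ℝ)} {A A' k k' : ℝ → ℂ}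

/-- The factor `k` is merely bounded; it is the vertical boundedness of `Ω` that makes it square
integrable there. -/
theorem memLp_tensor (hA : MemLp A 2 volume) (hk : Measurable k) {c : ℝ} (hc : ∀ y, ‖k y‖ ≤ c)
    {a b : ℝ} (hΩ : ∀ z ∈ Ω, z.2 ∈ Ioo a b) :
    MemLp (fun z : ℝ × ℝ => A z.1 * k z.2) 2 (volume.restrict (Ω : Set (ℝ × ℝ))) := by
  have hk2 : MemLp ((Ioo a b).indicator k) 2 volume := by
    rw [memLp_indicator_iff_restrict measurableSet_Ioo]
    have : IsFiniteMeasure (volume.restrict (Ioo a b)) := ⟨by simp⟩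
    exact MemLp.of_bound hk.aestronglyMeasurable c (Eventually.of_forall hc)
  have h1 : MemLp (fun z : ℝ × ℝ => A z.1 * (Ioo a b).indicator k z.2) 2 volume := by
    have hm : AEStronglyMeasurable (fun z : ℝ × ℝ => A z.1 * (Ioo a b).indicator k z.2) volume :=
      hA.1.comp_fst.mul hk2.1.comp_snd
    rw [memLp_two_iff_integrable_sq_norm hm]
    have := ((memLp_two_iff_integrable_sq_norm hA.1).1 hA).mul_prod
      ((memLp_two_iff_integrable_sq_norm hk2.1).1 hk2)
    refine this.congr (Eventually.of_forall fun z => ?_)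
    simp only [norm_mul, mul_pow]
  refine (memLp_congr_ae ?_).1 (h1.restrict (Ω : Set (ℝ × ℝ)))
  filter_upwards [ae_restrict_mem Ω.isOpen.measurableSet] with z hz
  rw [indicator_of_mem (hΩ z hz)]

theorem contDiff_slice {φ : ℝ × ℝ → ℝ} (hφ : ContDiff ℝ ∞ φ) :
    (∀ y, ContDiff ℝ ∞ fun x => φ (x, y)) ∧ ∀ x, ContDiff ℝ ∞ fun y => φ (x, y) :=
  ⟨fun _ => hφ.comp (contDiff_id.prodMk contDiff_const),
    fun _ => hφ.comp (contDiff_const.prodMk contDiff_id)⟩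

theorem tsupport_slice_fst {φ : ℝ × ℝ → ℝ} (y : ℝ) :
    tsupport (fun x => φ (x, y)) ⊆ (fun x => (x, y)) ⁻¹' tsupport φ :=
  closure_minimal (fun _ hx => subset_closure hx)
    ((isClosed_tsupport _).preimage (by fun_prop))

theorem tsupport_slice_snd {φ : ℝ × ℝ → ℝ} (x : ℝ) :
    tsupport (fun y => φ (x, y)) ⊆ (fun y => (x, y)) ⁻¹' tsupport φ :=
  closure_minimal (fun _ hx => subset_closure hx)
    ((isClosed_tsupport _).preimage (by fun_prop))

theorem hasCompactSupport_slice {φ : ℝ × ℝ → ℝ} (h : HasCompactSupport φ) :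
    (∀ y, HasCompactSupport fun x => φ (x, y)) ∧ ∀ x, HasCompactSupport fun y => φ (x, y) := by
  refine ⟨fun y => ?_, fun x => ?_⟩
  · refine (h.image continuous_fst).of_isClosed_subset (isClosed_tsupport _) fun x hx => ?_
    exact ⟨_, tsupport_slice_fst y hx, rfl⟩
  · refine (h.image continuous_snd).of_isClosed_subset (isClosed_tsupport _) fun y hy => ?_
    exact ⟨_, tsupport_slice_snd x hy, rfl⟩

theorem deriv_slice_fst {φ : ℝ × ℝ → ℝ} (hφ : ContDiff ℝ ∞ φ) (x y : ℝ) :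
    deriv (fun x => φ (x, y)) x = fderiv ℝ φ (x, y) (1, 0) := by
  have h1 : HasFDerivAt φ (fderiv ℝ φ (x, y)) (x, y) :=
    ((hφ.differentiable (by simp)) _).hasFDerivAt
  have h2 : HasDerivAt (fun x : ℝ => (x, y)) (1, 0) x :=
    (hasDerivAt_id x).prodMk (hasDerivAt_const x y)
  exact (h1.comp_hasDerivAt x h2).deriv

theorem deriv_slice_snd {φ : ℝ × ℝ → ℝ} (hφ : ContDiff ℝ ∞ φ) (x y : ℝ) :
    deriv (fun y => φ (x, y)) y = fderiv ℝ φ (x, y) (0, 1) := by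
  have h1 : HasFDerivAt φ (fderiv ℝ φ (x, y)) (x, y) :=
    ((hφ.differentiable (by simp)) _).hasFDerivAt
  have h2 : HasDerivAt (fun y : ℝ => (x, y)) (0, 1) y :=
    (hasDerivAt_const y x).prodMk (hasDerivAt_id y)
  exact (h1.comp_hasDerivAt y h2).deriv

theorem HasWeakDeriv.integral_eq {Ω₀ : Opens ℝ} (h : HasWeakDeriv Ω₀ 1 A A') {φ : ℝ → ℝ}
    (h1 : ContDiff ℝ ∞ φ) (h2 : HasCompactSupport φ) (h3 : tsupport φ ⊆ Ω₀) :
    ∫ x, deriv φ x • A x = -∫ x, φ x • A' x := by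
  have hz : ∀ x ∉ (Ω₀ : Set ℝ), φ x = 0 := fun x hx => image_eq_zero_of_notMem_tsupport
    (fun hx' => hx (h3 hx'))
  have hz' : ∀ x ∉ (Ω₀ : Set ℝ), deriv φ x = 0 := fun x hx => image_eq_zero_of_notMem_tsupport
    (fun hx' => hx (h3 (tsupport_deriv_subset hx')))
  have := h.2.2 φ h1 h2 h3
  simp only [fderiv_apply_one_eq_deriv] at this
  rwa [setIntegral_eq_integral_of_forall_compl_eq_zero (fun x hx => by simp [hz' x hx]),
    setIntegral_eq_integral_of_forall_compl_eq_zero (fun x hx => by simp [hz x hx])] at this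

theorem hasWeakDeriv_of_integral_eq {e : ℝ × ℝ} {u g : ℝ × ℝ → ℂ}
    (hu : LocallyIntegrableOn u (Ω : Set (ℝ × ℝ))) (hg : LocallyIntegrableOn g (Ω : Set (ℝ × ℝ)))
    (h : ∀ φ : ℝ × ℝ → ℝ, ContDiff ℝ ∞ φ → HasCompactSupport φ → tsupport φ ⊆ (Ω : Set (ℝ × ℝ)) →
      ∫ z, fderiv ℝ φ z e • u z = -∫ z, φ z • g z) : HasWeakDeriv Ω e u g := by
  refine ⟨hu, hg, fun φ h1 h2 h3 => ?_⟩
  have hz : ∀ x ∉ (Ω : Set (ℝ × ℝ)), φ x = 0 := fun x hx => image_eq_zero_of_notMem_tsupport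
    (fun hx' => hx (h3 hx'))
  have hz' : ∀ x ∉ (Ω : Set (ℝ × ℝ)), fderiv ℝ φ x e = 0 := fun x hx =>
    image_eq_zero_of_notMem_tsupport (f := fun x => fderiv ℝ φ x e)
    (fun hx' => hx (h3 (tsupport_fderiv_apply_subset ℝ e hx')))
  rw [setIntegral_eq_integral_of_forall_compl_eq_zero (fun x hx => by simp [hz' x hx]),
    setIntegral_eq_integral_of_forall_compl_eq_zero (fun x hx => by simp [hz x hx])]
  exact h φ h1 h2 h3

/-- By Fubini, only horizontal slices at heights with `k y ≠ 0` matter, and on those the slice of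
the test function is supported in `Ω₀`. So `A` needs a weak derivative only on `Ω₀`, even if `Ω` is
wider elsewhere. -/
theorem HasWeakDeriv.tensor_fst {Ω₀ : Opens ℝ} (h : HasWeakDeriv Ω₀ 1 A A')
    (hu : LocallyIntegrableOn (fun z : ℝ × ℝ => A z.1 * k z.2) (Ω : Set (ℝ × ℝ)))
    (hg : LocallyIntegrableOn (fun z : ℝ × ℝ => A' z.1 * k z.2) (Ω : Set (ℝ × ℝ)))
    (hz : ∀ z ∈ Ω, k z.2 ≠ 0 → z.1 ∈ Ω₀) :
    HasWeakDeriv Ω (1, 0) (fun z : ℝ × ℝ => A z.1 * k z.2) (fun z : ℝ × ℝ => A' z.1 * k z.2) := by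
  refine hasWeakDeriv_of_integral_eq hu hg fun φ h1 h2 h3 => ?_
  have i1 := integrable_fderiv_smul (1, 0) h1 h2 h3 hu
  have i2 := integrable_smul_of_tsupport h1.continuous h2 h3 hg
  rw [Measure.volume_eq_prod] at i1 i2 ⊢
  rw [integral_prod_symm _ i1, integral_prod_symm _ i2, ← integral_neg]
  refine integral_congr_ae (Eventually.of_forall fun y => ?_)
  simp only
  by_cases hy : k y = 0
  · simp [hy]
  have e1 : ∀ x, fderiv ℝ φ (x, y) (1, 0) • (A x * k y) =
      (deriv (fun x => φ (x, y)) x • A x) * k y := fun x => by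
    rw [deriv_slice_fst h1, smul_mul_assoc]
  have e2 : ∀ x, φ (x, y) • (A' x * k y) = (φ (x, y) • A' x) * k y := fun x => by
    rw [smul_mul_assoc]
  simp only [e1, e2]
  rw [integral_mul_const, integral_mul_const, h.integral_eq ((contDiff_slice h1).1 y)
    ((hasCompactSupport_slice h2).1 y) (fun x hx => hz _ (h3 (tsupport_slice_fst y hx)) hy),
    neg_mul]

theorem HasWeakDeriv.tensor_snd (h : HasWeakDeriv ⊤ 1 k k')
    (hu : LocallyIntegrableOn (fun z : ℝ × ℝ => A z.1 * k z.2) (Ω : Set (ℝ × ℝ)))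
    (hg : LocallyIntegrableOn (fun z : ℝ × ℝ => A z.1 * k' z.2) (Ω : Set (ℝ × ℝ))) :
    HasWeakDeriv Ω (0, 1) (fun z : ℝ × ℝ => A z.1 * k z.2) (fun z : ℝ × ℝ => A z.1 * k' z.2) := by
  refine hasWeakDeriv_of_integral_eq hu hg fun φ h1 h2 h3 => ?_
  have i1 := integrable_fderiv_smul (0, 1) h1 h2 h3 hu
  have i2 := integrable_smul_of_tsupport h1.continuous h2 h3 hg
  rw [Measure.volume_eq_prod] at i1 i2 ⊢
  rw [integral_prod _ i1, integral_prod _ i2, ← integral_neg]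
  refine integral_congr_ae (Eventually.of_forall fun x => ?_)
  simp only
  have e1 : ∀ y, fderiv ℝ φ (x, y) (0, 1) • (A x * k y) =
      A x * (deriv (fun y => φ (x, y)) y • k y) := fun y => by
    rw [deriv_slice_snd h1, mul_smul_comm]
  have e2 : ∀ y, φ (x, y) • (A x * k' y) = A x * (φ (x, y) • k' y) := fun y => by
    rw [mul_smul_comm]
  simp only [e1, e2]
  rw [integral_const_mul, integral_const_mul, h.integral_eq ((contDiff_slice h1).2 x)
    ((hasCompactSupport_slice h2).2 x) (fun _ _ => trivial), mul_neg]

end Tensor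

/-! ### The vertical cut-off in the passage -/

section Cutoff

/-- The piecewise linear function which is `0` on `(-∞, 0]` and `1` on `[h, ∞)`. -/
noncomputable def ramp (h y : ℝ) : ℝ := max 0 (min 1 (y / h))

/-- The derivative of `ramp h`. -/
noncomputable def rampDeriv (h : ℝ) : ℝ → ℂ := (Ioc 0 h).indicator fun _ => ((h⁻¹ : ℝ) : ℂ)

variable {h : ℝ}

theorem ramp_nonneg (y : ℝ) : 0 ≤ ramp h y := le_max_left _ _

theorem ramp_le_one (y : ℝ) : ramp h y ≤ 1 := max_le zero_le_one (min_le_left _ _)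

theorem ramp_of_nonpos (hh : 0 < h) {y : ℝ} (hy : y ≤ 0) : ramp h y = 0 :=
  max_eq_left ((min_le_right _ _).trans (div_nonpos_of_nonpos_of_nonneg hy hh.le))

theorem ramp_of_le (hh : 0 < h) {y : ℝ} (hy : h ≤ y) : ramp h y = 1 := by
  unfold ramp
  rw [min_eq_left ((one_le_div hh).2 hy)]
  simp

theorem continuous_ramp : Continuous (ramp h) := by
  unfold ramp; fun_prop

theorem measurable_rampDeriv : Measurable (rampDeriv h) :=
  measurable_const.indicator measurableSet_Ioc

theorem norm_rampDeriv_le (hh : 0 < h) (y : ℝ) : ‖rampDeriv h y‖ ≤ h⁻¹ := by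
  unfold rampDeriv
  refine (norm_indicator_le_norm_self _ _).trans ?_
  rw [Complex.norm_real, Real.norm_of_nonneg (inv_nonneg.2 hh.le)]

theorem ramp_eq_integral (hh : 0 < h) (y : ℝ) :
    (ramp h y : ℂ) = ∫ t in (0 : ℝ)..y, rampDeriv h t := by
  rcases le_total y 0 with hy | hy
  · rw [ramp_of_nonpos hh hy, intervalIntegral.integral_of_ge hy,
      setIntegral_eq_zero_of_forall_eq_zero]
    · simp
    · intro t ht
      exact indicator_of_notMem (fun h' => absurd h'.1 (not_lt.2 ht.2)) _
  · rw [intervalIntegral.integral_of_le hy]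
    unfold rampDeriv
    rw [setIntegral_indicator measurableSet_Ioc, Ioc_inter_Ioc, max_self, setIntegral_const]
    unfold ramp
    rw [max_eq_right (le_min zero_le_one (by positivity))]
    rcases le_total y h with h1 | h1
    · rw [min_eq_left h1, min_eq_right ((div_le_one hh).2 h1)]
      simp [hy, div_eq_mul_inv]
    · rw [min_eq_right h1, min_eq_left ((one_le_div hh).2 h1)]
      simp [hh.le, hh.ne']

theorem locallyIntegrable_rampDeriv : LocallyIntegrable (rampDeriv h) volume := by
  refine Integrable.locallyIntegrable ?_
  unfold rampDeriv
  rw [integrable_indicator_iff measurableSet_Ioc]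
  exact integrableOn_const (by simp)

theorem hasWeakDeriv_ramp (hh : 0 < h) :
    HasWeakDeriv ⊤ 1 (fun y => (ramp h y : ℂ)) (rampDeriv h) := by
  have h1 := isPrimitiveOn_integral (I := univ) ordConnected_univ (mem_univ (0 : ℝ))
    (locallyIntegrable_rampDeriv (h := h).locallyIntegrableOn univ)
  have h2 := h1.hasWeakDeriv (Ω := ⊤) ordConnected_univ
  simpa only [ramp_eq_integral hh] using h2

theorem hasWeakDeriv_one_sub_ramp (hh : 0 < h) :
    HasWeakDeriv ⊤ 1 (fun y => ((1 - ramp h y : ℝ) : ℂ)) (fun y => -rampDeriv h y) := by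
  have h1 : IsPrimitiveOn (⊤ : Opens ℝ) (fun _ => (1 : ℂ)) 0 :=
    ⟨locallyIntegrableOn_zero, by simp⟩
  have h2 := (h1.hasWeakDeriv (Ω := ⊤) ordConnected_univ).add ((hasWeakDeriv_ramp hh).smul (-1))
  refine h2.congr (Eventually.of_forall fun y => ?_) (Eventually.of_forall fun y => ?_)
  · simp [sub_eq_add_neg]
  · simp

end Cutoff

/-! ### The isometric embedding of the limit space -/

section Embedding

variable {ℓm ℓp : EReal} {α β γ ε : ℝ}

/-- The function on the waveguide corresponding to an element of `L²(Ω₀) ⊕ ℂ`: constant in the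
transversal direction of the strip, constant in the room and zero in the passage. -/
noncomputable def embeddingFun (α β ε : ℝ) (f : H0 (interval ℓm ℓp)) : ℝ × ℝ → ℂ := fun p =>
  (strip ℓm ℓp ε).indicator (fun p => (((√ε)⁻¹ : ℝ) : ℂ) * f.fst p.1) p +
    (room α β ε).indicator (fun _ => (((ε ^ β)⁻¹ : ℝ) : ℂ) * f.snd) p

variable {f : H0 (interval ℓm ℓp)} {p : ℝ × ℝ}

theorem embeddingFun_strip (hε : 0 < ε) (hp : p ∈ strip ℓm ℓp ε) :
    embeddingFun α β ε f p = (((√ε)⁻¹ : ℝ) : ℂ) * f.fst p.1 := by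
  unfold embeddingFun
  rw [indicator_of_mem hp, indicator_of_notMem, add_zero]
  exact Set.disjoint_left.1 (disjoint_room (γ := 0) hε) (Or.inl hp)

theorem embeddingFun_passage (hε : 0 < ε) (hp : p ∈ passage α γ ε) :
    embeddingFun α β ε f p = 0 := by
  unfold embeddingFun
  rw [indicator_of_notMem, indicator_of_notMem, add_zero]
  · exact Set.disjoint_left.1 (disjoint_room (ℓm := ℓm) (ℓp := ℓp) hε) (Or.inr hp)
  · exact Set.disjoint_right.1 disjoint_strip_passage hp

theorem embeddingFun_room (hε : 0 < ε) (hp : p ∈ room α β ε) :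
    embeddingFun α β ε f p = (((ε ^ β)⁻¹ : ℝ) : ℂ) * f.snd := by
  unfold embeddingFun
  rw [indicator_of_notMem, indicator_of_mem hp, zero_add]
  exact fun h => Set.disjoint_right.1 (disjoint_room (γ := 0) hε) hp (Or.inl h)

theorem measurable_embeddingFun : Measurable (embeddingFun α β ε f) := by
  refine Measurable.add ?_ ?_
  · exact (((Lp.stronglyMeasurable f.fst).measurable.comp measurable_fst).const_mul _).indicator
      isOpen_strip.measurableSet
  · exact measurable_const.indicator isOpen_room.measurableSet

theorem enorm_ofReal_sq (c : ℝ) : ‖(c : ℂ)‖ₑ ^ 2 = ENNReal.ofReal (c ^ 2) := by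
  rw [← ofReal_norm, ← ENNReal.ofReal_pow (norm_nonneg _), Complex.norm_real,
    Real.norm_eq_abs, sq_abs]

/-- The strip has height `ε` and the room has area `(ε ^ β)²`, so the factors `ε ^ (-1/2)` and `ε ^
(-β)` preserve both norms. -/
theorem lintegral_embeddingFun (hε : 0 < ε) (f : H0 (interval ℓm ℓp)) :
    ∫⁻ p in (waveguide ℓm ℓp α β γ ε : Set (ℝ × ℝ)), ‖embeddingFun α β ε f p‖ₑ ^ 2 = ‖f‖ₑ ^ 2 := by
  have hb : 0 < ε ^ β := Real.rpow_pos_of_pos hε β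
  have hS : ∫⁻ p in strip ℓm ℓp ε, ‖embeddingFun α β ε f p‖ₑ ^ 2 = ‖f.fst‖ₑ ^ 2 := by
    have hm : Measurable fun p : ℝ × ℝ => (((√ε)⁻¹ : ℝ) : ℂ) * f.fst p.1 :=
      ((Lp.stronglyMeasurable f.fst).measurable.comp measurable_fst).const_mul _
    rw [setLIntegral_congr_fun isOpen_strip.measurableSet fun p hp => by
      rw [embeddingFun_strip hε hp], strip_eq, setLIntegral_prod_enorm_sq hm]
    simp only [enorm_mul, mul_pow, setLIntegral_const, enorm_ofReal_sq]
    rw [lintegral_mul_const _ (((Lp.stronglyMeasurable f.fst).measurable.enorm.pow_const 2).const_mul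
      _), lintegral_const_mul _ ((Lp.stronglyMeasurable f.fst).measurable.enorm.pow_const 2),
      ← enorm_sq_eq_lintegral, mul_right_comm, Real.volume_Ioo, ← ENNReal.ofReal_mul (by positivity),
      inv_pow, Real.sq_sqrt hε.le, zero_sub, neg_neg, inv_mul_cancel₀ hε.ne', ENNReal.ofReal_one,
      one_mul]
  have hP : ∫⁻ p in passage α γ ε, ‖embeddingFun α β ε f p‖ₑ ^ 2 = 0 := by
    rw [setLIntegral_congr_fun isOpen_passage.measurableSet fun p hp => by
      rw [embeddingFun_passage hε hp]]
    simp
  have hR : ∫⁻ p in room α β ε, ‖embeddingFun α β ε f p‖ₑ ^ 2 = ‖f.snd‖ₑ ^ 2 := by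
    rw [setLIntegral_congr_fun isOpen_room.measurableSet fun p hp => by
      rw [embeddingFun_room hε hp], setLIntegral_const, room_eq, Measure.volume_eq_prod,
      Measure.prod_prod, Real.volume_Ioo, Real.volume_Ioo, enorm_mul, mul_pow, enorm_ofReal_sq,
      mul_right_comm, ← ENNReal.ofReal_mul (by linarith), ← ENNReal.ofReal_mul (by positivity)]
    rw [show ((ε ^ β)⁻¹) ^ 2 * ((ε ^ β / 2 - -(ε ^ β / 2)) * (ε ^ α + ε ^ β - ε ^ α)) = 1 by
      field_simp; ring, ENNReal.ofReal_one, one_mul]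
  rw [setLIntegral_waveguide hε, hS, hP, hR, add_zero]
  have := WithLp.prod_norm_sq_eq_of_L2 f
  rw [← ofReal_norm f, ← ENNReal.ofReal_pow (norm_nonneg _), this,
    ENNReal.ofReal_add (by positivity) (by positivity), ENNReal.ofReal_pow (norm_nonneg _),
    ENNReal.ofReal_pow (norm_nonneg _), ofReal_norm, ofReal_norm]

theorem memLp_embeddingFun (hε : 0 < ε) (f : H0 (interval ℓm ℓp)) :
    MemLp (embeddingFun α β ε f) 2
      (volume.restrict (waveguide ℓm ℓp α β γ ε : Set (ℝ × ℝ))) := by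
  refine ⟨measurable_embeddingFun.aestronglyMeasurable, ?_⟩
  rw [eLpNorm_lt_top_iff_lintegral_rpow_enorm_lt_top (by norm_num) (by norm_num)]
  have := lintegral_embeddingFun (α := α) (β := β) (γ := γ) hε f
  norm_num
  rw [this]
  exact ENNReal.pow_lt_top enorm_lt_top

theorem ae_fst_of_ae {P : ℝ → Prop} (h : ∀ᵐ x ∂volume.restrict (interval ℓm ℓp : Set ℝ), P x) :
    ∀ᵐ p : ℝ × ℝ, p ∈ strip ℓm ℓp ε → P p.1 := by
  rw [ae_restrict_iff' (interval ℓm ℓp).isOpen.measurableSet] at h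
  filter_upwards [Measure.quasiMeasurePreserving_fst.ae h] with p hp hpS
  exact hp hpS.1

/-- The isometric embedding of the limit space into `L²(Ω_ε)`. -/
noncomputable def embedding (α β γ : ℝ) (hε : 0 < ε) :
    H0 (interval ℓm ℓp) →ₗᵢ[ℂ] L2 (waveguide ℓm ℓp α β γ ε) where
  toFun f := (memLp_embeddingFun hε f).toLp _
  map_add' f g := by
    rw [← MemLp.toLp_add]
    refine MemLp.toLp_congr _ _ (ae_restrict_of_ae ?_)
    filter_upwards [ae_fst_of_ae (ε := ε) (Lp.coeFn_add f.fst g.fst)] with p hp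
    have e' : (f + g).snd = f.snd + g.snd := rfl
    simp only [Pi.add_apply, embeddingFun, e']
    by_cases h : p ∈ strip ℓm ℓp ε
    · have e : (f + g).fst p.1 = f.fst p.1 + g.fst p.1 := hp h
      by_cases h' : p ∈ room α β ε
      · simp only [h, h', e, indicator_of_mem]; ring
      · simp only [h, h', e, indicator_of_mem, indicator_of_notMem, not_false_eq_true]; ring
    · by_cases h' : p ∈ room α β ε
      · simp [h, h']; ring
      · simp [h, h']
  map_smul' c f := by
    rw [RingHom.id_apply, ← MemLp.toLp_const_smul]
    refine MemLp.toLp_congr _ _ (ae_restrict_of_ae ?_)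
    filter_upwards [ae_fst_of_ae (ε := ε) (Lp.coeFn_smul c f.fst)] with p hp
    simp only [Pi.smul_apply, embeddingFun]
    by_cases h : p ∈ strip ℓm ℓp ε
    · by_cases h' : p ∈ room α β ε
      · simp [h, h', hp h]; ring
      · simp [h, h', hp h]; ring
    · by_cases h' : p ∈ room α β ε
      · simp [h, h']; ring
      · simp [h, h']
  norm_map' f := by
    change ‖(memLp_embeddingFun (γ := γ) hε f).toLp _‖ = ‖f‖
    rw [← enorm_eq_iff_norm_eq]
    have : ‖(memLp_embeddingFun (γ := γ) (α := α) (β := β) hε f).toLp _‖ₑ ^ 2 = ‖f‖ₑ ^ 2 := by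
      rw [enorm_sq_eq_lintegral, ← lintegral_embeddingFun (α := α) (β := β) (γ := γ) hε f]
      refine lintegral_congr_ae ?_
      filter_upwards [(memLp_embeddingFun (γ := γ) (α := α) (β := β) hε f).coeFn_toLp] with p hp
      rw [hp]
    exact (ENNReal.pow_right_strictMono two_ne_zero).injective this

theorem coeFn_embedding (hε : 0 < ε) (f : H0 (interval ℓm ℓp)) :
    embedding α β γ hε f =ᵐ[volume.restrict (waveguide ℓm ℓp α β γ ε : Set (ℝ × ℝ))]
      embeddingFun α β ε f :=
  (memLp_embeddingFun hε f).coeFn_toLp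

end Embedding

/-! ### The adjoint embedding as a transversal mean -/

section Adjoint

variable {ℓm ℓp : EReal} {α β γ ε : ℝ}

theorem restrict_strip : (volume : Measure (ℝ × ℝ)).restrict (strip ℓm ℓp ε) =
    (volume.restrict (interval ℓm ℓp : Set ℝ)).prod (volume.restrict (Ioo (-ε) 0)) := by
  rw [strip_eq, Measure.volume_eq_prod, ← Measure.prod_restrict]

/-- Pairing with the embedding of `(φ, 0)` describes the first component of the adjoint against test
functions, which suffices for its weak derivative and avoids a pointwise formula on all of `Ω₀`. -/
theorem integrableOn_strip_and_integral_adjoint (hε : 0 < ε) (v : L2 (waveguide ℓm ℓp α β γ ε))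
    {φ : ℝ → ℝ} (hφ : Continuous φ) (hφs : HasCompactSupport φ) :
    IntegrableOn (fun p : ℝ × ℝ => φ p.1 • v p) (strip ℓm ℓp ε) ∧
    ∫ x in (interval ℓm ℓp : Set ℝ),
        φ x • (ContinuousLinearMap.adjoint (embedding α β γ hε).toContinuousLinearMap v).fst x =
      (√ε)⁻¹ • ∫ p in strip ℓm ℓp ε, φ p.1 • v p := by
  have hL : MemLp (fun x => (φ x : ℂ)) 2 (volume.restrict (interval ℓm ℓp : Set ℝ)) :=
    ((Complex.continuous_ofReal.comp hφ).memLp_of_hasCompactSupport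
      (hφs.comp_left (g := Complex.ofReal) (by simp))).restrict _
  set f : H0 (interval ℓm ℓp) := WithLp.toLp 2 (hL.toLp _, 0) with hf
  set w := ContinuousLinearMap.adjoint (embedding α β γ hε).toContinuousLinearMap v with hw
  have hs : 0 < √ε := Real.sqrt_pos.2 hε
  have hfp : ∀ᵐ p : ℝ × ℝ, p ∈ strip ℓm ℓp ε → f.fst p.1 = φ p.1 :=
    ae_fst_of_ae hL.coeFn_toLp
  have h1 : inner ℂ f w = ∫ x in (interval ℓm ℓp : Set ℝ), φ x • w.fst x := by
    rw [WithLp.prod_inner_apply]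
    change inner ℂ (hL.toLp _) w.fst + inner ℂ (0 : ℂ) w.snd = _
    rw [inner_zero_left, add_zero, inner_eq_integral _ _ hL.coeFn_toLp (EventuallyEq.refl _ _)]
    refine integral_congr_ae (Eventually.of_forall fun x => ?_)
    simp [mul_comm]
  have h2 : inner ℂ f w = inner ℂ (embedding α β γ hε f) v := by
    rw [hw, ContinuousLinearMap.adjoint_inner_right]
    rfl
  have e1 : ∀ᵐ p ∂volume.restrict (waveguide ℓm ℓp α β γ ε : Set (ℝ × ℝ)),
      inner ℂ (embedding α β γ hε f p) (v p) =
        (strip ℓm ℓp ε).indicator (fun p => (√ε)⁻¹ • (φ p.1 • v p)) p := by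
    filter_upwards [coeFn_embedding hε f, ae_restrict_of_ae hfp] with p hp hp'
    rw [hp]
    have h0 : f.snd = 0 := rfl
    unfold embeddingFun
    by_cases h : p ∈ strip ℓm ℓp ε
    · rw [indicator_of_mem h, indicator_of_mem h, h0, mul_zero, indicator_zero, add_zero, hp' h]
      simp; ring
    · rw [indicator_of_notMem h, indicator_of_notMem h, h0, mul_zero, indicator_zero, add_zero,
        inner_zero_left]
  have i1 := (integrable_congr e1).1 (L2.integrable_inner (embedding α β γ hε f) v)
  rw [integrable_indicator_iff isOpen_strip.measurableSet, IntegrableOn, Measure.restrict_restrict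
    isOpen_strip.measurableSet, inter_eq_left.2 strip_subset] at i1
  refine ⟨?_, ?_⟩
  · have := i1.smul (√ε)
    refine this.congr (Eventually.of_forall fun p => ?_)
    simp only [Pi.smul_apply]
    rw [smul_smul, mul_inv_cancel₀ hs.ne', one_smul]
  · rw [← h1, h2, L2.inner_def, integral_congr_ae e1,
      setIntegral_indicator isOpen_strip.measurableSet, inter_eq_right.2 strip_subset,
      integral_smul]

/-- Transversal averaging commutes with the horizontal derivative, because almost every horizontal
slice of `v` has the slice of `g` as weak derivative. Hence the adjoint maps `H¹` of the waveguide
into the form domain of the limit. -/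
theorem hasWeakDeriv_adjoint (hε : 0 < ε) {v g : L2 (waveguide ℓm ℓp α β γ ε)}
    (h : HasWeakDeriv (waveguide ℓm ℓp α β γ ε) (1, 0) v g) :
    HasWeakDeriv (interval ℓm ℓp) 1
      (ContinuousLinearMap.adjoint (embedding α β γ hε).toContinuousLinearMap v).fst
      (ContinuousLinearMap.adjoint (embedding α β γ hε).toContinuousLinearMap g).fst := by
  refine ⟨L2.locallyIntegrableOn _, L2.locallyIntegrableOn _, fun φ h1 h2 h3 => ?_⟩
  simp only [fderiv_apply_one_eq_deriv]
  obtain ⟨i1, e1⟩ := integrableOn_strip_and_integral_adjoint hε v (h1.continuous_deriv (by simp))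
    h2.deriv
  obtain ⟨i2, e2⟩ := integrableOn_strip_and_integral_adjoint hε g h1.continuous h2
  rw [e1, e2, ← smul_neg]
  congr 1
  rw [IntegrableOn, restrict_strip] at i1 i2
  rw [restrict_strip, integral_prod_symm _ i1,
    integral_prod_symm _ i2, ← integral_neg]
  let K : Opens ℝ := ⟨Ioo (-ε) 0, isOpen_Ioo⟩
  have hs := (ae_restrict_iff' K.isOpen.measurableSet).2
    (h.slice_fst (I := interval ℓm ℓp) (K := K) (ordConnected_interval ℓm ℓp) strip_subset)
  refine integral_congr_ae ?_
  filter_upwards [hs] with y hy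
  have := hy.2.2 φ h1 h2 h3
  simpa only [fderiv_apply_one_eq_deriv] using this

/-- The first component of the adjoint embedding is the transversal mean value. -/
theorem lintegral_adjoint_sub_le (h : IsAdmissible ℓm ℓp α β γ ε)
    (v : L2 (waveguide ℓm ℓp α β γ ε)) (k : ℂ) :
    ∫⁻ x in Ioo (-(ε / 2)) (ε / 2),
      ‖(ContinuousLinearMap.adjoint (embedding α β γ h.pos).toContinuousLinearMap v).fst x -
        (√ε : ℂ) * k‖ₑ ^ 2 ≤
      ∫⁻ p in Ioo (-(ε / 2)) (ε / 2) ×ˢ Ioo (-ε) 0, ‖v p - k‖ₑ ^ 2 := by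
  have hε := h.pos
  have hs : 0 < √ε := Real.sqrt_pos.2 hε
  have hI : Ioo (-(ε / 2)) (ε / 2) ⊆ (interval ℓm ℓp : Set ℝ) := fun x hx =>
    h.Icc_subset_interval ⟨by linarith [hx.1], by linarith [hx.2]⟩
  have hQ : Ioo (-(ε / 2)) (ε / 2) ×ˢ Ioo (-ε) 0 ⊆ strip ℓm ℓp ε := prod_mono hI le_rfl
  set w := ContinuousLinearMap.adjoint (embedding α β γ hε).toContinuousLinearMap v with hw
  set W : ℝ → ℂ := fun x => (√ε)⁻¹ • ∫ y in Ioo (-ε) 0, v (x, y) with hW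
  have iv : Integrable v ((volume.restrict (Ioo (-(ε / 2)) (ε / 2))).prod
      (volume.restrict (Ioo (-ε) 0))) := by
    rw [Measure.prod_restrict, ← Measure.volume_eq_prod]
    have hL : MemLp v 2 (volume.restrict (Ioo (-(ε / 2)) (ε / 2) ×ˢ Ioo (-ε) 0)) :=
      (Lp.memLp v).mono_measure (Measure.restrict_mono (hQ.trans strip_subset) le_rfl)
    have : IsFiniteMeasure (volume.restrict (Ioo (-(ε / 2)) (ε / 2) ×ˢ Ioo (-ε) 0)) := ⟨by
      rw [Measure.restrict_apply_univ, Measure.volume_eq_prod, Measure.prod_prod]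
      exact ENNReal.mul_lt_top (by simp) (by simp)⟩
    exact hL.integrable (by norm_num)
  have iW : IntegrableOn W (Ioo (-(ε / 2)) (ε / 2)) := Integrable.smul (√ε)⁻¹ iv.integral_prod_left
  -- On the bounded window the adjoint is identified with the explicit mean `W` by testing.
  have key : ∀ᵐ x, x ∈ Ioo (-(ε / 2)) (ε / 2) → (w.fst - W : ℝ → ℂ) x = 0 := by
    have il : LocallyIntegrableOn w.fst (Ioo (-(ε / 2)) (ε / 2)) :=
      (L2.locallyIntegrableOn w.fst).mono_set hI
    refine isOpen_Ioo.ae_eq_zero_of_integral_contDiff_smul_eq_zero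
      (il.sub iW.locallyIntegrableOn) ?_
    intro φ h1 h2 h3
    have hz : ∀ x ∉ Ioo (-(ε / 2)) (ε / 2), φ x = 0 := fun x hx =>
      image_eq_zero_of_notMem_tsupport (fun hx' => hx (h3 hx'))
    obtain ⟨i1, e1⟩ := integrableOn_strip_and_integral_adjoint hε v h1.continuous h2
    have j1 := integrable_smul_of_tsupport (Ω := ⟨Ioo (-(ε / 2)) (ε / 2), isOpen_Ioo⟩)
      h1.continuous h2 h3 il
    have j2 := integrable_smul_of_tsupport (Ω := ⟨Ioo (-(ε / 2)) (ε / 2), isOpen_Ioo⟩)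
      h1.continuous h2 h3 iW.locallyIntegrableOn
    simp only [Pi.sub_apply, smul_sub]
    rw [integral_sub j1 j2, sub_eq_zero, ← setIntegral_eq_integral_of_forall_compl_eq_zero
      (s := (interval ℓm ℓp : Set ℝ)) (fun x hx => by simp [hz x (fun h' => hx (hI h'))]), e1,
      ← setIntegral_eq_integral_of_forall_compl_eq_zero
      (s := (interval ℓm ℓp : Set ℝ)) (fun x hx => by simp [hz x (fun h' => hx (hI h'))])]
    rw [IntegrableOn, restrict_strip] at i1
    rw [restrict_strip, integral_prod _ i1,
      ← integral_smul]
    refine integral_congr_ae (Eventually.of_forall fun x => ?_)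
    simp only [hW]
    rw [integral_smul, smul_comm]
  have hm : Measurable fun p : ℝ × ℝ => v p - k := (Lp.stronglyMeasurable v).measurable.sub_const k
  rw [setLIntegral_prod_enorm_sq hm]
  refine lintegral_mono_ae ?_
  have iv' := iv.prod_right_ae
  filter_upwards [(ae_restrict_iff' measurableSet_Ioo).2 key, iv'] with x hx hxi
  have e1 : w.fst x = W x := sub_eq_zero.1 hx
  have e2 : W x - (√ε : ℂ) * k = (√ε)⁻¹ • ∫ y in Ioo (-ε) 0, (v (x, y) - k) := by
    rw [integral_sub hxi (integrable_const _), hW, smul_sub, setIntegral_const]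
    congr 1
    simp only [Measure.real, Real.volume_Ioo]
    rw [ENNReal.toReal_ofReal (by linarith), smul_smul, Complex.real_smul, zero_sub, neg_neg,
      show (√ε)⁻¹ * ε = √ε by
        rw [inv_mul_eq_div, div_eq_iff hs.ne', Real.mul_self_sqrt hε.le]]
  rw [e1, e2]
  calc ‖(√ε)⁻¹ • ∫ y in Ioo (-ε) 0, (v (x, y) - k)‖ₑ ^ 2
      = ENNReal.ofReal ε⁻¹ * ‖∫ y in Ioo (-ε) 0, (v (x, y) - k)‖ₑ ^ 2 := by
        rw [← Complex.coe_smul, smul_eq_mul, enorm_mul, mul_pow, enorm_ofReal_sq, inv_pow,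
          Real.sq_sqrt hε.le]
    -- Cauchy–Schwarz over a height `ε` gains exactly the factor lost by the normalisation.
    _ ≤ ENNReal.ofReal ε⁻¹ * (ENNReal.ofReal ε * ∫⁻ y in Ioo (-ε) 0, ‖v (x, y) - k‖ₑ ^ 2) := by
        gcongr
        have hm' : AEMeasurable (fun y => ‖v (x, y) - k‖ₑ) (volume.restrict (Ioo (-ε) 0)) :=
          (hm.comp measurable_prodMk_left).enorm.aemeasurable
        have := sq_lintegral_le _ hm'
        rw [Measure.restrict_apply_univ, Real.volume_Ioo, zero_sub, neg_neg] at this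
        refine le_trans ?_ this
        gcongr
        exact enorm_integral_le_lintegral_enorm _
    _ = _ := by
        rw [← mul_assoc, ← ENNReal.ofReal_mul (by positivity), inv_mul_cancel₀ hε.ne',
          ENNReal.ofReal_one, one_mul]

end Adjoint

/-! ### The flux through the passage, and the distance to the range of the embedding -/

section Flux

variable {ℓm ℓp : EReal} {α β γ ε : ℝ}

theorem volume_prod_eq (s t : Set ℝ) : volume (s ×ˢ t) = volume s * volume t := by
  rw [Measure.volume_eq_prod, Measure.prod_prod]

theorem lintegral_le_of_norm_le {E : Type*} [NormedAddCommGroup E] [NormedSpace ℝ E]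
    [FiniteDimensional ℝ E] [MeasureSpace E] [BorelSpace E] {Ω : Opens E} (g : L2 Ω) {A : ℝ}
    (hA : 0 ≤ A) (hg : ‖g‖ ≤ A) {S : Set E} (hS : S ⊆ Ω) : ∫⁻ p in S, ‖g p‖ₑ ^ 2 ≤ ENNReal.ofReal (A ^ 2) := by
  refine (lintegral_mono_set hS).trans ?_
  rw [← enorm_sq_eq_lintegral, enorm_sq_le_ofReal_sq_iff hA]
  exact hg

theorem norm_adjoint_embedding_le (hε : 0 < ε) (g : L2 (waveguide ℓm ℓp α β γ ε)) :
    ‖ContinuousLinearMap.adjoint (embedding α β γ hε).toContinuousLinearMap g‖ ≤ ‖g‖ := by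
  refine (ContinuousLinearMap.le_opNorm _ _).trans ?_
  rw [LinearIsometryEquiv.norm_map]
  exact mul_le_of_le_one_left (norm_nonneg _) (LinearIsometry.norm_toContinuousLinearMap_le _)

theorem norm_fst_le' {Ω : Opens ℝ} (f : H0 Ω) : ‖f.fst‖ ≤ ‖f‖ := by
  rw [← sq_le_sq₀ (norm_nonneg _) (norm_nonneg _), WithLp.prod_norm_sq_eq_of_L2]
  exact le_add_of_nonneg_right (by positivity)

theorem norm_snd_le' {Ω : Opens ℝ} (f : H0 Ω) : ‖f.snd‖ ≤ ‖f‖ := by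
  rw [← sq_le_sq₀ (norm_nonneg _) (norm_nonneg _), WithLp.prod_norm_sq_eq_of_L2 f]
  exact le_add_of_nonneg_left (by positivity)

theorem adjoint_mem_dom0 (hε : 0 < ε) (v : H1 (waveguide ℓm ℓp α β γ ε)) :
    ContinuousLinearMap.adjoint (embedding α β γ hε).toContinuousLinearMap
      (v : L2 (waveguide ℓm ℓp α β γ ε)) ∈ dom0 (interval ℓm ℓp) :=
  mem_H1_of_hasWeakDeriv _ _ (hasWeakDeriv_adjoint hε (hasWeakDeriv_weakDeriv _ (1, 0) v))

theorem weakDeriv_adjoint (hε : 0 < ε) (v : H1 (waveguide ℓm ℓp α β γ ε)) :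
    weakDeriv (interval ℓm ℓp) 1 ⟨_, adjoint_mem_dom0 hε v⟩ =
      (ContinuousLinearMap.adjoint (embedding α β γ hε).toContinuousLinearMap
        (weakDeriv (waveguide ℓm ℓp α β γ ε) (1, 0) v)).fst :=
  weakDeriv_eq _ _ (hasWeakDeriv_adjoint hε (hasWeakDeriv_weakDeriv _ (1, 0) v))

theorem ofReal_mul_enorm_sq_le_iff {z : ℂ} {c D : ℝ} (hD : 0 < D) (hc : 0 ≤ c) {X : ℝ≥0∞}
    (h : ENNReal.ofReal D * ‖z‖ₑ ^ 2 ≤ X) (hX : X ≤ ENNReal.ofReal (D * c ^ 2)) : ‖z‖ ≤ c := by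
  rw [← enorm_sq_le_ofReal_sq_iff hc]
  rw [ENNReal.ofReal_mul hD.le] at hX
  exact (ENNReal.mul_le_mul_iff_right (by simpa using hD) (by simp)).1 (h.trans hX)

/-- On an interval of length `ε` the transversal mean minus `√ε k` has squared norm at most `4 ε²
A²`, and its derivative has norm at most `A`. The pointwise bound gives `ε |·|² ≤ 10 ε² A²`. -/
theorem norm_evalAt_adjoint_sub_le (h : IsAdmissible ℓm ℓp α β γ ε)
    (h0 : (0 : ℝ) ∈ interval ℓm ℓp)
    (v : H1 (waveguide ℓm ℓp α β γ ε)) {A : ℝ} (hA : 0 ≤ A)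
    (hA₁ : ‖weakDeriv (waveguide ℓm ℓp α β γ ε) (1, 0) v‖ ≤ A) {k : ℂ}
    (hk : ∫⁻ p in Ioo (-(ε / 2)) (ε / 2) ×ˢ Ioo (-ε) 0,
      ‖(v : L2 (waveguide ℓm ℓp α β γ ε)) p - k‖ₑ ^ 2 ≤ ENNReal.ofReal (4 * ε ^ 2 * A ^ 2)) :
    ‖evalAt (ordConnected_interval ℓm ℓp) h0 ⟨_, adjoint_mem_dom0 h.pos v⟩ - (√ε : ℂ) * k‖ ≤
      4 * (√ε * A) := by
  have hε := h.pos
  have hI : Ioo (-(ε / 2)) (ε / 2) ⊆ (interval ℓm ℓp : Set ℝ) := fun x hx =>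
    h.Icc_subset_interval ⟨by linarith [hx.1], by linarith [hx.2]⟩
  obtain ⟨U, hU, hae, hev⟩ := exists_representative (ordConnected_interval ℓm ℓp)
    ⟨_, adjoint_mem_dom0 h.pos v⟩
  rw [hev h0]
  have hU' : IsPrimitiveOn (Ioo (-(ε / 2)) (ε / 2)) (fun x => U x - (√ε : ℂ) * k)
      (weakDeriv (interval ℓm ℓp) 1 ⟨_, adjoint_mem_dom0 h.pos v⟩) :=
    ⟨hU.1.mono_set hI, fun x hx y hy => by rw [← hU.2 x (hI hx) y (hI hy)]; ring⟩
  have h1 := hU'.enorm_sq_le ordConnected_Ioo measurableSet_Ioo (x := 0)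
    ⟨by linarith, by linarith⟩
  rw [Real.volume_Ioo, show ε / 2 - -(ε / 2) = ε by ring] at h1
  refine ofReal_mul_enorm_sq_le_iff hε (by positivity) h1 ?_
  have h2 : ∫⁻ x in Ioo (-(ε / 2)) (ε / 2), ‖U x - (√ε : ℂ) * k‖ₑ ^ 2 ≤
      ENNReal.ofReal (4 * ε ^ 2 * A ^ 2) := by
    refine le_trans (le_of_eq ?_) ((lintegral_adjoint_sub_le h (v : L2 (waveguide ℓm ℓp α β γ ε)) k).trans hk)
    refine lintegral_congr_ae ?_
    filter_upwards [ae_restrict_of_ae_restrict_of_subset hI hae] with x hx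
    rw [← hx]
    rfl
  have h3 : ∫⁻ x in Ioo (-(ε / 2)) (ε / 2),
      ‖weakDeriv (interval ℓm ℓp) 1 ⟨_, adjoint_mem_dom0 h.pos v⟩ x‖ₑ ^ 2 ≤
      ENNReal.ofReal (A ^ 2) := by
    refine (lintegral_mono_set hI).trans ?_
    rw [← enorm_sq_eq_lintegral, enorm_sq_le_ofReal_sq_iff hA, weakDeriv_adjoint]
    exact (norm_fst_le' _).trans ((norm_adjoint_embedding_le _ _).trans hA₁)
  calc _ ≤ 2 * (ENNReal.ofReal (4 * ε ^ 2 * A ^ 2) + ENNReal.ofReal ε ^ 2 *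
        ENNReal.ofReal (A ^ 2)) := by gcongr
    _ ≤ _ := by
      rw [show (2 : ℝ≥0∞) = ENNReal.ofReal 2 by simp, ← ENNReal.ofReal_pow hε.le,
        ← ENNReal.ofReal_mul (by positivity), ← ENNReal.ofReal_add (by positivity)
        (by positivity), ← ENNReal.ofReal_mul (by positivity)]
      refine ENNReal.ofReal_le_ofReal ?_
      rw [mul_pow, mul_pow, Real.sq_sqrt hε.le]
      nlinarith [mul_nonneg (sq_nonneg ε) (sq_nonneg A)]

/-- As `ε ≤ γ`, the width of the passage is at least `ε ^ (α + 2)`, hence at least `(ε ^ β) ^ (n +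
1)`. So `n + 1` steps of ratio `ε ^ (-β)` reach it from any size up to `1`, with `n` depending only
on the exponents. -/
theorem IsAdmissible.ratio_le (h : IsAdmissible ℓm ℓp α β γ ε) {n : ℕ}
    (hn : α + 2 ≤ β * (n + 1)) {L : ℝ} (hL : L ≤ 1) :
    L ≤ ((ε ^ β)⁻¹) ^ (n + 1) * (γ * ε ^ (α + 1)) := by
  refine hL.trans ?_
  have hε := h.pos
  have h1 : ε ^ (α + 2) ≤ γ * ε ^ (α + 1) := by
    rw [show α + 2 = α + 1 + 1 by ring, Real.rpow_add_one hε.ne' (α + 1), mul_comm]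
    exact mul_le_mul_of_nonneg_right h.le_gamma (Real.rpow_pos_of_pos hε _).le
  have h2 : (ε ^ β) ^ (n + 1) ≤ ε ^ (α + 2) := by
    rw [← Real.rpow_mul_natCast hε.le]
    refine Real.rpow_le_rpow_of_exponent_ge hε h.lt_one.le ?_
    push_cast; exact hn
  rw [inv_pow, inv_mul_eq_div, one_le_div (pow_pos h.size_pos _)]
  exact h2.trans h1

/-- The flux through the passage is determined by the trace at `0` of the transversal mean value. -/
theorem norm_flux_add_le (h : IsAdmissible ℓm ℓp α β γ ε) (h0 : (0 : ℝ) ∈ interval ℓm ℓp)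
    (v : H1 (waveguide ℓm ℓp α β γ ε)) {A : ℝ} (hA : 0 ≤ A)
    (hA₀ : ‖(v : L2 (waveguide ℓm ℓp α β γ ε))‖ ≤ A)
    (hA₁ : ‖weakDeriv (waveguide ℓm ℓp α β γ ε) (1, 0) v‖ ≤ A)
    (hA₂ : ‖weakDeriv (waveguide ℓm ℓp α β γ ε) (0, 1) v‖ ≤ A) {n : ℕ}
    (hn : α + 2 ≤ β * (n + 1)) :
    ‖(γ : ℂ) * evalAt (ordConnected_interval ℓm ℓp) h0 ⟨_, adjoint_mem_dom0 h.pos v⟩ +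
      (((√ε * ε ^ α)⁻¹ : ℝ) : ℂ) *
        ∫ p in passage α γ ε, weakDeriv (waveguide ℓm ℓp α β γ ε) (0, 1) v p‖ ≤
      γ * (12 * n + 27) * (√ε * (ε ^ β)⁻¹) * A := by
  have hε := h.pos
  have hb := h.size_pos
  have hh := h.height_pos
  have hd := h.width_pos
  have hs : 0 < √ε := Real.sqrt_pos.2 hε
  set d := γ * ε ^ (α + 1) with hd_def
  set g₁ := weakDeriv (waveguide ℓm ℓp α β γ ε) (1, 0) v with hg₁
  set g₂ := weakDeriv (waveguide ℓm ℓp α β γ ε) (0, 1) v with hg₂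
  set w0 := evalAt (ordConnected_interval ℓm ℓp) h0 ⟨_, adjoint_mem_dom0 h.pos v⟩ with hw0
  have w₁ : HasWeakDeriv (waveguide ℓm ℓp α β γ ε) (1, 0) (v : L2 (waveguide ℓm ℓp α β γ ε)) g₁ :=
    hasWeakDeriv_weakDeriv _ _ v
  have w₂ : HasWeakDeriv (waveguide ℓm ℓp α β γ ε) (0, 1) (v : L2 (waveguide ℓm ℓp α β γ ε)) g₂ :=
    hasWeakDeriv_weakDeriv _ _ v
  have m := (Lp.stronglyMeasurable (v : L2 (waveguide ℓm ℓp α β γ ε))).measurable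
  have m₁ := (Lp.stronglyMeasurable g₁).measurable
  have m₂ := (Lp.stronglyMeasurable g₂).measurable
  have b₁ := lintegral_le_of_norm_le g₁ hA hA₁ le_rfl
  have b₂ := lintegral_le_of_norm_le g₂ hA hA₂ le_rfl
  have hρ : 1 ≤ (ε ^ β)⁻¹ := (one_le_inv₀ hb).2 h.size_le_one
  have hIε : Ioo (-(ε / 2)) (ε / 2) ⊆ (interval ℓm ℓp : Set ℝ) := fun x hx =>
    h.Icc_subset_interval ⟨by linarith [hx.1], by linarith [hx.2]⟩
  -- Squares hanging from the lower mouth of the passage into the strip, from side `ε` down to the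
  -- width of the passage.
  obtain ⟨km, k0, hkm, hk0, hmm⟩ := exists_good_squares w₁ w₂ m m₁ m₂ hA (s := fun L => -L)
    (L₀ := ε) (fun _ _ hab => neg_le_neg hab) (fun _ _ _ => by simp)
    (by rw [neg_add_cancel]; exact (Set.prod_mono hIε le_rfl).trans strip_subset)
    b₁ b₂ hρ n hd h.width_le (h.ratio_le hn h.lt_one.le)
  -- Squares standing on the floor of the room, from the full room down to the width of the passage.
  obtain ⟨kp, k1, hkp, hk1, hpp⟩ := exists_good_squares w₁ w₂ m m₁ m₂ hA (s := fun _ => ε ^ α)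
    (L₀ := ε ^ β) (fun _ _ _ => le_rfl) (fun _ _ hab => add_le_add le_rfl hab)
    (by rw [← room_eq]; exact room_subset)
    b₁ b₂ hρ n hd h.width_le_size (h.ratio_le hn h.size_le_one)
  simp only [neg_add_cancel] at hkm hk0
  have t1 := norm_evalAt_adjoint_sub_le h h0 v hA hA₁ hkm
  -- The mean over the room is bounded only through the norm of `v`: the area is `(ε ^ β)²`, so the
  -- bound grows like `ε ^ (-β)`. Multiplied by `√ε` this is the error of order `ε ^ (1/2 - β)`.
  have t2 : ‖kp‖ ≤ 4 * ((ε ^ β)⁻¹ * A) := by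
    have := volume_mul_enorm_sub_sq_le m (S := Ioo (-(ε ^ β / 2)) (ε ^ β / 2) ×ˢ
      Ioo (ε ^ α) (ε ^ α + ε ^ β)) le_rfl kp 0
    simp only [sub_zero] at this
    rw [volume_prod_eq, Real.volume_Ioo, Real.volume_Ioo,
      ← ENNReal.ofReal_mul (by linarith)] at this
    refine ofReal_mul_enorm_sq_le_iff (by nlinarith) (by positivity) this ?_
    calc _ ≤ 2 * (ENNReal.ofReal (4 * (ε ^ β) ^ 2 * A ^ 2) + ENNReal.ofReal (A ^ 2)) := by
          gcongr
          exact lintegral_le_of_norm_le _ hA hA₀ (by rw [← room_eq]; exact room_subset)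
      _ ≤ _ := by
          rw [show (2 : ℝ≥0∞) = ENNReal.ofReal 2 by simp,
            ← ENNReal.ofReal_add (by positivity) (by positivity),
            ← ENNReal.ofReal_mul (by positivity)]
          refine ENNReal.ofReal_le_ofReal ?_
          rw [show (ε ^ β / 2 - -(ε ^ β / 2)) * (ε ^ α + ε ^ β - ε ^ α) *
            (4 * ((ε ^ β)⁻¹ * A)) ^ 2 = 16 * A ^ 2 by field_simp; ring]
          have : (ε ^ β) ^ 2 ≤ 1 := pow_le_one₀ hb.le h.size_le_one
          nlinarith [mul_le_mul_of_nonneg_right this (sq_nonneg A), sq_nonneg A]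
  have hchan : Ioo (-(d / 2)) (d / 2) ×ˢ Ioo (-d) (ε ^ α + d) ⊆
      (waveguide ℓm ℓp α β γ ε : Set (ℝ × ℝ)) := by
    refine (Set.prod_mono le_rfl (Ioo_subset_Ioo ?_ ?_)).trans h.channel_subset
    · linarith [h.width_le]
    · linarith [h.width_le_size]
  have hgi : IntegrableOn g₂ (Ioo (-(d / 2)) (d / 2) ×ˢ Ioo 0 (ε ^ α)) := by
    have hL : MemLp g₂ 2 (volume.restrict (Ioo (-(d / 2)) (d / 2) ×ˢ Ioo 0 (ε ^ α))) :=
      (Lp.memLp g₂).mono_measure (Measure.restrict_mono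
        (by rw [← passage_eq]; exact passage_subset) le_rfl)
    have : IsFiniteMeasure (volume.restrict (Ioo (-(d / 2)) (d / 2) ×ˢ Ioo 0 (ε ^ α))) := ⟨by
      rw [Measure.restrict_apply_univ, Measure.volume_eq_prod, Measure.prod_prod]
      exact ENNReal.mul_lt_top (by simp) (by simp)⟩
    exact hL.integrable (by norm_num)
  have t3 : ‖(∫ p in passage α γ ε, g₂ p) - (d : ℂ) * (k1 - k0)‖ ≤ 7 * (d * A) := by
    have := w₂.flux_sub_sq_le m m₂ (I := ⟨Ioo (-(d / 2)) (d / 2), isOpen_Ioo⟩) (η := ε ^ α) hd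
      h.width_le_height (by
        change volume (Ioo (-(d / 2)) (d / 2)) = _
        rw [Real.volume_Ioo]; congr 1; ring) hchan hgi k0 k1
    rw [passage_eq, ← enorm_sq_le_ofReal_sq_iff (by positivity)]
    refine this.trans ?_
    calc _ ≤ 4 * (ENNReal.ofReal (4 * d ^ 2 * A ^ 2) + ENNReal.ofReal (4 * d ^ 2 * A ^ 2) +
          ENNReal.ofReal (4 * d ^ 2) * ENNReal.ofReal (A ^ 2)) := by
          gcongr
          · exact hk0
          · exact hk1
          · exact lintegral_le_of_norm_le _ hA hA₂ hchan
      _ ≤ _ := by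
          rw [show (4 : ℝ≥0∞) = ENNReal.ofReal 4 by simp, ← ENNReal.ofReal_mul (by positivity),
            ← ENNReal.ofReal_add (by positivity) (by positivity),
            ← ENNReal.ofReal_add (by positivity) (by positivity),
            ← ENNReal.ofReal_mul (by positivity)]
          refine ENNReal.ofReal_le_ofReal ?_
          nlinarith [mul_nonneg (sq_nonneg d) (sq_nonneg A)]
  -- The scaling behind the limit: width over height of the passage is `γ ε`, which makes `γ` the
  -- strength of the interaction.
  have hcd : (√ε * ε ^ α)⁻¹ * d = γ * √ε := by
    rw [hd_def, h.width_eq]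
    field_simp
    rw [Real.sq_sqrt hε.le, mul_comm]
  have hcd' : (((√ε * ε ^ α)⁻¹ : ℝ) : ℂ) * (d : ℂ) = (γ : ℂ) * (√ε : ℂ) := by
    exact_mod_cast congrArg (fun x : ℝ => (x : ℂ)) hcd
  set F := ∫ p in passage α γ ε, g₂ p with hF
  -- Path from the trace at `0` to the flux: trace, mean over side `ε`, mean at the lower mouth;
  -- then mean at the upper mouth, mean over the room, zero; finally the flux error. The constants
  -- add up as `4 + 6(n+1) + 6(n+1) + 4 + 7 = 12 n + 27`.
  have split : (γ : ℂ) * w0 + (((√ε * ε ^ α)⁻¹ : ℝ) : ℂ) * F =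
      (γ : ℂ) * (w0 - (√ε : ℂ) * km) + (γ : ℂ) * (√ε : ℂ) * (km - k0) +
      (γ : ℂ) * (√ε : ℂ) * (k1 - kp) + (γ : ℂ) * (√ε : ℂ) * kp +
      (((√ε * ε ^ α)⁻¹ : ℝ) : ℂ) * (F - (d : ℂ) * (k1 - k0)) := by
    linear_combination (k1 - k0) * hcd'
  rw [split]
  have nγ : ‖(γ : ℂ)‖ = γ := by rw [Complex.norm_real, Real.norm_of_nonneg h.gamma_pos.le]
  have nε : ‖(√ε : ℂ)‖ = √ε := by rw [Complex.norm_real, Real.norm_of_nonneg hs.le]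
  have nc : ‖(((√ε * ε ^ α)⁻¹ : ℝ) : ℂ)‖ = (√ε * ε ^ α)⁻¹ := by
    rw [Complex.norm_real, Real.norm_of_nonneg (by positivity)]
  have hγ := h.gamma_pos
  have x0 : √ε * A ≤ √ε * (ε ^ β)⁻¹ * A := by
    gcongr
    exact le_mul_of_one_le_right hs.le hρ
  have x1 : ‖(γ : ℂ) * (w0 - (√ε : ℂ) * km)‖ ≤ γ * (4 * (√ε * (ε ^ β)⁻¹ * A)) := by
    rw [norm_mul, nγ]
    gcongr
    exact t1.trans (by linarith)
  have x2 : ‖(γ : ℂ) * (√ε : ℂ) * (km - k0)‖ ≤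
      γ * √ε * (3 * (n + 1) * (ε ^ β)⁻¹ * (2 * A)) := by
    rw [norm_mul, norm_mul, nγ, nε]; gcongr
  have x3 : ‖(γ : ℂ) * (√ε : ℂ) * (k1 - kp)‖ ≤
      γ * √ε * (3 * (n + 1) * (ε ^ β)⁻¹ * (2 * A)) := by
    rw [norm_mul, norm_mul, nγ, nε, norm_sub_rev]; gcongr
  have x4 : ‖(γ : ℂ) * (√ε : ℂ) * kp‖ ≤ γ * √ε * (4 * ((ε ^ β)⁻¹ * A)) := by
    rw [norm_mul, norm_mul, nγ, nε]; gcongr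
  have x5 : ‖(((√ε * ε ^ α)⁻¹ : ℝ) : ℂ) * (F - (d : ℂ) * (k1 - k0))‖ ≤
      γ * (7 * (√ε * (ε ^ β)⁻¹ * A)) := by
    rw [norm_mul, nc]
    calc _ ≤ (√ε * ε ^ α)⁻¹ * (7 * (d * A)) := by gcongr
      _ = 7 * (((√ε * ε ^ α)⁻¹ * d) * A) := by ring
      _ = 7 * (γ * (√ε * A)) := by rw [hcd]; ring
      _ ≤ 7 * (γ * (√ε * (ε ^ β)⁻¹ * A)) := by gcongr
      _ = _ := by ring
  refine (norm_add_le _ _).trans ?_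
  refine (add_le_add (norm_add_le _ _) le_rfl).trans ?_
  refine (add_le_add (add_le_add (norm_add_le _ _) le_rfl) le_rfl).trans ?_
  refine (add_le_add (add_le_add (add_le_add (norm_add_le _ _) le_rfl) le_rfl) le_rfl).trans ?_
  refine (add_le_add (add_le_add (add_le_add (add_le_add x1 x2) x3) x4) x5).trans (le_of_eq ?_)
  ring

/-- Every `H¹`-function on the waveguide is close to the range of the embedding. -/
theorem exists_norm_sub_embedding_le (h : IsAdmissible ℓm ℓp α β γ ε) {e₀ : ℝ} (he : ε ≤ e₀)
    (he1 : e₀ ≤ 1) (hI : Ioo (-e₀) e₀ ⊆ (interval ℓm ℓp : Set ℝ))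
    (v : H1 (waveguide ℓm ℓp α β γ ε)) {A : ℝ} (hA : 0 ≤ A)
    (hA₀ : ‖(v : L2 (waveguide ℓm ℓp α β γ ε))‖ ≤ A)
    (hA₁ : ‖weakDeriv (waveguide ℓm ℓp α β γ ε) (1, 0) v‖ ≤ A)
    (hA₂ : ‖weakDeriv (waveguide ℓm ℓp α β γ ε) (0, 1) v‖ ≤ A) :
    ∃ z : H0 (interval ℓm ℓp),
      ‖(v : L2 (waveguide ℓm ℓp α β γ ε)) - embedding α β γ h.pos z‖ ^ 2 ≤
        (ε ^ 2 + 4 * (ε ^ β) ^ 2 + (4 + 10 / e₀) * ε ^ α) * A ^ 2 := by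
  have hε := h.pos
  have hb := h.size_pos
  have hh := h.height_pos
  have hd := h.width_pos
  have hs : 0 < √ε := Real.sqrt_pos.2 hε
  have he0 : 0 < e₀ := hε.trans_le he
  set d := γ * ε ^ (α + 1) with hd_def
  set g₁ := weakDeriv (waveguide ℓm ℓp α β γ ε) (1, 0) v with hg₁
  set g₂ := weakDeriv (waveguide ℓm ℓp α β γ ε) (0, 1) v with hg₂
  have w₁ : HasWeakDeriv (waveguide ℓm ℓp α β γ ε) (1, 0) (v : L2 (waveguide ℓm ℓp α β γ ε)) g₁ :=
    hasWeakDeriv_weakDeriv _ _ v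
  have w₂ : HasWeakDeriv (waveguide ℓm ℓp α β γ ε) (0, 1) (v : L2 (waveguide ℓm ℓp α β γ ε)) g₂ :=
    hasWeakDeriv_weakDeriv _ _ v
  have m := (Lp.stronglyMeasurable (v : L2 (waveguide ℓm ℓp α β γ ε))).measurable
  have m₁ := (Lp.stronglyMeasurable g₁).measurable
  have m₂ := (Lp.stronglyMeasurable g₂).measurable
  -- the strip
  let K : Opens ℝ := ⟨Ioo (-ε) 0, isOpen_Ioo⟩
  have s1 := w₂.ae_lintegral_enorm_sub_sq_le m m₂ (I := interval ℓm ℓp) (K := K) ordConnected_Ioo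
    strip_subset
  have s2 : ∀ᵐ y ∂volume.restrict (K : Set ℝ),
      ∫⁻ x in (interval ℓm ℓp : Set ℝ), ‖(v : L2 (waveguide ℓm ℓp α β γ ε)) (x, y)‖ₑ ^ 2 < ⊤ := by
    refine ae_lt_top ((m.enorm.pow_const 2).lintegral_prod_left') ?_
    rw [← setLIntegral_prod_enorm_sq_symm m]
    exact ((lintegral_le_of_norm_le _ hA hA₀ strip_subset).trans_lt ENNReal.ofReal_lt_top).ne
  have : NeBot (ae (volume.restrict (K : Set ℝ))) := by
    rw [ae_neBot, Ne, Measure.restrict_eq_zero]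
    change volume (Ioo (-ε) 0) ≠ 0
    simpa using hε
  -- A single typical slice `v(·, y)`, scaled by `√ε`, serves as first component. It need not be the
  -- best approximation, as the orthogonal projection replaces it later.
  obtain ⟨y, hy1, hy2⟩ := (s1.and s2).exists
  -- the room
  obtain ⟨k, hk⟩ := exists_lintegral_enorm_sub_const_sq_le w₁ w₂ m m₁ m₂
    (a := -(ε ^ β / 2)) (b := ε ^ β / 2) (c := ε ^ α) (d := ε ^ α + ε ^ β) (by linarith)
    (by linarith) (by rw [← room_eq]; exact room_subset)
  have hL : MemLp (fun x => (√ε : ℂ) * (v : L2 (waveguide ℓm ℓp α β γ ε)) (x, y)) 2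
      (volume.restrict (interval ℓm ℓp : Set ℝ)) := by
    refine MemLp.const_mul ⟨(m.comp measurable_prodMk_right).aestronglyMeasurable, ?_⟩ _
    rw [eLpNorm_lt_top_iff_lintegral_rpow_enorm_lt_top (by norm_num) (by norm_num)]
    norm_num
    exact hy2
  refine ⟨WithLp.toLp 2 (hL.toLp _, ((ε ^ β : ℝ) : ℂ) * k), ?_⟩
  set z : H0 (interval ℓm ℓp) := WithLp.toLp 2 (hL.toLp _, ((ε ^ β : ℝ) : ℂ) * k) with hz
  have hz1 : ∀ᵐ p : ℝ × ℝ, p ∈ strip ℓm ℓp ε →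
      z.fst p.1 = (√ε : ℂ) * (v : L2 (waveguide ℓm ℓp α β γ ε)) (p.1, y) :=
    ae_fst_of_ae hL.coeFn_toLp
  have tot : ‖(v : L2 (waveguide ℓm ℓp α β γ ε)) - embedding α β γ h.pos z‖ₑ ^ 2 =
      ∫⁻ p in (waveguide ℓm ℓp α β γ ε : Set (ℝ × ℝ)),
        ‖(v : L2 (waveguide ℓm ℓp α β γ ε)) p - embeddingFun α β ε z p‖ₑ ^ 2 := by
    rw [enorm_sq_eq_lintegral]
    refine lintegral_congr_ae ?_
    filter_upwards [Lp.coeFn_sub (v : L2 (waveguide ℓm ℓp α β γ ε)) (embedding α β γ h.pos z),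
      coeFn_embedding h.pos z] with p h1 h2
    rw [h1, Pi.sub_apply, h2]
  have bS : ∫⁻ p in strip ℓm ℓp ε,
      ‖(v : L2 (waveguide ℓm ℓp α β γ ε)) p - embeddingFun α β ε z p‖ₑ ^ 2 ≤
      ENNReal.ofReal (ε ^ 2 * A ^ 2) := by
    calc _ = ∫⁻ p in strip ℓm ℓp ε, ‖(v : L2 (waveguide ℓm ℓp α β γ ε)) p -
          (v : L2 (waveguide ℓm ℓp α β γ ε)) (p.1, y)‖ₑ ^ 2 := by
          refine lintegral_congr_ae ?_
          filter_upwards [(ae_restrict_iff' isOpen_strip.measurableSet).2 hz1,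
            ae_restrict_mem isOpen_strip.measurableSet] with p h1 h2
          rw [embeddingFun_strip hε h2, h1, ← mul_assoc, ← Complex.ofReal_mul,
            inv_mul_cancel₀ hs.ne', Complex.ofReal_one, one_mul]
      _ ≤ _ := hy1
      _ ≤ ENNReal.ofReal ε ^ 2 * ENNReal.ofReal (A ^ 2) := by
          gcongr
          · change volume (Ioo (-ε) 0) ≤ _
            simp
          · exact lintegral_le_of_norm_le _ hA hA₂ strip_subset
      _ = _ := by rw [← ENNReal.ofReal_pow hε.le, ← ENNReal.ofReal_mul (by positivity)]
  have bR : ∫⁻ p in room α β ε,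
      ‖(v : L2 (waveguide ℓm ℓp α β γ ε)) p - embeddingFun α β ε z p‖ₑ ^ 2 ≤
      ENNReal.ofReal (4 * (ε ^ β) ^ 2 * A ^ 2) := by
    rw [setLIntegral_congr_fun isOpen_room.measurableSet fun p hp => by
      rw [embeddingFun_room hε hp]]
    have e : (((ε ^ β)⁻¹ : ℝ) : ℂ) * z.snd = k := by
      change (((ε ^ β)⁻¹ : ℝ) : ℂ) * (((ε ^ β : ℝ) : ℂ) * k) = k
      rw [← mul_assoc, ← Complex.ofReal_mul, inv_mul_cancel₀ hb.ne', Complex.ofReal_one, one_mul]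
    rw [e, room_eq]
    refine hk.trans ?_
    rw [Real.volume_Ioo, Real.volume_Ioo, add_sub_cancel_left,
      show ε ^ β / 2 - -(ε ^ β / 2) = ε ^ β by ring]
    calc _ ≤ 2 * (ENNReal.ofReal (ε ^ β) ^ 2 * ENNReal.ofReal (A ^ 2) +
          ENNReal.ofReal (ε ^ β) ^ 2 * ENNReal.ofReal (A ^ 2)) := by
          gcongr
          · exact lintegral_le_of_norm_le _ hA hA₂ (by rw [← room_eq]; exact room_subset)
          · exact lintegral_le_of_norm_le _ hA hA₁ (by rw [← room_eq]; exact room_subset)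
      _ = _ := by
          rw [show (2 : ℝ≥0∞) = ENNReal.ofReal 2 by simp, ← ENNReal.ofReal_pow hb.le,
            ← ENNReal.ofReal_mul (by positivity), ← ENNReal.ofReal_add (by positivity)
            (by positivity), ← ENNReal.ofReal_mul (by positivity)]
          congr 1; ring
  -- the passage
  have bP : ∫⁻ p in passage α γ ε,
      ‖(v : L2 (waveguide ℓm ℓp α β γ ε)) p - embeddingFun α β ε z p‖ₑ ^ 2 ≤
      ENNReal.ofReal ((4 + 10 / e₀) * ε ^ α * A ^ 2) := by
    rw [setLIntegral_congr_fun isOpen_passage.measurableSet fun p hp => by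
      rw [embeddingFun_passage hε hp, sub_zero]]
    have hW : Ioo (-(d / 2)) (d / 2) ⊆ Ioo (-e₀) e₀ :=
      Ioo_subset_Ioo (by linarith [h.width_le]) (by linarith [h.width_le])
    -- Two comparisons reach the passage: `c1` moves horizontally inside the strip from a fixed
    -- window to the part under the passage, `c2` then moves vertically from there up into the
    -- passage.
    have c1 := w₁.mul_lintegral_fst_le m m₁ (I := ⟨Ioo (-e₀) e₀, isOpen_Ioo⟩) (K := K)
      ordConnected_Ioo ((Set.prod_mono hI le_rfl).trans strip_subset) (J := Ioo (-e₀) e₀)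
      (L := Ioo (-(d / 2)) (d / 2)) measurableSet_Ioo le_rfl measurableSet_Ioo hW
    have hchan : Ioo (-(d / 2)) (d / 2) ×ˢ Ioo (-ε) (ε ^ α) ⊆
      (waveguide ℓm ℓp α β γ ε : Set (ℝ × ℝ)) :=
      (Set.prod_mono le_rfl (Ioo_subset_Ioo le_rfl (by linarith))).trans h.channel_subset
    have c2 := w₂.mul_lintegral_snd_le m m₂ (I := ⟨Ioo (-(d / 2)) (d / 2), isOpen_Ioo⟩)
      (K := ⟨Ioo (-ε) (ε ^ α), isOpen_Ioo⟩)
      ordConnected_Ioo hchan (J := Ioo (-ε) 0) (L := Ioo 0 (ε ^ α)) measurableSet_Ioo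
      (Ioo_subset_Ioo le_rfl hh.le) measurableSet_Ioo (Ioo_subset_Ioo (by linarith) le_rfl)
    simp only [Opens.coe_mk, Real.volume_Ioo, K] at c1 c2
    rw [show e₀ - -e₀ = 2 * e₀ by ring, show d / 2 - -(d / 2) = d by ring] at c1
    rw [sub_zero, show (0 : ℝ) - -ε = ε by ring, show ε ^ α - -ε = ε ^ α + ε by ring] at c2
    -- Since `e₀ ≤ 1`, the right-hand side of `c1` is at most `d · 2 (A² + 4 A²)`, and `d ≤ ε`.
    have d1 : ∫⁻ p in Ioo (-(d / 2)) (d / 2) ×ˢ Ioo (-ε) 0,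
        ‖(v : L2 (waveguide ℓm ℓp α β γ ε)) p‖ₑ ^ 2 ≤ ENNReal.ofReal (5 * ε / e₀ * A ^ 2) := by
      refine (ENNReal.mul_le_mul_iff_right (a := ENNReal.ofReal (2 * e₀))
        (ENNReal.ofReal_pos.2 (by positivity)).ne' ENNReal.ofReal_ne_top).1 (c1.trans ?_)
      calc _ ≤ ENNReal.ofReal d * (2 * (ENNReal.ofReal (A ^ 2) + ENNReal.ofReal (2 * e₀) *
            (ENNReal.ofReal (2 * e₀) * ENNReal.ofReal (A ^ 2)))) := by
            gcongr
            · exact lintegral_le_of_norm_le _ hA hA₀ ((Set.prod_mono hI le_rfl).trans strip_subset)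
            · exact lintegral_le_of_norm_le _ hA hA₁ ((Set.prod_mono hI le_rfl).trans strip_subset)
        _ ≤ _ := by
            rw [show (2 : ℝ≥0∞) = ENNReal.ofReal 2 by simp, ← ENNReal.ofReal_mul (by positivity),
              ← ENNReal.ofReal_mul (by positivity), ← ENNReal.ofReal_add (by positivity)
              (by positivity), ← ENNReal.ofReal_mul (by positivity),
              ← ENNReal.ofReal_mul (by positivity), ← ENNReal.ofReal_mul (by positivity)]
            refine ENNReal.ofReal_le_ofReal ?_
            rw [show 2 * e₀ * (5 * ε / e₀ * A ^ 2) = 10 * (ε * A ^ 2) by field_simp; ring]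
            have e2 : e₀ ^ 2 ≤ 1 := pow_le_one₀ he0.le he1
            have e3 : d * A ^ 2 ≤ ε * A ^ 2 := by gcongr; exact h.width_le
            have e4 : e₀ ^ 2 * (d * A ^ 2) ≤ 1 * (d * A ^ 2) := by gcongr
            nlinarith
    rw [passage_eq]
    refine (ENNReal.mul_le_mul_iff_right (a := ENNReal.ofReal ε) (by simpa using hε)
      (by simp)).1 (c2.trans ?_)
    calc _ ≤ ENNReal.ofReal (ε ^ α) * (2 * (ENNReal.ofReal (5 * ε / e₀ * A ^ 2) +
          ENNReal.ofReal ε * (ENNReal.ofReal (ε ^ α + ε) * ENNReal.ofReal (A ^ 2)))) := by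
          gcongr
          exact lintegral_le_of_norm_le _ hA hA₂ hchan
      _ ≤ _ := by
          rw [show (2 : ℝ≥0∞) = ENNReal.ofReal 2 by simp, ← ENNReal.ofReal_mul (by positivity),
            ← ENNReal.ofReal_mul (by positivity), ← ENNReal.ofReal_add (by positivity)
            (by positivity), ← ENNReal.ofReal_mul (by positivity),
            ← ENNReal.ofReal_mul (by positivity), ← ENNReal.ofReal_mul (by positivity)]
          refine ENNReal.ofReal_le_ofReal ?_
          have e2 : (ε ^ α + ε) * (ε * ε ^ α * A ^ 2) ≤ 2 * (ε * ε ^ α * A ^ 2) := by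
            gcongr
            linarith [h.height_le_one, h.lt_one]
          rw [show ε * ((4 + 10 / e₀) * ε ^ α * A ^ 2) =
            4 * (ε * ε ^ α * A ^ 2) + ε ^ α * (2 * (5 * ε / e₀ * A ^ 2)) by ring]
          nlinarith
  have hT : ‖(v : L2 (waveguide ℓm ℓp α β γ ε)) - embedding α β γ h.pos z‖ₑ ^ 2 ≤
      ENNReal.ofReal ((ε ^ 2 + 4 * (ε ^ β) ^ 2 + (4 + 10 / e₀) * ε ^ α) * A ^ 2) := by
    rw [tot, setLIntegral_waveguide hε]
    refine (add_le_add (add_le_add bS bP) bR).trans (le_of_eq ?_)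
    rw [← ENNReal.ofReal_add (by positivity) (by positivity),
      ← ENNReal.ofReal_add (by positivity) (by positivity)]
    congr 1; ring
  rw [← ofReal_norm, ← ENNReal.ofReal_pow (norm_nonneg _)] at hT
  exact (ENNReal.ofReal_le_ofReal_iff (by positivity)).1 hT

end Flux

/-! ### Trial functions on the waveguide -/

section Trial

variable {ℓm ℓp : EReal} {α β γ ε : ℝ}

/-- For `u ∈ H¹(Ω₀) × ℂ` the function on the waveguide which is `ε^(-1/2) u₁(x₁)` on the strip, constant
on the room, and interpolates between the two in the passage. -/
theorem exists_trial (h : IsAdmissible ℓm ℓp α β γ ε) (u : dom0 (interval ℓm ℓp)) {U₁ : ℝ → ℂ}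
    (hae : (projH1 _ u : L2 (interval ℓm ℓp)) =ᵐ[volume.restrict (interval ℓm ℓp : Set ℝ)] U₁) :
    ∃ U : H1 (waveguide ℓm ℓp α β γ ε),
      (∀ᵐ p ∂volume.restrict (waveguide ℓm ℓp α β γ ε : Set (ℝ × ℝ)),
        (U : L2 (waveguide ℓm ℓp α β γ ε)) p =
          (interval ℓm ℓp : Set ℝ).indicator (fun x => (((√ε)⁻¹ : ℝ) : ℂ) * U₁ x) p.1 *
            ((1 - ramp (ε ^ α) p.2 : ℝ) : ℂ) +
          (Ioo (-1 : ℝ) 1).indicator (fun _ => (((ε ^ β)⁻¹ : ℝ) : ℂ) * (u : H0 (interval ℓm ℓp)).snd) p.1 *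
            (ramp (ε ^ α) p.2 : ℂ)) ∧
      (∀ᵐ p ∂volume.restrict (waveguide ℓm ℓp α β γ ε : Set (ℝ × ℝ)),
        weakDeriv (waveguide ℓm ℓp α β γ ε) (1, 0) U p =
          (interval ℓm ℓp : Set ℝ).indicator
            (fun x => (((√ε)⁻¹ : ℝ) : ℂ) * weakDeriv _ 1 (projH1 _ u) x) p.1 *
            ((1 - ramp (ε ^ α) p.2 : ℝ) : ℂ)) ∧
      (∀ᵐ p ∂volume.restrict (waveguide ℓm ℓp α β γ ε : Set (ℝ × ℝ)),
        weakDeriv (waveguide ℓm ℓp α β γ ε) (0, 1) U p =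
          ((Ioo (-1 : ℝ) 1).indicator (fun _ => (((ε ^ β)⁻¹ : ℝ) : ℂ) * (u : H0 (interval ℓm ℓp)).snd) p.1 -
          (interval ℓm ℓp : Set ℝ).indicator (fun x => (((√ε)⁻¹ : ℝ) : ℂ) * U₁ x) p.1) *
            rampDeriv (ε ^ α) p.2) := by
  have hh := h.height_pos
  set A : ℝ → ℂ := (interval ℓm ℓp : Set ℝ).indicator (fun x => (((√ε)⁻¹ : ℝ) : ℂ) * U₁ x) with hA
  set A' : ℝ → ℂ := (interval ℓm ℓp : Set ℝ).indicator
    (fun x => (((√ε)⁻¹ : ℝ) : ℂ) * weakDeriv _ 1 (projH1 _ u) x) with hA'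
  -- The constant of the room, cut off to `|x₁| < 1` so as to be square integrable. Where the
  -- cut-off would be felt, in the strip, the factor `ramp` vanishes.
  set B : ℝ → ℂ := (Ioo (-1 : ℝ) 1).indicator
    (fun _ => (((ε ^ β)⁻¹ : ℝ) : ℂ) * (u : H0 (interval ℓm ℓp)).snd) with hB
  have mΩ := (interval ℓm ℓp).isOpen.measurableSet
  have lA : MemLp A 2 volume := by
    rw [hA, memLp_indicator_iff_restrict mΩ]
    exact ((memLp_congr_ae hae).1 (Lp.memLp _)).const_mul _
  have lA' : MemLp A' 2 volume := by
    rw [hA', memLp_indicator_iff_restrict mΩ]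
    exact (Lp.memLp _).const_mul _
  have lB : MemLp B 2 volume := by
    rw [hB, memLp_indicator_iff_restrict measurableSet_Ioo]
    have : IsFiniteMeasure (volume.restrict (Ioo (-1 : ℝ) 1)) := ⟨by simp⟩
    exact memLp_const _
  have wA : HasWeakDeriv (interval ℓm ℓp) 1 A A' := by
    refine ((hasWeakDeriv_weakDeriv _ 1 (projH1 _ u)).smul (((√ε)⁻¹ : ℝ) : ℂ)).congr ?_ ?_
    · filter_upwards [hae, ae_restrict_mem mΩ] with x hx hxI
      rw [hA, indicator_of_mem hxI, Pi.smul_apply, hx, smul_eq_mul]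
    · filter_upwards [ae_restrict_mem mΩ] with x hxI
      rw [hA', indicator_of_mem hxI, Pi.smul_apply, smul_eq_mul]
  have wB : HasWeakDeriv ⟨Ioo (-1 : ℝ) 1, isOpen_Ioo⟩ 1 B 0 := by
    have hp : IsPrimitiveOn (Ioo (-1 : ℝ) 1) B 0 :=
      ⟨locallyIntegrableOn_zero, fun x hx y hy => by
        rw [hB, indicator_of_mem hx, indicator_of_mem hy]; simp⟩
    exact IsPrimitiveOn.hasWeakDeriv (Ω := ⟨Ioo (-1 : ℝ) 1, isOpen_Ioo⟩) ordConnected_Ioo hp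
  have hbd : ∀ z ∈ waveguide ℓm ℓp α β γ ε, z.2 ∈ Ioo (-2 : ℝ) 3 := fun z hz =>
    (h.bound_of_mem hz).1
  have mq : Measurable fun y => (ramp (ε ^ α) y : ℂ) :=
    (Complex.continuous_ofReal.comp continuous_ramp).measurable
  have mp : Measurable fun y => ((1 - ramp (ε ^ α) y : ℝ) : ℂ) :=
    (Complex.continuous_ofReal.comp (continuous_const.sub continuous_ramp)).measurable
  have nq : ∀ y, ‖(ramp (ε ^ α) y : ℂ)‖ ≤ 1 := fun y => by
    rw [Complex.norm_real, Real.norm_of_nonneg (ramp_nonneg y)]; exact ramp_le_one y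
  have np : ∀ y, ‖((1 - ramp (ε ^ α) y : ℝ) : ℂ)‖ ≤ 1 := fun y => by
    rw [Complex.norm_real, Real.norm_of_nonneg (by linarith [ramp_le_one (h := ε ^ α) y])]
    linarith [ramp_nonneg (h := ε ^ α) y]
  have md : Measurable fun y => -rampDeriv (ε ^ α) y := measurable_rampDeriv.neg
  have nd : ∀ y, ‖-rampDeriv (ε ^ α) y‖ ≤ (ε ^ α)⁻¹ := fun y => by
    rw [norm_neg]; exact norm_rampDeriv_le hh y
  have tA := memLp_tensor (Ω := waveguide ℓm ℓp α β γ ε) lA mp np hbd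
  have tA' := memLp_tensor (Ω := waveguide ℓm ℓp α β γ ε) lA' mp np hbd
  have tB := memLp_tensor (Ω := waveguide ℓm ℓp α β γ ε) lB mq nq hbd
  have tAd := memLp_tensor (Ω := waveguide ℓm ℓp α β γ ε) lA md nd hbd
  have tBd := memLp_tensor (Ω := waveguide ℓm ℓp α β γ ε) lB measurable_rampDeriv
    (norm_rampDeriv_le hh) hbd
  have loc : ∀ {f : ℝ × ℝ → ℂ},
      MemLp f 2 (volume.restrict (waveguide ℓm ℓp α β γ ε : Set (ℝ × ℝ))) →
      LocallyIntegrableOn f (waveguide ℓm ℓp α β γ ε : Set (ℝ × ℝ)) := fun hf =>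
    locallyIntegrableOn_of_locallyIntegrable_restrict (hf.locallyIntegrable (by norm_num))
  -- `1 - ramp` vanishes from height `ε ^ α` on, and below it the waveguide lies over `Ω₀`.
  have dA := wA.tensor_fst (k := fun y => ((1 - ramp (ε ^ α) y : ℝ) : ℂ)) (loc tA) (loc tA')
    (fun z hz hk => h.fst_mem_interval hz (by
      by_contra hc
      exact hk (by rw [ramp_of_le hh (not_lt.1 hc)]; simp)))
  have dB := wB.tensor_fst (k := fun y => (ramp (ε ^ α) y : ℂ)) (loc tB)
    (Ω := waveguide ℓm ℓp α β γ ε) (by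
      simp only [Pi.zero_apply, zero_mul]; exact locallyIntegrableOn_zero)
    (fun z hz hk => (h.bound_of_mem hz).2 (by
      by_contra hc
      exact hk (by rw [ramp_of_nonpos hh (not_lt.1 hc)]; simp)))
  have eA := (hasWeakDeriv_one_sub_ramp hh).tensor_snd (loc tA) (loc tAd)
  have eB := (hasWeakDeriv_ramp hh).tensor_snd (loc tB) (loc tBd)
  have d1 := dA.add dB
  have d2 := eA.add eB
  have c0 : (tA.add tB).toLp _ =ᵐ[volume.restrict (waveguide ℓm ℓp α β γ ε : Set (ℝ × ℝ))] _ :=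
    (tA.add tB).coeFn_toLp
  have c1 : tA'.toLp _ =ᵐ[volume.restrict (waveguide ℓm ℓp α β γ ε : Set (ℝ × ℝ))] _ :=
    tA'.coeFn_toLp
  have c2 : (tAd.add tBd).toLp _ =ᵐ[volume.restrict
      (waveguide ℓm ℓp α β γ ε : Set (ℝ × ℝ))] _ := (tAd.add tBd).coeFn_toLp
  have d1' := d1.congr c0.symm (g' := tA'.toLp _) (by
    filter_upwards [c1] with p hp
    rw [hp]; simp)
  have d2' := d2.congr c0.symm c2.symm
  refine ⟨⟨_, mem_H1_of_hasWeakDeriv_prod d1' d2'⟩, c0, ?_, ?_⟩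
  · rw [weakDeriv_eq ⟨_, mem_H1_of_hasWeakDeriv_prod d1' d2'⟩ _ d1']
    exact c1
  · rw [weakDeriv_eq ⟨_, mem_H1_of_hasWeakDeriv_prod d1' d2'⟩ _ d2']
    filter_upwards [c2] with p hp
    rw [hp, Pi.add_apply]; ring

theorem IsAdmissible.sqrt_passage (h : IsAdmissible ℓm ℓp α β γ ε) :
    √(γ * ε ^ (α + 1) * ε ^ α) = √γ * (√ε * ε ^ α) := by
  rw [h.width_eq, show γ * ε * ε ^ α * ε ^ α = γ * (ε * (ε ^ α) ^ 2) by ring,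
    Real.sqrt_mul h.gamma_pos.le, Real.sqrt_mul h.pos.le, Real.sqrt_sq h.height_pos.le]

theorem volume_passage (h : IsAdmissible ℓm ℓp α β γ ε) :
    volume (passage α γ ε) = ENNReal.ofReal (γ * ε ^ (α + 1) * ε ^ α) := by
  rw [passage_eq, volume_prod_eq, Real.volume_Ioo, Real.volume_Ioo,
    ← ENNReal.ofReal_mul (by linarith [h.width_pos])]
  congr 1; ring

/-- All errors of the trial function live in the passage, whose area is `γ ε (ε ^ α)²`. -/
theorem norm_le_of_passage (h : IsAdmissible ℓm ℓp α β γ ε) (F : L2 (waveguide ℓm ℓp α β γ ε))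
    {c : ℝ} (hc : 0 ≤ c)
    (hS : ∀ᵐ p ∂volume.restrict (waveguide ℓm ℓp α β γ ε : Set (ℝ × ℝ)),
      p ∈ strip ℓm ℓp ε → F p = 0)
    (hP : ∀ᵐ p ∂volume.restrict (waveguide ℓm ℓp α β γ ε : Set (ℝ × ℝ)),
      p ∈ passage α γ ε → ‖F p‖ ≤ c)
    (hR : ∀ᵐ p ∂volume.restrict (waveguide ℓm ℓp α β γ ε : Set (ℝ × ℝ)),
      p ∈ room α β ε → F p = 0) :
    ‖F‖ ≤ c * (√γ * (√ε * ε ^ α)) := by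
  have hd := h.width_pos
  have hh := h.height_pos
  have key : ∀ {T : Set (ℝ × ℝ)} {P : ℝ × ℝ → Prop}, IsOpen T →
      T ⊆ (waveguide ℓm ℓp α β γ ε : Set (ℝ × ℝ)) →
      (∀ᵐ p ∂volume.restrict (waveguide ℓm ℓp α β γ ε : Set (ℝ × ℝ)), p ∈ T → P p) →
      ∀ᵐ p ∂volume.restrict T, P p := by
    intro T P ho hsub hT
    filter_upwards [ae_restrict_of_ae_restrict_of_subset hsub hT,
      ae_restrict_mem ho.measurableSet] with p h1 h2
    exact h1 h2
  rw [← h.sqrt_passage, ← enorm_sq_le_ofReal_sq_iff (by positivity), enorm_sq_eq_lintegral,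
    setLIntegral_waveguide h.pos, mul_pow, Real.sq_sqrt (by positivity)]
  have e1 : ∫⁻ p in strip ℓm ℓp ε, ‖F p‖ₑ ^ 2 = 0 := by
    rw [lintegral_congr_ae (g := fun _ => 0)]
    · simp
    · filter_upwards [key isOpen_strip strip_subset hS] with p hp
      rw [hp]; simp
  have e3 : ∫⁻ p in room α β ε, ‖F p‖ₑ ^ 2 = 0 := by
    rw [lintegral_congr_ae (g := fun _ => 0)]
    · simp
    · filter_upwards [key isOpen_room room_subset hR] with p hp
      rw [hp]; simp
  have e2 : ∫⁻ p in passage α γ ε, ‖F p‖ₑ ^ 2 ≤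
      ENNReal.ofReal (c ^ 2) * volume (passage α γ ε) := by
    calc _ ≤ ∫⁻ _ in passage α γ ε, ENNReal.ofReal (c ^ 2) := by
          refine lintegral_mono_ae ?_
          filter_upwards [key isOpen_passage passage_subset hP] with p hp
          exact (enorm_sq_le_ofReal_sq_iff hc).2 hp
      _ = _ := by rw [setLIntegral_const]
  rw [e1, e3, zero_add, add_zero]
  refine e2.trans (le_of_eq ?_)
  rw [volume_passage h, ← ENNReal.ofReal_mul (by positivity)]

/-- The characteristic function of the passage. -/
noncomputable def passageIndicator (h : IsAdmissible ℓm ℓp α β γ ε) : L2 (waveguide ℓm ℓp α β γ ε) :=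
  indicatorConstLp 2 (s := passage α γ ε) isOpen_passage.measurableSet
    (((Measure.restrict_apply_le _ _).trans_lt (by
      rw [volume_passage h]; exact ENNReal.ofReal_lt_top)).ne) (1 : ℂ)

theorem inner_passageIndicator (h : IsAdmissible ℓm ℓp α β γ ε)
    (g : L2 (waveguide ℓm ℓp α β γ ε)) :
    inner ℂ g (passageIndicator h) = starRingEnd ℂ (∫ p in passage α γ ε, g p) := by
  rw [← inner_conj_symm]
  congr 1
  rw [passageIndicator, L2.inner_indicatorConstLp_one, Measure.restrict_restrict
    isOpen_passage.measurableSet, inter_eq_left.2 passage_subset]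

theorem coeFn_passageIndicator (h : IsAdmissible ℓm ℓp α β γ ε) :
    passageIndicator h =ᵐ[volume.restrict (waveguide ℓm ℓp α β γ ε : Set (ℝ × ℝ))]
      (passage α γ ε).indicator fun _ => (1 : ℂ) :=
  indicatorConstLp_coeFn

/-- The trial function of `exists_trial` together with the bounds it satisfies. -/
theorem exists_trial_bounds (h : IsAdmissible ℓm ℓp α β γ ε) (u : dom0 (interval ℓm ℓp))
    {U₁ : ℝ → ℂ} (hU₁ : IsPrimitiveOn (interval ℓm ℓp : Set ℝ) U₁ (weakDeriv _ 1 (projH1 _ u)))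
    (hae : (projH1 _ u : L2 (interval ℓm ℓp)) =ᵐ[volume.restrict (interval ℓm ℓp : Set ℝ)] U₁)
    (V₀ : Lp ℝ ∞ (volume.restrict (interval ℓm ℓp : Set ℝ)))
    {M : ℝ} (hM : 0 ≤ M) (hM₀ : ∀ x ∈ Ioo (-ε) ε, ‖U₁ x‖ ≤ M)
    (hM₁ : ∀ᵐ x, x ∈ Ioo (-ε) ε → ‖weakDeriv _ 1 (projH1 _ u) x‖ ≤ M)
    (hM₂ : ‖(u : H0 (interval ℓm ℓp)).snd‖ ≤ M) :
    ∃ U : H1 (waveguide ℓm ℓp α β γ ε),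
      ‖(U : L2 (waveguide ℓm ℓp α β γ ε)) - embedding α β γ h.pos u‖ ≤ 2 * √γ * ε ^ α * M ∧
      ‖weakDeriv (waveguide ℓm ℓp α β γ ε) (1, 0) U -
        embedding α β γ h.pos (WithLp.toLp 2 (weakDeriv _ 1 (projH1 _ u), 0))‖ ≤
          √γ * ε ^ α * M ∧
      ‖weakDeriv (waveguide ℓm ℓp α β γ ε) (0, 1) U +
        ((((√ε * ε ^ α)⁻¹ : ℝ) : ℂ) * U₁ 0) • passageIndicator h‖ ≤
          2 * √γ * (√ε * (ε ^ β)⁻¹) * M ∧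
      mulOp ((memLp_stripPotential α β γ ε V₀).toLp (stripPotential ℓm ℓp ε V₀))
        (U : L2 (waveguide ℓm ℓp α β γ ε)) =
        embedding α β γ h.pos (WithLp.toLp 2 (mulOp V₀ (projH1 _ u : L2 (interval ℓm ℓp)), 0)) := by
  have hε := h.pos
  have hb := h.size_pos
  have hh := h.height_pos
  have hd := h.width_pos
  have hγ := h.gamma_pos
  have hs : 0 < √ε := Real.sqrt_pos.2 hε
  have hsγ : 0 < √γ := Real.sqrt_pos.2 hγ
  obtain ⟨U, hU, hU1, hU2⟩ := exists_trial h u hae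
  -- Here `β < 1/2` enters: the contribution of the room is dominated by that of the strip.
  have hsb : √ε ≤ ε ^ β := by
    rw [Real.sqrt_eq_rpow]
    exact Real.rpow_le_rpow_of_exponent_ge hε h.lt_one.le h.beta_lt.le
  have hsb1 : √ε * (ε ^ β)⁻¹ ≤ 1 := by
    rw [← div_eq_mul_inv]; exact (div_le_one hb).2 hsb
  have hεs : ε ≤ √ε * (ε ^ β)⁻¹ := by
    have h1 : ε ≤ √ε := by
      have := Real.sqrt_le_one.2 h.lt_one.le
      nlinarith [Real.mul_self_sqrt hε.le]
    refine h1.trans (le_mul_of_one_le_right hs.le ?_)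
    exact (one_le_inv₀ hb).2 h.size_le_one
  have Wsub : ∀ p ∈ passage α γ ε, p.1 ∈ Ioo (-ε) ε ∧ p.1 ∈ (interval ℓm ℓp : Set ℝ) ∧
      p.1 ∈ Ioo (-1 : ℝ) 1 := by
    intro p hp
    rw [passage_eq] at hp
    have h1 := h.window_subset hp.1
    have h2 := h.lt_one
    exact ⟨⟨by linarith [h1.1], by linarith [h1.2]⟩,
      h.Icc_subset_interval ⟨by linarith [h1.1], by linarith [h1.2]⟩,
      ⟨by linarith [h1.1], by linarith [h1.2]⟩⟩
  have Rsub : ∀ p ∈ room α β ε, p.1 ∈ Ioo (-1 : ℝ) 1 := by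
    intro p hp
    rw [room_eq] at hp
    have h2 := h.size_le_one
    exact ⟨by linarith [hp.1.1], by linarith [hp.1.2]⟩
  have rS : ∀ p ∈ strip ℓm ℓp ε, ramp (ε ^ α) p.2 = 0 ∧ rampDeriv (ε ^ α) p.2 = 0 := fun p hp =>
    ⟨ramp_of_nonpos hh hp.2.2.le, indicator_of_notMem (fun h' => lt_asymm (show (0:ℝ) < p.2 from h'.1) hp.2.2) _⟩
  have rR : ∀ p ∈ room α β ε, ramp (ε ^ α) p.2 = 1 ∧ rampDeriv (ε ^ α) p.2 = 0 := fun p hp =>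
    ⟨ramp_of_le hh hp.2.1.le, indicator_of_notMem (fun h' => (show p.2 ≤ ε ^ α from h'.2).not_gt hp.2.1) _⟩
  have rP : ∀ p ∈ passage α γ ε, rampDeriv (ε ^ α) p.2 = (((ε ^ α)⁻¹ : ℝ) : ℂ) := fun p hp =>
    indicator_of_mem (show p.2 ∈ Ioc 0 (ε ^ α) from ⟨hp.2.1, hp.2.2.le⟩) _
  have nP : ∀ y, ‖((1 - ramp (ε ^ α) y : ℝ) : ℂ)‖ ≤ 1 ∧ ‖(ramp (ε ^ α) y : ℂ)‖ ≤ 1 := fun y => by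
    have h1 := ramp_le_one (h := ε ^ α) y
    have h2 := ramp_nonneg (h := ε ^ α) y
    rw [Complex.norm_real, Complex.norm_real, Real.norm_of_nonneg (by linarith),
      Real.norm_of_nonneg h2]
    exact ⟨by linarith, h1⟩
  have ns : ‖(((√ε)⁻¹ : ℝ) : ℂ)‖ = (√ε)⁻¹ := by
    rw [Complex.norm_real, Real.norm_of_nonneg (by positivity)]
  have nb : ‖(((ε ^ β)⁻¹ : ℝ) : ℂ)‖ = (ε ^ β)⁻¹ := by
    rw [Complex.norm_real, Real.norm_of_nonneg (by positivity)]
  have nh : ‖(((ε ^ α)⁻¹ : ℝ) : ℂ)‖ = (ε ^ α)⁻¹ := by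
    rw [Complex.norm_real, Real.norm_of_nonneg (by positivity)]
  have hu0 : ∀ᵐ p ∂volume.restrict (waveguide ℓm ℓp α β γ ε : Set (ℝ × ℝ)),
      p ∈ strip ℓm ℓp ε → (u : H0 (interval ℓm ℓp)).fst p.1 = U₁ p.1 :=
    ae_restrict_of_ae (ae_fst_of_ae hae)
  refine ⟨U, ?_, ?_, ?_, ?_⟩
  · have hsub : ∀ᵐ p ∂volume.restrict (waveguide ℓm ℓp α β γ ε : Set (ℝ × ℝ)),
        ((U : L2 (waveguide ℓm ℓp α β γ ε)) - embedding α β γ h.pos u :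
          L2 (waveguide ℓm ℓp α β γ ε)) p = (U : L2 (waveguide ℓm ℓp α β γ ε)) p -
          embeddingFun α β ε (u : H0 (interval ℓm ℓp)) p := by
      filter_upwards [Lp.coeFn_sub (U : L2 (waveguide ℓm ℓp α β γ ε)) (embedding α β γ h.pos u),
        coeFn_embedding h.pos (u : H0 (interval ℓm ℓp))] with p h1 h2
      rw [h1, Pi.sub_apply, h2]
    -- The embedded function vanishes in the passage, so there the error is the trial function
    -- itself, of size `M / √ε + M / ε ^ β`.
    refine (norm_le_of_passage h _ (c := (√ε)⁻¹ * M + (ε ^ β)⁻¹ * M) (by positivity)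
      ?_ ?_ ?_).trans ?_
    · filter_upwards [hsub, hU, hu0] with p h1 h2 h3 hp
      rw [h1, h2, embeddingFun_strip hε hp, h3 hp, (rS p hp).1, indicator_of_mem hp.1]
      simp
    · filter_upwards [hsub, hU] with p h1 h2 hp
      obtain ⟨w1, w2, w3⟩ := Wsub p hp
      rw [h1, h2, embeddingFun_passage hε hp, sub_zero, indicator_of_mem w2, indicator_of_mem w3]
      refine (norm_add_le _ _).trans ?_
      rw [norm_mul, norm_mul, norm_mul, norm_mul, ns, nb]
      have n1 := nP p.2
      have n2 := hM₀ _ w1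
      calc _ ≤ (√ε)⁻¹ * M * 1 + (ε ^ β)⁻¹ * M * 1 := by
            gcongr
            · exact n1.1
            · exact n1.2
        _ = _ := by ring
    · filter_upwards [hsub, hU] with p h1 h2 hp
      rw [h1, h2, embeddingFun_room hε hp, (rR p hp).1, indicator_of_mem (Rsub p hp)]
      simp
    · calc ((√ε)⁻¹ * M + (ε ^ β)⁻¹ * M) * (√γ * (√ε * ε ^ α))
          = √γ * ε ^ α * M * (1 + √ε * (ε ^ β)⁻¹) := by field_simp
        _ ≤ √γ * ε ^ α * M * (1 + 1) := by gcongr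
        _ = _ := by ring
  · set f : H0 (interval ℓm ℓp) := WithLp.toLp 2 (weakDeriv _ 1 (projH1 _ u), 0) with hf
    have hsub : ∀ᵐ p ∂volume.restrict (waveguide ℓm ℓp α β γ ε : Set (ℝ × ℝ)),
        (weakDeriv (waveguide ℓm ℓp α β γ ε) (1, 0) U - embedding α β γ h.pos f :
          L2 (waveguide ℓm ℓp α β γ ε)) p = weakDeriv (waveguide ℓm ℓp α β γ ε) (1, 0) U p -
          embeddingFun α β ε f p := by
      filter_upwards [Lp.coeFn_sub (weakDeriv (waveguide ℓm ℓp α β γ ε) (1, 0) U)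
        (embedding α β γ h.pos f), coeFn_embedding h.pos f] with p h1 h2
      rw [h1, Pi.sub_apply, h2]
    refine (norm_le_of_passage h _ (c := (√ε)⁻¹ * M) (by positivity) ?_ ?_ ?_).trans ?_
    · filter_upwards [hsub, hU1] with p h1 h2 hp
      rw [h1, h2, embeddingFun_strip hε hp, (rS p hp).1, indicator_of_mem hp.1, hf]
      simp
    · have hM₁' : ∀ᵐ p : ℝ × ℝ, p.1 ∈ Ioo (-ε) ε → ‖weakDeriv _ 1 (projH1 _ u) p.1‖ ≤ M :=
        Measure.quasiMeasurePreserving_fst.ae hM₁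
      filter_upwards [hsub, hU1, ae_restrict_of_ae hM₁'] with p h1 h2 h3 hp
      obtain ⟨w1, w2, w3⟩ := Wsub p hp
      rw [h1, h2, embeddingFun_passage hε hp, sub_zero, indicator_of_mem w2]
      rw [norm_mul, norm_mul, ns]
      have n1 := nP p.2
      have n2 := h3 w1
      calc _ ≤ (√ε)⁻¹ * M * 1 := by
            gcongr
            exact n1.1
        _ = _ := by ring
    · filter_upwards [hsub, hU1] with p h1 h2 hp
      rw [h1, h2, embeddingFun_room hε hp, (rR p hp).1, hf]
      simp
    · refine le_of_eq ?_
      field_simp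
  · have hsub : ∀ᵐ p ∂volume.restrict (waveguide ℓm ℓp α β γ ε : Set (ℝ × ℝ)),
        (weakDeriv (waveguide ℓm ℓp α β γ ε) (0, 1) U +
          ((((√ε * ε ^ α)⁻¹ : ℝ) : ℂ) * U₁ 0) • passageIndicator h :
          L2 (waveguide ℓm ℓp α β γ ε)) p = weakDeriv (waveguide ℓm ℓp α β γ ε) (0, 1) U p +
          ((((√ε * ε ^ α)⁻¹ : ℝ) : ℂ) * U₁ 0) * (passage α γ ε).indicator (fun _ => (1 : ℂ)) p := by
      filter_upwards [Lp.coeFn_add (weakDeriv (waveguide ℓm ℓp α β γ ε) (0, 1) U)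
        (((((√ε * ε ^ α)⁻¹ : ℝ) : ℂ) * U₁ 0) • passageIndicator h),
        Lp.coeFn_smul ((((√ε * ε ^ α)⁻¹ : ℝ) : ℂ) * U₁ 0) (passageIndicator h),
        coeFn_passageIndicator h] with p h1 h2 h3
      rw [h1, Pi.add_apply, h2, Pi.smul_apply, h3, smul_eq_mul]
    have dP : ∀ p ∈ passage α γ ε, p ∉ strip ℓm ℓp ε ∧ p ∉ room α β ε := fun p hp =>
      ⟨Set.disjoint_right.1 disjoint_strip_passage hp,
        Set.disjoint_left.1 (disjoint_room (ℓm := ℓm) (ℓp := ℓp) hε) (Or.inr hp)⟩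
    -- After adding the constant slope, two terms remain in the passage: the constant from the room
    -- and the variation of `U₁` around `0`, both divided by the height.
    refine (norm_le_of_passage h _
      (c := (ε ^ α)⁻¹ * ((ε ^ β)⁻¹ * M + (√ε)⁻¹ * (ε * M))) (by positivity) ?_ ?_ ?_).trans ?_
    · filter_upwards [hsub, hU2] with p h1 h2 hp
      rw [h1, h2, (rS p hp).2, indicator_of_notMem (s := passage α γ ε) (fun h' => (dP p h').1 hp)]
      simp
    · filter_upwards [hsub, hU2] with p h1 h2 hp
      obtain ⟨w1, w2, w3⟩ := Wsub p hp
      -- The pointwise bound on the derivative gives a variation of order `ε`; an `L²` bound alone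
      -- would give only `√ε`, and after division by `√ε` no smallness.
      have e : ‖U₁ p.1 - U₁ 0‖ ≤ ε * M := by
        have hI : Ioo (-ε) ε ⊆ (interval ℓm ℓp : Set ℝ) :=
          Ioo_subset_Icc_self.trans h.Icc_subset_interval
        have z0 : (0 : ℝ) ∈ Ioo (-ε) ε := ⟨by linarith, hε⟩
        rw [hU₁.2 0 (hI z0) p.1 w2]
        refine (intervalIntegral.norm_integral_le_of_norm_le_const_ae (C := M) ?_).trans ?_
        · filter_upwards [hM₁] with x hx hx'
          exact hx ((ordConnected_Ioo.uIcc_subset z0 w1) (uIoc_subset_uIcc hx'))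
        · rw [sub_zero, mul_comm]
          gcongr
          exact abs_le.2 ⟨w1.1.le, w1.2.le⟩
      rw [h1, h2, indicator_of_mem w2, indicator_of_mem w3, indicator_of_mem hp, rP p hp]
      have e2 : ((((ε ^ β)⁻¹ : ℝ) : ℂ) * (u : H0 (interval ℓm ℓp)).snd -
          (((√ε)⁻¹ : ℝ) : ℂ) * U₁ p.1) * (((ε ^ α)⁻¹ : ℝ) : ℂ) +
          (((√ε * ε ^ α)⁻¹ : ℝ) : ℂ) * U₁ 0 * 1 =
          (((ε ^ α)⁻¹ : ℝ) : ℂ) * ((((ε ^ β)⁻¹ : ℝ) : ℂ) * (u : H0 (interval ℓm ℓp)).snd -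
          (((√ε)⁻¹ : ℝ) : ℂ) * (U₁ p.1 - U₁ 0)) := by
        rw [mul_inv, Complex.ofReal_mul]; ring
      rw [e2, norm_mul, nh]
      gcongr
      refine (norm_sub_le _ _).trans ?_
      rw [norm_mul, norm_mul, ns, nb]
      gcongr
    · filter_upwards [hsub, hU2] with p h1 h2 hp
      rw [h1, h2, (rR p hp).2, indicator_of_notMem (s := passage α γ ε) (fun h' => (dP p h').2 hp)]
      simp
    · calc (ε ^ α)⁻¹ * ((ε ^ β)⁻¹ * M + (√ε)⁻¹ * (ε * M)) * (√γ * (√ε * ε ^ α))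
          = √γ * M * (√ε * (ε ^ β)⁻¹ + ε) := by field_simp
        _ ≤ √γ * M * (√ε * (ε ^ β)⁻¹ + √ε * (ε ^ β)⁻¹) := by gcongr
        _ = _ := by ring
  · refine Lp.ext ?_
    have hV : ∀ᵐ p ∂volume.restrict (waveguide ℓm ℓp α β γ ε : Set (ℝ × ℝ)),
        p ∈ strip ℓm ℓp ε → mulOp V₀ (projH1 _ u : L2 (interval ℓm ℓp)) p.1 =
          (V₀ p.1 : ℂ) * U₁ p.1 := by
      refine ae_restrict_of_ae (ae_fst_of_ae (P := fun x => mulOp V₀ (projH1 _ u : L2 (interval ℓm ℓp)) x =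
        (V₀ x : ℂ) * U₁ x) ?_)
      filter_upwards [coeFn_mulOp V₀ (projH1 _ u : L2 (interval ℓm ℓp)), hae] with x h1 h2
      rw [h1, h2]
    filter_upwards [coeFn_mulOp ((memLp_stripPotential α β γ ε V₀).toLp (stripPotential ℓm ℓp ε V₀))
        (U : L2 (waveguide ℓm ℓp α β γ ε)), (memLp_stripPotential α β γ ε V₀).coeFn_toLp, hU, hV,
      coeFn_embedding h.pos (WithLp.toLp 2 (mulOp V₀ (projH1 _ u : L2 (interval ℓm ℓp)), 0))]
      with p h1 h2 h3 h4 h5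
    have e : (room α β ε).indicator (fun _ : ℝ × ℝ => (((ε ^ β)⁻¹ : ℝ) : ℂ) *
        (WithLp.toLp 2 (mulOp V₀ (projH1 _ u : L2 (interval ℓm ℓp)), (0 : ℂ)) :
          H0 (interval ℓm ℓp)).snd) p = 0 := by simp
    rw [h1, h2, h5]
    unfold stripPotential embeddingFun
    rw [e, add_zero]
    by_cases hp : p ∈ strip ℓm ℓp ε
    · rw [indicator_of_mem hp, indicator_of_mem hp, h3, (rS p hp).1, indicator_of_mem hp.1]
      have e' := h4 hp
      change _ = (((√ε)⁻¹ : ℝ) : ℂ) * mulOp V₀ (projH1 _ u : L2 (interval ℓm ℓp)) p.1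
      rw [e']
      push_cast
      ring
    · rw [indicator_of_notMem hp, indicator_of_notMem hp]
      simp

end Trial

/-! ### Multiplication operators: symmetry and positivity -/

section Multiplication

variable {E : Type*} [MeasurableSpace E] {μ : Measure E}

theorem inner_mulOp_left (V : Lp ℝ ∞ μ) (u v : Lp ℂ 2 μ) :
    inner ℂ (mulOp V u) v = inner ℂ u (mulOp V v) := by
  rw [inner_eq_integral _ _ (coeFn_mulOp V u) (EventuallyEq.refl _ v),
    inner_eq_integral _ _ (EventuallyEq.refl _ u) (coeFn_mulOp V v)]
  refine integral_congr_ae (Eventually.of_forall fun x => ?_)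
  simp only [map_mul, Complex.conj_ofReal]
  ring

theorem re_inner_mulOp_nonneg {V : Lp ℝ ∞ μ} (hV : 0 ≤ᵐ[μ] V) (u : Lp ℂ 2 μ) :
    0 ≤ (inner ℂ u (mulOp V u) : ℂ).re := by
  rw [inner_eq_integral _ _ (EventuallyEq.refl _ u) (coeFn_mulOp V u)]
  have e : ∀ x, (V x : ℂ) * u x * starRingEnd ℂ (u x) = ((V x * ‖u x‖ ^ 2 : ℝ) : ℂ) := fun x => by
    rw [mul_assoc, Complex.mul_conj']
    push_cast
    ring
  simp only [e]
  rw [integral_complex_ofReal, Complex.ofReal_re]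
  refine integral_nonneg_of_ae ?_
  filter_upwards [hV] with x hx
  have : (0 : ℝ) ≤ V x := hx
  change (0 : ℝ) ≤ V x * ‖u x‖ ^ 2
  positivity

end Multiplication

/-! ### Energy of the resolvent on the waveguide -/

section Forms

variable {Ω : Opens (ℝ × ℝ)} {V : Lp ℝ ∞ (volume.restrict (Ω : Set (ℝ × ℝ)))}

theorem schrodingerForm_apply (u v : H1 Ω) :
    (schrodingerForm Ω V).form u v =
      inner ℂ (weakDeriv Ω (1, 0) v) (weakDeriv Ω (1, 0) u) +
      inner ℂ (weakDeriv Ω (0, 1) v) (weakDeriv Ω (0, 1) u) +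
      inner ℂ (v : L2 Ω) (mulOp V (u : L2 Ω)) := rfl

theorem schrodingerForm_conj (u v : H1 Ω) :
    starRingEnd ℂ ((schrodingerForm Ω V).form u v) = (schrodingerForm Ω V).form v u := by
  rw [schrodingerForm_apply, schrodingerForm_apply, map_add, map_add, inner_conj_symm,
    inner_conj_symm, inner_conj_symm, inner_mulOp_left]

/-- The energy of the resolvent. -/
theorem energy_le {R : L2 Ω →L[ℂ] L2 Ω} (hR : IsFormResolvent (schrodingerForm Ω V) R)
    (hV : 0 ≤ᵐ[volume.restrict (Ω : Set (ℝ × ℝ))] V) (g : L2 Ω) :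
    ‖R g‖ ^ 2 + ‖weakDeriv Ω (1, 0) ⟨R g, hR.mem_dom g⟩‖ ^ 2 +
      ‖weakDeriv Ω (0, 1) ⟨R g, hR.mem_dom g⟩‖ ^ 2 ≤ (inner ℂ (R g) g : ℂ).re := by
  have h : inner ℂ (weakDeriv Ω (1, 0) ⟨R g, hR.mem_dom g⟩) (weakDeriv Ω (1, 0) ⟨R g, hR.mem_dom g⟩) +
      inner ℂ (weakDeriv Ω (0, 1) ⟨R g, hR.mem_dom g⟩) (weakDeriv Ω (0, 1) ⟨R g, hR.mem_dom g⟩) +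
      inner ℂ (R g) (mulOp V (R g)) + inner ℂ (R g) (R g) = (inner ℂ (R g) g : ℂ) :=
    hR.form_eq g ⟨R g, hR.mem_dom g⟩
  rw [inner_self_eq_norm_sq_to_K, inner_self_eq_norm_sq_to_K,
    inner_self_eq_norm_sq_to_K] at h
  have h' := congrArg Complex.re h
  have hn := re_inner_mulOp_nonneg hV (R g)
  simp only [Complex.add_re] at h'
  have e : ∀ r : ℝ, (((r : ℂ)) ^ 2).re = r ^ 2 := fun r => by
    rw [← Complex.ofReal_pow, Complex.ofReal_re]
  have e' : ∀ r : ℝ, (((RCLike.ofReal r : ℂ)) ^ 2).re = r ^ 2 := e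
  rw [e', e', e'] at h'
  linarith

/-- The energy is at most `‖R g‖ ‖g‖`; its first term yields `‖R g‖ ≤ ‖g‖`, which in turn bounds the
derivatives. -/
theorem norm_resolvent_le {R : L2 Ω →L[ℂ] L2 Ω} (hR : IsFormResolvent (schrodingerForm Ω V) R)
    (hV : 0 ≤ᵐ[volume.restrict (Ω : Set (ℝ × ℝ))] V) (g : L2 Ω) :
    ‖R g‖ ≤ ‖g‖ ∧ ‖weakDeriv Ω (1, 0) ⟨R g, hR.mem_dom g⟩‖ ≤ ‖g‖ ∧
      ‖weakDeriv Ω (0, 1) ⟨R g, hR.mem_dom g⟩‖ ≤ ‖g‖ := by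
  have h := energy_le hR hV g
  have h1 : (inner ℂ (R g) g : ℂ).re ≤ ‖R g‖ * ‖g‖ :=
    (Complex.re_le_norm _).trans (norm_inner_le_norm _ _)
  have a0 := norm_nonneg (R g)
  have a1 := norm_nonneg g
  have h0 : ‖R g‖ ≤ ‖g‖ := by
    by_contra! hc
    nlinarith [sq_nonneg ‖weakDeriv Ω (1, 0) ⟨R g, hR.mem_dom g⟩‖,
      sq_nonneg ‖weakDeriv Ω (0, 1) ⟨R g, hR.mem_dom g⟩‖]
  have h2 : ‖R g‖ * ‖g‖ ≤ ‖g‖ ^ 2 := by rw [sq]; gcongr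
  refine ⟨h0, ?_, ?_⟩ <;> refine (sq_le_sq₀ (norm_nonneg _) (norm_nonneg _)).1 ?_ <;>
    nlinarith [sq_nonneg ‖weakDeriv Ω (1, 0) ⟨R g, hR.mem_dom g⟩‖,
      sq_nonneg ‖weakDeriv Ω (0, 1) ⟨R g, hR.mem_dom g⟩‖, sq_nonneg ‖R g‖]

end Forms

/-! ### Comparison of forms and resolvents -/

section Comparison

variable {ℓm ℓp : EReal} {α β γ ε : ℝ}

/-- The two forms nearly agree when one argument is a trial function. -/
theorem norm_form_sub_form_le (hm : ℓm < 0) (hp : 0 < ℓp) (h : IsAdmissible ℓm ℓp α β γ ε)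
    (V₀ : Lp ℝ ∞ (volume.restrict (interval ℓm ℓp : Set ℝ)))
    {V : Lp ℝ ∞ (volume.restrict (waveguide ℓm ℓp α β γ ε : Set (ℝ × ℝ)))}
    (u : dom0 (interval ℓm ℓp)) (U v : H1 (waveguide ℓm ℓp α β γ ε)) {z : ℂ}
    (hz : evalAt (ordConnected_interval ℓm ℓp) (zero_mem_interval hm hp) (projH1 _ u) = z)
    {M A r₁ r₂ : ℝ} (hM : ‖z‖ ≤ M)
    (hU₁ : ‖weakDeriv (waveguide ℓm ℓp α β γ ε) (1, 0) U -
        embedding α β γ h.pos (WithLp.toLp 2 (weakDeriv _ 1 (projH1 _ u), 0))‖ ≤ r₁)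
    (hU₂ : ‖weakDeriv (waveguide ℓm ℓp α β γ ε) (0, 1) U +
        ((((√ε * ε ^ α)⁻¹ : ℝ) : ℂ) * z) • passageIndicator h‖ ≤ r₂)
    (hU₃ : mulOp V (U : L2 (waveguide ℓm ℓp α β γ ε)) =
        embedding α β γ h.pos (WithLp.toLp 2 (mulOp V₀ (projH1 _ u : L2 (interval ℓm ℓp)), 0)))
    (hA : 0 ≤ A)
    (hA₀ : ‖(v : L2 (waveguide ℓm ℓp α β γ ε))‖ ≤ A)
    (hA₁ : ‖weakDeriv (waveguide ℓm ℓp α β γ ε) (1, 0) v‖ ≤ A)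
    (hA₂ : ‖weakDeriv (waveguide ℓm ℓp α β γ ε) (0, 1) v‖ ≤ A) {n : ℕ}
    (hn : α + 2 ≤ β * (n + 1)) :
    ‖(limitForm (ordConnected_interval ℓm ℓp) (zero_mem_interval hm hp) γ V₀).form u
        ⟨_, adjoint_mem_dom0 h.pos v⟩ -
      (schrodingerForm (waveguide ℓm ℓp α β γ ε) V).form U v‖ ≤
      (γ * (12 * n + 27) * (√ε * (ε ^ β)⁻¹) * M + r₁ + r₂) * A := by
  set J' := ContinuousLinearMap.adjoint (embedding (ℓm := ℓm) (ℓp := ℓp) α β γ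
    h.pos).toContinuousLinearMap with hJ'
  have hadj : ∀ (x : L2 (waveguide ℓm ℓp α β γ ε)) (y : L2 (interval ℓm ℓp)),
      inner ℂ (J' x).fst y = inner ℂ x (embedding α β γ h.pos (WithLp.toLp 2 (y, 0))) := by
    intro x y
    have := ContinuousLinearMap.adjoint_inner_left
      (embedding (ℓm := ℓm) (ℓp := ℓp) α β γ h.pos).toContinuousLinearMap
      (WithLp.toLp 2 (y, 0)) x
    rw [← hJ', WithLp.prod_inner_apply] at this
    simpa using this
  set w0 := evalAt (ordConnected_interval ℓm ℓp) (zero_mem_interval hm hp)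
    ⟨_, adjoint_mem_dom0 h.pos v⟩ with hw0
  have e0 : (limitForm (ordConnected_interval ℓm ℓp) (zero_mem_interval hm hp) γ V₀).form u
      ⟨_, adjoint_mem_dom0 h.pos v⟩ =
      inner ℂ (weakDeriv (interval ℓm ℓp) 1 ⟨_, adjoint_mem_dom0 h.pos v⟩)
        (weakDeriv (interval ℓm ℓp) 1 (projH1 _ u)) +
      inner ℂ (J' (v : L2 (waveguide ℓm ℓp α β γ ε))).fst
        (mulOp V₀ (projH1 _ u : L2 (interval ℓm ℓp))) +
      (γ : ℂ) * (inner ℂ w0 z : ℂ) := by rw [← hz]; rfl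
  rw [e0, weakDeriv_adjoint, ← hJ', hadj, hadj, ← hU₃, schrodingerForm_apply]
  set X := embedding α β γ h.pos (WithLp.toLp 2 (weakDeriv (interval ℓm ℓp) 1 (projH1 _ u), 0))
    with hX
  set c : ℂ := (((√ε * ε ^ α)⁻¹ : ℝ) : ℂ) with hc
  set v₁ := weakDeriv (waveguide ℓm ℓp α β γ ε) (1, 0) v with hv₁
  set v₂ := weakDeriv (waveguide ℓm ℓp α β γ ε) (0, 1) v with hv₂
  have hflux := norm_flux_add_le h (zero_mem_interval hm hp) v hA hA₀ hA₁ hA₂ hn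
  rw [← hw0, ← hc, ← hv₂] at hflux
  -- The potential terms cancel exactly, the horizontal ones up to the error of `U`. The point
  -- interaction and the mean slope of `U` combine into the quantity bounded by `norm_flux_add_le`.
  have key : inner ℂ v₁ X + inner ℂ (v : L2 (waveguide ℓm ℓp α β γ ε))
        (mulOp V (U : L2 (waveguide ℓm ℓp α β γ ε))) + (γ : ℂ) * (inner ℂ w0 z : ℂ) -
      (inner ℂ v₁ (weakDeriv (waveguide ℓm ℓp α β γ ε) (1, 0) U) +
        inner ℂ v₂ (weakDeriv (waveguide ℓm ℓp α β γ ε) (0, 1) U) +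
        inner ℂ (v : L2 (waveguide ℓm ℓp α β γ ε)) (mulOp V (U : L2 (waveguide ℓm ℓp α β γ ε)))) =
      z * starRingEnd ℂ ((γ : ℂ) * w0 + c * ∫ p in passage α γ ε, v₂ p) -
      inner ℂ v₁ (weakDeriv (waveguide ℓm ℓp α β γ ε) (1, 0) U - X) -
      inner ℂ v₂ (weakDeriv (waveguide ℓm ℓp α β γ ε) (0, 1) U +
        (c * z) • passageIndicator h) := by
    rw [inner_sub_right, inner_add_right, inner_smul_right, inner_passageIndicator,
      RCLike.inner_apply, map_add, map_mul, map_mul, Complex.conj_ofReal, hc, Complex.conj_ofReal]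
    ring
  rw [key]
  refine (norm_sub_le _ _).trans ((add_le_add (norm_sub_le _ _) le_rfl).trans ?_)
  have b1 : ‖z * starRingEnd ℂ ((γ : ℂ) * w0 + c * ∫ p in passage α γ ε, v₂ p)‖ ≤
      M * (γ * (12 * n + 27) * (√ε * (ε ^ β)⁻¹) * A) := by
    rw [norm_mul, RCLike.norm_conj]
    gcongr
    exact (norm_nonneg _).trans hM
  have b2 : ‖(inner ℂ v₁ (weakDeriv (waveguide ℓm ℓp α β γ ε) (1, 0) U - X) : ℂ)‖ ≤ A * r₁ :=
    (norm_inner_le_norm _ _).trans (by gcongr)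
  have b3 : ‖(inner ℂ v₂ (weakDeriv (waveguide ℓm ℓp α β γ ε) (0, 1) U +
        (c * z) • passageIndicator h) : ℂ)‖ ≤ A * r₂ :=
    (norm_inner_le_norm _ _).trans (by gcongr)
  calc _ ≤ M * (γ * (12 * n + 27) * (√ε * (ε ^ β)⁻¹) * A) + A * r₁ + A * r₂ :=
        add_le_add (add_le_add b1 b2) b3
    _ = _ := by ring

/-- The resolvents are close on the range of the embedding. -/
theorem norm_resolvent_embedding_sub_le (hm : ℓm < 0) (hp : 0 < ℓp)
    (h : IsAdmissible ℓm ℓp α β γ ε)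
    {V₀ : Lp ℝ ∞ (volume.restrict (interval ℓm ℓp : Set ℝ))}
    {V : Lp ℝ ∞ (volume.restrict (waveguide ℓm ℓp α β γ ε : Set (ℝ × ℝ)))}
    (hV : 0 ≤ᵐ[volume.restrict (waveguide ℓm ℓp α β γ ε : Set (ℝ × ℝ))] V)
    {R₀ : H0 (interval ℓm ℓp) →L[ℂ] H0 (interval ℓm ℓp)}
    (hR₀ : IsFormResolvent
      (limitForm (ordConnected_interval ℓm ℓp) (zero_mem_interval hm hp) γ V₀) R₀)
    {R : L2 (waveguide ℓm ℓp α β γ ε) →L[ℂ] L2 (waveguide ℓm ℓp α β γ ε)}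
    (hR : IsFormResolvent (schrodingerForm (waveguide ℓm ℓp α β γ ε) V) R)
    (f : H0 (interval ℓm ℓp)) (U : H1 (waveguide ℓm ℓp α β γ ε)) {z : ℂ}
    (hz : evalAt (ordConnected_interval ℓm ℓp) (zero_mem_interval hm hp)
      (projH1 _ ⟨R₀ f, hR₀.mem_dom f⟩) = z)
    {M r₀ r₁ r₂ : ℝ} (hM : ‖z‖ ≤ M)
    (hU₀ : ‖(U : L2 (waveguide ℓm ℓp α β γ ε)) - embedding α β γ h.pos (R₀ f)‖ ≤ r₀)
    (hU₁ : ‖weakDeriv (waveguide ℓm ℓp α β γ ε) (1, 0) U -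
        embedding α β γ h.pos
          (WithLp.toLp 2 (weakDeriv _ 1 (projH1 _ ⟨R₀ f, hR₀.mem_dom f⟩), 0))‖ ≤ r₁)
    (hU₂ : ‖weakDeriv (waveguide ℓm ℓp α β γ ε) (0, 1) U +
        ((((√ε * ε ^ α)⁻¹ : ℝ) : ℂ) * z) • passageIndicator h‖ ≤ r₂)
    (hU₃ : mulOp V (U : L2 (waveguide ℓm ℓp α β γ ε)) =
        embedding α β γ h.pos (WithLp.toLp 2
          (mulOp V₀ (projH1 _ ⟨R₀ f, hR₀.mem_dom f⟩ : L2 (interval ℓm ℓp)), 0)))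
    {n : ℕ} (hn : α + 2 ≤ β * (n + 1)) :
    ‖R (embedding α β γ h.pos f) - embedding α β γ h.pos (R₀ f)‖ ≤
      γ * (12 * n + 27) * (√ε * (ε ^ β)⁻¹) * M + 2 * r₀ + r₁ + r₂ := by
  set J := embedding (ℓm := ℓm) (ℓp := ℓp) α β γ h.pos with hJ
  -- Duality: the error `g` itself is the right-hand side, and `v = R g` the test function in both
  -- weak equations, so that `‖g‖²` is expressed by the difference of the forms.
  set g := R (J f) - J (R₀ f) with hg
  obtain ⟨n0, n1, n2⟩ := norm_resolvent_le hR hV g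
  set v : H1 (waveguide ℓm ℓp α β γ ε) := ⟨R g, hR.mem_dom g⟩ with hv
  have hd := norm_form_sub_form_le hm hp h V₀ (V := V) ⟨R₀ f, hR₀.mem_dom f⟩ U v hz hM hU₁ hU₂ hU₃
    (norm_nonneg g) n0 n1 n2 hn
  have r0 : 0 ≤ r₀ := (norm_nonneg _).trans hU₀
  have a1 := hR₀.form_eq f ⟨_, adjoint_mem_dom0 h.pos v⟩
  have a2 : (schrodingerForm (waveguide ℓm ℓp α β γ ε) V).form U v +
      inner ℂ (v : L2 (waveguide ℓm ℓp α β γ ε)) (U : L2 (waveguide ℓm ℓp α β γ ε)) =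
      inner ℂ g (U : L2 (waveguide ℓm ℓp α β γ ε)) := by
    have := congrArg (starRingEnd ℂ) (hR.form_eq g U)
    rw [map_add, inner_conj_symm, inner_conj_symm] at this
    exact (congrArg (· + _) (schrodingerForm_conj v U)).symm.trans this
  have a3 : inner ℂ g (R (J f)) = inner ℂ (v : L2 (waveguide ℓm ℓp α β γ ε)) (J f) := by
    have := ContinuousLinearMap.adjoint_inner_left R (J f) g
    rw [← ContinuousLinearMap.star_eq_adjoint, hR.selfAdjoint.star_eq] at this
    exact this.symm
  have hadj : ∀ y : H0 (interval ℓm ℓp),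
      inner ℂ (ContinuousLinearMap.adjoint J.toContinuousLinearMap
        (v : L2 (waveguide ℓm ℓp α β γ ε))) y =
      inner ℂ (v : L2 (waveguide ℓm ℓp α β γ ε)) (J y) := fun y =>
    ContinuousLinearMap.adjoint_inner_left J.toContinuousLinearMap y _
  rw [hadj, hadj] at a1
  -- `(g, R J f) = (R g, J f)`; inserting the equations for `R₀ f` and for `v`, the latter tested
  -- with `U`, leaves the difference of forms and two copies of the error `U - J R₀ f`.
  have key : (inner ℂ g g : ℂ) =
      ((limitForm (ordConnected_interval ℓm ℓp) (zero_mem_interval hm hp) γ V₀).form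
        ⟨R₀ f, hR₀.mem_dom f⟩ ⟨_, adjoint_mem_dom0 h.pos v⟩ -
      (schrodingerForm (waveguide ℓm ℓp α β γ ε) V).form U v) -
      inner ℂ (v : L2 (waveguide ℓm ℓp α β γ ε))
        ((U : L2 (waveguide ℓm ℓp α β γ ε)) - J (R₀ f)) +
      inner ℂ g ((U : L2 (waveguide ℓm ℓp α β γ ε)) - J (R₀ f)) := by
    have s0 : (inner ℂ g g : ℂ) = inner ℂ g (R (J f)) - inner ℂ g (J (R₀ f)) := by
      rw [← inner_sub_right]
    have s1 := inner_sub_right (𝕜 := ℂ) g (U : L2 (waveguide ℓm ℓp α β γ ε)) (J (R₀ f))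
    have s2 := inner_sub_right (𝕜 := ℂ) (v : L2 (waveguide ℓm ℓp α β γ ε))
      (U : L2 (waveguide ℓm ℓp α β γ ε)) (J (R₀ f))
    linear_combination s0 + a3 + s2 - s1 - a1 + a2
  have hb : ‖g‖ ^ 2 ≤
      (γ * (12 * n + 27) * (√ε * (ε ^ β)⁻¹) * M + 2 * r₀ + r₁ + r₂) * ‖g‖ := by
    have e : ‖(inner ℂ g g : ℂ)‖ = ‖g‖ ^ 2 := by
      rw [inner_self_eq_norm_sq_to_K, norm_pow]
      simp
    rw [← e, key]
    refine (norm_add_le _ _).trans ((add_le_add (norm_sub_le _ _) le_rfl).trans ?_)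
    have b2 : ‖(inner ℂ (v : L2 (waveguide ℓm ℓp α β γ ε))
        ((U : L2 (waveguide ℓm ℓp α β γ ε)) - J (R₀ f)) : ℂ)‖ ≤ ‖g‖ * r₀ :=
      (norm_inner_le_norm _ _).trans (by gcongr)
    have b3 : ‖(inner ℂ g ((U : L2 (waveguide ℓm ℓp α β γ ε)) - J (R₀ f)) : ℂ)‖ ≤ ‖g‖ * r₀ :=
      (norm_inner_le_norm _ _).trans (by gcongr)
    calc _ ≤ (γ * (12 * n + 27) * (√ε * (ε ^ β)⁻¹) * M + r₁ + r₂) * ‖g‖ + ‖g‖ * r₀ + ‖g‖ * r₀ :=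
          add_le_add (add_le_add hd b2) b3
      _ = _ := by ring
  rcases (norm_nonneg g).eq_or_lt with h0 | h0
  · rw [← h0]
    have x1 : 0 ≤ M := (norm_nonneg _).trans hM
    have x2 : 0 ≤ r₁ := (norm_nonneg _).trans hU₁
    have x3 : 0 ≤ r₂ := (norm_nonneg _).trans hU₂
    have := h.pos
    have := h.gamma_pos
    have := h.size_pos
    positivity
  · rw [sq] at hb
    exact le_of_mul_le_mul_right hb h0

/-- The part of the resolvent orthogonal to the range of the embedding. -/
theorem norm_resolvent_sub_proj_le (h : IsAdmissible ℓm ℓp α β γ ε) {e₀ : ℝ} (he : ε ≤ e₀)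
    (he1 : e₀ ≤ 1) (hI : Ioo (-e₀) e₀ ⊆ (interval ℓm ℓp : Set ℝ))
    {V : Lp ℝ ∞ (volume.restrict (waveguide ℓm ℓp α β γ ε : Set (ℝ × ℝ)))}
    (hV : 0 ≤ᵐ[volume.restrict (waveguide ℓm ℓp α β γ ε : Set (ℝ × ℝ))] V)
    {R : L2 (waveguide ℓm ℓp α β γ ε) →L[ℂ] L2 (waveguide ℓm ℓp α β γ ε)}
    (hR : IsFormResolvent (schrodingerForm (waveguide ℓm ℓp α β γ ε) V) R)
    (g : L2 (waveguide ℓm ℓp α β γ ε))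
    (hg : ContinuousLinearMap.adjoint (embedding (ℓm := ℓm) (ℓp := ℓp) α β γ
      h.pos).toContinuousLinearMap g = 0) :
    ‖R g - embedding α β γ h.pos (ContinuousLinearMap.adjoint (embedding (ℓm := ℓm) (ℓp := ℓp)
      α β γ h.pos).toContinuousLinearMap (R g))‖ ≤
      (ε ^ 2 + 4 * (ε ^ β) ^ 2 + (4 + 10 / e₀) * ε ^ α) * ‖g‖ := by
  set J := embedding (ℓm := ℓm) (ℓp := ℓp) α β γ h.pos with hJ
  set J' := ContinuousLinearMap.adjoint J.toContinuousLinearMap with hJ'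
  set k := ε ^ 2 + 4 * (ε ^ β) ^ 2 + (4 + 10 / e₀) * ε ^ α with hk
  have hb := h.size_pos
  have hh := h.height_pos
  have hε := h.pos
  have e0 : 0 < e₀ := hε.trans_le he
  have hk0 : 0 ≤ k := by positivity
  have hE := energy_le hR hV g
  set v : H1 (waveguide ℓm ℓp α β γ ε) := ⟨R g, hR.mem_dom g⟩ with hv
  set E2 : ℝ := ‖R g‖ ^ 2 + ‖weakDeriv (waveguide ℓm ℓp α β γ ε) (1, 0) v‖ ^ 2 +
      ‖weakDeriv (waveguide ℓm ℓp α β γ ε) (0, 1) v‖ ^ 2 with hE2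
  have q0 := sq_nonneg ‖R g‖
  have q1 := sq_nonneg ‖weakDeriv (waveguide ℓm ℓp α β γ ε) (1, 0) v‖
  have q2 := sq_nonneg ‖weakDeriv (waveguide ℓm ℓp α β γ ε) (0, 1) v‖
  have hE0 : 0 ≤ E2 := by positivity
  have A0 : ‖R g‖ ≤ √E2 := Real.le_sqrt_of_sq_le (by linarith)
  have A1 : ‖weakDeriv (waveguide ℓm ℓp α β γ ε) (1, 0) v‖ ≤ √E2 :=
    Real.le_sqrt_of_sq_le (by linarith)
  have A2 : ‖weakDeriv (waveguide ℓm ℓp α β γ ε) (0, 1) v‖ ≤ √E2 :=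
    Real.le_sqrt_of_sq_le (by linarith)
  obtain ⟨z, hz⟩ := exists_norm_sub_embedding_le h he he1 hI v (Real.sqrt_nonneg E2) A0 A1 A2
  rw [Real.sq_sqrt hE0] at hz
  have hJ1 : ∀ y, J' (J y) = y := fun y => by
    refine ext_inner_right ℂ fun x => ?_
    rw [hJ', ContinuousLinearMap.adjoint_inner_left]
    exact J.inner_map_map y x
  set Q := R g - J (J' (R g)) with hQ
  have hQJ : ∀ y, inner ℂ Q (J y) = 0 := fun y => by
    have e : (inner ℂ Q (J y) : ℂ) = inner ℂ (J' Q) y :=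
      (ContinuousLinearMap.adjoint_inner_left J.toContinuousLinearMap y Q).symm
    rw [e, hQ, map_sub, hJ1, sub_self, inner_zero_left]
  -- the orthogonal projection is at least as good as any other approximation
  have hbest : ‖Q‖ ^ 2 ≤ ‖(v : L2 (waveguide ℓm ℓp α β γ ε)) - J z‖ ^ 2 := by
    have e : (v : L2 (waveguide ℓm ℓp α β γ ε)) - J z = Q + J (J' (R g) - z) := by
      rw [hQ, map_sub, hv]; abel
    have := norm_add_sq_eq_norm_sq_add_norm_sq_of_inner_eq_zero (𝕜 := ℂ) Q (J (J' (R g) - z)) (hQJ _)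
    rw [e, sq, sq, this]
    exact le_add_of_nonneg_right (by positivity)
  -- As `g` is orthogonal to the range of `J`, only the component `Q` of `R g` contributes to the
  -- energy. This makes the final bound linear in `k` instead of `√k`.
  have hin : (inner ℂ (R g) g : ℂ).re ≤ ‖Q‖ * ‖g‖ := by
    have e : (inner ℂ (R g) g : ℂ) = inner ℂ Q g := by
      rw [hQ, inner_sub_left]
      have : (inner ℂ (J (J' (R g))) g : ℂ) = inner ℂ (J' (R g)) (J' g) :=
        (ContinuousLinearMap.adjoint_inner_right J.toContinuousLinearMap _ _).symm
      rw [this, hg, inner_zero_right, sub_zero]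
    rw [e]
    exact (Complex.re_le_norm _).trans (norm_inner_le_norm _ _)
  have hfin : ‖Q‖ ^ 2 ≤ k * ‖g‖ * ‖Q‖ := by
    calc _ ≤ k * E2 := hbest.trans hz
      _ ≤ k * (‖Q‖ * ‖g‖) := by gcongr; exact hE.trans hin
      _ = _ := by ring
  rcases (norm_nonneg Q).eq_or_lt with h0 | h0
  · rw [← h0]; positivity
  · rw [sq] at hfin
    exact le_of_mul_le_mul_right hfin h0

end Comparison

/-! ### Bounded multiplication operators and their square roots -/

section Multiplication

variable {E : Type*} [MeasurableSpace E] {μ : Measure E}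

theorem norm_mulOp_le (V : Lp ℝ ∞ μ) (u : Lp ℂ 2 μ) : ‖mulOp V u‖ ≤ ‖V‖ * ‖u‖ :=
  Lp.norm_smul_le V u

theorem continuous_mulOp (V : Lp ℝ ∞ μ) : Continuous (mulOp V) :=
  AddMonoidHomClass.continuous_of_bound (mulOp V) ‖V‖ (norm_mulOp_le V)

/-- Writes the potential term as an inner product of images under one operator, the shape required
by `exists_isFormResolvent`. -/
theorem exists_mulOp_sqrt {V : Lp ℝ ∞ μ} (hV : 0 ≤ᵐ[μ] V) :
    ∃ S : Lp ℝ ∞ μ, ∀ u v : Lp ℂ 2 μ, inner ℂ (mulOp S u) (mulOp S v) = inner ℂ u (mulOp V v) := by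
  have hS : MemLp (fun x => √(V x)) ∞ μ := by
    -- The square root is bounded because `√t ≤ 1 + t`.
    refine MemLp.of_le ((memLp_top_const (1 : ℝ)).add (Lp.memLp V).norm)
      (Real.continuous_sqrt.comp_aestronglyMeasurable (Lp.aestronglyMeasurable V)) ?_
    filter_upwards [hV] with x hx
    have hx' : (0 : ℝ) ≤ V x := hx
    change ‖√(V x)‖ ≤ ‖1 + ‖V x‖‖
    rw [Real.norm_of_nonneg hx', Real.norm_of_nonneg (Real.sqrt_nonneg _),
      Real.norm_of_nonneg (by positivity)]
    exact Real.sqrt_le_iff.2 ⟨by positivity, by nlinarith⟩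
  refine ⟨hS.toLp _, fun u v => ?_⟩
  rw [inner_mulOp_left]
  congr 1
  refine Lp.ext ?_
  filter_upwards [coeFn_mulOp (hS.toLp _) (mulOp (hS.toLp _) v), coeFn_mulOp (hS.toLp _) v,
    coeFn_mulOp V v, hS.coeFn_toLp, hV] with x h1 h2 h3 h4 h5
  rw [h1, h2, h3, h4, ← mul_assoc, ← Complex.ofReal_mul, Real.mul_self_sqrt h5]

theorem ae_nonneg_of_nonneg {V : Lp ℝ ∞ μ} (hV : 0 ≤ V) : 0 ≤ᵐ[μ] V :=
  (Lp.coeFn_nonneg V).2 hV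

end Multiplication

/-! ### Closedness of the weak derivative and continuity of point evaluation -/

section Closed

variable {E : Type*} [NormedAddCommGroup E] [NormedSpace ℝ E] [FiniteDimensional ℝ E]
  [MeasureSpace E] [BorelSpace E] [IsLocallyFiniteMeasure (volume : Measure E)]

/-- Weak derivatives are closed under convergence in `L²`. -/
theorem isClosed_setOf_hasWeakDeriv (Ω : Opens E) (e : E) :
    IsClosed {p : L2 Ω × L2 Ω | HasWeakDeriv Ω e p.1 p.2} := by
  -- Integration against a compactly supported continuous function is an inner product in `L²`, so
  -- each defining identity is a closed condition.
  have hc : ∀ φ : E → ℝ, Continuous φ → HasCompactSupport φ →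
      Continuous fun u : L2 Ω => ∫ x in (Ω : Set E), φ x • u x := by
    intro φ h1 h2
    have hL : MemLp (fun x => (φ x : ℂ)) 2 (volume.restrict (Ω : Set E)) :=
      ((Complex.continuous_ofReal.comp h1).memLp_of_hasCompactSupport
        (h2.comp_left (g := Complex.ofReal) (by simp))).restrict _
    have e1 : (fun u : L2 Ω => ∫ x in (Ω : Set E), φ x • u x) = fun u => inner ℂ (hL.toLp _) u := by
      funext u
      rw [inner_eq_integral _ _ hL.coeFn_toLp (EventuallyEq.refl _ u)]
      refine integral_congr_ae (Eventually.of_forall fun x => ?_)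
      simp [mul_comm]
    rw [e1]
    exact continuous_const.inner continuous_id
  have hset : {p : L2 Ω × L2 Ω | HasWeakDeriv Ω e p.1 p.2} =
      ⋂ (φ : E → ℝ) (_ : ContDiff ℝ ∞ φ) (_ : HasCompactSupport φ) (_ : tsupport φ ⊆ (Ω : Set E)),
        {p : L2 Ω × L2 Ω | ∫ x in (Ω : Set E), fderiv ℝ φ x e • p.1 x =
          -∫ x in (Ω : Set E), φ x • p.2 x} := by
    ext p
    simp only [mem_iInter, mem_ofPred_eq]
    exact ⟨fun h => h.2.2, fun h => ⟨L2.locallyIntegrableOn _, L2.locallyIntegrableOn _, h⟩⟩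
  rw [hset]
  refine isClosed_iInter fun φ => isClosed_iInter fun h1 => isClosed_iInter fun h2 =>
    isClosed_iInter fun _ => isClosed_eq ?_ ?_
  · exact (hc _ ((h1.continuous_fderiv (by simp)).clm_apply continuous_const)
      (h2.fderiv_apply (𝕜 := ℝ) e)).comp continuous_fst
  · exact ((hc φ h1.continuous h2).comp continuous_snd).neg

end Closed

theorem IsPrimitiveOn.norm_sq_le {a b : ℝ} (hab : a < b) {u g : ℝ → ℂ}
    (h : IsPrimitiveOn (Ioo a b) u g) {A B : ℝ}
    (hA : ∫⁻ t in Ioo a b, ‖u t‖ₑ ^ 2 ≤ ENNReal.ofReal (A ^ 2))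
    (hB : ∫⁻ t in Ioo a b, ‖g t‖ₑ ^ 2 ≤ ENNReal.ofReal (B ^ 2)) {x : ℝ} (hx : x ∈ Ioo a b) :
    ‖u x‖ ^ 2 ≤ 2 * (A ^ 2 / (b - a) + (b - a) * B ^ 2) := by
  have hl : 0 < b - a := sub_pos.2 hab
  have h1 := h.enorm_sq_le ordConnected_Ioo measurableSet_Ioo hx
  rw [Real.volume_Ioo] at h1
  have h2 : ENNReal.ofReal (b - a) * ‖u x‖ₑ ^ 2 ≤
      2 * (ENNReal.ofReal (A ^ 2) + ENNReal.ofReal (b - a) ^ 2 * ENNReal.ofReal (B ^ 2)) :=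
    h1.trans (by gcongr)
  rw [← ofReal_norm, ← ENNReal.ofReal_pow (norm_nonneg _), ← ENNReal.ofReal_pow hl.le,
    ← ENNReal.ofReal_mul hl.le, ← ENNReal.ofReal_mul (by positivity),
    ← ENNReal.ofReal_add (by positivity) (by positivity),
    show (2 : ℝ≥0∞) = ENNReal.ofReal 2 by simp, ← ENNReal.ofReal_mul (by norm_num),
    ENNReal.ofReal_le_ofReal_iff (by positivity)] at h2
  have h3 : (b - a) * ‖u x‖ ^ 2 ≤ (b - a) * (2 * (A ^ 2 / (b - a) + (b - a) * B ^ 2)) := by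
    refine h2.trans (le_of_eq ?_)
    field_simp
  exact le_of_mul_le_mul_left h3 hl

/-- Point evaluation is bounded on `H¹`. -/
theorem exists_norm_evalAt_le {Ω : Opens ℝ} (hΩ : OrdConnected (Ω : Set ℝ)) {x₀ : ℝ} (hx₀ : x₀ ∈ Ω) :
    ∃ C, ∀ u : H1 Ω, ‖evalAt hΩ hx₀ u‖ ≤ C * (‖(u : L2 Ω)‖ + ‖weakDeriv Ω 1 u‖) := by
  obtain ⟨r, hr, hball⟩ := Metric.isOpen_iff.1 Ω.isOpen x₀ hx₀
  rw [Real.ball_eq_Ioo] at hball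
  refine ⟨√(2 * (1 / (2 * r) + 2 * r)), fun u => ?_⟩
  obtain ⟨U, hU, hae, hev⟩ := exists_representative hΩ u
  rw [hev hx₀]
  set A := ‖(u : L2 Ω)‖ + ‖weakDeriv Ω 1 u‖ with hA
  have hA0 : 0 ≤ A := by positivity
  have e1 : ∫⁻ t in Ioo (x₀ - r) (x₀ + r), ‖U t‖ₑ ^ 2 ≤ ENNReal.ofReal (A ^ 2) := by
    refine le_trans (le_of_eq ?_) (lintegral_le_of_norm_le (u : L2 Ω) hA0 (by simp [hA]) hball)
    refine lintegral_congr_ae ?_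
    filter_upwards [ae_restrict_of_ae_restrict_of_subset hball hae] with x hx
    rw [hx]
  have e2 := lintegral_le_of_norm_le (weakDeriv Ω 1 u) hA0 (by simp [hA]) hball
  have h := (hU.mono hball).norm_sq_le (by linarith) e1 e2 (x := x₀) ⟨by linarith, by linarith⟩
  refine (sq_le_sq₀ (norm_nonneg _) (by positivity)).1 (h.trans (le_of_eq ?_))
  rw [mul_pow, Real.sq_sqrt (by positivity)]
  ring

/-! ### Existence of the resolvents; the form domains are proper -/

section Resolvents

variable {ℓm ℓp : EReal}

/-- The form is that of `D = (∂₁, ∂₂, √V)`, whose graph is cut out by closed conditions. -/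
theorem exists_isFormResolvent_schrodingerForm {Ω : Opens (ℝ × ℝ)}
    {V : Lp ℝ ∞ (volume.restrict (Ω : Set (ℝ × ℝ)))}
    (hV : 0 ≤ᵐ[volume.restrict (Ω : Set (ℝ × ℝ))] V) :
    ∃ R, IsFormResolvent (schrodingerForm Ω V) R := by
  obtain ⟨S, hS⟩ := exists_mulOp_sqrt hV
  let D : H1 Ω →ₗ[ℂ] WithLp 2 (L2 Ω × WithLp 2 (L2 Ω × L2 Ω)) :=
    (WithLp.linearEquiv 2 ℂ _).symm.toLinearMap ∘ₗ
      ((weakDeriv Ω (1, 0)).prod ((WithLp.linearEquiv 2 ℂ _).symm.toLinearMap ∘ₗ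
        ((weakDeriv Ω (0, 1)).prod (mulOp S ∘ₗ (H1 Ω).subtype))))
  have hD : ∀ u, D u = WithLp.toLp 2 (weakDeriv Ω (1, 0) u,
      WithLp.toLp 2 (weakDeriv Ω (0, 1) u, mulOp S (u : L2 Ω))) := fun u => rfl
  refine exists_isFormResolvent (schrodingerForm Ω V) D (fun (u v : H1 Ω) => ?_) ?_
  · have e : inner ℂ (D v) (D u) = inner ℂ (weakDeriv Ω (1, 0) v) (weakDeriv Ω (1, 0) u) +
      (inner ℂ (weakDeriv Ω (0, 1) v) (weakDeriv Ω (0, 1) u) +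
        inner ℂ (mulOp S (v : L2 Ω)) (mulOp S (u : L2 Ω))) := rfl
    rw [hS, ← add_assoc] at e
    exact (schrodingerForm_apply u v).trans e.symm
  · have hset : {p : L2 Ω × WithLp 2 (L2 Ω × WithLp 2 (L2 Ω × L2 Ω)) |
        ∃ hu : p.1 ∈ H1 Ω, D ⟨p.1, hu⟩ = p.2} =
        ((fun p => (p.1, p.2.fst)) ⁻¹' {q : L2 Ω × L2 Ω | HasWeakDeriv Ω (1, 0) q.1 q.2} ∩
        (fun p => (p.1, p.2.snd.fst)) ⁻¹' {q : L2 Ω × L2 Ω | HasWeakDeriv Ω (0, 1) q.1 q.2}) ∩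
        {p | mulOp S p.1 = p.2.snd.snd} := by
      ext ⟨u, w⟩
      constructor
      · rintro ⟨hu, he⟩
        replace hu : u ∈ H1 Ω := hu
        replace he : D ⟨u, hu⟩ = w := he
        subst he
        exact ⟨⟨hasWeakDeriv_weakDeriv Ω (1, 0) ⟨u, hu⟩, hasWeakDeriv_weakDeriv Ω (0, 1) ⟨u, hu⟩⟩,
          rfl⟩
      · rintro ⟨⟨h1, h2⟩, h3⟩
        refine ⟨mem_H1_of_hasWeakDeriv_prod h1 h2, ?_⟩
        rw [hD, weakDeriv_eq ⟨u, mem_H1_of_hasWeakDeriv_prod h1 h2⟩ _ h1,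
          weakDeriv_eq ⟨u, mem_H1_of_hasWeakDeriv_prod h1 h2⟩ _ h2]
        have h3' : mulOp S u = w.snd.snd := h3
        rw [h3']
        rfl
    have hw : Continuous fun p : L2 Ω × WithLp 2 (L2 Ω × WithLp 2 (L2 Ω × L2 Ω)) =>
        WithLp.ofLp p.2 := (WithLp.prod_continuous_ofLp 2 _ _).comp continuous_snd
    have hw' : Continuous fun p : L2 Ω × WithLp 2 (L2 Ω × WithLp 2 (L2 Ω × L2 Ω)) =>
        WithLp.ofLp p.2.snd := (WithLp.prod_continuous_ofLp 2 _ _).comp (continuous_snd.comp hw)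
    refine hset.symm ▸ (((isClosed_setOf_hasWeakDeriv Ω (1, 0)).preimage ?_).inter
      ((isClosed_setOf_hasWeakDeriv Ω (0, 1)).preimage ?_)).inter (isClosed_eq ?_ ?_)
    · exact continuous_fst.prodMk (continuous_fst.comp hw)
    · exact continuous_fst.prodMk (continuous_fst.comp hw')
    · exact (continuous_mulOp S).comp continuous_fst
    · exact continuous_snd.comp hw'

/-- Here `D` consists of the weak derivative, multiplication by `√V₀`, and `√γ` times evaluation at
`0`. Evaluation is not continuous in `L²`, but it is in the graph norm of the derivative, so it
passes to the limit once the derivatives converge. -/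
theorem exists_isFormResolvent_limitForm {Ω : Opens ℝ} (hΩ : OrdConnected (Ω : Set ℝ))
    (h0 : (0 : ℝ) ∈ Ω) {γ : ℝ} (hγ : 0 < γ)
    {V₀ : Lp ℝ ∞ (volume.restrict (Ω : Set ℝ))} (hV : 0 ≤ V₀) :
    ∃ R, IsFormResolvent (limitForm hΩ h0 γ V₀) R := by
  obtain ⟨S, hS⟩ := exists_mulOp_sqrt (ae_nonneg_of_nonneg hV)
  set ev := evalAt hΩ h0 with hev
  let D : dom0 Ω →ₗ[ℂ] WithLp 2 (L2 Ω × WithLp 2 (L2 Ω × ℂ)) :=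
    (WithLp.linearEquiv 2 ℂ _).symm.toLinearMap ∘ₗ
      ((weakDeriv Ω 1 ∘ₗ projH1 Ω).prod ((WithLp.linearEquiv 2 ℂ _).symm.toLinearMap ∘ₗ
        ((mulOp S ∘ₗ (H1 Ω).subtype ∘ₗ projH1 Ω).prod (((√γ : ℝ) : ℂ) • (ev ∘ₗ projH1 Ω)))))
  have hD : ∀ u, D u = WithLp.toLp 2 (weakDeriv Ω 1 (projH1 Ω u),
      WithLp.toLp 2 (mulOp S (projH1 Ω u : L2 Ω), ((√γ : ℝ) : ℂ) * ev (projH1 Ω u))) := fun u => rfl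
  refine exists_isFormResolvent _ D (fun (u v : dom0 Ω) => ?_) ?_
  · have e : inner ℂ (D v) (D u) =
        inner ℂ (weakDeriv Ω 1 (projH1 Ω v)) (weakDeriv Ω 1 (projH1 Ω u)) +
      (inner ℂ (mulOp S (projH1 Ω v : L2 Ω)) (mulOp S (projH1 Ω u : L2 Ω)) +
        inner ℂ (((√γ : ℝ) : ℂ) * ev (projH1 Ω v)) (((√γ : ℝ) : ℂ) * ev (projH1 Ω u))) := rfl
    have hs : ((√γ : ℝ) : ℂ) * ((√γ : ℝ) : ℂ) = γ := by
      rw [← Complex.ofReal_mul, Real.mul_self_sqrt hγ.le]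
    have e' : (limitForm hΩ h0 γ V₀).form u v =
        inner ℂ (weakDeriv Ω 1 (projH1 Ω v)) (weakDeriv Ω 1 (projH1 Ω u)) +
        inner ℂ (projH1 Ω v : L2 Ω) (mulOp V₀ (projH1 Ω u : L2 Ω)) +
        (γ : ℂ) * inner ℂ (ev (projH1 Ω v)) (ev (projH1 Ω u)) := rfl
    refine e'.trans (Eq.trans ?_ e.symm)
    rw [hS, RCLike.inner_apply, RCLike.inner_apply, map_mul, Complex.conj_ofReal, ← hs]
    ring
  · obtain ⟨C, hC⟩ := exists_norm_evalAt_le hΩ h0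
    refine IsSeqClosed.isClosed ?_
    intro x p hx hlim
    choose hu hxe using hx
    have hl1 : Tendsto (fun k => (x k).1.fst) atTop (𝓝 p.1.fst) :=
      ((continuous_fst.comp (WithLp.prod_continuous_ofLp 2 _ _)).comp
        continuous_fst).continuousAt.tendsto.comp hlim
    have hw : Continuous fun p : H0 Ω × WithLp 2 (L2 Ω × WithLp 2 (L2 Ω × ℂ)) =>
        WithLp.ofLp p.2 := (WithLp.prod_continuous_ofLp 2 _ _).comp continuous_snd
    have hw' : Continuous fun p : H0 Ω × WithLp 2 (L2 Ω × WithLp 2 (L2 Ω × ℂ)) =>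
        WithLp.ofLp p.2.snd := (WithLp.prod_continuous_ofLp 2 _ _).comp (continuous_snd.comp hw)
    have hl2 : Tendsto (fun k => (x k).2.fst) atTop (𝓝 p.2.fst) :=
      (continuous_fst.comp hw).continuousAt.tendsto.comp hlim
    have hl3 : Tendsto (fun k => (x k).2.snd.fst) atTop (𝓝 p.2.snd.fst) :=
      (continuous_fst.comp hw').continuousAt.tendsto.comp hlim
    have hl4 : Tendsto (fun k => (x k).2.snd.snd) atTop (𝓝 p.2.snd.snd) :=
      (continuous_snd.comp hw').continuousAt.tendsto.comp hlim
    have hx2 : ∀ k, (x k).2.fst = weakDeriv Ω 1 (projH1 Ω ⟨(x k).1, hu k⟩) := fun k => by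
      rw [← hxe k]; rfl
    have hx3 : ∀ k, (x k).2.snd.fst = mulOp S (x k).1.fst := fun k => by
      rw [← hxe k]; rfl
    have hx4 : ∀ k, (x k).2.snd.snd = ((√γ : ℝ) : ℂ) * ev (projH1 Ω ⟨(x k).1, hu k⟩) := fun k => by
      rw [← hxe k]; rfl
    have hwd : HasWeakDeriv Ω 1 p.1.fst p.2.fst := by
      have := (isClosed_setOf_hasWeakDeriv Ω (1 : ℝ)).mem_of_tendsto (hl1.prodMk_nhds hl2)
        (Eventually.of_forall fun k => by
          rw [hx2]; exact hasWeakDeriv_weakDeriv Ω 1 (projH1 Ω ⟨(x k).1, hu k⟩))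
      exact this
    have hmem : p.1 ∈ dom0 Ω := mem_H1_of_hasWeakDeriv _ _ hwd
    have hwe : weakDeriv Ω 1 (projH1 Ω ⟨p.1, hmem⟩) = p.2.fst := weakDeriv_eq _ _ hwd
    refine ⟨hmem, ?_⟩
    have f3 : mulOp S p.1.fst = p.2.snd.fst := by
      refine tendsto_nhds_unique ?_ hl3
      simp only [hx3]
      exact ((continuous_mulOp S).tendsto _).comp hl1
    have f4 : ((√γ : ℝ) : ℂ) * ev (projH1 Ω ⟨p.1, hmem⟩) = p.2.snd.snd := by
      refine tendsto_nhds_unique ?_ hl4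
      simp only [hx4]
      refine Tendsto.const_mul _ ?_
      rw [tendsto_iff_norm_sub_tendsto_zero]
      have hz : Tendsto (fun k => C * (‖(x k).1.fst - p.1.fst‖ + ‖(x k).2.fst - p.2.fst‖)) atTop
          (𝓝 0) := by
        have := ((tendsto_iff_norm_sub_tendsto_zero.1 hl1).add
          (tendsto_iff_norm_sub_tendsto_zero.1 hl2)).const_mul C
        simpa using this
      refine squeeze_zero (fun _ => norm_nonneg _) (fun k => ?_) hz
      rw [← map_sub]
      refine (hC _).trans (le_of_eq ?_)
      rw [map_sub, hwe, ← hx2]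
      rfl
    have : D ⟨p.1, hmem⟩ = WithLp.toLp 2 (p.2.fst, WithLp.toLp 2 (p.2.snd.fst, p.2.snd.snd)) := by
      rw [hD, hwe, f4]
      have f3' : mulOp S (projH1 Ω ⟨p.1, hmem⟩ : L2 Ω) = p.2.snd.fst := f3
      rw [f3']
    exact this

/-- The indicator function of `(0, 1)` jumps at `0` and has no continuous representative. -/
theorem H1_interval_ne_top (hm : ℓm < 0) (hp : 0 < ℓp) : H1 (interval ℓm ℓp) ≠ ⊤ := by
  intro htop
  have hL : MemLp ((Ioo (0 : ℝ) 1).indicator fun _ => (1 : ℂ)) 2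
      (volume.restrict (interval ℓm ℓp : Set ℝ)) := by
    refine MemLp.restrict _ ?_
    rw [memLp_indicator_iff_restrict measurableSet_Ioo]
    have : IsFiniteMeasure (volume.restrict (Ioo (0 : ℝ) 1)) := ⟨by simp⟩
    exact memLp_const _
  have hu : hL.toLp _ ∈ H1 (interval ℓm ℓp) := by rw [htop]; exact Submodule.mem_top
  have h0 := zero_mem_interval hm hp
  obtain ⟨U, hU, hae⟩ := exists_continuousOn_ae_eq (ordConnected_interval ℓm ℓp) h0
    (hasWeakDeriv_weakDeriv _ 1 ⟨_, hu⟩)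
  have hae' := hae.symm.trans hL.coeFn_toLp
  obtain ⟨r, hr, hball⟩ := Metric.isOpen_iff.1 (interval ℓm ℓp).isOpen 0 h0
  rw [Real.ball_eq_Ioo, zero_sub, zero_add] at hball
  have hUc : Tendsto U (𝓝 0) (𝓝 (U 0)) := hU.continuousAt ((interval ℓm ℓp).isOpen.mem_nhds h0)
  have hr1 : 0 < min r 1 := lt_min hr one_pos
  have s1 : Ioo 0 (min r 1) ⊆ (interval ℓm ℓp : Set ℝ) := fun x hx =>
    hball ⟨by linarith [hx.1], hx.2.trans_le (min_le_left _ _)⟩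
  have s2 : Ioo (-r) 0 ⊆ (interval ℓm ℓp : Set ℝ) := fun x hx =>
    hball ⟨hx.1, by linarith [hx.2]⟩
  have e1 : EqOn U (fun _ => 1) (Ioo 0 (min r 1)) := by
    refine Measure.eqOn_open_of_ae_eq (μ := volume) ?_ isOpen_Ioo (hU.mono s1) continuousOn_const
    filter_upwards [ae_restrict_of_ae_restrict_of_subset s1 hae', ae_restrict_mem measurableSet_Ioo]
      with x hx hx'
    rw [hx, indicator_of_mem]
    exact ⟨hx'.1, hx'.2.trans_le (min_le_right _ _)⟩
  have e2 : EqOn U (fun _ => 0) (Ioo (-r) 0) := by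
    refine Measure.eqOn_open_of_ae_eq (μ := volume) ?_ isOpen_Ioo (hU.mono s2) continuousOn_const
    filter_upwards [ae_restrict_of_ae_restrict_of_subset s2 hae', ae_restrict_mem measurableSet_Ioo]
      with x hx hx'
    rw [hx, indicator_of_notMem]
    exact fun h => lt_asymm h.1 hx'.2
  have l1 : U 0 = 1 := tendsto_nhds_unique (hUc.mono_left nhdsWithin_le_nhds)
    (tendsto_const_nhds.congr' (by
      filter_upwards [Ioo_mem_nhdsGT hr1] with x hx using (e1 hx).symm))
  have l2 : U 0 = 0 := tendsto_nhds_unique (hUc.mono_left (nhdsWithin_le_nhds (s := Iio 0)))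
    (tendsto_const_nhds.congr' (by
      filter_upwards [Ioo_mem_nhdsLT (neg_lt_zero.2 hr)] with x hx using (e2 hx).symm))
  exact one_ne_zero (l1.symm.trans l2)

theorem dom0_ne_top (hm : ℓm < 0) (hp : 0 < ℓp) : dom0 (interval ℓm ℓp) ≠ ⊤ := by
  intro htop
  refine H1_interval_ne_top hm hp ((Submodule.eq_top_iff').2 fun f => ?_)
  have : (WithLp.toLp 2 (f, 0) : H0 (interval ℓm ℓp)) ∈ dom0 (interval ℓm ℓp) := by
    rw [htop]; exact Submodule.mem_top
  exact this

theorem adjoint_comp_embedding {α β γ ε : ℝ} (hε : 0 < ε) :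
    ContinuousLinearMap.adjoint (embedding (ℓm := ℓm) (ℓp := ℓp) α β γ
      hε).toContinuousLinearMap ∘L (embedding α β γ hε).toContinuousLinearMap = 1 := by
  ext1 y
  refine ext_inner_right ℂ fun x => ?_
  rw [ContinuousLinearMap.comp_apply, ContinuousLinearMap.adjoint_inner_left]
  exact (embedding (ℓm := ℓm) (ℓp := ℓp) α β γ hε).inner_map_map y x

/-- Since `J* J = 1` and `J*` maps `H¹` of the waveguide into the limit form domain, the latter
would otherwise be everything too. -/
theorem H1_waveguide_ne_top (hm : ℓm < 0) (hp : 0 < ℓp) {α β γ ε : ℝ} (hε : 0 < ε) :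
    H1 (waveguide ℓm ℓp α β γ ε) ≠ ⊤ := by
  intro htop
  refine dom0_ne_top hm hp ((Submodule.eq_top_iff').2 fun f => ?_)
  have hf : embedding α β γ hε f ∈ H1 (waveguide ℓm ℓp α β γ ε) := by
    rw [htop]; exact Submodule.mem_top
  have h1 := adjoint_mem_dom0 hε ⟨_, hf⟩
  have h2 : ContinuousLinearMap.adjoint (embedding (ℓm := ℓm) (ℓp := ℓp) α β γ
      hε).toContinuousLinearMap (embedding α β γ hε f) = f :=
    congrArg (fun T : H0 (interval ℓm ℓp) →L[ℂ] H0 (interval ℓm ℓp) => T f)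
      (adjoint_comp_embedding hε)
  exact h2 ▸ h1

end Resolvents

/-! ### Regularity of the range of the limit resolvent -/

section LimitResolvent

variable {ℓm ℓp : EReal} {γ : ℝ} {V₀ : Lp ℝ ∞ (volume.restrict (interval ℓm ℓp : Set ℝ))}

theorem norm_limit_resolvent_le (hm : ℓm < 0) (hp : 0 < ℓp) (hγ : 0 < γ) (hV₀ : 0 ≤ V₀)
    {R₀ : H0 (interval ℓm ℓp) →L[ℂ] H0 (interval ℓm ℓp)}
    (hR₀ : IsFormResolvent
      (limitForm (ordConnected_interval ℓm ℓp) (zero_mem_interval hm hp) γ V₀) R₀)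
    (f : H0 (interval ℓm ℓp)) :
    ‖R₀ f‖ ≤ ‖f‖ ∧ ‖weakDeriv _ 1 (projH1 _ ⟨R₀ f, hR₀.mem_dom f⟩)‖ ≤ ‖f‖ := by
  set u : H1 (interval ℓm ℓp) := projH1 _ ⟨R₀ f, hR₀.mem_dom f⟩ with hu
  have h : inner ℂ (weakDeriv _ 1 u) (weakDeriv _ 1 u) +
      inner ℂ (u : L2 (interval ℓm ℓp)) (mulOp V₀ (u : L2 (interval ℓm ℓp))) +
      (γ : ℂ) * inner ℂ (evalAt (ordConnected_interval ℓm ℓp) (zero_mem_interval hm hp) u)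
        (evalAt (ordConnected_interval ℓm ℓp) (zero_mem_interval hm hp) u) +
      inner ℂ (R₀ f) (R₀ f) = (inner ℂ (R₀ f) f : ℂ) :=
    hR₀.form_eq f ⟨R₀ f, hR₀.mem_dom f⟩
  rw [inner_self_eq_norm_sq_to_K, inner_self_eq_norm_sq_to_K,
    inner_self_eq_norm_sq_to_K] at h
  have h' := congrArg Complex.re h
  have hn := re_inner_mulOp_nonneg (ae_nonneg_of_nonneg hV₀) (u : L2 (interval ℓm ℓp))
  simp only [Complex.add_re, Complex.re_ofReal_mul] at h'
  have e : ∀ r : ℝ, (((RCLike.ofReal r : ℂ)) ^ 2).re = r ^ 2 := fun r => by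
    change ((r : ℂ) ^ 2).re = r ^ 2
    rw [← Complex.ofReal_pow, Complex.ofReal_re]
  rw [e, e, e] at h'
  have h1 : (inner ℂ (R₀ f) f : ℂ).re ≤ ‖R₀ f‖ * ‖f‖ :=
    (Complex.re_le_norm _).trans (norm_inner_le_norm _ _)
  have h2 : 0 ≤ γ * ‖evalAt (ordConnected_interval ℓm ℓp) (zero_mem_interval hm hp) u‖ ^ 2 := by
    positivity
  have a0 := norm_nonneg (R₀ f)
  have a1 := norm_nonneg f
  have h0 : ‖R₀ f‖ ≤ ‖f‖ := by
    by_contra! hc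
    nlinarith [sq_nonneg ‖weakDeriv _ 1 u‖]
  have h3 : ‖R₀ f‖ * ‖f‖ ≤ ‖f‖ ^ 2 := by rw [sq]; gcongr
  refine ⟨h0, (sq_le_sq₀ (norm_nonneg _) (norm_nonneg _)).1 ?_⟩
  nlinarith [sq_nonneg ‖R₀ f‖]

/-- This yields a square integrable second derivative on each side of `0`, hence a bounded first
derivative near `0`, as the trial function requires. -/
theorem limit_resolvent_mem_deltaGraph (hm : ℓm < 0) (hp : 0 < ℓp)
    {R₀ : H0 (interval ℓm ℓp) →L[ℂ] H0 (interval ℓm ℓp)}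
    (hR₀ : IsFormResolvent
      (limitForm (ordConnected_interval ℓm ℓp) (zero_mem_interval hm hp) γ V₀) R₀)
    (f : H0 (interval ℓm ℓp)) : ((R₀ f).fst, (f - R₀ f).fst) ∈ deltaGraph ℓm ℓp γ V₀ := by
  rw [mem_deltaGraph_iff hm hp]
  refine ⟨hR₀.mem_dom f, fun v => ?_⟩
  have hv : (WithLp.toLp 2 ((v : L2 (interval ℓm ℓp)), (0 : ℂ)) : H0 (interval ℓm ℓp)) ∈
      dom0 (interval ℓm ℓp) := v.2
  have h := hR₀.form_eq f ⟨_, hv⟩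
  have e : ∀ x : H0 (interval ℓm ℓp),
      inner ℂ (WithLp.toLp 2 ((v : L2 (interval ℓm ℓp)), (0 : ℂ)) : H0 (interval ℓm ℓp)) x =
        inner ℂ (v : L2 (interval ℓm ℓp)) x.fst := fun x => by
    rw [WithLp.prod_inner_apply]; simp
  have h' : deltaForm hm hp γ V₀ ⟨(R₀ f).fst, hR₀.mem_dom f⟩ v +
      inner ℂ (v : L2 (interval ℓm ℓp)) (R₀ f).fst = inner ℂ (v : L2 (interval ℓm ℓp)) f.fst := by
    rw [← e, ← e]; exact h
  have e2 : (f - R₀ f).fst = f.fst - (R₀ f).fst := rfl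
  rw [e2, inner_sub_right]
  exact eq_sub_of_add_eq h'

/-- Pointwise bounds near `0` for functions in the range of the limit resolvent. -/
theorem exists_limit_resolvent_bounds (hm : ℓm < 0) (hp : 0 < ℓp) (hγ : 0 < γ) (hV₀ : 0 ≤ V₀)
    {e : ℝ} (he : 0 < e) (hI : Ioo (-e) e ⊆ (interval ℓm ℓp : Set ℝ)) :
    ∃ C, 0 ≤ C ∧ ∀ {R₀ : H0 (interval ℓm ℓp) →L[ℂ] H0 (interval ℓm ℓp)}
      (hR₀ : IsFormResolvent
        (limitForm (ordConnected_interval ℓm ℓp) (zero_mem_interval hm hp) γ V₀) R₀)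
      (f : H0 (interval ℓm ℓp)), ∃ U : ℝ → ℂ,
        IsPrimitiveOn (interval ℓm ℓp : Set ℝ) U
          (weakDeriv _ 1 (projH1 _ ⟨R₀ f, hR₀.mem_dom f⟩)) ∧
        (projH1 _ ⟨R₀ f, hR₀.mem_dom f⟩ : L2 (interval ℓm ℓp))
          =ᵐ[volume.restrict (interval ℓm ℓp : Set ℝ)] U ∧
        evalAt (ordConnected_interval ℓm ℓp) (zero_mem_interval hm hp)
          (projH1 _ ⟨R₀ f, hR₀.mem_dom f⟩) = U 0 ∧
        (∀ x ∈ Ioo (-e) e, ‖U x‖ ≤ C * ‖f‖) ∧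
        (∀ᵐ x, x ∈ Ioo (-e) e →
          ‖weakDeriv _ 1 (projH1 _ ⟨R₀ f, hR₀.mem_dom f⟩) x‖ ≤ C * ‖f‖) ∧
        ‖(R₀ f).snd‖ ≤ C * ‖f‖ := by
  -- Bound for the second derivative: up to sign it is the first component of `f - R₀ f - V₀ R₀ f`,
  -- and `‖R₀ f‖ ≤ ‖f‖`.
  set K := 2 + ‖V₀‖ with hK
  have hK2 : 2 ≤ K := by rw [hK]; linarith [norm_nonneg V₀]
  -- Chosen to dominate all three bounds at once: the function, its derivative, and the component in
  -- `ℂ`.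
  set C2 := 1 + 2 * (1 / e + 2 * e * K ^ 2) with hC2
  have hC0 : 0 ≤ C2 := by positivity
  refine ⟨√C2, Real.sqrt_nonneg _, fun {R₀} hR₀ f => ?_⟩
  have hle : ∀ {z : ℂ}, ‖z‖ ^ 2 ≤ C2 * ‖f‖ ^ 2 → ‖z‖ ≤ √C2 * ‖f‖ := fun {z} hz => by
    refine (sq_le_sq₀ (norm_nonneg _) (by positivity)).1 ?_
    rwa [mul_pow, Real.sq_sqrt hC0]
  obtain ⟨n0, n1⟩ := norm_limit_resolvent_le hm hp hγ hV₀ hR₀ f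
  have nf := norm_nonneg f
  set u : H1 (interval ℓm ℓp) := projH1 _ ⟨R₀ f, hR₀.mem_dom f⟩ with hu
  have nu : ‖(u : L2 (interval ℓm ℓp))‖ ≤ ‖f‖ := (norm_fst_le' (R₀ f)).trans n0
  obtain ⟨U, hU, hae, hev⟩ := exists_representative (ordConnected_interval ℓm ℓp) u
  obtain ⟨f₀, f₁, f₂, hd, g0, g2⟩ := limit_resolvent_mem_deltaGraph hm hp hR₀ f
  refine ⟨U, hU, hae, hev _, fun x hx => hle ?_, ?_, hle ?_⟩
  · have e1 : ∫⁻ t in Ioo (-e) e, ‖U t‖ₑ ^ 2 ≤ ENNReal.ofReal (‖f‖ ^ 2) := by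
      refine le_trans (le_of_eq ?_) (lintegral_le_of_norm_le (u : L2 (interval ℓm ℓp)) nf nu hI)
      refine lintegral_congr_ae ?_
      filter_upwards [ae_restrict_of_ae_restrict_of_subset hI hae] with x hx
      rw [hx]
    have e2 := lintegral_le_of_norm_le (weakDeriv _ 1 u) nf n1 hI
    refine ((hU.mono hI).norm_sq_le (by linarith) e1 e2 hx).trans ?_
    have x1 : ‖f‖ ^ 2 / (e - -e) ≤ 1 / e * ‖f‖ ^ 2 := by
      rw [div_mul_eq_mul_div, one_mul]
      gcongr
      linarith
    have x2 : (e - -e) * ‖f‖ ^ 2 ≤ 2 * e * K ^ 2 * ‖f‖ ^ 2 := by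
      gcongr
      rw [sub_neg_eq_add, ← two_mul]
      exact le_mul_of_one_le_right (by positivity) (one_le_pow₀ (by linarith))
    rw [hC2]
    nlinarith [sq_nonneg ‖f‖]
  · have hp1 : (weakDeriv _ 1 u : L2 (interval ℓm ℓp))
        =ᵐ[volume.restrict (interval ℓm ℓp : Set ℝ)] f₁ := by
      have h0 : (R₀ f).fst =ᵐ[volume.restrict (punctured ℓm ℓp : Set ℝ)] f₀ := by
        rw [restrict_punctured]
        exact g0
      have h1 := (((hasWeakDeriv_weakDeriv _ 1 u).mono (Ω' := punctured ℓm ℓp)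
        sdiff_subset).congr h0 (EventuallyEq.refl _ _)).unique hd.deriv_zero
      rwa [restrict_punctured] at h1
    have hsubn : ‖(f - R₀ f).fst - mulOp V₀ (R₀ f).fst‖ ≤ K * ‖f‖ := by
      have y1 : ‖(f - R₀ f).fst‖ ≤ ‖f‖ + ‖f‖ :=
        (norm_fst_le' _).trans ((norm_sub_le _ _).trans (by gcongr))
      have y2 : ‖mulOp V₀ (R₀ f).fst‖ ≤ ‖V₀‖ * ‖f‖ :=
        (norm_mulOp_le V₀ _).trans (by gcongr; exact nu)
      calc _ ≤ (‖f‖ + ‖f‖) + ‖V₀‖ * ‖f‖ := (norm_sub_le _ _).trans (add_le_add y1 y2)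
        _ = _ := by rw [hK]; ring
    -- The derivative jumps at `0`, so the pointwise bound is applied separately on `(-e, 0)` and
    -- `(0, e)`.
    have side : ∀ a b : ℝ, b - a = e → Ioo a b ⊆ (punctured ℓm ℓp : Set ℝ) →
        ∀ x ∈ Ioo a b, ‖f₁ x‖ ≤ √C2 * ‖f‖ := by
      intro a b hab hsub x hx
      have hsub' : Ioo a b ⊆ (interval ℓm ℓp : Set ℝ) := hsub.trans sdiff_subset
      have hprim : IsPrimitiveOn (Ioo a b) f₁ f₂ :=
        (hd.deriv_one.mono (Ω' := ⟨Ioo a b, isOpen_Ioo⟩) hsub).isPrimitiveOn ordConnected_Ioo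
          (hd.cont_one.mono hsub)
      have e1 : ∫⁻ t in Ioo a b, ‖f₁ t‖ₑ ^ 2 ≤ ENNReal.ofReal (‖f‖ ^ 2) := by
        refine le_trans (le_of_eq ?_) (lintegral_le_of_norm_le (weakDeriv _ 1 u) nf n1 hsub')
        refine lintegral_congr_ae ?_
        filter_upwards [ae_restrict_of_ae_restrict_of_subset hsub' hp1] with x hx
        rw [hx]
      have e2 : ∫⁻ t in Ioo a b, ‖f₂ t‖ₑ ^ 2 ≤ ENNReal.ofReal ((K * ‖f‖) ^ 2) := by
        refine le_trans (le_of_eq ?_) (lintegral_le_of_norm_le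
          ((f - R₀ f).fst - mulOp V₀ (R₀ f).fst) (by positivity) hsubn hsub')
        refine lintegral_congr_ae ?_
        filter_upwards [ae_restrict_of_ae_restrict_of_subset hsub' g2] with x hx
        have hx' : ((f - R₀ f).fst - mulOp V₀ (R₀ f).fst : L2 (interval ℓm ℓp)) x = (-f₂) x := hx
        rw [hx', Pi.neg_apply, enorm_neg]
      refine hle ((hprim.norm_sq_le (by linarith) e1 e2 hx).trans ?_)
      rw [hab, hC2]
      have x1 : ‖f‖ ^ 2 / e = 1 / e * ‖f‖ ^ 2 := by ring
      have x2 : 0 ≤ e * K ^ 2 * ‖f‖ ^ 2 := by positivity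
      nlinarith [sq_nonneg ‖f‖]
    have sr := side 0 e (by ring) fun x hx => ⟨hI ⟨by linarith [hx.1], hx.2⟩, hx.1.ne'⟩
    have sl := side (-e) 0 (by ring) fun x hx => ⟨hI ⟨hx.1, by linarith [hx.2]⟩, hx.2.ne⟩
    rw [EventuallyEq, ae_restrict_iff' (interval ℓm ℓp).isOpen.measurableSet] at hp1
    filter_upwards [hp1, Measure.ae_ne volume (0 : ℝ)] with x hx hx0 hxe
    rw [hx (hI hxe)]
    rcases lt_or_gt_of_ne hx0 with h | h
    · exact sl x ⟨hxe.1, h⟩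
    · exact sr x ⟨h, hxe.2⟩
  · have : ‖(R₀ f).snd‖ ^ 2 ≤ ‖f‖ ^ 2 := by
      gcongr
      exact (norm_snd_le' _).trans n0
    refine this.trans (le_mul_of_one_le_left (by positivity) ?_)
    rw [hC2]
    have : 0 ≤ 2 * (1 / e + 2 * e * K ^ 2) := by positivity
    linarith

end LimitResolvent

/-! ### Assembly of the estimates -/

section Main

variable {ℓm ℓp : EReal} {α β γ : ℝ}

theorem isAdmissible_of_le (hα : 0 < α) (hβ : 0 < β) (hβ' : β < 1 / 2) (hγ : 0 < γ) {ε₀ : ℝ}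
    (hε₁ : ε₀ < (2 * γ) ^ (-1 / α)) (hε₂ : (ε₀ : EReal) < -ℓm) (hε₃ : (ε₀ : EReal) < ℓp)
    (hε₅ : ε₀ < min γ γ⁻¹) {ε : ℝ} (hε : 0 < ε) (hle : ε ≤ ε₀) : IsAdmissible ℓm ℓp α β γ ε := by
  have h1 := lt_min_iff.1 hε₅
  have hle' : (ε : EReal) ≤ ε₀ := EReal.coe_le_coe_iff.2 hle
  refine ⟨hε, ?_, hα, hβ, hβ', hγ, hle'.trans_lt hε₂, hle'.trans_lt hε₃, ?_, ?_, ?_⟩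
  -- One of `γ` and `γ⁻¹` is at most `1`, so `ε < 1`.
  · rcases le_total γ 1 with h | h
    · linarith
    · linarith [inv_le_one_of_one_le₀ h]
  · have h2 : ε ^ α ≤ (2 * γ)⁻¹ := by
      calc ε ^ α ≤ ((2 * γ) ^ (-1 / α)) ^ α :=
            Real.rpow_le_rpow hε.le (hle.trans hε₁.le) hα.le
        _ = (2 * γ)⁻¹ := by
            rw [← Real.rpow_mul (by positivity), div_mul_cancel₀ _ hα.ne', Real.rpow_neg_one]
    calc γ * ε ^ α ≤ γ * (2 * γ)⁻¹ := by gcongr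
      _ = 1 / 2 := by field_simp
  · calc γ * ε ≤ γ * γ⁻¹ := by gcongr; linarith
      _ = 1 := mul_inv_cancel₀ hγ.ne'
  · linarith

theorem stripPotential_nonneg {V₀ : Lp ℝ ∞ (volume.restrict (interval ℓm ℓp : Set ℝ))}
    (hV₀ : 0 ≤ V₀) (ε : ℝ) :
    0 ≤ᵐ[volume.restrict (waveguide ℓm ℓp α β γ ε : Set (ℝ × ℝ))]
      (memLp_stripPotential α β γ ε V₀).toLp (stripPotential ℓm ℓp ε V₀) := by
  have h : ∀ᵐ p : ℝ × ℝ, p ∈ strip ℓm ℓp ε → 0 ≤ V₀ p.1 :=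
    ae_fst_of_ae (P := fun x => 0 ≤ V₀ x) (ae_nonneg_of_nonneg hV₀)
  filter_upwards [(memLp_stripPotential α β γ ε V₀).coeFn_toLp, ae_restrict_of_ae h] with p h1 h2
  rw [h1]
  unfold stripPotential
  by_cases hp : p ∈ strip ℓm ℓp ε
  · rw [indicator_of_mem hp]; exact h2 hp
  · rw [indicator_of_notMem hp]; exact le_rfl

/-- Convergence of the spectra of the waveguides. -/
theorem exists_dTilde_le (hm : ℓm < 0) (hp : 0 < ℓp) (hβ : 0 < β) (hγ : 0 < γ) {ε₀ : ℝ}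
    (hε₀ : 0 < ε₀) (had : ∀ ε, 0 < ε → ε ≤ ε₀ → IsAdmissible ℓm ℓp α β γ ε)
    {V₀ : Lp ℝ ∞ (volume.restrict (interval ℓm ℓp : Set ℝ))} (hV₀ : 0 ≤ V₀) :
    ∃ C₂ : ℝ, 0 < C₂ ∧ ∀ ε : ℝ, 0 < ε → ε ≤ ε₀ →
      dTilde (opSpectrum (opEps ℓm ℓp α β γ ε V₀)) (opSpectrum (opZero hm hp γ V₀)) ≤
        ENNReal.ofReal (C₂ * ε ^ min α (min (1 / 2 - β) (2 * β))) := by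
  have had₀ := had ε₀ hε₀ le_rfl
  have hI : Ioo (-ε₀) ε₀ ⊆ (interval ℓm ℓp : Set ℝ) :=
    Ioo_subset_Icc_self.trans had₀.Icc_subset_interval
  obtain ⟨C, hC0, hC⟩ := exists_limit_resolvent_bounds hm hp hγ hV₀ hε₀ hI
  obtain ⟨R₀, hR₀⟩ := exists_isFormResolvent_limitForm (ordConnected_interval ℓm ℓp)
    (zero_mem_interval hm hp) hγ hV₀
  -- The length of the chain of squares, fixed once for all `ε`.
  obtain ⟨n, hn'⟩ := exists_nat_ge ((α + 2) / β)
  have hn : α + 2 ≤ β * (n + 1) := by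
    rw [div_le_iff₀ hβ] at hn'
    nlinarith
  -- The flux constant plus `4 + 1 + 2` times `√γ`, from the trial function (counted twice), its
  -- horizontal derivative and its vertical derivative.
  set D := γ * (12 * n + 27) + 7 * √γ with hD
  have hD0 : 0 ≤ D := by positivity
  -- This is `2 δ + κ` with `ε ^ r` factored out, where `9 = 1 + 4 + 4`; the additional `1` provides
  -- the strict inequality asked for by `dTilde_le`.
  refine ⟨2 * (D * C) + (9 + 10 / ε₀) + 1, by positivity, fun ε hε hle => ?_⟩
  have h := had ε hε hle
  set r := min α (min (1 / 2 - β) (2 * β)) with hr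
  have hV := stripPotential_nonneg (α := α) (β := β) (γ := γ) hV₀ ε
  obtain ⟨R, hR⟩ := exists_isFormResolvent_schrodingerForm hV
  have hb := h.size_pos
  have hr0 : 0 < ε ^ r := Real.rpow_pos_of_pos hε r
  have s1 : √ε * (ε ^ β)⁻¹ ≤ ε ^ r := by
    rw [Real.sqrt_eq_rpow, ← Real.rpow_neg hε.le, ← Real.rpow_add hε]
    refine Real.rpow_le_rpow_of_exponent_ge hε h.lt_one.le ?_
    exact (min_le_right _ _).trans ((min_le_left _ _).trans (le_of_eq (by ring)))
  have s2 : ε ^ α ≤ ε ^ r :=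
    Real.rpow_le_rpow_of_exponent_ge hε h.lt_one.le (min_le_left _ _)
  have s3 : (ε ^ β) ^ 2 ≤ ε ^ r := by
    rw [← Real.rpow_natCast, ← Real.rpow_mul hε.le]
    refine Real.rpow_le_rpow_of_exponent_ge hε h.lt_one.le ?_
    exact (min_le_right _ _).trans ((min_le_right _ _).trans (le_of_eq (by push_cast; ring)))
  -- The transversal error of the strip is absorbed by that of the room, as `ε ≤ ε ^ β`.
  have s4 : ε ^ 2 ≤ ε ^ r := by
    refine le_trans ?_ s3
    gcongr
    exact h.le_size
  have hδ : ∀ f, ‖R (embedding α β γ h.pos f) - embedding α β γ h.pos (R₀ f)‖ ≤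
      (D * C * ε ^ r) * ‖f‖ := by
    intro f
    obtain ⟨U₁, hU₁, hae, hev, b0, b1, b2⟩ := hC hR₀ f
    have hM : 0 ≤ C * ‖f‖ := by positivity
    obtain ⟨U, t0, t1, t2, t3⟩ := exists_trial_bounds h ⟨R₀ f, hR₀.mem_dom f⟩ hU₁ hae V₀ hM
      (fun x hx => b0 x ⟨by linarith [hx.1], by linarith [hx.2]⟩)
      (by filter_upwards [b1] with x hx hx' using hx ⟨by linarith [hx'.1], by linarith [hx'.2]⟩) b2
    refine (norm_resolvent_embedding_sub_le hm hp h hV hR₀ hR f U hev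
      (b0 0 ⟨by linarith, hε₀⟩) t0 t1 t2 t3 hn).trans ?_
    calc γ * (12 * n + 27) * (√ε * (ε ^ β)⁻¹) * (C * ‖f‖) + 2 * (2 * √γ * ε ^ α * (C * ‖f‖)) +
          √γ * ε ^ α * (C * ‖f‖) + 2 * √γ * (√ε * (ε ^ β)⁻¹) * (C * ‖f‖)
        ≤ γ * (12 * n + 27) * ε ^ r * (C * ‖f‖) + 2 * (2 * √γ * ε ^ r * (C * ‖f‖)) +
          √γ * ε ^ r * (C * ‖f‖) + 2 * √γ * ε ^ r * (C * ‖f‖) := by gcongr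
      _ = _ := by rw [hD]; ring
  have hκ : ∀ g : L2 (waveguide ℓm ℓp α β γ ε),
      ContinuousLinearMap.adjoint (embedding (ℓm := ℓm) (ℓp := ℓp) α β γ
        h.pos).toContinuousLinearMap g = 0 →
      ‖R g - embedding α β γ h.pos (ContinuousLinearMap.adjoint (embedding (ℓm := ℓm) (ℓp := ℓp)
        α β γ h.pos).toContinuousLinearMap (R g))‖ ≤ ((9 + 10 / ε₀) * ε ^ r) * ‖g‖ := by
    intro g hg
    refine (norm_resolvent_sub_proj_le h hle had₀.lt_one.le hI hV hR g hg).trans ?_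
    gcongr
    calc ε ^ 2 + 4 * (ε ^ β) ^ 2 + (4 + 10 / ε₀) * ε ^ α
        ≤ ε ^ r + 4 * ε ^ r + (4 + 10 / ε₀) * ε ^ r := by gcongr
      _ = _ := by ring
  have hη := norm_sub_conj_isometry_le hR.selfAdjoint
    (embedding (ℓm := ℓm) (ℓp := ℓp) α β γ h.pos).toContinuousLinearMap
    (adjoint_comp_embedding h.pos) (R₀ := R₀) hδ (by positivity) hκ (by positivity)
  refine dTilde_le hR₀ hR (dom0_ne_top hm hp) (H1_waveguide_ne_top hm hp h.pos)
    (embedding (ℓm := ℓm) (ℓp := ℓp) α β γ h.pos).toContinuousLinearMap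
    (adjoint_comp_embedding h.pos) (hη.trans_lt ?_)
  nlinarith

end Main

end Waveguide

theorem theorem2p2 (ℓm ℓp : EReal) (hm : ℓm < 0) (hp : 0 < ℓp)
    (α β γ : ℝ) (hα : 0 < α) (hβ : 0 < β) (hβ' : β < 1 / 2) (hγ : 0 < γ)
    (ε₀ : ℝ) (hε₀ : 0 < ε₀)
    (hε₁ : ε₀ < (2 * γ) ^ (-1 / α)) (hε₂ : (ε₀ : EReal) < -ℓm) (hε₃ : (ε₀ : EReal) < ℓp)
    (hε₄ : ε₀ < γ ^ (-1 / (α + 1 - β))) (hε₅ : ε₀ < min γ γ⁻¹)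
    (V₀ : Lp ℝ ∞ (volume.restrict (interval ℓm ℓp : Set ℝ))) (hV₀ : 0 ≤ V₀) :
    opSpectrum (opZero hm hp γ V₀) = opSpectrum (deltaOp ℓm ℓp γ V₀) ∪ {0} ∧
    ∃ C₂ : ℝ, 0 < C₂ ∧ ∀ ε : ℝ, 0 < ε → ε ≤ ε₀ →
      dTilde (opSpectrum (opEps ℓm ℓp α β γ ε V₀)) (opSpectrum (opZero hm hp γ V₀)) ≤
        ENNReal.ofReal (C₂ * ε ^ min α (min (1 / 2 - β) (2 * β))) :=
  ⟨opSpectrum_opZero hm hp γ V₀, exists_dTilde_le hm hp hβ hγ hε₀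
    (fun _ hε hle => isAdmissible_of_le hα hβ hβ' hγ hε₁ hε₂ hε₃ hε₅ hε hle) hV₀⟩
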